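/- **Setting.** For each $k=1,2,\dots$ consider a panel with $N=N_k$ individuals and $T=T_k$ periods, $$Y_t=X_t\beta+\Lambda f_t+u_t,\qquad t\ge 1,$$ observed for $t\le T$, where $X_t=(X_{1t},\dots,X_{Nt})'$ is $N\times d$, $f_t\in\mathbb R^r$, $u_t\in\mathbb R^N$ are random, $\beta\in\mathbb R^d$ and $\Lambda=(\lambda_1,\dots,\lambda_N)'\in\mathbb R^{N\times r}$ are deterministic, and only $(Y_t,X_t)_{t\le T}$ is observed; $d,r$ are fixed and $r$ is known. All objects may depend on $k$, and all limits, $o$, $O$, $o_p$, $O_p$ are for $k\to\infty$; constants do not depend on $k$. Write $\Sigma_u=\mathrm{cov}(u_t)$, $W=\Sigma_u^{-1}$, $\Lambda'W=(d_1,\dots,d_N)$, $F_0=(f_1,\dots,f_T)'$, $\omega_T=\sqrt{\log N/T}+1/\sqrt N$, $Z=(X_{11},\dots,X_{1T},X_{21},\dots,X_{NT})'$ ($NT\times d$), $U=(u_{11},\dots,u_{1T},u_{21},\dots,u_{NT})'$, and, for a $T\times r$ matrix $F$, $$M_F=I_T-F(F'F)^{-1}F',\quad A_F=\big[\Sigma_u^{-1}-\Sigma_u^{-1}\Lambda(\Lambda'\Sigma_u^{-1}\Lambda)^{-1}\Lambda'\Sigma_u^{-1}\big]\otimes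 M_F,\quad V(F)=\tfrac1{NT}Z'A_FZ .$$ For $q\in[0,1/2)$ let $m_N=\max_{i\le N}\sum_{j\le N}|\Sigma_{u,ij}|^q$, where $0^0=0$. **Assumptions.** 1. $N,T\to\infty$, $N/T\to\infty$, and $m_N=o(T^2)$. 2. $\{(u_t,f_t)\}_{t\ge1}$ is strictly stationary with $Eu_{it}=Eu_{it}f_{jt}=0$. There are $c_1,c_2>0$ such that all eigenvalues of $\Sigma_u$ and $\mathrm{cov}(f_t)$ lie in $(c_2,c_1)$ and $\max_j\|\lambda_j\|<c_1$. There are $r_1,r_2,b_1,b_2>0$ with $P(|u_{it}|>s)\le\exp(-(s/b_1)^{r_1})$ and $P(|f_{jt}|>s)\le\exp(-(s/b_2)^{r_2})$ for all $s>0$ and all $i,j,t$. There are $r_3,c>0$ such that the strong mixing coefficients of $\{(u_t,f_t)\}$ satisfy $\alpha(n)\le\exp(-cn^{r_3})$ for all $n\ge1$. 3. The eigenvalues of $\Lambda'\Lambda/N$ are bounded away from $0$ and $\infty$. 4. For each $t$, $E\|\frac1{\sqrt{NT}}\sum_{s\le T}f_s(u_s'Wu_t-Eu_s'Wu_t)\|^2=O(1)$;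 for each $i$, $E\|\frac1{\sqrt{NT}}\sum_{t\le T}\sum_{j\le N}d_j(u_{jt}u_{it}-Eu_{jt}u_{it})\|=O(1)$; for each $i\le r$, $E\|\frac1{\sqrt{NT}}\sum_{t\le T}\sum_{j\le N}d_ju_{jt}f_{it}\|=O(1)$; and there are $\delta\ge4$ and $K$ such that for all large $k$ and all $s,t\le T$, $E|\frac1{\sqrt N}(u_s'Wu_t-Eu_s'Wu_t)|^\delta\le K$ and $E\|\frac1{\sqrt N}\Lambda'Wu_t\|^\delta\le K$. 5. For some $q\in[0,1/2)$, $m_N=o\big(\min\{N^{-1/4}(T/\log N)^{(1-q)/2},\,N^{1/4-q/2}\}\big)$ (with the same $q$ as in 1). There is a partition $\{1,\dots,N\}^2=S_L\cup S_U$ with $(i,i)\in S_U$ for all $i$, $\#\{(i,j)\in S_U:i\ne j\}=O(N)$, $\sum_{(i,j)\in S_L}|\Sigma_{u,ij}|=O(1)$, $\max_{(i,j)\in S_L}|\Sigma_{u,ij}|=O(\omega_T)$ and $\omega_T=O(\min_{(i,j)\in S_U}|\Sigma_{u,ij}|)$. 6. There is $c>0$ such that, with probability approaching one, $\inf_{F:\,F'F/T=I_r}\lambda_{\min}(V(F))\ge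 c$. 7. There is a fixed positive definite $d\times d$ matrix $\Gamma$ with $V(F_0)\to^p\Gamma$ and $\frac1{\sqrt{NT}}Z'A_{F_0}U\to^d\mathcal N(0,\Gamma)$. 8. $u_t\sim\mathcal N(0,\Sigma_u)$; $\{u_t\}_{t\ge1}$ is independent of $\{(f_t,X_t)\}_{t\ge1}$; and $(u_t,f_t,X_t)$, $t\ge1$, are independent across $t$. 9. $\frac1{NT}\sum_{i\le N}\sum_{t\le T}\|X_{it}\|^2=O_p(1)$. **Estimators.** For a weight matrix $W_T$, the weighted principal components estimator of $(\beta,\Lambda,F_0)$ is a minimizer of $$\sum_{t\le T}(Y_t-\Lambda f_t-X_t\beta)'W_T(Y_t-\Lambda f_t-X_t\beta)$$ subject to $\frac1T\sum_{t\le T} f_tf_t'=I_r$ and $\Lambda'W_T\Lambda$ diagonal. (If there are several minimizers any one may be used; where none exists the estimators are arbitrary.) Let $\hat\beta_0$ be the estimator of $\beta$ for $W_T=I_N$. Let $\nu_1\ge\dots\ge\nu_N$ and $g_1,\dots,g_N$ be eigenvalues and orthonormal eigenvectors of $\frac1T\sum_{t\le T}(Y_t-X_t\hat\beta_0)(Y_t-X_t\hat\beta_0)'$,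 and $\widetilde R=\sum_{i>r}\nu_ig_ig_i'$. Let $s_\tau:\mathbb R\to\mathbb R$, $\tau>0$, be thresholding functions: $s_\tau(z)=0$ if $|z|<\tau$; $|s_\tau(z)-z|\le\tau$; and, for some constants $a>0$, $b>1$, $|s_\tau(z)-z|\le a\tau^2$ if $|z|>b\tau$. Put $\widetilde\Sigma_{u,ii}=\widetilde R_{ii}$ and $\widetilde\Sigma_{u,ij}=s_{\tau_{ij}}(\widetilde R_{ij})$ for $i\ne j$, with $\tau_{ij}=C\sqrt{\widetilde R_{ii}\widetilde R_{jj}}\,\omega_T$. Let $(\hat\beta,\widetilde\Lambda,\widetilde F)$ be the weighted principal components estimator for $W_T=\widetilde\Sigma_u^{-1}$, let $\widetilde A$ be $A_F$ with $F,\Lambda,\Sigma_u^{-1}$ replaced by $\widetilde F,\widetilde\Lambda,\widetilde\Sigma_u^{-1}$, and $$\widetilde\Gamma=\frac1{NT}Z'\widetilde AZ .$$ **Theorem.** There is a universal constant $C_0>0$ such that, under Assumptions 1–9 and for every threshold constant $C\ge C_0$, $$\widetilde\Gamma^{-1}\to^p\Gamma^{-1}.$$ -/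

import Mathlib

open MeasureTheory ProbabilityTheory Filter Topology Asymptotics
open scoped Matrix Kronecker

/-- A panel data model with interactive effects, with `d` regressors and `r` factors, for one panel
of `N` individuals and `T` periods. Time is indexed by `ℕ`, so that `t = 0, 1, 2, …` stands for the
periods `1, 2, 3, …`; the sample consists of the first `T` of them. The loadings `Λ` (with rows
`λ_i'`) and the slope `β` are deterministic, the errors `u`, the factors `f` and the regressors `X`
are random. -/
structure PanelModel.{v} (d r : ℕ) where
  N : ℕ
  T : ℕ
  Ω : Type v
  mΩ : MeasurableSpace Ω
  P : Measure Ω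
  isProb : IsProbabilityMeasure P
  β : Fin d → ℝ
  Λ : Matrix (Fin N) (Fin r) ℝ
  u : ℕ → Ω → Fin N → ℝ
  f : ℕ → Ω → Fin r → ℝ
  X : ℕ → Ω → Fin N → Fin d → ℝ
  measurable_u : ∀ t, Measurable (u t)
  measurable_f : ∀ t, Measurable (f t)
  measurable_X : ∀ t, Measurable (X t)

attribute [instance] PanelModel.mΩ PanelModel.isProb

noncomputable section

/-! ### Matrix-valued building blocks -/

/-- The matrix `A_F = [W - WΛ(Λ'WΛ)⁻¹Λ'W] ⊗ M_F`, where `M_F = I - F(F'F)⁻¹F'`. -/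
def projKron {N T r : ℕ} (W : Matrix (Fin N) (Fin N) ℝ) (Λ : Matrix (Fin N) (Fin r) ℝ)
    (F : Matrix (Fin T) (Fin r) ℝ) : Matrix (Fin N × Fin T) (Fin N × Fin T) ℝ :=
  (W - W * Λ * (Λᵀ * W * Λ)⁻¹ * Λᵀ * W) ⊗ₖ (1 - F * (Fᵀ * F)⁻¹ * Fᵀ)

/-- The weighted least squares criterion `∑ₜ (Yₜ - Λfₜ - Xₜb)' W (Yₜ - Λfₜ - Xₜb)`. -/
def wlsCriterion {N T d r : ℕ} (W : Matrix (Fin N) (Fin N) ℝ) (Y : Fin T → Fin N → ℝ)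
    (X : Fin T → Matrix (Fin N) (Fin d) ℝ) (b : Fin d → ℝ) (L : Matrix (Fin N) (Fin r) ℝ)
    (F : Matrix (Fin T) (Fin r) ℝ) : ℝ :=
  ∑ t, (Y t - L *ᵥ F t - X t *ᵥ b) ⬝ᵥ W *ᵥ (Y t - L *ᵥ F t - X t *ᵥ b)

/-- The normalization: `(1/T) ∑ₜ fₜfₜ' = I` and `Λ'WΛ` is diagonal. -/
def IsNormalized {N T r : ℕ} (W : Matrix (Fin N) (Fin N) ℝ) (L : Matrix (Fin N) (Fin r) ℝ)
    (F : Matrix (Fin T) (Fin r) ℝ) : Prop :=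
  (T : ℝ)⁻¹ • (Fᵀ * F) = 1 ∧ (Lᵀ * W * L).IsDiag

/-- `(b, L, F)` is a weighted principal components estimate of `(β, Λ, F)` with weight matrix `W`:
a minimizer of the criterion under the normalization. -/
def IsWPC {N T d r : ℕ} (W : Matrix (Fin N) (Fin N) ℝ) (Y : Fin T → Fin N → ℝ)
    (X : Fin T → Matrix (Fin N) (Fin d) ℝ) (b : Fin d → ℝ) (L : Matrix (Fin N) (Fin r) ℝ)
    (F : Matrix (Fin T) (Fin r) ℝ) : Prop :=
  IsNormalized W L F ∧
    ∀ (b' : Fin d → ℝ) (L' : Matrix (Fin N) (Fin r) ℝ) (F' : Matrix (Fin T) (Fin r) ℝ),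
      IsNormalized W L' F' → wlsCriterion W Y X b L F ≤ wlsCriterion W Y X b' L' F'

/-- The sample second moment matrix `(1/T) ∑ₜ (Yₜ - Xₜb)(Yₜ - Xₜb)'`. -/
def residSecondMoment {N T d : ℕ} (Y : Fin T → Fin N → ℝ) (X : Fin T → Matrix (Fin N) (Fin d) ℝ)
    (b : Fin d → ℝ) : Matrix (Fin N) (Fin N) ℝ :=
  (T : ℝ)⁻¹ • ∑ t, Matrix.vecMulVec (Y t - X t *ᵥ b) (Y t - X t *ᵥ b)

/-- `R = ∑_{i > r} νᵢ gᵢ gᵢ'` for an orthonormal system of eigenvectors `g₁, …, g_N` of `S` with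
eigenvalues `ν₁ ≥ … ≥ ν_N`. The columns of `G` are the eigenvectors. -/
def IsTailPart {N : ℕ} (r : ℕ) (S R : Matrix (Fin N) (Fin N) ℝ) : Prop :=
  ∃ (ν : Fin N → ℝ) (G : Matrix (Fin N) (Fin N) ℝ), Antitone ν ∧ Gᵀ * G = 1 ∧
    S = G * Matrix.diagonal ν * Gᵀ ∧
    R = G * Matrix.diagonal (fun i => if r ≤ i.val then ν i else 0) * Gᵀ

/-- The rate `ω = √(log N / T) + 1/√N`. -/
def omegaRate (N T : ℕ) : ℝ := √(Real.log N / T) + 1 / √N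

/-- A thresholding function; `s τ z` is the value at `z` for the threshold `τ`. -/
def IsThresholding (s : ℝ → ℝ → ℝ) : Prop :=
  ∃ a b : ℝ, 0 < a ∧ 1 < b ∧ ∀ τ z : ℝ, 0 < τ →
    (|z| < τ → s τ z = 0) ∧ |s τ z - z| ≤ τ ∧ (b * τ < |z| → |s τ z - z| ≤ a * τ ^ 2)

/-- The thresholded covariance matrix with thresholds `τᵢⱼ = C √(Rᵢᵢ Rⱼⱼ) ω`. -/
def thresholdCov {N : ℕ} (T : ℕ) (s : ℝ → ℝ → ℝ) (C : ℝ) (R : Matrix (Fin N) (Fin N) ℝ) :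
    Matrix (Fin N) (Fin N) ℝ :=
  Matrix.of fun i j =>
    if i = j then R i i else s (C * √(R i i * R j j) * omegaRate N T) (R i j)

/-- The sparsity measure `m = maxᵢ ∑ⱼ |Σᵢⱼ|^q`, where a zero entry contributes `0` also for
`q = 0`. -/
def sparsity {N : ℕ} (q : ℝ) (S : Matrix (Fin N) (Fin N) ℝ) : ℝ :=
  ⨆ i, ∑ j, if S i j = 0 then 0 else |S i j| ^ q

/-- The covariance matrix of a random vector. -/
def covMatrix {Ω : Type*} [MeasurableSpace Ω] {n : ℕ} (P : Measure Ω) (x : Ω → Fin n → ℝ) :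
    Matrix (Fin n) (Fin n) ℝ :=
  Matrix.of fun i j => cov[fun ω => x ω i, fun ω => x ω j; P]

/-- The Euclidean norm of a vector. -/
def enorm2 {n : ℕ} (v : Fin n → ℝ) : ℝ := ‖WithLp.toLp 2 v‖

namespace PanelModel

variable {d r : ℕ} (m : PanelModel d r)

/-- `Σ_u`, the covariance matrix of `u_t` (the same for all `t`, as `u` is stationary). -/
def Sigma : Matrix (Fin m.N) (Fin m.N) ℝ := covMatrix m.P (m.u 0)

/-- The observed regressors. -/
def Xs (ω : m.Ω) : Fin m.T → Matrix (Fin m.N) (Fin d) ℝ := fun t => Matrix.of (m.X t ω)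

/-- The `T × r` matrix of the true factors. -/
def F₀ (ω : m.Ω) : Matrix (Fin m.T) (Fin r) ℝ := Matrix.of fun t => m.f t ω

/-- The observed outcomes `Yₜ = Xₜβ + Λfₜ + uₜ`. -/
def Y (ω : m.Ω) : Fin m.T → Fin m.N → ℝ :=
  fun t => m.Xs ω t *ᵥ m.β + m.Λ *ᵥ m.f t ω + m.u t ω

/-- The `NT × d` design matrix; its row `(i, t)` is `X_{it}'`. -/
def Z (ω : m.Ω) : Matrix (Fin m.N × Fin m.T) (Fin d) ℝ := Matrix.of fun p => m.X p.2 ω p.1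

/-- The `NT` vector of the errors. -/
def U (ω : m.Ω) : Fin m.N × Fin m.T → ℝ := fun p => m.u p.2 ω p.1

/-- `V(F) = (NT)⁻¹ Z' A_F Z`, with the true loadings and error covariance. -/
def V (ω : m.Ω) (F : Matrix (Fin m.T) (Fin r) ℝ) : Matrix (Fin d) (Fin d) ℝ :=
  ((m.N : ℝ) * m.T)⁻¹ • ((m.Z ω)ᵀ * projKron m.Sigma⁻¹ m.Λ F * m.Z ω)

/-- The score `(NT)^{-1/2} Z' A_{F₀} U`. -/
def score (ω : m.Ω) : EuclideanSpace ℝ (Fin d) :=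
  WithLp.toLp 2
    ((√((m.N : ℝ) * m.T))⁻¹ • (((m.Z ω)ᵀ * projKron m.Sigma⁻¹ m.Λ (m.F₀ ω)) *ᵥ m.U ω))

/-- `u_s' W u_t` with `W = Σ_u⁻¹`. -/
def uWu (s t : ℕ) (ω : m.Ω) : ℝ := m.u s ω ⬝ᵥ m.Sigma⁻¹ *ᵥ m.u t ω

/-- `d_j`, the `j`-th column of `Λ'W`, with `W = Σ_u⁻¹`. -/
def dcol (j : Fin m.N) : Fin r → ℝ := fun a => (m.Λᵀ * m.Sigma⁻¹) a j

/-- The plug-in estimator `Γ̃ = (NT)⁻¹ Z' Ã Z` formed with a weight matrix, loadings and factors. -/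
def plugIn (ω : m.Ω) (W : Matrix (Fin m.N) (Fin m.N) ℝ) (L : Matrix (Fin m.N) (Fin r) ℝ)
    (F : Matrix (Fin m.T) (Fin r) ℝ) : Matrix (Fin d) (Fin d) ℝ :=
  ((m.N : ℝ) * m.T)⁻¹ • ((m.Z ω)ᵀ * projKron W L F * m.Z ω)

/-- The feasible weighted principal components procedure. `β₀` is the regular principal components
estimate of `β` (identity weight), `R` the residual covariance that it leads to, and `(β', L, F)` is
the estimate of `(β, Λ, F₀)` with the inverse of the thresholded `R` as its weight. The estimates are
minimizers for every outcome for which a minimizer exists. Where there is none, they are arbitrary.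
If there are several, any of them may be chosen. -/
structure IsFeasibleWPC (s : ℝ → ℝ → ℝ) (C : ℝ) (β₀ : m.Ω → Fin d → ℝ)
    (R : m.Ω → Matrix (Fin m.N) (Fin m.N) ℝ) (β' : m.Ω → Fin d → ℝ)
    (L : m.Ω → Matrix (Fin m.N) (Fin r) ℝ) (F : m.Ω → Matrix (Fin m.T) (Fin r) ℝ) : Prop where
  initial : ∀ ω,
    (∃ (b : Fin d → ℝ) (L₁ : Matrix (Fin m.N) (Fin r) ℝ) (F₁ : Matrix (Fin m.T) (Fin r) ℝ),
      IsWPC 1 (m.Y ω) (m.Xs ω) b L₁ F₁) →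
    ∃ (L₁ : Matrix (Fin m.N) (Fin r) ℝ) (F₁ : Matrix (Fin m.T) (Fin r) ℝ),
      IsWPC 1 (m.Y ω) (m.Xs ω) (β₀ ω) L₁ F₁
  resid : ∀ ω, IsTailPart r (residSecondMoment (m.Y ω) (m.Xs ω) (β₀ ω)) (R ω)
  final : ∀ ω,
    (∃ (b : Fin d → ℝ) (L₁ : Matrix (Fin m.N) (Fin r) ℝ) (F₁ : Matrix (Fin m.T) (Fin r) ℝ),
      IsWPC (thresholdCov m.T s C (R ω))⁻¹ (m.Y ω) (m.Xs ω) b L₁ F₁) →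
    IsWPC (thresholdCov m.T s C (R ω))⁻¹ (m.Y ω) (m.Xs ω) (β' ω) (L ω) (F ω)

end PanelModel

/-! ### Assumptions on a sequence of panels

Each of them is a condition on the whole sequence `M`; constants do not depend on the panel. -/

section Assumptions

universe v

variable {d r : ℕ} (M : ℕ → PanelModel.{v} d r)

/-- Strict stationarity of `{u_t, f_t}`, bounded moments and loadings, exponential tails, and strong
mixing. -/
structure DataGenerating : Prop where
  stationary : ∀ k h,
    Measure.map (fun ω (t : ℕ) => ((M k).u (t + h) ω, (M k).f (t + h) ω)) (M k).P =
      Measure.map (fun ω (t : ℕ) => ((M k).u t ω, (M k).f t ω)) (M k).P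
  mean_u : ∀ k t i, ∫ ω, (M k).u t ω i ∂(M k).P = 0
  mean_uf : ∀ k t i j, ∫ ω, (M k).u t ω i * (M k).f t ω j ∂(M k).P = 0
  bounds : ∃ c₁ c₂ : ℝ, 0 < c₁ ∧ 0 < c₂ ∧ ∀ k,
    ((M k).Sigma - c₂ • (1 : Matrix _ _ ℝ)).PosDef ∧
    (c₁ • (1 : Matrix _ _ ℝ) - (M k).Sigma).PosDef ∧
    (∀ j, enorm2 ((M k).Λ j) < c₁) ∧
    ∀ t, (covMatrix (M k).P ((M k).f t) - c₂ • (1 : Matrix _ _ ℝ)).PosDef ∧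
      (c₁ • (1 : Matrix _ _ ℝ) - covMatrix (M k).P ((M k).f t)).PosDef
  tails : ∃ r₁ r₂ b₁ b₂ : ℝ, 0 < r₁ ∧ 0 < r₂ ∧ 0 < b₁ ∧ 0 < b₂ ∧ ∀ k t (x : ℝ), 0 < x →
    (∀ i, (M k).P.real {ω | x < |(M k).u t ω i|} ≤ Real.exp (-(x / b₁) ^ r₁)) ∧
    ∀ j, (M k).P.real {ω | x < |(M k).f t ω j|} ≤ Real.exp (-(x / b₂) ^ r₂)
  mixing : ∃ r₃ c : ℝ, 0 < r₃ ∧ 0 < c ∧ ∀ k (t n : ℕ), 0 < n → ∀ A B : Set (M k).Ω,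
    MeasurableSet[⨆ s ∈ Set.Iic t,
      MeasurableSpace.comap (fun ω => ((M k).u s ω, (M k).f s ω)) inferInstance] A →
    MeasurableSet[⨆ s ∈ Set.Ici (t + n),
      MeasurableSpace.comap (fun ω => ((M k).u s ω, (M k).f s ω)) inferInstance] B →
    |(M k).P.real A * (M k).P.real B - (M k).P.real (A ∩ B)| ≤ Real.exp (-c * (n : ℝ) ^ r₃)

/-- Pervasive factors: the eigenvalues of `Λ'Λ/N` are bounded away from zero and infinity. -/
def Pervasive : Prop :=
  ∃ c C : ℝ, 0 < c ∧ 0 < C ∧ ∀ᶠ k in atTop,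
    (((M k).N : ℝ)⁻¹ • ((M k).Λᵀ * (M k).Λ) - c • (1 : Matrix _ _ ℝ)).PosDef ∧
    (C • (1 : Matrix _ _ ℝ) - ((M k).N : ℝ)⁻¹ • ((M k).Λᵀ * (M k).Λ)).PosDef

/-- Moment bounds on weighted averages, for the weight `W = Σ_u⁻¹`. -/
structure WeightedMoments : Prop where
  one : ∀ t : ℕ, ∃ K : ℝ, ∀ᶠ k in atTop,
    ∫⁻ ω, ENNReal.ofReal (enorm2 ((√(((M k).N : ℝ) * (M k).T))⁻¹ •
      ∑ s : Fin (M k).T, ((M k).uWu s t ω - ∫ ω', (M k).uWu s t ω' ∂(M k).P) • (M k).f s ω) ^ 2)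
      ∂(M k).P ≤ ENNReal.ofReal K
  two : ∀ i : ℕ, ∃ K : ℝ, ∀ᶠ k in atTop, ∀ hi : i < (M k).N,
    ∫⁻ ω, ENNReal.ofReal (enorm2 ((√(((M k).N : ℝ) * (M k).T))⁻¹ •
      ∑ t : Fin (M k).T, ∑ j,
        ((M k).u t ω j * (M k).u t ω ⟨i, hi⟩
          - ∫ ω', (M k).u t ω' j * (M k).u t ω' ⟨i, hi⟩ ∂(M k).P) • (M k).dcol j))
      ∂(M k).P ≤ ENNReal.ofReal K
  three : ∀ i : Fin r, ∃ K : ℝ, ∀ᶠ k in atTop,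
    ∫⁻ ω, ENNReal.ofReal (enorm2 ((√(((M k).N : ℝ) * (M k).T))⁻¹ •
      ∑ t : Fin (M k).T, ∑ j, ((M k).u t ω j * (M k).f t ω i) • (M k).dcol j))
      ∂(M k).P ≤ ENNReal.ofReal K
  four : ∃ δ K : ℝ, 4 ≤ δ ∧ ∀ᶠ k in atTop, ∀ s t : Fin (M k).T,
    ∫⁻ ω, ENNReal.ofReal (|(√((M k).N : ℝ))⁻¹ *
        ((M k).uWu s t ω - ∫ ω', (M k).uWu s t ω' ∂(M k).P)| ^ δ)
      ∂(M k).P ≤ ENNReal.ofReal K ∧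
    ∫⁻ ω, ENNReal.ofReal (enorm2 ((√((M k).N : ℝ))⁻¹ •
        (((M k).Λᵀ * (M k).Sigma⁻¹) *ᵥ (M k).u t ω)) ^ δ)
      ∂(M k).P ≤ ENNReal.ofReal K

/-- Conditional sparsity of `Σ_u` with exponent `q`. The set `S_U k` holds the positions of the large
entries of `Σ_u`, its complement those of the small entries. -/
structure ConditionallySparse (q : ℝ) : Prop where
  q_nonneg : 0 ≤ q
  q_lt : q < 1 / 2
  rate : (fun k => sparsity q (M k).Sigma) =o[atTop] fun k =>
    min (1 / ((M k).N : ℝ) ^ (1 / 4 : ℝ) * ((M k).T / Real.log (M k).N) ^ ((1 - q) / 2))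
      (((M k).N : ℝ) ^ (1 / 4 - q / 2))
  partition : ∃ S_U : ∀ k, Finset (Fin (M k).N × Fin (M k).N),
    (∀ k i, (i, i) ∈ S_U k) ∧
    ∃ K : ℝ, ∀ᶠ k in atTop,
      (((S_U k).filter fun p => p.1 ≠ p.2).card : ℝ) ≤ K * (M k).N ∧
      ∑ p ∈ (S_U k)ᶜ, |(M k).Sigma p.1 p.2| ≤ K ∧
      (∀ p ∈ (S_U k)ᶜ, |(M k).Sigma p.1 p.2| ≤ K * omegaRate (M k).N (M k).T) ∧
      ∀ p ∈ S_U k, omegaRate (M k).N (M k).T ≤ K * |(M k).Sigma p.1 p.2|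

/-- With probability approaching one, `λ_min(V(F))` is bounded below by a positive constant, uniformly
over all `F` with `F'F/T = I`. -/
def UniformlyIdentified : Prop :=
  ∃ c : ℝ, 0 < c ∧ Tendsto (fun k => (M k).P {ω | ¬ ∀ F : Matrix (Fin (M k).T) (Fin r) ℝ,
    ((M k).T : ℝ)⁻¹ • (Fᵀ * F) = 1 →
      ∀ v : Fin d → ℝ, c * (v ⬝ᵥ v) ≤ v ⬝ᵥ (M k).V ω F *ᵥ v}) atTop (𝓝 0)

/-- Convergence in probability, entry by entry, of random matrices to a constant matrix. -/
def TendstoInProb (A : ∀ k, (M k).Ω → Matrix (Fin d) (Fin d) ℝ) (B : Matrix (Fin d) (Fin d) ℝ) :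
    Prop :=
  ∀ i j, ∀ ε : ℝ, 0 < ε →
    Tendsto (fun k => (M k).P {ω | ε ≤ |A k ω i j - B i j|}) atTop (𝓝 0)

/-- `Γ` is positive definite, `V(F₀) → Γ` in probability, and the score converges in distribution to
`N(0, Γ)`. -/
structure ScoreLimit (Γ : Matrix (Fin d) (Fin d) ℝ) : Prop where
  posDef : Γ.PosDef
  prob : TendstoInProb M (fun k ω => (M k).V ω ((M k).F₀ ω)) Γ
  dist : TendstoInDistribution (fun k => (M k).score) atTop
    (id : EuclideanSpace ℝ (Fin d) → EuclideanSpace ℝ (Fin d)) (fun k => (M k).P)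
    (multivariateGaussian 0 Γ)

/-- Gaussian errors that are independent of the factors and the regressors, and serial
independence. -/
structure GaussianErrors : Prop where
  gaussian : ∀ k t, Measure.map (fun ω => WithLp.toLp 2 ((M k).u t ω)) (M k).P =
    multivariateGaussian 0 (M k).Sigma
  indep : ∀ k, IndepFun (fun ω (t : ℕ) => (M k).u t ω)
    (fun ω (t : ℕ) => ((M k).f t ω, (M k).X t ω)) (M k).P
  serial : ∀ k, iIndepFun (fun (t : ℕ) ω => ((M k).u t ω, (M k).f t ω, (M k).X t ω)) (M k).P

/-- The regressors have bounded second moments on average: `(NT)⁻¹ ∑ᵢ ∑ₜ ‖X_{it}‖² = O_p(1)`. -/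
def RegressorsBounded : Prop :=
  ∀ ε : ℝ, 0 < ε → ∃ K : ℝ, ∀ᶠ k in atTop,
    (M k).P {ω | K < (((M k).N : ℝ) * (M k).T)⁻¹ *
      ∑ i, ∑ t : Fin (M k).T, enorm2 ((M k).X t ω i) ^ 2} ≤ ENNReal.ofReal ε

/-- `N, T → ∞`, `N/T → ∞`, and `m_N = o(T²)`. -/
structure PanelGrowth (q : ℝ) : Prop where
  N_tendsto : Tendsto (fun k => (M k).N) atTop atTop
  T_tendsto : Tendsto (fun k => (M k).T) atTop atTop
  ratio : Tendsto (fun k => ((M k).N : ℝ) / (M k).T) atTop atTop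
  sparsity_rate : (fun k => sparsity q (M k).Sigma) =o[atTop] fun k => ((M k).T : ℝ) ^ 2

end Assumptions

end

/-! ### Frobenius and operator norms of real matrices -/

section FrobeniusAPI

set_option linter.unusedSectionVars false

open scoped Matrix.Norms.L2Operator

variable {m n l : Type*} [Fintype m] [Fintype n] [Fintype l]

/-! Stack the data as N×T matrices, let δ be the error of a slope estimate and D = √(NT)‖δ‖. The
residual of a fit is ΛF₀' + u − Xδ − LF'. All that is random is collected in `RegularPanel K θ q`, a
list of inequalities on one realization in which K bounds what is bounded and θ what is small. By
`regular_whp` the list holds with probability tending to one for every fixed θ, given a bound on the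
regressors. The rest is deterministic: `plugIn_close` bounds Γ̃ − V(F₀) entrywise by a constant
times θ, and since V(F₀) → Γ and inversion is continuous at Γ, the theorem follows.

The crux is that the thresholded covariance is consistent in operator norm. The residual covariance
of the initial fit contains (XδM)(XδM)'/T, where M projects off the estimated factors; its Frobenius
norm is of order D²/T. Comparing the minimum with the value at the truth (`crude_rate`) gives only D
= O(√N), hence a bound N/T → ∞. `refined_rate` gives D = O(θ√T) by comparing two expansions of the
criterion. From below, the residual is projected by M_Λ and M_{F₀}, which leaves M_Λ u M_{F₀} − M_Λ
Xδ M_{F₀} minus a product of two thin small matrices. From above, the criterion is evaluated at the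
true slope with loadings and factors corrected to first order in u, so that the residual is M_Λ u
M_{F₀} minus another such product. The large term ‖M_Λ u M_{F₀}‖² cancels, and its cross terms with
the thin products cost its operator norm, of order √N, instead of its Frobenius norm, of order
√(NT). This requires √N log N = o(T), which is hidden in the sparsity rate: the diagonal bounds m_N
from below, while m_N = o(N^{-1/4}(T/log N)^{(1−q)/2}).

The residual covariance is then, entry by entry, within 11σᵢσⱼ√(log N/T) of Σ_u up to a matrix of
small Frobenius norm (`initial_resid`). The estimated standard deviations are wrong by a bounded
factor, so C ≥ 44 puts the thresholds above twice the noise, and `thresholdCov_op_le` bounds the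
error of the thresholded matrix by O(θ).

In the second step the weight is within O(θ) of Σ_u⁻¹, and the crude rate suffices: ‖δ‖ = O(θ) and
F₀'M = O(θ√T). The estimated loadings and factors therefore nearly span the true spaces. Γ̃ depends
on them only through these spaces (`wproj_mul_right`), so the unidentified rotation does not matter,
and projections depend continuously on the spaces (`wproj_perturb`).

Estimates are arbitrary where no minimizer exists, so existence has to be proved on regular
realizations (`exists_isWPC`). The matrix R, built from any eigenvectors, is shown to be the
residual covariance of an actual minimizer (`IsTailPart.exists_isWPC`).

The probabilistic part rests on Gaussian errors. Given factors and regressors, linear forms in u are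
sub-Gaussian, and a union bound over O(N²) of them costs √(log N). The operator norm of u is treated
by nets, its sample covariance by chi-square tails and polarization, and the factors by Chebyshev's
inequality. -/

/-- The Frobenius inner product `tr(A'B)`. -/
def frobInner (A B : Matrix m n ℝ) : ℝ := (Aᵀ * B).trace

/-- The Frobenius norm. -/
noncomputable def frob (A : Matrix m n ℝ) : ℝ := √(frobInner A A)

lemma frobInner_eq_sum (A B : Matrix m n ℝ) : frobInner A B = ∑ i, ∑ j, A i j * B i j := by
  simp only [frobInner, Matrix.trace, Matrix.diag, Matrix.mul_apply, Matrix.transpose_apply]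
  rw [Finset.sum_comm]

lemma frobInner_comm (A B : Matrix m n ℝ) : frobInner A B = frobInner B A := by
  simp only [frobInner_eq_sum, mul_comm]

lemma frobInner_add_left (A B C : Matrix m n ℝ) :
    frobInner (A + B) C = frobInner A C + frobInner B C := by
  simp [frobInner, Matrix.add_mul]

lemma frobInner_add_right (A B C : Matrix m n ℝ) :
    frobInner A (B + C) = frobInner A B + frobInner A C := by
  simp [frobInner, Matrix.mul_add]

lemma frobInner_sub_left (A B C : Matrix m n ℝ) :
    frobInner (A - B) C = frobInner A C - frobInner B C := by
  simp [frobInner, Matrix.sub_mul]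

lemma frobInner_sub_right (A B C : Matrix m n ℝ) :
    frobInner A (B - C) = frobInner A B - frobInner A C := by
  simp [frobInner, Matrix.mul_sub]

lemma frobInner_smul_left (c : ℝ) (A B : Matrix m n ℝ) :
    frobInner (c • A) B = c * frobInner A B := by
  simp [frobInner]

lemma frobInner_smul_right (c : ℝ) (A B : Matrix m n ℝ) :
    frobInner A (c • B) = c * frobInner A B := by
  simp [frobInner]

lemma frobInner_sum_left {ι : Type*} (s : Finset ι) (A : ι → Matrix m n ℝ) (B : Matrix m n ℝ) :
    frobInner (∑ k ∈ s, A k) B = ∑ k ∈ s, frobInner (A k) B := by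
  simp [frobInner, Matrix.transpose_sum, Matrix.sum_mul, Matrix.trace_sum]

lemma frobInner_mul_left (A : Matrix m l ℝ) (B : Matrix l n ℝ) (C : Matrix m n ℝ) :
    frobInner (A * B) C = frobInner B (Aᵀ * C) := by
  simp [frobInner, Matrix.mul_assoc]

lemma frobInner_mul_right (A : Matrix m l ℝ) (B : Matrix l n ℝ) (C : Matrix m n ℝ) :
    frobInner (A * B) C = frobInner A (C * Bᵀ) := by
  rw [frobInner, frobInner, Matrix.transpose_mul, Matrix.mul_assoc, Matrix.trace_mul_comm,
    Matrix.mul_assoc]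

lemma frobInner_transpose (A B : Matrix m n ℝ) : frobInner Aᵀ Bᵀ = frobInner A B := by
  simp only [frobInner_eq_sum, Matrix.transpose_apply]
  rw [Finset.sum_comm]

lemma frobInner_self_nonneg (A : Matrix m n ℝ) : 0 ≤ frobInner A A := by
  rw [frobInner_eq_sum]
  exact Finset.sum_nonneg fun i _ => Finset.sum_nonneg fun j _ => mul_self_nonneg _

lemma frob_nonneg (A : Matrix m n ℝ) : 0 ≤ frob A := Real.sqrt_nonneg _

lemma frob_sq (A : Matrix m n ℝ) : frob A ^ 2 = frobInner A A :=
  Real.sq_sqrt (frobInner_self_nonneg A)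

lemma frob_eq_norm (A : Matrix m n ℝ) :
    frob A = ‖(WithLp.toLp 2 (fun p : m × n => A p.1 p.2) : EuclideanSpace ℝ (m × n))‖ := by
  rw [EuclideanSpace.norm_eq, frob, frobInner_eq_sum, Fintype.sum_prod_type]
  simp [pow_two]

lemma abs_frobInner_le (A B : Matrix m n ℝ) : |frobInner A B| ≤ frob A * frob B := by
  have h := abs_real_inner_le_norm
    (WithLp.toLp 2 (fun p : m × n => A p.1 p.2) : EuclideanSpace ℝ (m × n))
    (WithLp.toLp 2 (fun p : m × n => B p.1 p.2))
  rw [← frob_eq_norm, ← frob_eq_norm] at h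
  convert h using 2
  rw [frobInner_eq_sum, PiLp.inner_apply, Fintype.sum_prod_type]
  simp [mul_comm]

lemma frobInner_le (A B : Matrix m n ℝ) : frobInner A B ≤ frob A * frob B :=
  (le_abs_self _).trans (abs_frobInner_le A B)

lemma frob_add_le (A B : Matrix m n ℝ) : frob (A + B) ≤ frob A + frob B := by
  refine (pow_le_pow_iff_left₀ (frob_nonneg _)
    (add_nonneg (frob_nonneg _) (frob_nonneg _)) two_ne_zero).1 ?_
  have h := frobInner_le A B
  rw [frob_sq, add_sq, frob_sq, frob_sq, frobInner_add_left, frobInner_add_right,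
    frobInner_add_right, frobInner_comm B A]
  linarith

lemma frob_smul (c : ℝ) (A : Matrix m n ℝ) : frob (c • A) = |c| * frob A := by
  rw [frob, frobInner_smul_left, frobInner_smul_right, ← mul_assoc, Real.sqrt_mul
    (mul_self_nonneg c), Real.sqrt_mul_self_eq_abs, frob]

@[simp] lemma frob_zero : frob (0 : Matrix m n ℝ) = 0 := by simp [frob, frobInner]

lemma frob_neg (A : Matrix m n ℝ) : frob (-A) = frob A := by simp [frob, frobInner]

lemma frob_sub_le (A B : Matrix m n ℝ) : frob (A - B) ≤ frob A + frob B := by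
  rw [sub_eq_add_neg, ← frob_neg B]
  exact frob_add_le _ _

lemma frob_transpose (A : Matrix m n ℝ) : frob Aᵀ = frob A := by
  rw [frob, frobInner_transpose, frob]

lemma frob_eq_zero {A : Matrix m n ℝ} (h : frob A = 0) : A = 0 := by
  rw [frob_eq_norm, norm_eq_zero] at h
  ext i j
  exact congrFun (congrArg WithLp.ofLp h) (i, j)

lemma frob_sum_le {ι : Type*} (s : Finset ι) (A : ι → Matrix m n ℝ) :
    frob (∑ k ∈ s, A k) ≤ ∑ k ∈ s, frob (A k) := by
  classical
  induction s using Finset.induction_on with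
  | empty => simp
  | insert a s ha ih =>
    rw [Finset.sum_insert ha, Finset.sum_insert ha]
    exact (frob_add_le _ _).trans (by gcongr)

lemma dotProduct_self_eq_norm (x : n → ℝ) :
    x ⬝ᵥ x = ‖(WithLp.toLp 2 x : EuclideanSpace ℝ n)‖ ^ 2 := by
  rw [EuclideanSpace.norm_sq_eq]
  simp [dotProduct, pow_two]

lemma frob_sq_eq_sum_cols (A : Matrix m n ℝ) : frob A ^ 2 = ∑ j, (fun i => A i j) ⬝ᵥ fun i => A i j := by
  rw [frob_sq, frobInner_eq_sum, Finset.sum_comm]; rfl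

lemma frob_one_eq [DecidableEq n] : frob (1 : Matrix n n ℝ) = √(Fintype.card n) := by
  simp [frob, frobInner, Matrix.trace_one]

section Op

variable [DecidableEq m] [DecidableEq n] [DecidableEq l]

lemma op_transpose (A : Matrix m n ℝ) : ‖Aᵀ‖ = ‖A‖ := by
  rw [← Matrix.conjTranspose_eq_transpose_of_trivial, Matrix.l2_opNorm_conjTranspose]

lemma mulVec_dot_le (A : Matrix m n ℝ) (x : n → ℝ) :
    (A *ᵥ x) ⬝ᵥ (A *ᵥ x) ≤ ‖A‖ ^ 2 * (x ⬝ᵥ x) := by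
  rw [dotProduct_self_eq_norm, dotProduct_self_eq_norm, ← mul_pow]
  gcongr
  exact Matrix.l2_opNorm_mulVec A (WithLp.toLp 2 x)

lemma op_le_of_mulVec {A : Matrix m n ℝ} {c : ℝ} (hc : 0 ≤ c)
    (h : ∀ x : n → ℝ, (A *ᵥ x) ⬝ᵥ (A *ᵥ x) ≤ c ^ 2 * (x ⬝ᵥ x)) : ‖A‖ ≤ c := by
  rw [Matrix.l2_opNorm_def]
  refine ContinuousLinearMap.opNorm_le_bound _ hc fun x => ?_
  have := h x.ofLp
  rw [dotProduct_self_eq_norm, dotProduct_self_eq_norm, ← mul_pow] at this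
  exact (pow_le_pow_iff_left₀ (norm_nonneg _) (by positivity) two_ne_zero).1 this

lemma abs_dot_mulVec_le (A : Matrix m n ℝ) (x : m → ℝ) (y : n → ℝ) :
    |x ⬝ᵥ A *ᵥ y| ≤ ‖A‖ * (√(x ⬝ᵥ x) * √(y ⬝ᵥ y)) := by
  have h := abs_real_inner_le_norm (WithLp.toLp 2 x : EuclideanSpace ℝ m) (WithLp.toLp 2 (A *ᵥ y))
  have h2 := Matrix.l2_opNorm_mulVec A (WithLp.toLp 2 y)
  rw [dotProduct_self_eq_norm, dotProduct_self_eq_norm, Real.sqrt_sq (norm_nonneg _),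
    Real.sqrt_sq (norm_nonneg _)]
  have e : inner ℝ (WithLp.toLp 2 x : EuclideanSpace ℝ m) (WithLp.toLp 2 (A *ᵥ y))
      = x ⬝ᵥ A *ᵥ y := by
    simp [PiLp.inner_apply, dotProduct, mul_comm]
  rw [e] at h
  calc _ ≤ _ := h
    _ ≤ ‖(WithLp.toLp 2 x : EuclideanSpace ℝ m)‖ *
        (‖A‖ * ‖(WithLp.toLp 2 y : EuclideanSpace ℝ n)‖) := by
        gcongr; exact h2
    _ = _ := by ring

/-- Testing with x = Ay turns the bilinear bound into ‖Ay‖² ≤ c‖Ay‖‖y‖. -/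
lemma op_le_of_dot {A : Matrix m n ℝ} {c : ℝ} (hc : 0 ≤ c)
    (h : ∀ (x : m → ℝ) (y : n → ℝ), x ⬝ᵥ A *ᵥ y ≤ c * (√(x ⬝ᵥ x) * √(y ⬝ᵥ y))) : ‖A‖ ≤ c := by
  refine op_le_of_mulVec hc fun y => ?_
  have h1 := h (A *ᵥ y) y
  set a := (A *ᵥ y) ⬝ᵥ (A *ᵥ y) with ha
  have ha0 : 0 ≤ a := by rw [ha, dotProduct_self_eq_norm]; positivity
  have hy0 : 0 ≤ y ⬝ᵥ y := by rw [dotProduct_self_eq_norm]; positivity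
  have h2 : √a ^ 2 ≤ c * (√a * √(y ⬝ᵥ y)) := by rwa [Real.sq_sqrt ha0]
  have h3 : √a ≤ c * √(y ⬝ᵥ y) := by
    rcases (Real.sqrt_nonneg a).eq_or_lt with h0 | h0
    · rw [← h0]; positivity
    · nlinarith
  calc a = √a ^ 2 := (Real.sq_sqrt ha0).symm
    _ ≤ (c * √(y ⬝ᵥ y)) ^ 2 := by gcongr
    _ = _ := by rw [mul_pow, Real.sq_sqrt hy0]

lemma frob_mul_le_op (A : Matrix m n ℝ) (B : Matrix n l ℝ) : frob (A * B) ≤ ‖A‖ * frob B := by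
  refine (pow_le_pow_iff_left₀ (frob_nonneg _) (by have := frob_nonneg B; positivity) two_ne_zero).1 ?_
  rw [mul_pow, frob_sq_eq_sum_cols, frob_sq_eq_sum_cols, Finset.mul_sum]
  exact Finset.sum_le_sum fun j _ => mulVec_dot_le A fun i => B i j

lemma frob_mul_le_op' (A : Matrix m n ℝ) (B : Matrix n l ℝ) : frob (A * B) ≤ frob A * ‖B‖ := by
  rw [← frob_transpose, Matrix.transpose_mul, ← frob_transpose A, ← op_transpose B, mul_comm]
  exact frob_mul_le_op _ _

lemma op_le_frob (A : Matrix m n ℝ) : ‖A‖ ≤ frob A := by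
  refine op_le_of_mulVec (frob_nonneg A) fun x => ?_
  rw [frob_sq, frobInner_eq_sum, Finset.sum_mul]
  refine Finset.sum_le_sum fun i _ => ?_
  have := Finset.sum_mul_sq_le_sq_mul_sq Finset.univ (fun j => A i j) x
  simpa [Matrix.mulVec, dotProduct, pow_two] using this

lemma frob_mul_le (A : Matrix m n ℝ) (B : Matrix n l ℝ) : frob (A * B) ≤ frob A * frob B :=
  (frob_mul_le_op A B).trans (mul_le_mul_of_nonneg_right (op_le_frob A) (frob_nonneg B))

/-- The C*-identity gives ‖P‖ = ‖P'P‖ = ‖P‖². -/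
lemma op_le_one_of_proj {P : Matrix n n ℝ} (hs : Pᵀ = P) (hp : P * P = P) : ‖P‖ ≤ 1 := by
  have h := Matrix.l2_opNorm_conjTranspose_mul_self P
  rw [Matrix.conjTranspose_eq_transpose_of_trivial, hs, hp] at h
  by_contra! hc
  nlinarith

/-- Used with A a noise matrix and BC a product of thin matrices: only the operator norm of A
enters, which is smaller than its Frobenius norm by the factor √T. The refined rate depends on this
gain. -/
lemma frobInner_mul_le (A : Matrix m n ℝ) (B : Matrix m l ℝ) (C : Matrix l n ℝ) :
    |frobInner A (B * C)| ≤ ‖A‖ * frob B * frob C := by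
  rw [frobInner_comm, frobInner_mul_left]
  calc _ ≤ frob C * frob (Bᵀ * A) := abs_frobInner_le _ _
    _ ≤ frob C * (frob Bᵀ * ‖A‖) := by
      gcongr
      · exact frob_nonneg _
      · exact frob_mul_le_op' _ _
    _ = _ := by rw [frob_transpose]; ring

/-- A square matrix whose quadratic form is bounded below is invertible, with bounded inverse. -/
lemma inv_of_coercive {S : Matrix n n ℝ} {c : ℝ} (hc : 0 < c)
    (h : ∀ v : n → ℝ, c * (v ⬝ᵥ v) ≤ v ⬝ᵥ S *ᵥ v) : IsUnit S.det ∧ ‖S⁻¹‖ ≤ 1 / c := by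
  have hu : IsUnit S.det := by
    rw [isUnit_iff_ne_zero]
    intro h0
    obtain ⟨v, hv, hv0⟩ := Matrix.exists_mulVec_eq_zero_iff.2 h0
    have := h v
    rw [hv0, dotProduct_zero] at this
    have h2 : 0 < v ⬝ᵥ v := by
      rw [dotProduct_self_eq_norm]
      have : (WithLp.toLp 2 v : EuclideanSpace ℝ n) ≠ 0 := fun hh => hv (by
        simpa using congrArg WithLp.ofLp hh)
      positivity
    nlinarith
  refine ⟨hu, op_le_of_mulVec (by positivity) fun x => ?_⟩
  set y := S⁻¹ *ᵥ x with hy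
  have hx : S *ᵥ y = x := by rw [hy, Matrix.mulVec_mulVec, Matrix.mul_nonsing_inv _ hu, Matrix.one_mulVec]
  have h1 := h y
  rw [hx] at h1
  have h2 := abs_real_inner_le_norm (WithLp.toLp 2 y : EuclideanSpace ℝ n) (WithLp.toLp 2 x)
  have e : inner ℝ (WithLp.toLp 2 y : EuclideanSpace ℝ n) (WithLp.toLp 2 x) = y ⬝ᵥ x := by
    simp [PiLp.inner_apply, dotProduct, mul_comm]
  rw [e] at h2
  rw [dotProduct_self_eq_norm] at h1
  rw [dotProduct_self_eq_norm, dotProduct_self_eq_norm]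
  set a := ‖(WithLp.toLp 2 y : EuclideanSpace ℝ n)‖
  set b := ‖(WithLp.toLp 2 x : EuclideanSpace ℝ n)‖
  have ha : 0 ≤ a := norm_nonneg _
  have h3 : c * a ^ 2 ≤ a * b := h1.trans ((le_abs_self _).trans h2)
  have h4 : c * a ≤ b := by
    rcases ha.eq_or_lt with h0 | h0
    · rw [← h0, mul_zero]; exact norm_nonneg _
    · nlinarith
  have h5 : a ≤ 1 / c * b := by rw [one_div, ← div_eq_inv_mul, le_div_iff₀ hc]; linarith
  rw [← mul_pow]
  gcongr

lemma frobInner_coercive {S : Matrix m m ℝ} {c : ℝ}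
    (h : ∀ v : m → ℝ, c * (v ⬝ᵥ v) ≤ v ⬝ᵥ S *ᵥ v) (B : Matrix m n ℝ) :
    c * frob B ^ 2 ≤ frobInner B (S * B) := by
  rw [frob_sq_eq_sum_cols, frobInner_eq_sum, Finset.sum_comm, Finset.mul_sum]
  exact Finset.sum_le_sum fun j _ => h fun i => B i j

end Op

/-- The Euclidean norm of a row. -/
noncomputable def rowNorm (A : Matrix m n ℝ) (i : m) : ℝ := frob (Matrix.of fun (_ : Unit) j => A i j)

lemma rowNorm_nonneg (A : Matrix m n ℝ) (i : m) : 0 ≤ rowNorm A i := frob_nonneg _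

lemma rowNorm_sq (A : Matrix m n ℝ) (i : m) : rowNorm A i ^ 2 = ∑ j, A i j ^ 2 := by
  rw [rowNorm, frob_sq, frobInner_eq_sum]; simp [pow_two]

lemma frob_sq_eq_sum_rows (A : Matrix m n ℝ) : frob A ^ 2 = ∑ i, rowNorm A i ^ 2 := by
  rw [frob_sq, frobInner_eq_sum]
  exact Finset.sum_congr rfl fun i _ => by rw [rowNorm_sq]; simp [pow_two]

lemma rowNorm_le_frob (A : Matrix m n ℝ) (i : m) : rowNorm A i ≤ frob A := by
  refine (pow_le_pow_iff_left₀ (rowNorm_nonneg _ _) (frob_nonneg _) two_ne_zero).1 ?_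
  rw [frob_sq_eq_sum_rows]
  exact Finset.single_le_sum (f := fun i => rowNorm A i ^ 2) (fun _ _ => sq_nonneg _) (Finset.mem_univ i)

lemma abs_entry_le_rowNorm (A : Matrix m n ℝ) (i : m) (j : n) : |A i j| ≤ rowNorm A i := by
  refine abs_le_of_sq_le_sq ?_ (rowNorm_nonneg _ _)
  rw [rowNorm_sq]
  exact Finset.single_le_sum (f := fun j => A i j ^ 2) (fun _ _ => sq_nonneg _) (Finset.mem_univ j)

lemma abs_entry_le_frob (A : Matrix m n ℝ) (i : m) (j : n) : |A i j| ≤ frob A :=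
  (abs_entry_le_rowNorm A i j).trans (rowNorm_le_frob A i)

lemma rowNorm_sub_le (A B : Matrix m n ℝ) (i : m) : rowNorm (A - B) i ≤ rowNorm A i + rowNorm B i :=
  frob_sub_le (Matrix.of fun (_ : Unit) j => A i j) (Matrix.of fun (_ : Unit) j => B i j)

lemma rowNorm_mul_le [DecidableEq n] [DecidableEq l] (A : Matrix m n ℝ) (B : Matrix n l ℝ) (i : m) :
    rowNorm (A * B) i ≤ rowNorm A i * ‖B‖ :=
  frob_mul_le_op' (Matrix.of fun (_ : Unit) j => A i j) B

lemma abs_mul_transpose_apply_le (A : Matrix m n ℝ) (B : Matrix l n ℝ) (i : m) (j : l) :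
    |(A * Bᵀ) i j| ≤ rowNorm A i * rowNorm B j := by
  have h := abs_frobInner_le (Matrix.of fun (_ : Unit) k => A i k)
    (Matrix.of fun (_ : Unit) k => B j k)
  rw [frobInner_eq_sum] at h
  simpa [Matrix.mul_apply, rowNorm] using h

end FrobeniusAPI


/-! ### Normalizing loadings and factors -/

section Normalization

open InnerProductSpace in
/-- A tall matrix factors through a matrix with orthonormal columns. -/
lemma exists_orthonormal_factor {T r : ℕ} (h : r ≤ T) (F : Matrix (Fin T) (Fin r) ℝ) :
    ∃ (Q : Matrix (Fin T) (Fin r) ℝ) (S : Matrix (Fin r) (Fin r) ℝ), Qᵀ * Q = 1 ∧ F = Q * S := by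
  -- The columns are padded with zeros to T vectors, so that Gram–Schmidt returns a full orthonormal
  -- basis even if F is rank deficient. By triangularity, column c lies in the span of the first c +
  -- 1 basis vectors, hence of the first r.
  let f : Fin T → EuclideanSpace ℝ (Fin T) := fun i =>
    if hi : i.val < r then WithLp.toLp 2 (fun t => F t ⟨i, hi⟩) else 0
  have hcard : Module.finrank ℝ (EuclideanSpace ℝ (Fin T)) = Fintype.card (Fin T) := by simp
  let b := gramSchmidtOrthonormalBasis hcard f
  have hb : ∀ i j, i < j → inner ℝ (b j) (f i) = 0 := fun i j hij =>
    gramSchmidtOrthonormalBasis_inv_triangular hcard f hij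
  let Q : Matrix (Fin T) (Fin r) ℝ := Matrix.of fun t a => b (Fin.castLE h a) t
  let S : Matrix (Fin r) (Fin r) ℝ := Matrix.of fun a c => inner ℝ (b (Fin.castLE h a)) (f (Fin.castLE h c))
  refine ⟨Q, S, ?_, ?_⟩
  · ext a c
    have h1 := orthonormal_iff_ite.1 b.orthonormal (Fin.castLE h c) (Fin.castLE h a)
    rw [PiLp.inner_apply] at h1
    simp only [Matrix.mul_apply, Matrix.transpose_apply, Matrix.one_apply, Q, Matrix.of_apply]
    simpa [eq_comm] using h1
  · ext t c
    have h1 := b.sum_repr' (f (Fin.castLE h c))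
    have h2 := congrArg (fun v : EuclideanSpace ℝ (Fin T) => v t) h1
    have h3 : f (Fin.castLE h c) t = F t c := by simp [f]
    simp only [WithLp.ofLp_sum, WithLp.ofLp_smul, Finset.sum_apply, Pi.smul_apply, smul_eq_mul] at h2
    rw [h3] at h2
    rw [← h2, Matrix.mul_apply]
    symm
    refine Finset.sum_of_injOn (Fin.castLE h) (Fin.castLE_injective h).injOn (by simp) ?_ ?_
    · intro j _ hj
      rw [hb _ _ ?_, zero_mul]
      rw [Fin.lt_def]
      by_contra hc
      push Not at hc
      exact hj ⟨⟨j, lt_of_le_of_lt hc (by simp)⟩, by simp, rfl⟩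
    · intro a _
      simp [Q, S, mul_comm]

lemma exists_orthogonal_diag {r : ℕ} {A : Matrix (Fin r) (Fin r) ℝ} (hA : Aᵀ = A) :
    ∃ O : Matrix (Fin r) (Fin r) ℝ, Oᵀ * O = 1 ∧ O * Oᵀ = 1 ∧ (Oᵀ * A * O).IsDiag := by
  have hh : A.IsHermitian := by
    rw [Matrix.IsHermitian, Matrix.conjTranspose_eq_transpose_of_trivial, hA]
  obtain ⟨U, hU⟩ : ∃ U : Matrix (Fin r) (Fin r) ℝ, U = hh.eigenvectorUnitary := ⟨_, rfl⟩
  have h1 : Uᵀ * U = 1 := by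
    have := Unitary.coe_star_mul_self hh.eigenvectorUnitary
    rwa [← hU, Matrix.star_eq_conjTranspose,
      Matrix.conjTranspose_eq_transpose_of_trivial] at this
  have h2 : U * Uᵀ = 1 := mul_eq_one_comm.1 h1
  refine ⟨U, h1, h2, ?_⟩
  have h3 := hh.spectral_theorem
  rw [Unitary.conjStarAlgAut_apply, ← hU, Matrix.star_eq_conjTranspose,
    Matrix.conjTranspose_eq_transpose_of_trivial] at h3
  have h4 : Uᵀ * A * U = Matrix.diagonal (RCLike.ofReal ∘ hh.eigenvalues) := by
    conv_lhs => rw [h3]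
    rw [Matrix.mul_assoc, Matrix.mul_assoc, Matrix.mul_assoc, h1, Matrix.mul_one, ← Matrix.mul_assoc,
      h1, Matrix.one_mul]
  rw [h4]
  exact Matrix.isDiag_diagonal _

/-- Every product `L F'` can be written with normalized loadings and factors. -/
lemma exists_isNormalized {N T r : ℕ} (hT : 0 < T) (h : r ≤ T) {W : Matrix (Fin N) (Fin N) ℝ} (hW : Wᵀ = W)
    (L : Matrix (Fin N) (Fin r) ℝ) (F : Matrix (Fin T) (Fin r) ℝ) :
    ∃ (L' : Matrix (Fin N) (Fin r) ℝ) (F' : Matrix (Fin T) (Fin r) ℝ), IsNormalized W L' F' ∧ L' * F'ᵀ = L * Fᵀ := by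
  obtain ⟨Q, S, hQ, hF⟩ := exists_orthonormal_factor h F
  obtain ⟨O, hO, hO', hd⟩ := exists_orthogonal_diag (A := (L * Sᵀ)ᵀ * W * (L * Sᵀ)) (by
    simp [Matrix.transpose_mul, hW, Matrix.mul_assoc])
  have hT' : (0 : ℝ) < T := by exact_mod_cast hT
  have hs : √(T : ℝ) ≠ 0 := (Real.sqrt_pos.2 hT').ne'
  -- With F = QS, the triangular factor S is moved into the loadings, the rotation O diagonalizes
  -- their weighted Gram matrix, and √T adjusts the scale; O and √T cancel in the product.
  refine ⟨(√(T : ℝ))⁻¹ • (L * Sᵀ * O), √(T : ℝ) • (Q * O), ⟨?_, ?_⟩, ?_⟩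
  · rw [Matrix.transpose_smul, Matrix.smul_mul, Matrix.mul_smul, smul_smul, smul_smul,
      mul_assoc, Real.mul_self_sqrt hT'.le, inv_mul_cancel₀ hT'.ne', one_smul, Matrix.transpose_mul,
      Matrix.mul_assoc, ← Matrix.mul_assoc Qᵀ, hQ, Matrix.one_mul, hO]
  · have : ((√(T : ℝ))⁻¹ • (L * Sᵀ * O))ᵀ * W * ((√(T : ℝ))⁻¹ • (L * Sᵀ * O)) =
        ((√(T : ℝ))⁻¹ * (√(T : ℝ))⁻¹) • (Oᵀ * ((L * Sᵀ)ᵀ * W * (L * Sᵀ)) * O) := by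
      simp only [Matrix.transpose_smul, Matrix.smul_mul, Matrix.mul_smul, smul_smul,
        Matrix.transpose_mul, Matrix.mul_assoc]
    rw [this]
    exact hd.smul _
  · rw [Matrix.transpose_smul, Matrix.smul_mul, Matrix.mul_smul, smul_smul, inv_mul_cancel₀ hs,
      one_smul, hF, Matrix.transpose_mul, Matrix.transpose_mul]
    calc L * Sᵀ * O * (Oᵀ * Qᵀ) = L * Sᵀ * (O * Oᵀ) * Qᵀ := by simp only [Matrix.mul_assoc]
      _ = _ := by rw [hO', Matrix.mul_one, Matrix.mul_assoc]

end Normalization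

/-! ### The criterion as a weighted Frobenius form -/

section Criterion

variable {N T d r : ℕ}

/-- The outcomes as an `N × T` matrix. -/
def stackY (Y : Fin T → Fin N → ℝ) : Matrix (Fin N) (Fin T) ℝ := Matrix.of fun i t => Y t i

/-- The `k`-th regressor as an `N × T` matrix. -/
def stackX (X : Fin T → Matrix (Fin N) (Fin d) ℝ) (k : Fin d) : Matrix (Fin N) (Fin T) ℝ :=
  Matrix.of fun i t => X t i k

/-- The linear combination `∑ₖ bₖ Xₖ` of regressor matrices. -/
def regComb (X : Fin d → Matrix (Fin N) (Fin T) ℝ) (b : Fin d → ℝ) : Matrix (Fin N) (Fin T) ℝ :=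
  ∑ k, b k • X k

lemma regComb_apply (X : Fin d → Matrix (Fin N) (Fin T) ℝ) (b : Fin d → ℝ) (i : Fin N) (t : Fin T) :
    regComb X b i t = ∑ k, b k * X k i t := by
  simp [regComb, Matrix.sum_apply]

lemma regComb_sub (X : Fin d → Matrix (Fin N) (Fin T) ℝ) (b c : Fin d → ℝ) :
    regComb X (b - c) = regComb X b - regComb X c := by
  simp [regComb, sub_smul, Finset.sum_sub_distrib]

lemma wlsCriterion_eq (W : Matrix (Fin N) (Fin N) ℝ) (Y : Fin T → Fin N → ℝ)
    (X : Fin T → Matrix (Fin N) (Fin d) ℝ) (b : Fin d → ℝ) (L : Matrix (Fin N) (Fin r) ℝ)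
    (F : Matrix (Fin T) (Fin r) ℝ) :
    wlsCriterion W Y X b L F = frobInner (stackY Y - regComb (stackX X) b - L * Fᵀ)
      (W * (stackY Y - regComb (stackX X) b - L * Fᵀ)) := by
  have h : ∀ t i, (stackY Y - regComb (stackX X) b - L * Fᵀ) i t
      = (Y t - L *ᵥ F t - X t *ᵥ b) i := by
    intro t i
    simp only [Matrix.sub_apply, regComb_apply, Pi.sub_apply, Matrix.mul_apply, Matrix.mulVec,
      dotProduct, Matrix.transpose_apply, stackY, stackX, Matrix.of_apply]
    rw [sub_right_comm]
    congr 1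
    exact Finset.sum_congr rfl fun k _ => mul_comm _ _
  rw [frobInner_eq_sum, Finset.sum_comm]
  simp only [Matrix.mul_apply, h]
  rfl

lemma residSecondMoment_eq (Y : Fin T → Fin N → ℝ) (X : Fin T → Matrix (Fin N) (Fin d) ℝ)
    (b : Fin d → ℝ) :
    residSecondMoment Y X b = (T : ℝ)⁻¹ • ((stackY Y - regComb (stackX X) b) *
      (stackY Y - regComb (stackX X) b)ᵀ) := by
  rw [residSecondMoment]
  congr 1
  ext i j
  simp only [Matrix.sum_apply, Matrix.vecMulVec_apply, Matrix.mul_apply, Matrix.transpose_apply,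
    Matrix.sub_apply, regComb_apply, stackY, stackX, Matrix.of_apply, Pi.sub_apply, Matrix.mulVec,
    dotProduct, mul_comm]

/-- The weighted principal components estimate minimizes the criterion without normalization, too. -/
lemma IsWPC.le_of_any {W : Matrix (Fin N) (Fin N) ℝ} {Y : Fin T → Fin N → ℝ}
    {X : Fin T → Matrix (Fin N) (Fin d) ℝ} {b : Fin d → ℝ} {L : Matrix (Fin N) (Fin r) ℝ}
    {F : Matrix (Fin T) (Fin r) ℝ} (h : IsWPC W Y X b L F) (hT : 0 < T) (hr : r ≤ T) (hW : Wᵀ = W)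
    (b' : Fin d → ℝ) (L' : Matrix (Fin N) (Fin r) ℝ) (F' : Matrix (Fin T) (Fin r) ℝ) :
    frobInner (stackY Y - regComb (stackX X) b - L * Fᵀ)
      (W * (stackY Y - regComb (stackX X) b - L * Fᵀ)) ≤
    frobInner (stackY Y - regComb (stackX X) b' - L' * F'ᵀ)
      (W * (stackY Y - regComb (stackX X) b' - L' * F'ᵀ)) := by
  obtain ⟨L₂, F₂, hn, he⟩ := exists_isNormalized hT hr hW L' F'
  have := h.2 b' L₂ F₂ hn
  rwa [wlsCriterion_eq, wlsCriterion_eq, he] at this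

end Criterion


/-! ### The spectral tail as a best low-rank fit -/

section TailPart

open scoped Matrix.Norms.L2Operator

variable {N T d r : ℕ}

/-- Scalar form of Ky Fan's maximum principle. Subtracting the pivot c = ν_r changes nothing, as
both weight systems have total r; afterwards every summand of the difference is a product of two
factors of the same sign. -/
lemma sum_mul_le_of_antitone (hr : r < N) {ν w : Fin N → ℝ} (hν : Antitone ν) (h0 : ∀ i, 0 ≤ w i)
    (h1 : ∀ i, w i ≤ 1) (hs : ∑ i, w i = r) :
    ∑ i, ν i * w i ≤ ∑ i : Fin N, if r ≤ i.val then 0 else ν i := by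
  have hc : ∑ i : Fin N, (if r ≤ i.val then (0 : ℝ) else 1) = r := by
    rw [Finset.sum_ite, Finset.sum_const_zero, zero_add, Finset.sum_const, nsmul_eq_mul, mul_one]
    have : (Finset.univ.filter fun i : Fin N => ¬ r ≤ i.val) = Finset.Iio (⟨r, hr⟩ : Fin N) := by
      ext i; simp [Fin.lt_def]
    rw [this, Fin.card_Iio]
  set c := ν ⟨r, hr⟩
  have key : 0 ≤ ∑ i : Fin N, ((if r ≤ i.val then (0 : ℝ) else 1) - w i) * (ν i - c) := by
    refine Finset.sum_nonneg fun i _ => ?_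
    split_ifs with h
    · have : ν i ≤ c := hν (Fin.le_def.2 h)
      nlinarith [h0 i]
    · have : c ≤ ν i := hν (Fin.le_def.2 (by simp; omega))
      nlinarith [h1 i]
  have e : ∑ i : Fin N, ((if r ≤ i.val then (0 : ℝ) else 1) - w i) * (ν i - c)
      = (∑ i : Fin N, if r ≤ i.val then 0 else ν i) - ∑ i, ν i * w i
        - c * (∑ i : Fin N, (if r ≤ i.val then (0 : ℝ) else 1)) + c * ∑ i, w i := by
    rw [Finset.mul_sum, Finset.mul_sum, ← Finset.sum_sub_distrib, ← Finset.sum_sub_distrib,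
      ← Finset.sum_add_distrib]
    refine Finset.sum_congr rfl fun i _ => ?_
    split_ifs <;> ring
  rw [e, hc, hs] at key
  linarith

/-- For a matrix with orthonormal columns, `I - QQ'` is a symmetric idempotent matrix. -/
lemma one_sub_proj {n k : Type*} [Fintype n] [Fintype k] [DecidableEq n] [DecidableEq k]
    {Q : Matrix n k ℝ} (hQ : Qᵀ * Q = 1) :
    (1 - Q * Qᵀ)ᵀ = 1 - Q * Qᵀ ∧ (1 - Q * Qᵀ) * (1 - Q * Qᵀ) = 1 - Q * Qᵀ ∧
      (1 - Q * Qᵀ) * Q = 0 := by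
  have h3 : (1 - Q * Qᵀ) * Q = 0 := by
    rw [Matrix.sub_mul, Matrix.one_mul, Matrix.mul_assoc, hQ, Matrix.mul_one, sub_self]
  refine ⟨by simp [Matrix.transpose_mul], ?_, h3⟩
  rw [Matrix.mul_sub, ← Matrix.mul_assoc, h3, Matrix.zero_mul, sub_zero, Matrix.mul_one]

/-- The tail part of a second moment matrix is the residual second moment of a best approximation of
rank `r`. -/
lemma IsTailPart.exists_best (hr : r < N) (hT : 0 < T) {M : Matrix (Fin N) (Fin T) ℝ}
    {R : Matrix (Fin N) (Fin N) ℝ} (h : IsTailPart r ((T : ℝ)⁻¹ • (M * Mᵀ)) R) :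
    ∃ (L : Matrix (Fin N) (Fin r) ℝ) (F : Matrix (Fin T) (Fin r) ℝ),
      (T : ℝ)⁻¹ • ((M - L * Fᵀ) * (M - L * Fᵀ)ᵀ) = R ∧
      ∀ (L' : Matrix (Fin N) (Fin r) ℝ) (F' : Matrix (Fin T) (Fin r) ℝ),
        frob (M - L * Fᵀ) ^ 2 ≤ frob (M - L' * F'ᵀ) ^ 2 := by
  obtain ⟨ν, G, hν, hG, hS, hR⟩ := h
  have hT' : (0 : ℝ) < T := by exact_mod_cast hT
  have hG' : G * Gᵀ = 1 := mul_eq_one_comm.1 hG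
  -- The optimal loadings are the r leading eigenvectors. With factors M'L the residual is the
  -- projection of M on the remaining eigenvectors.
  let L : Matrix (Fin N) (Fin r) ℝ := Matrix.of fun i a => G i (Fin.castLE hr.le a)
  let p : Fin N → ℝ := fun i => if r ≤ i.val then 1 else 0
  have hL : 1 - L * Lᵀ = G * Matrix.diagonal p * Gᵀ := by
    have : L * Lᵀ = G * Matrix.diagonal (1 - p) * Gᵀ := by
      ext i j
      rw [Matrix.mul_apply, Matrix.mul_apply]
      simp only [Matrix.transpose_apply, Matrix.mul_diagonal, L, Matrix.of_apply]
      refine Finset.sum_of_injOn (Fin.castLE hr.le) (Fin.castLE_injective hr.le).injOn (by simp) ?_ ?_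
      · intro k _ hk
        have : r ≤ k.val := by
          by_contra hc
          exact hk ⟨⟨k, by omega⟩, by simp, rfl⟩
        simp [p, this]
      · intro a _
        simp [p, not_le.2 a.isLt]
    have h2 : Matrix.diagonal (1 - p) = 1 - Matrix.diagonal p := by
      rw [← Matrix.diagonal_one, Matrix.diagonal_sub]; rfl
    rw [this, h2, Matrix.mul_sub, Matrix.sub_mul, Matrix.mul_one, hG', sub_sub_cancel]
  have hE : M - L * (Mᵀ * L)ᵀ = (1 - L * Lᵀ) * M := by
    simp [Matrix.sub_mul, Matrix.transpose_mul, Matrix.mul_assoc]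
  have hres : (T : ℝ)⁻¹ • ((M - L * (Mᵀ * L)ᵀ) * (M - L * (Mᵀ * L)ᵀ)ᵀ) = R := by
    rw [hE, hL, hR, Matrix.transpose_mul]
    have e1 : (G * Matrix.diagonal p * Gᵀ)ᵀ = G * Matrix.diagonal p * Gᵀ := by
      simp [Matrix.transpose_mul, Matrix.mul_assoc]
    rw [e1]
    calc (T : ℝ)⁻¹ • (G * Matrix.diagonal p * Gᵀ * M * (Mᵀ * (G * Matrix.diagonal p * Gᵀ)))
        = G * Matrix.diagonal p * Gᵀ * ((T : ℝ)⁻¹ • (M * Mᵀ)) * (G * Matrix.diagonal p * Gᵀ) := by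
          simp only [Matrix.mul_assoc, Matrix.smul_mul, Matrix.mul_smul]
      _ = G * (Matrix.diagonal p * ((Gᵀ * G) * Matrix.diagonal ν * (Gᵀ * G)) * Matrix.diagonal p) * Gᵀ := by
          rw [hS]; simp only [Matrix.mul_assoc]
      _ = _ := by
          rw [hG, Matrix.one_mul, Matrix.mul_one, Matrix.diagonal_mul_diagonal,
            Matrix.diagonal_mul_diagonal]
          congr 3
          ext i
          by_cases h : r ≤ i.val <;> simp [p, h]
  have hfrob : ∀ E : Matrix (Fin N) (Fin T) ℝ, frob E ^ 2 = T * ((T : ℝ)⁻¹ • (E * Eᵀ)).trace := by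
    intro E
    rw [Matrix.trace_smul, smul_eq_mul, mul_inv_cancel_left₀ hT'.ne', frob_sq, frobInner,
      Matrix.trace_mul_comm]
  refine ⟨L, Mᵀ * L, hres, fun L' F' => ?_⟩
  obtain ⟨Q, S, hQ, hQS⟩ := exists_orthonormal_factor hr.le L'
  obtain ⟨q1, q2, q3⟩ := one_sub_proj hQ
  have h1 : frob ((1 - Q * Qᵀ) * M) ≤ frob (M - L' * F'ᵀ) := by
    have : (1 - Q * Qᵀ) * M = (1 - Q * Qᵀ) * (M - L' * F'ᵀ) := by
      rw [Matrix.mul_sub, hQS, ← Matrix.mul_assoc, ← Matrix.mul_assoc, q3, Matrix.zero_mul,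
        Matrix.zero_mul, sub_zero]
    rw [this]
    refine (frob_mul_le_op _ _).trans ?_
    have := op_le_one_of_proj q1 q2
    nlinarith [frob_nonneg (M - L' * F'ᵀ)]
  refine le_trans ?_ (pow_le_pow_left₀ (frob_nonneg _) h1 2)
  rw [hfrob, hres, hfrob]
  gcongr
  -- A competitor leaves at least the part of M orthogonal to the column space of its loadings,
  -- spanned by Q. In the eigenbasis the normalized trace of that part is Σνᵢ − Σνᵢ(BB')ᵢᵢ, and the
  -- diagonal of the projection BB' has entries in [0,1] with sum r, so Ky Fan's principle applies.
  set B := Gᵀ * Q with hB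
  have hBB : Bᵀ * B = 1 := by
    rw [hB, Matrix.transpose_mul, Matrix.transpose_transpose, Matrix.mul_assoc, ← Matrix.mul_assoc G,
      hG', Matrix.one_mul, hQ]
  have htr : ((T : ℝ)⁻¹ • ((1 - Q * Qᵀ) * M * ((1 - Q * Qᵀ) * M)ᵀ)).trace
      = ∑ i, ν i - ∑ i, ν i * (B * Bᵀ) i i := by
    have : (T : ℝ)⁻¹ • ((1 - Q * Qᵀ) * M * ((1 - Q * Qᵀ) * M)ᵀ)
        = (1 - Q * Qᵀ) * (G * Matrix.diagonal ν * Gᵀ) * (1 - Q * Qᵀ) := by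
      rw [← hS, Matrix.transpose_mul, q1]
      simp only [Matrix.mul_assoc, Matrix.smul_mul, Matrix.mul_smul]
    rw [this, Matrix.trace_mul_comm, ← Matrix.mul_assoc, q2, Matrix.trace_mul_comm,
      Matrix.mul_assoc, Matrix.mul_assoc, Matrix.trace_mul_comm]
    rw [Matrix.mul_assoc]
    have e2 : Gᵀ * (1 - Q * Qᵀ) * G = 1 - B * Bᵀ := by
      rw [Matrix.mul_sub, Matrix.sub_mul, Matrix.mul_one, hG, hB, Matrix.transpose_mul,
        Matrix.transpose_transpose]
      simp only [Matrix.mul_assoc]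
    rw [e2, Matrix.mul_sub, Matrix.mul_one, Matrix.trace_sub, Matrix.trace_diagonal]
    simp [Matrix.trace, Matrix.diagonal_mul]
  have htR : R.trace = ∑ i : Fin N, if r ≤ i.val then ν i else 0 := by
    rw [hR, Matrix.trace_mul_comm, ← Matrix.mul_assoc, hG, Matrix.one_mul, Matrix.trace_diagonal]
  rw [htr, htR]
  have hw : ∀ i, (B * Bᵀ) i i = ∑ a, B i a ^ 2 := fun i => by
    simp [Matrix.mul_apply, pow_two]
  have hidem : (B * Bᵀ) * (B * Bᵀ) = B * Bᵀ := by
    rw [Matrix.mul_assoc, ← Matrix.mul_assoc Bᵀ, hBB, Matrix.one_mul]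
  have h01 : ∀ i, (B * Bᵀ) i i ≤ 1 := by
    intro i
    have e3 : (B * Bᵀ) i i = ∑ j, (B * Bᵀ) i j ^ 2 := by
      conv_lhs => rw [← hidem, Matrix.mul_apply]
      refine Finset.sum_congr rfl fun j _ => ?_
      rw [pow_two]
      congr 1
      simp [Matrix.mul_apply, mul_comm]
    have e4 : (B * Bᵀ) i i ^ 2 ≤ (B * Bᵀ) i i := by
      conv_rhs => rw [e3]
      exact Finset.single_le_sum (f := fun j => (B * Bᵀ) i j ^ 2) (fun _ _ => sq_nonneg _) (Finset.mem_univ i)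
    nlinarith
  have hsum : ∑ i, (B * Bᵀ) i i = r := by
    change (B * Bᵀ).trace = r
    rw [Matrix.trace_mul_comm, hBB, Matrix.trace_one, Fintype.card_fin]
  have := sum_mul_le_of_antitone hr hν (fun i => by
    rw [hw]; exact Finset.sum_nonneg fun _ _ => sq_nonneg _) h01 hsum
  have e5 : ∑ i, ν i = (∑ i : Fin N, if r ≤ i.val then 0 else ν i)
      + ∑ i : Fin N, if r ≤ i.val then ν i else 0 := by
    rw [← Finset.sum_add_distrib]
    exact Finset.sum_congr rfl fun i _ => by split_ifs <;> simp
  linarith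

/-- The tail part of the residual second moments at a regular principal components estimate of the
slope is the residual second moment matrix of some regular principal components estimate. -/
lemma IsTailPart.exists_isWPC (hr : r < N) (hT : 0 < T) (hrT : r ≤ T) {Y : Fin T → Fin N → ℝ}
    {X : Fin T → Matrix (Fin N) (Fin d) ℝ} {b : Fin d → ℝ} {R : Matrix (Fin N) (Fin N) ℝ}
    (h : IsTailPart r (residSecondMoment Y X b) R)
    (hb : ∃ (L₁ : Matrix (Fin N) (Fin r) ℝ) (F₁ : Matrix (Fin T) (Fin r) ℝ), IsWPC 1 Y X b L₁ F₁) :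
    ∃ (L : Matrix (Fin N) (Fin r) ℝ) (F : Matrix (Fin T) (Fin r) ℝ), IsWPC 1 Y X b L F ∧
      R = (T : ℝ)⁻¹ • ((stackY Y - regComb (stackX X) b - L * Fᵀ) *
        (stackY Y - regComb (stackX X) b - L * Fᵀ)ᵀ) := by
  rw [residSecondMoment_eq] at h
  obtain ⟨L, F, hR, hbest⟩ := h.exists_best hr hT
  obtain ⟨L₁, F₁, hW⟩ := hb
  obtain ⟨L', F', hn, he⟩ := exists_isNormalized hT hrT (W := (1 : Matrix (Fin N) (Fin N) ℝ))
    Matrix.transpose_one L F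
  refine ⟨L', F', ⟨hn, fun b₂ L₂ F₂ h₂ => ?_⟩, by rw [he, hR]⟩
  refine le_trans ?_ (hW.2 b₂ L₂ F₂ h₂)
  rw [wlsCriterion_eq, wlsCriterion_eq, he, Matrix.one_mul, Matrix.one_mul, ← frob_sq, ← frob_sq]
  exact hbest L₁ F₁

end TailPart

/-! ### Existence of minimizers -/

section Existence

open scoped Matrix.Norms.L2Operator

variable {N T d r : ℕ}

lemma regComb_frob_le (X : Fin d → Matrix (Fin N) (Fin T) ℝ) (b : Fin d → ℝ) :
    frob (regComb X b) ≤ √(b ⬝ᵥ b) * √(∑ k, frob (X k) ^ 2) := by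
  refine (frob_sum_le _ _).trans ?_
  simp only [frob_smul]
  have := Real.sum_mul_le_sqrt_mul_sqrt Finset.univ (fun k => |b k|) (fun k => frob (X k))
  simpa [dotProduct, pow_two] using this

/-- The projection on the orthogonal complement of normalized factors. -/
lemma normalized_proj {F : Matrix (Fin T) (Fin r) ℝ} (hF : (T : ℝ)⁻¹ • (Fᵀ * F) = 1) :
    (1 - (T : ℝ)⁻¹ • (F * Fᵀ))ᵀ = 1 - (T : ℝ)⁻¹ • (F * Fᵀ) ∧
    (1 - (T : ℝ)⁻¹ • (F * Fᵀ)) * (1 - (T : ℝ)⁻¹ • (F * Fᵀ)) = 1 - (T : ℝ)⁻¹ • (F * Fᵀ) ∧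
    (1 - (T : ℝ)⁻¹ • (F * Fᵀ)) * F = 0 ∧ Fᵀ * (1 - (T : ℝ)⁻¹ • (F * Fᵀ)) = 0 := by
  have h1 : (1 - (T : ℝ)⁻¹ • (F * Fᵀ))ᵀ = 1 - (T : ℝ)⁻¹ • (F * Fᵀ) := by
    simp [Matrix.transpose_mul]
  have h3 : (1 - (T : ℝ)⁻¹ • (F * Fᵀ)) * F = 0 := by
    rw [Matrix.sub_mul, Matrix.one_mul, Matrix.smul_mul, Matrix.mul_assoc, ← Matrix.mul_smul, hF,
      Matrix.mul_one, sub_self]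
  refine ⟨h1, ?_, h3, ?_⟩
  · have h4 : ∀ Z : Matrix (Fin T) (Fin T) ℝ,
        Z * (1 - (T : ℝ)⁻¹ • (F * Fᵀ)) = Z - (T : ℝ)⁻¹ • (Z * F * Fᵀ) := fun Z => by
      rw [Matrix.mul_sub, Matrix.mul_one, Matrix.mul_smul, Matrix.mul_assoc]
    rw [h4, h3, Matrix.zero_mul, smul_zero, sub_zero]
  · rw [← h1, ← Matrix.transpose_mul, h3, Matrix.transpose_zero]

lemma normalized_frob_sq (hT : 0 < T) {F : Matrix (Fin T) (Fin r) ℝ} (hF : (T : ℝ)⁻¹ • (Fᵀ * F) = 1) :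
    frob F ^ 2 = r * T := by
  have hT' : (0 : ℝ) < T := by exact_mod_cast hT
  have h := congrArg Matrix.trace hF
  rw [Matrix.trace_smul, Matrix.trace_one, Fintype.card_fin, smul_eq_mul, inv_mul_eq_div,
    div_eq_iff hT'.ne'] at h
  rw [frob_sq, frobInner, h]

/-- The sublevel sets of a coercive criterion are bounded. -/
lemma exists_bound_of_wlsCriterion_le (hT : 0 < T) {W : Matrix (Fin N) (Fin N) ℝ} {a c : ℝ}
    (ha : 0 < a) (hc : 0 < c) (hWa : ∀ v : Fin N → ℝ, a * (v ⬝ᵥ v) ≤ v ⬝ᵥ W *ᵥ v)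
    (Y : Fin T → Fin N → ℝ) (X : Fin T → Matrix (Fin N) (Fin d) ℝ)
    (hX : ∀ F : Matrix (Fin T) (Fin r) ℝ, (T : ℝ)⁻¹ • (Fᵀ * F) = 1 → ∀ v : Fin d → ℝ,
      c * (v ⬝ᵥ v) ≤ frob (regComb (stackX X) v * (1 - (T : ℝ)⁻¹ • (F * Fᵀ))) ^ 2) (w : ℝ) :
    ∃ B : ℝ, 0 ≤ B ∧ ∀ (b : Fin d → ℝ) (L : Matrix (Fin N) (Fin r) ℝ) (F : Matrix (Fin T) (Fin r) ℝ),
      IsNormalized W L F → wlsCriterion W Y X b L F ≤ w →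
      (∀ k, |b k| ≤ B) ∧ (∀ i j, |L i j| ≤ B) ∧ ∀ i j, |F i j| ≤ B := by
  have hT' : (0 : ℝ) < T := by exact_mod_cast hT
  -- On the sublevel set, e₀ bounds the residual. Projecting off F removes LF' and leaves the slope,
  -- bounded by b₀. Multiplying by F and using F'F = T then bounds the loadings by l₀.
  set e₀ := √(w / a)
  set y := frob (stackY Y)
  set x := √(∑ k, frob (stackX X k) ^ 2)
  set b₀ := √((e₀ + y) ^ 2 / c)
  set l₀ := (y + b₀ * x + e₀) * √(r * T) / T
  have he₀ : 0 ≤ e₀ := Real.sqrt_nonneg _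
  have hy : 0 ≤ y := frob_nonneg _
  have hx : 0 ≤ x := Real.sqrt_nonneg _
  have hb₀ : 0 ≤ b₀ := Real.sqrt_nonneg _
  have hl₀ : 0 ≤ l₀ := div_nonneg (mul_nonneg (add_nonneg (add_nonneg hy (mul_nonneg hb₀ hx)) he₀)
    (Real.sqrt_nonneg _)) (Nat.cast_nonneg _)
  obtain ⟨B, hB1, hB2, hB3⟩ : ∃ B, b₀ ≤ B ∧ l₀ ≤ B ∧ √(r * T) ≤ B :=
    ⟨max b₀ (max l₀ √(r * T)), le_max_left _ _, le_max_of_le_right (le_max_left _ _),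
      le_max_of_le_right (le_max_right _ _)⟩
  refine ⟨B, hb₀.trans hB1, ?_⟩
  rintro b L F ⟨hF, -⟩ hle
  set E := stackY Y - regComb (stackX X) b - L * Fᵀ with hE
  obtain ⟨p1, p2, p3, p4⟩ := normalized_proj hF
  set P := 1 - (T : ℝ)⁻¹ • (F * Fᵀ) with hP
  have hF1 : frob F = √(r * T) := by rw [← normalized_frob_sq hT hF, Real.sqrt_sq (frob_nonneg _)]
  have hEe : frob E ≤ e₀ := by
    refine Real.le_sqrt_of_sq_le ?_
    rw [le_div_iff₀ ha, mul_comm]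
    refine (frobInner_coercive hWa E).trans ?_
    rwa [wlsCriterion_eq] at hle
  have hb1 : √(b ⬝ᵥ b) ≤ b₀ := by
    refine Real.sqrt_le_sqrt ?_
    rw [le_div_iff₀ hc, mul_comm]
    refine (hX F hF b).trans ?_
    refine pow_le_pow_left₀ (frob_nonneg _) ?_ 2
    have e1 : regComb (stackX X) b * P = (stackY Y - E) * P := by
      have : L * Fᵀ * P = 0 := by rw [Matrix.mul_assoc, p4, Matrix.mul_zero]
      rw [show stackY Y - E = regComb (stackX X) b + L * Fᵀ by rw [hE]; abel, Matrix.add_mul,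
        this, add_zero]
    rw [e1]
    refine (frob_mul_le_op' _ _).trans ?_
    have h1 := op_le_one_of_proj p1 p2
    have h2 := frob_sub_le (stackY Y) E
    have h3 := frob_nonneg (stackY Y - E)
    nlinarith
  have hL1 : frob L ≤ l₀ := by
    have e2 : (T : ℝ) • L = (stackY Y - regComb (stackX X) b - E) * F := by
      rw [show stackY Y - regComb (stackX X) b - E = L * Fᵀ by rw [hE]; abel, Matrix.mul_assoc]
      have : Fᵀ * F = (T : ℝ) • (1 : Matrix (Fin r) (Fin r) ℝ) := by
        rw [← hF, smul_smul, mul_inv_cancel₀ hT'.ne', one_smul]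
      rw [this, Matrix.mul_smul, Matrix.mul_one]
    have e3 : T * frob L ≤ (y + b₀ * x + e₀) * √(r * T) := by
      have e4 : T * frob L = frob ((stackY Y - regComb (stackX X) b - E) * F) := by
        rw [← e2, frob_smul, abs_of_pos hT']
      rw [e4, ← hF1]
      refine (frob_mul_le _ _).trans ?_
      refine mul_le_mul_of_nonneg_right ?_ (frob_nonneg _)
      refine (frob_sub_le _ _).trans (add_le_add ((frob_sub_le _ _).trans ?_) hEe)
      exact add_le_add le_rfl ((regComb_frob_le _ _).trans (mul_le_mul_of_nonneg_right hb1 hx))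
    rw [le_div_iff₀ hT', mul_comm]; exact e3
  refine ⟨fun k => ?_, fun i j => ?_, fun i j => ?_⟩
  · refine le_trans (le_trans (Real.le_sqrt_of_sq_le ?_) hb1) hB1
    rw [sq_abs, dotProduct, pow_two]
    exact Finset.single_le_sum (f := fun k => b k * b k) (fun _ _ => mul_self_nonneg _)
      (Finset.mem_univ k)
  · exact (abs_entry_le_frob L i j).trans (hL1.trans hB2)
  · exact (abs_entry_le_frob F i j).trans (hF1.le.trans hB3)

/-- The criterion has a minimizer if it is coercive. -/
lemma exists_isWPC (hT : 0 < T) (hrT : r ≤ T) {W : Matrix (Fin N) (Fin N) ℝ} (hW : Wᵀ = W) {a c : ℝ}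
    (ha : 0 < a) (hc : 0 < c) (hWa : ∀ v : Fin N → ℝ, a * (v ⬝ᵥ v) ≤ v ⬝ᵥ W *ᵥ v)
    (Y : Fin T → Fin N → ℝ) (X : Fin T → Matrix (Fin N) (Fin d) ℝ)
    (hX : ∀ F : Matrix (Fin T) (Fin r) ℝ, (T : ℝ)⁻¹ • (Fᵀ * F) = 1 → ∀ v : Fin d → ℝ,
      c * (v ⬝ᵥ v) ≤ frob (regComb (stackX X) v * (1 - (T : ℝ)⁻¹ • (F * Fᵀ))) ^ 2) :
    ∃ (b : Fin d → ℝ) (L : Matrix (Fin N) (Fin r) ℝ) (F : Matrix (Fin T) (Fin r) ℝ),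
      IsWPC W Y X b L F := by
  obtain ⟨L₀, F₀, hn₀, -⟩ := exists_isNormalized hT hrT hW (0 : Matrix (Fin N) (Fin r) ℝ) 0
  obtain ⟨B, hB0, hB⟩ := exists_bound_of_wlsCriterion_le hT ha hc hWa Y X hX
    (wlsCriterion W Y X 0 L₀ F₀)
  let s : Set ((Fin d → ℝ) × (Fin N → Fin r → ℝ) × (Fin T → Fin r → ℝ)) :=
    {p | IsNormalized W (Matrix.of p.2.1) (Matrix.of p.2.2) ∧
      wlsCriterion W Y X p.1 (Matrix.of p.2.1) (Matrix.of p.2.2) ≤ wlsCriterion W Y X 0 L₀ F₀}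
  have hΦ : Continuous fun p : (Fin d → ℝ) × (Fin N → Fin r → ℝ) × (Fin T → Fin r → ℝ) =>
      wlsCriterion W Y X p.1 (Matrix.of p.2.1) (Matrix.of p.2.2) := by
    unfold wlsCriterion
    simp only [Matrix.mulVec, dotProduct, Pi.sub_apply, Matrix.of_apply]
    fun_prop
  have hclosed : IsClosed s := by
    refine IsClosed.and ?_ (isClosed_le hΦ continuous_const)
    refine IsClosed.and ?_ ?_
    · refine isClosed_eq ?_ continuous_const
      refine continuous_matrix fun i j => ?_
      simp only [Matrix.smul_apply, Matrix.mul_apply, Matrix.transpose_apply, Matrix.of_apply, smul_eq_mul]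
      fun_prop
    · simp only [Matrix.IsDiag, Pairwise, Set.ofPred_forall]
      refine isClosed_iInter fun i => isClosed_iInter fun j => isClosed_iInter fun _ => ?_
      refine isClosed_eq ?_ continuous_const
      simp only [Matrix.mul_apply, Matrix.transpose_apply, Matrix.of_apply]
      fun_prop
  have hsub : s ⊆ Metric.closedBall 0 B := by
    rintro ⟨b, L, F⟩ ⟨hF, hle⟩
    obtain ⟨h1, h2, h3⟩ := hB b _ _ hF hle
    rw [mem_closedBall_zero_iff, Prod.norm_mk, Prod.norm_mk]
    refine max_le ?_ (max_le ?_ ?_)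
    · exact (pi_norm_le_iff_of_nonneg hB0).2 h1
    · exact (pi_norm_le_iff_of_nonneg hB0).2 fun i => (pi_norm_le_iff_of_nonneg hB0).2 (h2 i)
    · exact (pi_norm_le_iff_of_nonneg hB0).2 fun i => (pi_norm_le_iff_of_nonneg hB0).2 (h3 i)
  have hcomp : IsCompact s := (isCompact_closedBall 0 B).of_isClosed_subset hclosed hsub
  obtain ⟨⟨b, L, F⟩, hp, hmin⟩ := hcomp.exists_isMinOn ⟨(0, L₀, F₀), hn₀, le_rfl⟩ hΦ.continuousOn
  refine ⟨b, Matrix.of L, Matrix.of F, hp.1, fun b' L' F' hn => ?_⟩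
  by_cases hle : wlsCriterion W Y X b' L' F' ≤ wlsCriterion W Y X 0 L₀ F₀
  · exact isMinOn_iff.1 hmin (b', L', F') ⟨hn, hle⟩
  · exact hp.2.trans (not_le.1 hle).le

end Existence


/-! ### First-order rates from comparison with the truth -/

section CrudeRate

open scoped Matrix.Norms.L2Operator

variable {N T d r : ℕ}

/-- The weight acts on the left and P on the right, so they commute, and by idempotence one copy of
P suffices. -/
lemma frobInner_proj_right {W : Matrix (Fin N) (Fin N) ℝ} {P : Matrix (Fin T) (Fin T) ℝ}
    (hs : Pᵀ = P) (hp : P * P = P) (A B : Matrix (Fin N) (Fin T) ℝ) :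
    frobInner (A * P) (W * (B * P)) = frobInner (A * P) (W * B) := by
  rw [frobInner_mul_right, frobInner_mul_right, hs, Matrix.mul_assoc, Matrix.mul_assoc, hp,
    Matrix.mul_assoc]

lemma frobInner_weight_comm {W : Matrix (Fin N) (Fin N) ℝ} (hW : Wᵀ = W)
    (A B : Matrix (Fin N) (Fin T) ℝ) : frobInner A (W * B) = frobInner B (W * A) := by
  rw [frobInner_comm, frobInner_mul_left, hW]

lemma one_sub_isProj {n : Type*} [Fintype n] [DecidableEq n] {P : Matrix n n ℝ} (hs : Pᵀ = P)
    (hp : P * P = P) : (1 - P)ᵀ = 1 - P ∧ (1 - P) * (1 - P) = 1 - P := by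
  refine ⟨by rw [Matrix.transpose_sub, Matrix.transpose_one, hs], ?_⟩
  rw [Matrix.mul_sub, Matrix.mul_one, Matrix.sub_mul, Matrix.one_mul, hp, sub_self, sub_zero]

lemma frobInner_pythagoras {W : Matrix (Fin N) (Fin N) ℝ} {P : Matrix (Fin T) (Fin T) ℝ}
    (hs : Pᵀ = P) (hp : P * P = P) (E : Matrix (Fin N) (Fin T) ℝ) :
    frobInner E (W * E) = frobInner (E * P) (W * (E * P))
      + frobInner (E * (1 - P)) (W * (E * (1 - P))) := by
  obtain ⟨hs', hp'⟩ := one_sub_isProj hs hp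
  rw [frobInner_proj_right hs hp, frobInner_proj_right hs' hp', ← frobInner_add_left,
    ← Matrix.mul_add, add_sub_cancel, Matrix.mul_one]

lemma frobInner_weight_le (W : Matrix (Fin N) (Fin N) ℝ) (A B : Matrix (Fin N) (Fin T) ℝ) :
    |frobInner A (W * B)| ≤ ‖W‖ * frob A * frob B := by
  refine (abs_frobInner_le _ _).trans ?_
  calc _ ≤ frob A * (‖W‖ * frob B) :=
        mul_le_mul_of_nonneg_left (frob_mul_le_op _ _) (frob_nonneg _)
    _ = _ := by ring

/-- If the bound failed, then G ≥ s + η, so s² ≤ sG. Every term on the right would carry a factor G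
that cancels, which gives the bound after all. -/
lemma le_of_quadratic {a C G s η : ℝ} (ha : 0 < a) (hC : 0 ≤ C) (hG : 0 ≤ G) (hs : 0 ≤ s) (hη : 0 ≤ η)
    (h : a * G ^ 2 ≤ C * (s ^ 2 + s * G + η * G)) : G ≤ (2 * C / a + 1) * (s + η) := by
  by_contra! hlt
  have h1 : 0 ≤ C / a := by positivity
  have h2 : G ^ 2 ≤ C / a * (s ^ 2 + s * G + η * G) := by
    rw [div_mul_eq_mul_div, le_div_iff₀ ha]; linarith
  have h3 : s + η ≤ G := by
    refine le_trans ?_ hlt.le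
    rw [mul_div_assoc]
    nlinarith
  have h4 : s ^ 2 ≤ s * G := by nlinarith
  have h5 : G ^ 2 ≤ 2 * (C / a) * (s + η) * G := by
    have : C / a * (s ^ 2 + s * G + η * G) ≤ C / a * (2 * (s + η) * G) := by
      gcongr; nlinarith [mul_nonneg hη hG]
    linarith
  have h6 : 0 < G := by
    refine lt_of_le_of_lt ?_ hlt
    positivity
  have h7 : G ≤ 2 * (C / a) * (s + η) := by
    by_contra! hh
    nlinarith
  rw [mul_div_assoc] at hlt
  nlinarith

/-- The bounds of first order for a weighted principal components estimate. Here `δ` stands for the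
error of the slope estimate and `D` for its norm, in the scale `√(NT)`. -/
theorem crude_rate (K : ℝ) (r : ℕ) : ∃ K' : ℝ, 0 < K' ∧ ∀ {N T d : ℕ}, 0 < N → 0 < T →
    ∀ (W : Matrix (Fin N) (Fin N) ℝ) (Λ L : Matrix (Fin N) (Fin r) ℝ)
      (F₀ F : Matrix (Fin T) (Fin r) ℝ) (u : Matrix (Fin N) (Fin T) ℝ)
      (X : Fin d → Matrix (Fin N) (Fin T) ℝ) (δ : Fin d → ℝ) (D η : ℝ),
      0 ≤ D → 0 ≤ η → 1 ≤ K → Wᵀ = W → (∀ v : Fin N → ℝ, K⁻¹ * (v ⬝ᵥ v) ≤ v ⬝ᵥ W *ᵥ v) → ‖W‖ ≤ K →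
      (T : ℝ)⁻¹ • (Fᵀ * F) = 1 →
      (∀ B : Matrix (Fin r) (Fin T) ℝ, √N * frob B ≤ K * frob (Λ * B)) →
      frob Λ ≤ K * √N → ‖u‖ ≤ K * √N →
      frob (regComb X δ) ≤ K * D →
      D ≤ K * frob ((Λ * F₀ᵀ - regComb X δ) * (1 - (T : ℝ)⁻¹ • (F * Fᵀ))) →
      |frobInner (regComb X δ) (W * u)| ≤ η * D →
      frobInner (Λ * F₀ᵀ + u - regComb X δ - L * Fᵀ) (W * (Λ * F₀ᵀ + u - regComb X δ - L * Fᵀ))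
        ≤ frobInner u (W * u) →
      D ≤ K' * (√N + η) ∧
      √N * frob (F₀ᵀ * (1 - (T : ℝ)⁻¹ • (F * Fᵀ))) ≤ K' * (√N + η) := by
  set C : ℝ := K * (r * K) ^ 2 + 2 * (K ^ 4 * (1 + K ^ 2)) + 2 * K + 2 * (K * (K * K) * (r * K)) with hC
  -- The condition 1 ≤ K enters only later, so absolute values keep the witness positive for every
  -- K.
  refine ⟨(|K| + 1 + |K| * (1 + |K| * |K|)) * (2 * |C| / |K|⁻¹ + 1), by positivity, ?_⟩
  intro N T d hN hT W Λ L F₀ F u X δ D η hD hη hK hW hWc hWn hF hΛ hΛf hu hX hDG hη' hmin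
  have hK0 : 0 < K := by linarith
  have hT' : (0 : ℝ) < T := by exact_mod_cast hT
  obtain ⟨p1, p2, p3, p4⟩ := normalized_proj hF
  obtain ⟨q1, q2⟩ := one_sub_isProj p1 p2
  set P := 1 - (T : ℝ)⁻¹ • (F * Fᵀ) with hP
  clear_value P
  set s := √(N : ℝ) with hs
  have hs0 : 0 < s := Real.sqrt_pos.2 (by exact_mod_cast hN)
  set A := Λ * F₀ᵀ with hA
  set H := regComb X δ with hH
  set B := (A - H) * P with hB
  set G := frob B with hG
  have hG0 : 0 ≤ G := frob_nonneg _
  have hPn : ‖P‖ ≤ 1 := op_le_one_of_proj p1 p2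
  -- I − P has Frobenius norm at most r, so this part of u is of the order of its operator norm √N
  -- and not of its Frobenius norm √(NT).
  have huP : frob (u * (1 - P)) ≤ r * K * s := by
    have : (1 : Matrix (Fin T) (Fin T) ℝ) - P = (T : ℝ)⁻¹ • (F * Fᵀ) := by rw [hP, sub_sub_cancel]
    rw [this]
    refine (frob_mul_le_op _ _).trans ?_
    have h1 : frob ((T : ℝ)⁻¹ • (F * Fᵀ)) ≤ r := by
      rw [frob_smul, abs_of_pos (inv_pos.2 hT'), inv_mul_le_iff₀ hT']
      refine (frob_mul_le _ _).trans ?_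
      rw [frob_transpose, ← pow_two, normalized_frob_sq hT hF, mul_comm]
    calc ‖u‖ * _ ≤ (K * s) * r := mul_le_mul hu h1 (frob_nonneg _) (by positivity)
      _ = _ := by ring
  -- Split both sides of the minimality inequality along P and I − P. The part of the residual along
  -- F is dropped, LF' vanishes under P, and the quadratic form of uP cancels.
  have hexp : K⁻¹ * G ^ 2 ≤ K * frob (u * (1 - P)) ^ 2 + 2 * |frobInner B (W * u)| := by
    set E := A + u - H - L * Fᵀ with hE
    have e1 : E * P = B + u * P := by
      have : L * Fᵀ * P = 0 := by rw [Matrix.mul_assoc, p4, Matrix.mul_zero]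
      rw [hE, hB, Matrix.sub_mul, this, sub_zero, ← Matrix.add_mul]
      congr 1; abel
    have e2 : frobInner (E * P) (W * (E * P)) = frobInner B (W * B) + 2 * frobInner B (W * u)
        + frobInner (u * P) (W * (u * P)) := by
      have h3 : frobInner B (W * (u * P)) = frobInner B (W * u) := by
        rw [hB, frobInner_proj_right p1 p2]
      rw [e1, Matrix.mul_add, frobInner_add_left, frobInner_add_right, frobInner_add_right,
        frobInner_weight_comm hW (u * P) B, h3]
      ring
    have e3 := frobInner_pythagoras (W := W) p1 p2 E
    have e4 := frobInner_pythagoras (W := W) p1 p2 u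
    have h1 : 0 ≤ frobInner (E * (1 - P)) (W * (E * (1 - P))) :=
      le_trans (by positivity) (frobInner_coercive hWc _)
    have h2 := frobInner_coercive hWc B
    have h3 := (le_abs_self _).trans (frobInner_weight_le W (u * (1 - P)) (u * (1 - P)))
    have h4 : ‖W‖ * frob (u * (1 - P)) * frob (u * (1 - P)) ≤ K * frob (u * (1 - P)) ^ 2 := by
      rw [pow_two, mul_assoc]
      exact mul_le_mul_of_nonneg_right hWn (mul_self_nonneg _)
    have h5 := neg_abs_le (frobInner B (W * u))
    linarith
  have hAP : frob (A * P) ≤ G + K * D := by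
    have : A * P = B + H * P := by rw [hB, Matrix.sub_mul, sub_add_cancel]
    rw [this]
    refine (frob_add_le _ _).trans (add_le_add le_rfl ?_)
    refine (frob_mul_le_op' _ _).trans ?_
    nlinarith [frob_nonneg H]
  have hFP : s * frob (F₀ᵀ * P) ≤ K * (G + K * D) := by
    refine (hΛ _).trans ?_
    rw [← Matrix.mul_assoc]
    gcongr
  -- Three sources: the factor space missed by F, paired with Λ'Wu; the score, bounded by η; and the
  -- correction of the score by the low-rank matrix u(I − P).
  have hcross : |frobInner B (W * u)| ≤ K ^ 4 * (G + K * D) * s + η * D + K * (K * D) * (r * K * s) := by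
    have e1 : frobInner B (W * u) = frobInner (A * P) (W * u) - frobInner H (W * u)
        + frobInner H (W * (u * (1 - P))) := by
      have h5 : frobInner (H * P) (W * u) = frobInner H (W * u) - frobInner H (W * (u * (1 - P))) := by
        rw [← frobInner_sub_right, ← Matrix.mul_sub, Matrix.mul_sub u, Matrix.mul_one, sub_sub_cancel,
          frobInner_mul_right, p1, Matrix.mul_assoc]
      rw [hB, Matrix.sub_mul, frobInner_sub_left, h5]; ring
    have h1 : |frobInner (A * P) (W * u)| ≤ K ^ 4 * (G + K * D) * s := by
      rw [hA, Matrix.mul_assoc, frobInner_mul_left]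
      refine (abs_frobInner_le _ _).trans ?_
      have h6 : frob (Λᵀ * (W * u)) ≤ K ^ 3 * s * s := by
        rw [← Matrix.mul_assoc]
        refine (frob_mul_le_op' _ _).trans ?_
        calc frob (Λᵀ * W) * ‖u‖ ≤ (K * s * K) * (K * s) := by
              refine mul_le_mul ?_ hu (norm_nonneg _) (by positivity)
              refine (frob_mul_le_op' _ _).trans ?_
              rw [frob_transpose]
              exact mul_le_mul hΛf hWn (norm_nonneg _) (by positivity)
          _ = _ := by ring
      calc frob (F₀ᵀ * P) * _ ≤ frob (F₀ᵀ * P) * (K ^ 3 * s * s) :=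
            mul_le_mul_of_nonneg_left h6 (frob_nonneg _)
        _ = K ^ 3 * s * (s * frob (F₀ᵀ * P)) := by ring
        _ ≤ K ^ 3 * s * (K * (G + K * D)) := by gcongr
        _ = _ := by ring
    have h2 : |frobInner H (W * (u * (1 - P)))| ≤ K * (K * D) * (r * K * s) :=
      (frobInner_weight_le _ _ _).trans (mul_le_mul (mul_le_mul hWn hX (frob_nonneg _) hK0.le) huP
        (frob_nonneg _) (by positivity))
    rw [e1]
    refine (abs_add_le _ _).trans (add_le_add ((abs_sub _ _).trans (add_le_add h1 hη')) h2)
  have hfin : K⁻¹ * G ^ 2 ≤ C * (s ^ 2 + s * G + η * G) := by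
    refine hexp.trans ?_
    have h1 : frob (u * (1 - P)) ^ 2 ≤ (r * K * s) ^ 2 := pow_le_pow_left₀ (frob_nonneg _) huP 2
    have h2 : |frobInner B (W * u)| ≤ K ^ 4 * (G + K * (K * G)) * s + η * (K * G)
        + K * (K * (K * G)) * (r * K * s) := hcross.trans (by gcongr)
    have hr0 : (0 : ℝ) ≤ r := by positivity
    calc _ ≤ K * (r * K * s) ^ 2 + 2 * (K ^ 4 * (G + K * (K * G)) * s + η * (K * G)
        + K * (K * (K * G)) * (r * K * s)) := by gcongr
      _ = (K * (r * K) ^ 2) * s ^ 2 + (2 * (K ^ 4 * (1 + K ^ 2)) + 2 * (K * (K * K) * (r * K))) * (s * G)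
          + (2 * K) * (η * G) := by ring
      _ ≤ C * s ^ 2 + C * (s * G) + C * (η * G) := by
        have a1 : 0 ≤ K * (r * K) ^ 2 := by positivity
        have a2 : 0 ≤ 2 * (K ^ 4 * (1 + K ^ 2)) := by positivity
        have a3 : 0 ≤ 2 * (K * (K * K) * (r * K)) := by positivity
        gcongr <;> rw [hC] <;> linarith
      _ = _ := by ring
  have hC0 : 0 ≤ C := by positivity
  have hGle := le_of_quadratic (inv_pos.2 hK0) hC0 hG0 hs0.le hη hfin
  rw [abs_of_pos hK0, abs_of_nonneg hC0]
  set Q := (2 * C / K⁻¹ + 1) * (s + η) with hQ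
  have hQ0 : 0 ≤ Q := by positivity
  constructor
  · refine hDG.trans ?_
    calc K * G ≤ K * Q := by gcongr
      _ ≤ (K + 1 + K * (1 + K * K)) * Q := by
        gcongr
        have : 0 ≤ K * (1 + K * K) := by positivity
        linarith
      _ = _ := by rw [hQ]; ring
  · refine hFP.trans ?_
    calc K * (G + K * D) ≤ K * (Q + K * (K * Q)) := by
          gcongr
          exact hDG.trans (by gcongr)
      _ = K * (1 + K * K) * Q := by ring
      _ ≤ (K + 1 + K * (1 + K * K)) * Q := by gcongr; linarith
      _ = _ := by rw [hQ]; ring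

end CrudeRate


/-! ### The refined rate of the unweighted slope estimate -/

section RefinedRate

open scoped Matrix.Norms.L2Operator

variable {N T d r : ℕ}

/-- The projection `I - L(L'L)⁻¹L'` on the orthogonal complement of the column space. -/
noncomputable def annih {n k : Type*} [Fintype n] [Fintype k] [DecidableEq n] [DecidableEq k]
    (L : Matrix n k ℝ) : Matrix n n ℝ := 1 - L * (Lᵀ * L)⁻¹ * Lᵀ

lemma annih_proj {n k : Type*} [Fintype n] [Fintype k] [DecidableEq n] [DecidableEq k]
    {L : Matrix n k ℝ} (h : IsUnit (Lᵀ * L).det) :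
    (annih L)ᵀ = annih L ∧ annih L * annih L = annih L ∧ annih L * L = 0 ∧ Lᵀ * annih L = 0 := by
  have h1 : (annih L)ᵀ = annih L := by
    simp [annih, Matrix.transpose_mul, Matrix.transpose_nonsing_inv, Matrix.mul_assoc]
  have h3 : annih L * L = 0 := by
    rw [annih, Matrix.sub_mul, Matrix.one_mul, Matrix.mul_assoc, Matrix.mul_assoc,
      Matrix.nonsing_inv_mul _ h, Matrix.mul_one, sub_self]
  refine ⟨h1, ?_, h3, ?_⟩
  · have h4 : ∀ Z : Matrix n n ℝ, Z * annih L = Z - Z * L * ((Lᵀ * L)⁻¹ * Lᵀ) := fun Z => by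
      rw [annih, Matrix.mul_sub, Matrix.mul_one, Matrix.mul_assoc Z L, Matrix.mul_assoc L]
    rw [h4, h3, Matrix.zero_mul, sub_zero]
  · rw [← h1, ← Matrix.transpose_mul, h3, Matrix.transpose_zero]

/-- First order condition for a least squares fit. -/
lemma transpose_mul_eq_zero_of_min {m n k : Type*} [Fintype m] [Fintype n] [Fintype k]
    {E : Matrix m n ℝ} {L : Matrix m k ℝ} (h : ∀ G : Matrix k n ℝ, frob E ^ 2 ≤ frob (E - L * G) ^ 2) :
    Lᵀ * E = 0 := by
  set a := frob (Lᵀ * E) ^ 2 with ha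
  set b := frob (L * (Lᵀ * E)) ^ 2 with hb
  have key : ∀ t : ℝ, 2 * t * a ≤ t ^ 2 * b := by
    intro t
    have h1 := h (t • (Lᵀ * E))
    rw [Matrix.mul_smul, frob_sq (E - _), frobInner_sub_left, frobInner_sub_right, frobInner_sub_right,
      frobInner_smul_left, frobInner_smul_right, frobInner_smul_right, frobInner_comm E (L * _),
      frobInner_smul_left, frobInner_mul_left L _ E, ← frob_sq, ← frob_sq, ← frob_sq] at h1
    nlinarith
  have ha0 : 0 ≤ a := sq_nonneg _
  have hb0 : 0 ≤ b := sq_nonneg _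
  have : a = 0 := by
    -- Nearly the optimal step length a/b; the 1 guards against b = 0.
    have h1 := key (a / (b + 1))
    have h2 : 0 < b + 1 := by linarith
    rw [div_pow] at h1
    have h3 : 2 * (a / (b + 1)) * a = 2 * a ^ 2 * (b + 1) / (b + 1) ^ 2 := by field_simp
    rw [h3, div_mul_eq_mul_div, div_le_div_iff_of_pos_right (by positivity)] at h1
    nlinarith [mul_nonneg (sq_nonneg a) hb0, sq_nonneg a]
  exact frob_eq_zero (pow_eq_zero_iff two_ne_zero |>.1 this)

lemma mul_eq_zero_of_min {m n k : Type*} [Fintype m] [Fintype n] [Fintype k]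
    {E : Matrix m n ℝ} {F : Matrix n k ℝ} (h : ∀ G : Matrix m k ℝ, frob E ^ 2 ≤ frob (E - G * Fᵀ) ^ 2) :
    E * F = 0 := by
  have := transpose_mul_eq_zero_of_min (E := Eᵀ) (L := F) fun G => by
    have := h Gᵀ
    rwa [← Matrix.transpose_mul, ← frob_transpose E, ← frob_transpose (E - _), Matrix.transpose_sub,
      Matrix.transpose_transpose] at this
  rw [← Matrix.transpose_transpose (E * F), Matrix.transpose_mul, this, Matrix.transpose_zero]

/-- The rotation `F₀'F/T` between true and estimated factors is invertible if the estimated factors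
nearly span the true ones. -/
lemma rotation_inv {K : ℝ} (hK : 1 ≤ K) (hT : 0 < T) {F₀ F : Matrix (Fin T) (Fin r) ℝ}
    (hF : (T : ℝ)⁻¹ • (Fᵀ * F) = 1)
    (hF₀ : ∀ v : Fin r → ℝ, T * (v ⬝ᵥ v) ≤ K * ((F₀ *ᵥ v) ⬝ᵥ (F₀ *ᵥ v)))
    (hP : 2 * K * frob (F₀ᵀ * (1 - (T : ℝ)⁻¹ • (F * Fᵀ))) ^ 2 ≤ T) :
    IsUnit ((T : ℝ)⁻¹ • (F₀ᵀ * F)).det ∧ ‖((T : ℝ)⁻¹ • (F₀ᵀ * F))⁻¹‖ ≤ 2 * K := by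
  have hT' : (0 : ℝ) < T := by exact_mod_cast hT
  obtain ⟨p1, p2, p3, p4⟩ := normalized_proj hF
  set P := 1 - (T : ℝ)⁻¹ • (F * Fᵀ) with hPd
  set H := (T : ℝ)⁻¹ • (F₀ᵀ * F) with hH
  -- Pythagoras for the columns of F₀: the part in the span of F is the whole minus the part
  -- outside, which by hypothesis takes at most half of the lower bound on F₀'F₀.
  have e1 : T • (H * Hᵀ) = F₀ᵀ * F₀ - F₀ᵀ * P * (F₀ᵀ * P)ᵀ := by
    have : F₀ᵀ * P * (F₀ᵀ * P)ᵀ = F₀ᵀ * F₀ - F₀ᵀ * ((T : ℝ)⁻¹ • (F * Fᵀ)) * F₀ := by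
      rw [Matrix.transpose_mul, p1, Matrix.transpose_transpose, Matrix.mul_assoc, ← Matrix.mul_assoc P,
        p2, hPd, Matrix.sub_mul, Matrix.one_mul, Matrix.mul_sub, Matrix.mul_assoc F₀ᵀ]
    rw [this, sub_sub_cancel, hH]
    rw [← Nat.cast_smul_eq_nsmul ℝ]
    simp only [Matrix.transpose_smul, Matrix.transpose_mul, Matrix.transpose_transpose,
      Matrix.smul_mul, Matrix.mul_smul, smul_smul, Matrix.mul_assoc, mul_inv_cancel_left₀ hT'.ne']
  have hco : ∀ v : Fin r → ℝ, (2 * K)⁻¹ * (v ⬝ᵥ v) ≤ v ⬝ᵥ (H * Hᵀ) *ᵥ v := by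
    intro v
    have h1 : T * (v ⬝ᵥ (H * Hᵀ) *ᵥ v) = (F₀ *ᵥ v) ⬝ᵥ (F₀ *ᵥ v)
        - ((F₀ᵀ * P)ᵀ *ᵥ v) ⬝ᵥ ((F₀ᵀ * P)ᵀ *ᵥ v) := by
      have := congrArg (fun A => v ⬝ᵥ A *ᵥ v) e1
      simp only [Matrix.sub_mulVec, dotProduct_sub] at this
      rw [← Nat.cast_smul_eq_nsmul ℝ, Matrix.smul_mulVec, dotProduct_smul, smul_eq_mul,
        ← Matrix.mulVec_mulVec, ← Matrix.mulVec_mulVec, Matrix.dotProduct_mulVec v F₀ᵀ,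
        Matrix.vecMul_transpose, ← Matrix.mulVec_mulVec v (F₀ᵀ * P), Matrix.dotProduct_mulVec v (F₀ᵀ * P),
        ← Matrix.mulVec_transpose (F₀ᵀ * P)] at this
      rw [← this, Matrix.mulVec_mulVec]
    have h2 := mulVec_dot_le (F₀ᵀ * P)ᵀ v
    have h3 : ‖(F₀ᵀ * P)ᵀ‖ ^ 2 ≤ frob (F₀ᵀ * P) ^ 2 := by
      rw [op_transpose]; exact pow_le_pow_left₀ (norm_nonneg _) (op_le_frob _) 2
    have hv : 0 ≤ v ⬝ᵥ v := by rw [dotProduct_self_eq_norm]; positivity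
    have h4 := hF₀ v
    have h5 : 2 * K * (frob (F₀ᵀ * P) ^ 2 * (v ⬝ᵥ v)) ≤ T * (v ⬝ᵥ v) := by
      rw [← mul_assoc]; exact mul_le_mul_of_nonneg_right hP hv
    have h6 : ‖(F₀ᵀ * P)ᵀ‖ ^ 2 * (v ⬝ᵥ v) ≤ frob (F₀ᵀ * P) ^ 2 * (v ⬝ᵥ v) :=
      mul_le_mul_of_nonneg_right h3 hv
    rw [inv_mul_le_iff₀ (by positivity)]
    have h7 : 2 * K * (T * (v ⬝ᵥ (H * Hᵀ) *ᵥ v)) ≥ T * (v ⬝ᵥ v) := by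
      rw [h1]; nlinarith
    nlinarith
  obtain ⟨hu, hn⟩ := inv_of_coercive (by positivity) hco
  have huH : IsUnit H.det := by
    rw [Matrix.det_mul, Matrix.det_transpose] at hu
    exact isUnit_of_mul_isUnit_left hu
  refine ⟨huH, ?_⟩
  have h1 := Matrix.l2_opNorm_conjTranspose_mul_self H⁻¹
  rw [Matrix.conjTranspose_eq_transpose_of_trivial, Matrix.transpose_nonsing_inv, ← Matrix.mul_inv_rev] at h1
  rw [h1, one_div, inv_inv] at hn
  by_contra! hc
  nlinarith

/-- Here n = √N, τ = √T and p is the logarithmic factor. Young's inequality absorbs the terms with D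
into three quarters of D², since τ² ≥ 4C. The four remaining terms are each at most C²θτ², whence 16
= 4·4. -/
lemma refined_scalar {C θ n p τ D : ℝ} (hC : 1 ≤ C) (hθ0 : 0 < θ) (hθ : 4 * C * θ ≤ 1) (hn : 1 ≤ n)
    (hp : 1 ≤ p) (hτ : 0 < τ) (hnp : n * p ^ 2 ≤ θ * τ ^ 2)
    (h : D ^ 2 ≤ C * (p * D + n * p + n * D / τ + p ^ 2 + D ^ 2 / τ ^ 2)) :
    D ^ 2 ≤ 16 * C ^ 2 * (θ * τ ^ 2) := by
  have hτ2 : 0 < τ ^ 2 := by positivity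
  have h1 : n * p ≤ θ * τ ^ 2 := by
    have : p ≤ p ^ 2 := by nlinarith
    exact (mul_le_mul_of_nonneg_left this (by linarith)).trans hnp
  have h2 : p ^ 2 ≤ θ * τ ^ 2 := le_trans (by nlinarith [sq_nonneg p]) hnp
  have h3 : 1 ≤ θ * τ ^ 2 := le_trans (by nlinarith) hnp
  have h4 : C * (D ^ 2 / τ ^ 2) ≤ D ^ 2 / 4 := by
    rw [mul_div_assoc', div_le_div_iff₀ hτ2 (by norm_num)]
    have : 4 * C ≤ τ ^ 2 := by nlinarith
    nlinarith [sq_nonneg D]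
  have h5 : C * (p * D) ≤ D ^ 2 / 4 + C ^ 2 * p ^ 2 := by nlinarith [sq_nonneg (D / 2 - C * p)]
  have h6 : (n / τ) ^ 2 ≤ θ * τ ^ 2 := by
    have h7 : n ≤ θ * τ ^ 2 := le_trans (by nlinarith) h1
    rw [div_pow, div_le_iff₀ hτ2]
    have hθ1 : θ ≤ 1 := by nlinarith
    calc n ^ 2 ≤ (θ * τ ^ 2) ^ 2 := by gcongr
      _ = θ * (θ * τ ^ 2 * τ ^ 2) := by ring
      _ ≤ 1 * (θ * τ ^ 2 * τ ^ 2) := by gcongr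
      _ = _ := by ring
  have h8 : C * (n * D / τ) ≤ D ^ 2 / 4 + C ^ 2 * (n / τ) ^ 2 := by
    rw [mul_div_right_comm]
    nlinarith [sq_nonneg (D / 2 - C * (n / τ))]
  have h9 : C ^ 2 * p ^ 2 ≤ C ^ 2 * (θ * τ ^ 2) := by gcongr
  have h10 : C ^ 2 * (n / τ) ^ 2 ≤ C ^ 2 * (θ * τ ^ 2) := by gcongr
  have h11 : C * (n * p) ≤ C ^ 2 * (θ * τ ^ 2) := by
    calc C * (n * p) ≤ C * (θ * τ ^ 2) := by gcongr
      _ ≤ C ^ 2 * (θ * τ ^ 2) := by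
        have : C ≤ C ^ 2 := by nlinarith
        gcongr
  have h12 : C * p ^ 2 ≤ C ^ 2 * (θ * τ ^ 2) := by
    calc C * p ^ 2 ≤ C * (θ * τ ^ 2) := by gcongr
      _ ≤ C ^ 2 * (θ * τ ^ 2) := by
        have : C ≤ C ^ 2 := by nlinarith
        gcongr
  have h13 : C * (p * D + n * p + n * D / τ + p ^ 2 + D ^ 2 / τ ^ 2) = C * (p * D) + C * (n * p)
    + C * (n * D / τ) + C * p ^ 2 + C * (D ^ 2 / τ ^ 2) := by ring
  linarith

lemma frob_sub_sq {m n : Type*} [Fintype m] [Fintype n] (A B : Matrix m n ℝ) :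
    frob (A - B) ^ 2 = frob A ^ 2 - 2 * frobInner A B + frob B ^ 2 := by
  rw [frob_sq, frob_sq, frob_sq, frobInner_sub_left, frobInner_sub_right, frobInner_sub_right,
    frobInner_comm B A]
  ring

/-- Only ⟨B, C⟩ is estimated, at the cost of half of ‖B‖². The products with A stay exact, because A
is the large noise matrix and Cauchy–Schwarz would be too crude for them. -/
lemma frob_sub_sub_sq_ge {m n : Type*} [Fintype m] [Fintype n] (A B C : Matrix m n ℝ) :
    frob A ^ 2 + frob B ^ 2 / 2 - frob C ^ 2 - 2 * frobInner A B - 2 * frobInner A C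
      ≤ frob (A - B - C) ^ 2 := by
  have h1 : frob (A - B - C) ^ 2 = frob A ^ 2 + frob B ^ 2 + frob C ^ 2
      - 2 * frobInner A B - 2 * frobInner A C + 2 * frobInner B C := by
    simp only [frob_sq, frobInner_sub_left, frobInner_sub_right, frobInner_comm C,
      frobInner_comm B A]
    ring
  have h2 := neg_abs_le (frobInner B C)
  have h3 := abs_frobInner_le B C
  nlinarith [sq_nonneg (frob B - 2 * frob C)]

/-- Bookkeeping for `refined_rate`: e is the squared norm of the projected regressor term, and all
powers of K are raised to a common one. -/
lemma refined_collect {K n p τ D e : ℝ} (hK : 1 ≤ K) (hn : 0 ≤ n) (hp : 0 ≤ p) (hτ : 0 < τ) (hD : 0 ≤ D)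
    (hD2 : D ^ 2 ≤ K ^ 2 * e)
    (h : e / 2 ≤ (96 * K ^ 11 * (p + D / τ)) ^ 2 + 2 * (K * p * D)
      + 2 * (K * n * (96 * K ^ 11 * (p + D / τ))) + 2 * (K * n * (K ^ 5 * p)) + (K ^ 5 * p) ^ 2) :
    D ^ 2 ≤ 40000 * K ^ 24 * (p * D + n * p + n * D / τ + p ^ 2 + D ^ 2 / τ ^ 2) := by
  have w1 : 0 ≤ p * D := by positivity
  have w2 : 0 ≤ n * p := by positivity
  have w3 : 0 ≤ n * D / τ := by positivity
  have w4 : 0 ≤ p ^ 2 := by positivity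
  have w5 : 0 ≤ D ^ 2 / τ ^ 2 := by positivity
  have v : ∀ k, k ≤ 22 → K ^ k ≤ K ^ 22 := fun k hk => pow_le_pow_right₀ hK hk
  have hpd : (p + D / τ) ^ 2 ≤ 2 * p ^ 2 + 2 * (D ^ 2 / τ ^ 2) := by
    rw [← div_pow]; nlinarith [sq_nonneg (p - D / τ)]
  have g1 : e ≤ 40000 * K ^ 22 * (p * D + n * p + n * D / τ + p ^ 2 + D ^ 2 / τ ^ 2) := by
    have t0 : (96 * K ^ 11 * (p + D / τ)) ^ 2 ≤ 9216 * K ^ 22 * (2 * p ^ 2 + 2 * (D ^ 2 / τ ^ 2)) := by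
      calc (96 * K ^ 11 * (p + D / τ)) ^ 2 = 9216 * K ^ 22 * (p + D / τ) ^ 2 := by ring
        _ ≤ _ := by gcongr
    have t1 : K * p * D ≤ K ^ 22 * (p * D) := by
      have := v 1 (by norm_num); rw [pow_one] at this; rw [mul_assoc]; gcongr
    have t2 : K * n * (96 * K ^ 11 * (p + D / τ)) ≤ 96 * K ^ 22 * (n * p + n * D / τ) := by
      have := v 12 (by norm_num)
      calc _ = 96 * K ^ 12 * (n * p + n * D / τ) := by ring
        _ ≤ _ := by gcongr
    have t3 : K * n * (K ^ 5 * p) ≤ K ^ 22 * (n * p) := by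
      have := v 6 (by norm_num)
      calc _ = K ^ 6 * (n * p) := by ring
        _ ≤ _ := by gcongr
    have t4 : (K ^ 5 * p) ^ 2 ≤ K ^ 22 * p ^ 2 := by
      have := v 10 (by norm_num)
      calc _ = K ^ 10 * p ^ 2 := by ring
        _ ≤ _ := by gcongr
    have k22 : 0 < K ^ 22 := by positivity
    linarith [mul_nonneg k22.le w1, mul_nonneg k22.le w2, mul_nonneg k22.le w3,
      mul_nonneg k22.le w4, mul_nonneg k22.le w5]
  calc D ^ 2 ≤ K ^ 2 * e := hD2
    _ ≤ K ^ 2 * (40000 * K ^ 22 * (p * D + n * p + n * D / τ + p ^ 2 + D ^ 2 / τ ^ 2)) := by gcongr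
    _ = _ := by ring

/-- As n, p ≥ 1, the rate condition forces θτ² ≥ 1: a small θ makes τ as large as needed. -/
lemma refined_scales {K θ n p τ : ℝ} (hK : 1 ≤ K) (hθ : 0 < θ) (hθK : 16 * (40000 * K ^ 24) ^ 2 * θ ≤ 1)
    (hn : 1 ≤ n) (hp : 1 ≤ p) (hτ : 1 ≤ τ) (hnp : n * p ^ 2 ≤ θ * τ ^ 2) :
    1 ≤ 40000 * K ^ 24 ∧ 4 * (40000 * K ^ 24) * θ ≤ 1 ∧ 8 * K ^ 5 ≤ τ ∧ n ≤ τ ^ 2 := by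
  have hc : 1 ≤ 40000 * K ^ 24 := by linarith [one_le_pow₀ hK (n := 24)]
  have h5 : 8 * K ^ 5 ≤ 40000 * K ^ 24 := by
    have h2 : K ^ 5 ≤ K ^ 24 := pow_le_pow_right₀ hK (by norm_num)
    have : 0 ≤ K ^ 24 := by positivity
    linarith
  have hk5 : 0 ≤ K ^ 5 := by positivity
  generalize 40000 * K ^ 24 = c at *
  have h1 : 1 ≤ θ * τ ^ 2 := (one_le_mul_of_one_le_of_one_le hn (one_le_pow₀ hp)).trans hnp
  have hcc : c ≤ c ^ 2 := le_self_pow₀ hc two_ne_zero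
  have h2 : 4 * c * θ ≤ 1 := le_trans (by gcongr; norm_num) hθK
  have h3 : c ^ 2 ≤ τ ^ 2 := by nlinarith [sq_nonneg c]
  refine ⟨hc, h2, h5.trans ((pow_le_pow_iff_left₀ (by linarith) (by linarith) two_ne_zero).1 h3), ?_⟩
  have hθ1 : θ ≤ 1 := by nlinarith
  calc n ≤ n * p ^ 2 := le_mul_of_one_le_right (by linarith) (one_le_pow₀ hp)
    _ ≤ θ * τ ^ 2 := hnp
    _ ≤ 1 * τ ^ 2 := by gcongr
    _ = _ := one_mul _

/-- The error of the loadings is smaller than n by the factor τ, so for τ ≥ 8K⁵ it is absorbed into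
half of the left side. -/
lemma coercive_scalar {K n τ b lb lam : ℝ} (hτ : 0 < τ) (hn : 0 ≤ n) (hb : 0 ≤ b)
    (hτK : 8 * K ^ 5 ≤ τ) (h5 : n * b ≤ 2 * K ^ 2 * lam) (h3 : lam ≤ lb + 2 * K ^ 3 * (n / τ) * b) :
    n * b ≤ 4 * K ^ 2 * lb := by
  have h4 : 2 * K ^ 2 * (2 * K ^ 3 * (n / τ) * b) ≤ n * b / 2 := by
    have : 4 * K ^ 5 * (n / τ) ≤ n / 2 := by
      rw [mul_div_assoc', div_le_div_iff₀ hτ (by norm_num)]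
      nlinarith
    nlinarith
  have h6 : 2 * K ^ 2 * lam ≤ 2 * K ^ 2 * (lb + 2 * K ^ 3 * (n / τ) * b) := by gcongr
  linarith

section Contraction

variable {m n l : Type*} [Fintype m] [Fintype n] [Fintype l] [DecidableEq m] [DecidableEq n]
  [DecidableEq l]

lemma frob_contract_left {P : Matrix m m ℝ} (hP : ‖P‖ ≤ 1) (A : Matrix m n ℝ) :
    frob (P * A) ≤ frob A :=
  (frob_mul_le_op _ _).trans (mul_le_of_le_one_left (frob_nonneg _) hP)

lemma frob_contract_right {P : Matrix n n ℝ} (hP : ‖P‖ ≤ 1) (A : Matrix m n ℝ) :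
    frob (A * P) ≤ frob A :=
  (frob_mul_le_op' _ _).trans (mul_le_of_le_one_right (frob_nonneg _) hP)

lemma op_contract_left {P : Matrix m m ℝ} (hP : ‖P‖ ≤ 1) (A : Matrix m n ℝ) : ‖P * A‖ ≤ ‖A‖ :=
  (Matrix.l2_opNorm_mul _ _).trans (mul_le_of_le_one_left (norm_nonneg _) hP)

lemma op_contract_right {P : Matrix n n ℝ} (hP : ‖P‖ ≤ 1) (A : Matrix m n ℝ) : ‖A * P‖ ≤ ‖A‖ :=
  (Matrix.l2_opNorm_mul _ _).trans (mul_le_of_le_one_right (norm_nonneg _) hP)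

end Contraction

set_option maxHeartbeats 1000000 in
/-- The refined bound for the unweighted principal components estimate: the error of the slope
estimate is of smaller order than `N^{-1/2}`. -/
theorem refined_rate (K : ℝ) (r : ℕ) (hK : 1 ≤ K) (hrK : r ≤ K) :
    ∃ K' : ℝ, 1 ≤ K' ∧ ∀ {N T d : ℕ}, 0 < N → 0 < T →
    ∀ (Λ L : Matrix (Fin N) (Fin r) ℝ)
      (F₀ F : Matrix (Fin T) (Fin r) ℝ) (u : Matrix (Fin N) (Fin T) ℝ)
      (X : Fin d → Matrix (Fin N) (Fin T) ℝ) (δ : Fin d → ℝ) (D θ p : ℝ),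
      0 ≤ D → 0 < θ → K' * θ ≤ 1 → 1 ≤ p → √N * p ^ 2 ≤ θ * T → T ≤ N →
      (T : ℝ)⁻¹ • (Fᵀ * F) = 1 →
      IsUnit (Λᵀ * Λ).det → IsUnit (F₀ᵀ * F₀).det → ‖(Λᵀ * Λ)⁻¹‖ ≤ K / N → ‖(F₀ᵀ * F₀)⁻¹‖ ≤ K / T →
      (∀ v : Fin r → ℝ, T * (v ⬝ᵥ v) ≤ K * ((F₀ *ᵥ v) ⬝ᵥ (F₀ *ᵥ v))) →
      (∀ B : Matrix (Fin r) (Fin T) ℝ, √N * frob B ≤ K * frob (Λ * B)) →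
      frob Λ ≤ K * √N → frob F₀ ≤ K * √T → ‖u‖ ≤ K * √N → frob (Λᵀ * u) ≤ K * (√N * √T * p) →
      frob (regComb X δ) ≤ K * D → D ≤ K * √N →
      frob (F₀ᵀ * (1 - (T : ℝ)⁻¹ • (F * Fᵀ))) ≤ K →
      D ≤ K * frob (annih Λ * regComb X δ * annih F₀) →
      |frobInner (annih Λ * regComb X δ * annih F₀) u| ≤ K * p * D →
      (∀ (L' : Matrix (Fin N) (Fin r) ℝ) (F' : Matrix (Fin T) (Fin r) ℝ),
        frob (Λ * F₀ᵀ + u - regComb X δ - L * Fᵀ) ^ 2 ≤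
          frob (Λ * F₀ᵀ + u - regComb X δ - L' * F'ᵀ) ^ 2) →
      (∀ (L' : Matrix (Fin N) (Fin r) ℝ) (F' : Matrix (Fin T) (Fin r) ℝ),
        frob (Λ * F₀ᵀ + u - regComb X δ - L * Fᵀ) ^ 2 ≤ frob (Λ * F₀ᵀ + u - L' * F'ᵀ) ^ 2) →
      D ^ 2 ≤ K' * (θ * T) := by
  refine ⟨16 * (40000 * K ^ 24) ^ 2, by nlinarith [one_le_pow₀ hK (n := 24)], ?_⟩
  intro N T d hN hT Λ L F₀ F u X δ D θ p hD hθ hθK hp hnp hTN hF huΛ huF hiΛ hiF hF₀c hΛc hΛf hF₀f hu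
    hΛu hX hDn hFP hDE hsc hmin1 hmin2
  have hK0 : 0 < K := by linarith
  have hT' : (0 : ℝ) < T := by exact_mod_cast hT
  have hN1 : (1 : ℝ) ≤ N := by exact_mod_cast hN
  have hT1 : (1 : ℝ) ≤ T := by exact_mod_cast hT
  set n := √(N : ℝ) with hn
  set τ := √(T : ℝ) with hτ
  have hn2 : n ^ 2 = N := Real.sq_sqrt (by positivity)
  have hτ2 : τ ^ 2 = T := Real.sq_sqrt hT'.le
  have hn1 : 1 ≤ n := Real.one_le_sqrt.2 hN1
  have hτ1 : 1 ≤ τ := Real.one_le_sqrt.2 hT1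
  clear_value n τ
  have hτ0 : 0 < τ := by linarith
  have hn0 : 0 < n := by linarith
  have hp0 : 0 < p := by linarith
  rw [← hτ2] at hnp
  obtain ⟨hc1, hθC, hτK, hnτ⟩ := refined_scales hK hθ hθK hn1 hp hτ1 hnp
  obtain ⟨p1, p2, p3, p4⟩ := normalized_proj hF
  obtain ⟨l1, l2, l3, l4⟩ := annih_proj huΛ
  obtain ⟨f1, f2, f3, f4⟩ := annih_proj huF
  have hMΛ := op_le_one_of_proj l1 l2
  have hMF := op_le_one_of_proj f1 f2
  have hFf : frob F ≤ K * τ := by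
    refine (pow_le_pow_iff_left₀ (frob_nonneg _) (by positivity) two_ne_zero).1 ?_
    rw [normalized_frob_sq hT hF, mul_pow, hτ2]
    gcongr
    exact hrK.trans (le_self_pow₀ hK two_ne_zero)
  set R := (T : ℝ)⁻¹ • (F₀ᵀ * F) with hR
  clear_value R
  have hRn : ‖R‖ ≤ K ^ 2 := by
    refine (op_le_frob _).trans ?_
    rw [hR, frob_smul, abs_of_pos (inv_pos.2 hT'), inv_mul_le_iff₀ hT', ← hτ2]
    refine (frob_mul_le _ _).trans ?_
    rw [frob_transpose]
    calc frob F₀ * frob F ≤ (K * τ) * (K * τ) := mul_le_mul hF₀f hFf (frob_nonneg _) (by positivity)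
      _ = _ := by ring
  obtain ⟨hRu, hRi⟩ := rotation_inv hK hT hF hF₀c (by
    calc 2 * K * frob (F₀ᵀ * (1 - (T : ℝ)⁻¹ • (F * Fᵀ))) ^ 2 ≤ 2 * K * K ^ 2 := by
          gcongr; exact frob_nonneg _
      _ ≤ (8 * K ^ 5) ^ 2 := by
        have h1 : K ^ 3 ≤ K ^ 10 := pow_le_pow_right₀ hK (by norm_num)
        calc 2 * K * K ^ 2 = 2 * K ^ 3 := by ring
          _ ≤ 64 * K ^ 10 := by linarith [pow_pos hK0 10]
          _ = _ := by ring
      _ ≤ τ ^ 2 := by gcongr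
      _ = T := hτ2)
  rw [← hR] at hRu hRi
  set H := regComb X δ with hH
  clear_value H
  set e := u - H with he
  clear_value e
  set E := Λ * F₀ᵀ + u - H - L * Fᵀ with hE
  clear_value E
  have hen : ‖e‖ ≤ 2 * K ^ 2 * n := by
    rw [he]
    refine (norm_sub_le _ _).trans ?_
    have h1 : ‖H‖ ≤ K * (K * n) := (op_le_frob _).trans (hX.trans (by gcongr))
    have h2 : K * n ≤ K ^ 2 * n := by gcongr; exact le_self_pow₀ hK two_ne_zero
    calc ‖u‖ + ‖H‖ ≤ K ^ 2 * n + K * (K * n) := add_le_add (hu.trans h2) h1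
      _ = _ := by ring
  -- First order conditions in the loadings alone and in the factors alone.
  have hEF : E * F = 0 := mul_eq_zero_of_min fun G => by
    have h1 := hmin1 (L + G) F
    rwa [Matrix.add_mul, ← sub_sub, ← hE] at h1
  have hLE : Lᵀ * E = 0 := transpose_mul_eq_zero_of_min fun G => by
    have h1 := hmin1 L (F + Gᵀ)
    rwa [Matrix.transpose_add, Matrix.transpose_transpose, Matrix.mul_add, ← sub_sub, ← hE] at h1
  have hEe : E = Λ * F₀ᵀ + e - L * Fᵀ := by rw [hE, he]; abel
  have hFF : Fᵀ * F = (T : ℝ) • (1 : Matrix (Fin r) (Fin r) ℝ) := by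
    rw [← hF, smul_smul, mul_inv_cancel₀ hT'.ne', one_smul]
  -- The condition EF = 0 solved for L: rotated true loadings plus an averaged error, which is of
  -- order n/τ.
  have hL : L = Λ * R + (T : ℝ)⁻¹ • (e * F) := by
    rw [hEe, Matrix.sub_mul, Matrix.mul_assoc L, hFF, Matrix.mul_smul, Matrix.mul_one, sub_eq_zero] at hEF
    rw [hR, Matrix.mul_smul, ← Matrix.mul_assoc, ← smul_add, ← Matrix.add_mul, hEF, smul_smul,
      inv_mul_cancel₀ hT'.ne', one_smul]
  have heF : frob ((T : ℝ)⁻¹ • (e * F)) ≤ 2 * K ^ 3 * (n / τ) := by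
    rw [frob_smul, abs_of_pos (inv_pos.2 hT'), inv_mul_le_iff₀ hT', ← hτ2]
    refine (frob_mul_le_op _ _).trans ?_
    calc ‖e‖ * frob F ≤ (2 * K ^ 2 * n) * (K * τ) := mul_le_mul hen hFf (frob_nonneg _) (by positivity)
      _ = τ ^ 2 * (2 * K ^ 3 * (n / τ)) := by field_simp
  have hnτ' : n / τ ≤ n := div_le_self hn0.le hτ1
  have hLf : frob L ≤ 3 * K ^ 3 * n := by
    rw [hL]
    refine (frob_add_le _ _).trans ?_
    have h1 : frob (Λ * R) ≤ (K * n) * K ^ 2 :=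
      (frob_mul_le_op' _ _).trans (mul_le_mul hΛf hRn (norm_nonneg _) (by positivity))
    have h2 : 2 * K ^ 3 * (n / τ) ≤ 2 * K ^ 3 * n := by gcongr
    calc _ ≤ (K * n) * K ^ 2 + 2 * K ^ 3 * n := add_le_add h1 (heF.trans h2)
      _ = _ := by ring
  -- L inherits the full rank of Λ: the rotation R has a bounded inverse and the remaining error is
  -- of smaller order.
  have hLc : ∀ B : Matrix (Fin r) (Fin T) ℝ, n * frob B ≤ 4 * K ^ 2 * frob (L * B) := by
    intro B
    have h1 : frob B ≤ 2 * K * frob (R * B) := by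
      have : B = R⁻¹ * (R * B) := by
        rw [← Matrix.mul_assoc, Matrix.nonsing_inv_mul _ hRu, Matrix.one_mul]
      conv_lhs => rw [this]
      exact (frob_mul_le_op _ _).trans (mul_le_mul_of_nonneg_right hRi (frob_nonneg _))
    have h2 := hΛc (R * B)
    have h3 : frob (Λ * (R * B)) ≤ frob (L * B) + 2 * K ^ 3 * (n / τ) * frob B := by
      have : Λ * (R * B) = L * B - ((T : ℝ)⁻¹ • (e * F)) * B := by
        rw [← Matrix.mul_assoc, ← Matrix.sub_mul]
        congr 1
        nth_rewrite 1 [hL]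
        rw [add_sub_cancel_right]
      rw [this]
      refine (frob_sub_le _ _).trans (add_le_add le_rfl ?_)
      exact (frob_mul_le _ _).trans (mul_le_mul_of_nonneg_right heF (frob_nonneg _))
    have h5 : n * frob B ≤ 2 * K ^ 2 * frob (Λ * (R * B)) := by
      calc n * frob B ≤ n * (2 * K * frob (R * B)) := by gcongr
        _ = 2 * K * (n * frob (R * B)) := by ring
        _ ≤ 2 * K * (K * frob (Λ * (R * B))) := by gcongr
        _ = _ := by ring
    exact coercive_scalar hτ0 hn0.le (frob_nonneg _) hτK h5 h3
  -- The part of the estimated factors outside the span of the true ones. With the matching part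
  -- `Y2` of the loadings it forms the second-order term of the lower expansion.
  set Z2 := Fᵀ * annih F₀ with hZ2
  clear_value Z2
  have hLe : frob (Lᵀ * e) ≤ 3 * K ^ 4 * n * (τ * p + D) := by
    have h1 : frob (Lᵀ * u) ≤ 3 * K ^ 4 * (n * τ * p) := by
      have : Lᵀ * u = Rᵀ * (Λᵀ * u) + (T : ℝ)⁻¹ • (Fᵀ * (eᵀ * u)) := by
        conv_lhs => rw [hL]
        rw [Matrix.transpose_add, Matrix.transpose_smul, Matrix.transpose_mul, Matrix.transpose_mul,
          Matrix.add_mul, Matrix.smul_mul, Matrix.mul_assoc, Matrix.mul_assoc]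
      rw [this]
      refine (frob_add_le _ _).trans ?_
      have h2 : frob (Rᵀ * (Λᵀ * u)) ≤ K ^ 2 * (K * (n * τ * p)) := by
        refine (frob_mul_le_op _ _).trans ?_
        rw [op_transpose]
        exact mul_le_mul hRn hΛu (frob_nonneg _) (by positivity)
      have h3 : frob ((T : ℝ)⁻¹ • (Fᵀ * (eᵀ * u))) ≤ 2 * K ^ 4 * (n * τ * p) := by
        rw [frob_smul, abs_of_pos (inv_pos.2 hT'), inv_mul_le_iff₀ hT', ← hτ2]
        refine (frob_mul_le_op' _ _).trans ?_
        rw [frob_transpose]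
        have h4 : ‖eᵀ * u‖ ≤ (2 * K ^ 2 * n) * (K * n) := by
          refine (Matrix.l2_opNorm_mul _ _).trans ?_
          rw [op_transpose]
          exact mul_le_mul hen hu (norm_nonneg _) (by positivity)
        calc frob F * ‖eᵀ * u‖ ≤ (K * τ) * ((2 * K ^ 2 * n) * (K * n)) :=
              mul_le_mul hFf h4 (norm_nonneg _) (by positivity)
          _ = 2 * K ^ 4 * n * τ * (n * 1) := by ring
          _ ≤ 2 * K ^ 4 * n * τ * (τ ^ 2 * p) := by gcongr
          _ = _ := by ring
      have h4 : K ^ 2 * (K * (n * τ * p)) ≤ K ^ 4 * (n * τ * p) := by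
        calc K ^ 2 * (K * (n * τ * p)) = K ^ 3 * (n * τ * p) := by ring
          _ ≤ _ := by gcongr <;> norm_num
      linarith
    have h2 : frob (Lᵀ * H) ≤ 3 * K ^ 4 * (n * D) := by
      refine (frob_mul_le _ _).trans ?_
      rw [frob_transpose]
      calc frob L * frob H ≤ (3 * K ^ 3 * n) * (K * D) := mul_le_mul hLf hX (frob_nonneg _) (by positivity)
        _ = _ := by ring
    rw [he, Matrix.mul_sub]
    refine (frob_sub_le _ _).trans ?_
    calc _ ≤ 3 * K ^ 4 * (n * τ * p) + 3 * K ^ 4 * (n * D) := add_le_add h1 h2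
      _ = _ := by ring
  have hΛM : Λ * F₀ᵀ * annih F₀ = 0 := by rw [Matrix.mul_assoc, f4, Matrix.mul_zero]
  have hMΛ0 : annih Λ * (Λ * F₀ᵀ) = 0 := by rw [← Matrix.mul_assoc, l3, Matrix.zero_mul]
  -- Applying M_{F₀} to L'E = 0 gives L'L Z2 = L'e M_{F₀}; the coercivity of L then divides out L'L.
  have hZ2n : n * frob Z2 ≤ 48 * K ^ 8 * (τ * p + D) := by
    have h1 : Lᵀ * (L * Z2) = Lᵀ * e * annih F₀ := by
      have h2 : Lᵀ * E * annih F₀ = 0 := by rw [hLE, Matrix.zero_mul]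
      rw [hEe, Matrix.mul_assoc, Matrix.sub_mul, Matrix.add_mul, hΛM, zero_add, Matrix.mul_sub,
        sub_eq_zero] at h2
      rw [hZ2, ← Matrix.mul_assoc L, ← h2, Matrix.mul_assoc]
    have h3 : frob (L * Z2) ^ 2 ≤ frob Z2 * (3 * K ^ 4 * n * (τ * p + D)) := by
      rw [frob_sq, frobInner_mul_left, h1]
      refine (frobInner_le _ _).trans (mul_le_mul_of_nonneg_left ?_ (frob_nonneg _))
      exact (frob_contract_right hMF _).trans hLe
    have h4 := hLc Z2
    have h5 : (n * frob Z2) ^ 2 ≤ (n * frob Z2) * (48 * K ^ 8 * (τ * p + D)) := by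
      calc (n * frob Z2) ^ 2 ≤ (4 * K ^ 2 * frob (L * Z2)) ^ 2 :=
            pow_le_pow_left₀ (mul_nonneg hn0.le (frob_nonneg _)) h4 2
        _ = 16 * K ^ 4 * frob (L * Z2) ^ 2 := by ring
        _ ≤ 16 * K ^ 4 * (frob Z2 * (3 * K ^ 4 * n * (τ * p + D))) := by gcongr
        _ = _ := by ring
    rcases (mul_nonneg hn0.le (frob_nonneg Z2)).eq_or_lt with h0 | h0
    · rw [← h0]; positivity
    · rw [pow_two] at h5; exact le_of_mul_le_mul_left h5 h0
  set Y2 := (T : ℝ)⁻¹ • (annih Λ * (e * F)) with hY2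
  clear_value Y2
  have hY2n : frob Y2 ≤ 2 * K ^ 3 * (n / τ) := by
    rw [hY2, ← Matrix.mul_smul]
    exact (frob_contract_left hMΛ _).trans heF
  have hYZ : frob Y2 * frob Z2 ≤ 96 * K ^ 11 * (p + D / τ) := by
    calc frob Y2 * frob Z2 ≤ 2 * K ^ 3 * (n / τ) * frob Z2 :=
          mul_le_mul_of_nonneg_right hY2n (frob_nonneg _)
      _ = 2 * K ^ 3 / τ * (n * frob Z2) := by ring
      _ ≤ 2 * K ^ 3 / τ * (48 * K ^ 8 * (τ * p + D)) := by gcongr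
      _ = _ := by field_simp; ring
  have hYZ0 : 0 ≤ 96 * K ^ 11 * (p + D / τ) := by positivity
  set E0 := annih Λ * u * annih F₀ with hE0
  clear_value E0
  set E1 := annih Λ * H * annih F₀ with hE1
  clear_value E1
  have hMu : ‖annih Λ * u‖ ≤ K * n := (op_contract_left hMΛ _).trans hu
  have hE0n : ‖E0‖ ≤ K * n := by
    rw [hE0]; exact (op_contract_right hMF _).trans hMu
  -- Lower expansion: projecting both sides of the residual can only shrink it, removes ΛF₀', and
  -- turns LF' into a product of two small factors.
  have hlow : frob (E0 - E1 - Y2 * Z2) ≤ frob E := by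
    have h1 : annih Λ * E * annih F₀ = E0 - E1 - Y2 * Z2 := by
      have h2 : annih Λ * L = Y2 := by
        rw [hL, Matrix.mul_add, ← Matrix.mul_assoc, l3, Matrix.zero_mul, zero_add, Matrix.mul_smul, hY2]
      rw [hEe, Matrix.mul_sub, Matrix.mul_add, hMΛ0, zero_add, Matrix.sub_mul, ← Matrix.mul_assoc, h2, he,
        Matrix.mul_sub, Matrix.sub_mul, Matrix.mul_assoc Y2, hE0, hE1, hZ2]
    rw [← h1]
    exact (frob_contract_right hMF _).trans (frob_contract_left hMΛ _)
  -- Upper expansion: least squares corrections of the true loadings and factors. With Λ + `Yu` and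
  -- F₀ + `Zu`' at the true slope, the fit removes from u everything but M_Λ u M_{F₀} and the
  -- product `Yu` `Zu`.
  set Yu := annih Λ * u * (F₀ * (F₀ᵀ * F₀)⁻¹) with hYu
  clear_value Yu
  set Zu := (Λᵀ * Λ)⁻¹ * (Λᵀ * u) with hZu
  clear_value Zu
  have hup : frob E ^ 2 ≤ frob (E0 - Yu * Zu) ^ 2 := by
    have h1 : Λ * F₀ᵀ + u - (Λ + Yu) * (F₀ + Zuᵀ)ᵀ = E0 - Yu * Zu := by
      have e1 : Yu * F₀ᵀ = annih Λ * u * (1 - annih F₀) := by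
        rw [hYu, annih, annih, sub_sub_cancel, Matrix.mul_assoc, Matrix.mul_assoc]
      have e2 : Λ * Zu = (1 - annih Λ) * u := by
        rw [hZu, annih, sub_sub_cancel]
        simp only [Matrix.mul_assoc]
      rw [Matrix.transpose_add, Matrix.transpose_transpose, Matrix.add_mul, Matrix.mul_add,
        Matrix.mul_add, e1, e2, hE0, Matrix.mul_sub, Matrix.mul_one, Matrix.sub_mul, Matrix.one_mul]
      abel
    rw [← h1]
    exact hmin2 _ _
  have hYZu : frob Yu * frob Zu ≤ K ^ 5 * p := by
    have h1 : frob Yu ≤ K ^ 3 * (n / τ) := by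
      rw [hYu]
      refine (frob_mul_le_op _ _).trans ?_
      have h3 : frob (F₀ * (F₀ᵀ * F₀)⁻¹) ≤ (K * τ) * (K / T) :=
        (frob_mul_le_op' _ _).trans (mul_le_mul hF₀f hiF (norm_nonneg _) (by positivity))
      calc _ ≤ (K * n) * ((K * τ) * (K / T)) := mul_le_mul hMu h3 (frob_nonneg _) (by positivity)
        _ = _ := by rw [← hτ2]; field_simp
    have h2 : frob Zu ≤ K ^ 2 * (τ * p / n) := by
      rw [hZu]
      refine (frob_mul_le_op _ _).trans ?_
      calc _ ≤ (K / N) * (K * (n * τ * p)) := mul_le_mul hiΛ hΛu (frob_nonneg _) (by positivity)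
        _ = _ := by rw [← hn2]; field_simp
    calc _ ≤ (K ^ 3 * (n / τ)) * (K ^ 2 * (τ * p / n)) := mul_le_mul h1 h2 (frob_nonneg _) (by positivity)
      _ = _ := by field_simp
  -- The projections move to `E1`, which already carries them; what remains is the score.
  have hc01 : frobInner E0 E1 = frobInner E1 u := by
    rw [hE0, frobInner_mul_right, frobInner_mul_left, frobInner_comm]
    have : (annih Λ)ᵀ * (E1 * (annih F₀)ᵀ) = E1 := by
      rw [l1, f1, hE1, Matrix.mul_assoc _ (annih F₀), f2, Matrix.mul_assoc, ← Matrix.mul_assoc, l2,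
        ← Matrix.mul_assoc]
    rw [this]
  -- The noise matrix enters through its operator norm of order n. With its Frobenius norm of order
  -- nτ the term would be too large.
  have hc02 : |frobInner E0 (Y2 * Z2)| ≤ K * n * (96 * K ^ 11 * (p + D / τ)) := by
    refine (frobInner_mul_le _ _ _).trans ?_
    rw [mul_assoc]
    exact mul_le_mul hE0n hYZ (mul_nonneg (frob_nonneg _) (frob_nonneg _)) (by positivity)
  have hc0u : |frobInner E0 (Yu * Zu)| ≤ K * n * (K ^ 5 * p) := by
    refine (frobInner_mul_le _ _ _).trans ?_
    rw [mul_assoc]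
    exact mul_le_mul hE0n hYZu (mul_nonneg (frob_nonneg _) (frob_nonneg _)) (by positivity)
  have hQ2 : frob (Y2 * Z2) ^ 2 ≤ (96 * K ^ 11 * (p + D / τ)) ^ 2 :=
    pow_le_pow_left₀ (frob_nonneg _) ((frob_mul_le _ _).trans hYZ) 2
  have hQu : frob (Yu * Zu) ^ 2 ≤ (K ^ 5 * p) ^ 2 :=
    pow_le_pow_left₀ (frob_nonneg _) ((frob_mul_le _ _).trans hYZu) 2
  have hx1 := frob_sub_sq E0 (Yu * Zu)
  have hx2 := frob_sub_sub_sq_ge E0 E1 (Y2 * Z2)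
  have hx3 : frob (E0 - E1 - Y2 * Z2) ^ 2 ≤ frob E ^ 2 := pow_le_pow_left₀ (frob_nonneg _) hlow 2
  have hD2 : D ^ 2 ≤ K ^ 2 * frob E1 ^ 2 := by
    rw [← mul_pow]; exact pow_le_pow_left₀ hD hDE 2
  have hcol := refined_collect hK hn0.le hp0.le hτ0 hD hD2 (by
    have := neg_abs_le (frobInner E0 (Yu * Zu))
    have := le_abs_self (frobInner E0 (Y2 * Z2))
    have := le_abs_self (frobInner E1 u)
    rw [hc01] at hx2
    linarith)
  rw [← hτ2]
  exact refined_scalar hc1 hθ hθC hn1 hp hτ0 hnp hcol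

end RefinedRate


/-! ### Entrywise expansion of the residual covariance -/

section ResidualCovariance

set_option linter.unusedSectionVars false

open scoped Matrix.Norms.L2Operator

variable {N T r : ℕ}

lemma rowNorm_mul_le_frob {m n l : Type*} [Fintype m] [Fintype n] [Fintype l] [DecidableEq n]
    [DecidableEq l] (A : Matrix m n ℝ) (B : Matrix n l ℝ) (i : m) :
    rowNorm (A * B) i ≤ rowNorm A i * frob B :=
  (rowNorm_mul_le A B i).trans (mul_le_mul_of_nonneg_left (op_le_frob B) (rowNorm_nonneg A i))

/-- Rows of `uF` for estimated factors `F` that nearly span the true ones. -/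
lemma rowNorm_mul_factors_le {m : Type*} [Fintype m] {c κ : ℝ} {F₀ F : Matrix (Fin T) (Fin r) ℝ} (u : Matrix m (Fin T) ℝ)
    (hR : IsUnit ((T : ℝ)⁻¹ • (F₀ᵀ * F)).det) (hRi : ‖((T : ℝ)⁻¹ • (F₀ᵀ * F))⁻¹‖ ≤ c)
    (hG : frob (F₀ᵀ * (1 - (T : ℝ)⁻¹ • (F * Fᵀ))) ≤ κ) (i : m) :
    rowNorm (u * F) i ≤ (rowNorm (u * F₀) i + rowNorm u i * κ) * c := by
  set R := (T : ℝ)⁻¹ • (F₀ᵀ * F) with hRd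
  set M := 1 - (T : ℝ)⁻¹ • (F * Fᵀ) with hM
  have hMt : Mᵀ = M := by simp [hM, Matrix.transpose_mul]
  have hR' : IsUnit Rᵀ.det := by rwa [Matrix.det_transpose]
  have h1 : F * Rᵀ = F₀ - (F₀ᵀ * M)ᵀ := by
    rw [Matrix.transpose_mul, hMt, Matrix.transpose_transpose, hM, hRd]
    simp [Matrix.sub_mul, Matrix.mul_assoc]
  have h2 : u * F = (u * F₀ - u * (F₀ᵀ * M)ᵀ) * Rᵀ⁻¹ := by
    rw [← Matrix.mul_sub, ← h1, Matrix.mul_assoc, Matrix.mul_assoc, Matrix.mul_nonsing_inv _ hR', Matrix.mul_one]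
  rw [h2]
  refine (rowNorm_mul_le _ _ i).trans (mul_le_mul ?_ ?_ (norm_nonneg _) ?_)
  · refine (rowNorm_sub_le _ _ i).trans (add_le_add le_rfl ?_)
    refine (rowNorm_mul_le_frob _ _ i).trans (mul_le_mul_of_nonneg_left ?_ (rowNorm_nonneg _ _))
    rwa [frob_transpose]
  · rwa [← Matrix.transpose_nonsing_inv, op_transpose]
  · have := (frob_nonneg _).trans hG
    have := rowNorm_nonneg u i
    have := rowNorm_nonneg (u * F₀) i
    positivity

/-- The residual second moments are those of the errors up to the matrix `HMMH'` of the regressors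
and a uniformly small matrix. -/
lemma abs_resid_entry_le {K D p τ : ℝ} (hK : 1 ≤ K) (hp : 1 ≤ p) (hD : 0 ≤ D) (hτ : 0 < τ)
    (hτT : τ ^ 2 = T) {Λ : Matrix (Fin N) (Fin r) ℝ} {F₀ F : Matrix (Fin T) (Fin r) ℝ}
    {u H : Matrix (Fin N) (Fin T) ℝ} (hF : (T : ℝ)⁻¹ • (Fᵀ * F) = 1) (hFf : frob F ≤ K * τ)
    (hR : IsUnit ((T : ℝ)⁻¹ • (F₀ᵀ * F)).det) (hRi : ‖((T : ℝ)⁻¹ • (F₀ᵀ * F))⁻¹‖ ≤ 2 * K)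
    (hG : frob (F₀ᵀ * (1 - (T : ℝ)⁻¹ • (F * Fᵀ))) ≤ K)
    (hΛ : ∀ i, rowNorm Λ i ≤ K) (hu : ∀ i, rowNorm u i ≤ K * τ)
    (huF : ∀ i, rowNorm (u * F₀) i ≤ K * (τ * p)) (hH : frob H ≤ K * D)
    (hHu : ∀ i j, |(H * uᵀ) i j| ≤ K * (p * D)) (i j : Fin N) :
    |((Λ * F₀ᵀ + u - H) * (1 - (T : ℝ)⁻¹ • (F * Fᵀ)) * ((Λ * F₀ᵀ + u - H) * (1 - (T : ℝ)⁻¹ • (F * Fᵀ)))ᵀ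
      - u * uᵀ - (H * (1 - (T : ℝ)⁻¹ • (F * Fᵀ))) * (H * (1 - (T : ℝ)⁻¹ • (F * Fᵀ)))ᵀ :
        Matrix (Fin N) (Fin N) ℝ) i j|
      ≤ 50 * K ^ 6 * (p ^ 2 + τ + p * D) := by
  obtain ⟨p1, p2, p3, p4⟩ := normalized_proj hF
  have huF' : ∀ i, rowNorm (u * F) i ≤ 4 * K ^ 3 * (τ * p) := fun i => by
    refine (rowNorm_mul_factors_le u hR hRi hG i).trans ?_
    have h1 : rowNorm u i * K ≤ K ^ 2 * (τ * p) := by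
      calc rowNorm u i * K ≤ (K * τ) * K := mul_le_mul_of_nonneg_right (hu i) (by linarith)
        _ = K ^ 2 * (τ * 1) := by ring
        _ ≤ _ := by gcongr
    have h2 : K * (τ * p) ≤ K ^ 2 * (τ * p) := by gcongr; exact le_self_pow₀ hK two_ne_zero
    calc _ ≤ (K ^ 2 * (τ * p) + K ^ 2 * (τ * p)) * (2 * K) := by
          refine mul_le_mul_of_nonneg_right ?_ (by linarith)
          linarith [huF i]
      _ = _ := by ring
  set P := (T : ℝ)⁻¹ • (F * Fᵀ) with hP
  set M := 1 - P with hM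
  have hPX : ∀ A B : Matrix (Fin N) (Fin T) ℝ, A * P * Bᵀ = (T : ℝ)⁻¹ • ((A * F) * (B * F)ᵀ) := by
    intro A B
    rw [hP, Matrix.mul_smul, Matrix.smul_mul, Matrix.transpose_mul]
    simp only [Matrix.mul_assoc]
  set G := F₀ᵀ * M with hGd
  have hGM : G * M = G := by rw [hGd, Matrix.mul_assoc, p2]
  set C := H * M with hC
  have hCM : C * M = C := by rw [hC, Matrix.mul_assoc, p2]
  have hK0 : 0 ≤ K := by linarith
  have hMn : ‖M‖ ≤ 1 := op_le_one_of_proj p1 p2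
  have hCf : ∀ i, rowNorm C i ≤ K * D := fun i =>
    (rowNorm_le_frob _ i).trans ((frob_contract_right hMn _).trans hH)
  have hΛG : ∀ i, rowNorm (Λ * G) i ≤ K ^ 2 := fun i => by
    refine (rowNorm_mul_le_frob _ _ i).trans ?_
    rw [pow_two]
    exact mul_le_mul (hΛ i) hG (frob_nonneg _) hK0
  have hHF : ∀ i, rowNorm (H * F) i ≤ K * D * (K * τ) := fun i =>
    (rowNorm_le_frob _ i).trans ((frob_mul_le _ _).trans
      (mul_le_mul hH hFf (frob_nonneg _) (by positivity)))
  have e0 : (Λ * F₀ᵀ + u - H) * M = (Λ * G - C) + u * M := by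
    rw [Matrix.sub_mul, Matrix.add_mul, Matrix.mul_assoc]; abel
  have e1 : (Λ * G - C) * M = Λ * G - C := by rw [Matrix.sub_mul, Matrix.mul_assoc, hGM, hCM]
  have e2 : u * M * Mᵀ * uᵀ = u * uᵀ - (T : ℝ)⁻¹ • ((u * F) * (u * F)ᵀ) := by
    rw [p1, Matrix.mul_assoc u, p2, hM, Matrix.mul_sub, Matrix.mul_one, Matrix.sub_mul, hPX]
  have e3 : C * uᵀ = H * uᵀ - (T : ℝ)⁻¹ • ((H * F) * (u * F)ᵀ) := by
    rw [hC, hM, Matrix.mul_sub, Matrix.mul_one, Matrix.sub_mul, hPX]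
  have e4 : (Λ * G - C) * (u * M)ᵀ = (Λ * G) * uᵀ - (H * uᵀ - (T : ℝ)⁻¹ • ((H * F) * (u * F)ᵀ)) := by
    rw [Matrix.transpose_mul, p1, ← Matrix.mul_assoc, e1, Matrix.sub_mul, e3]
  -- Expand the square with G = F₀'M, the factors missed by F, and C = HM. The part of u along F
  -- appears only through uF and HF, whose rows are controlled; CC' is left aside because it is
  -- small only in Frobenius norm.
  have e5 : (Λ * F₀ᵀ + u - H) * M * ((Λ * F₀ᵀ + u - H) * M)ᵀ - u * uᵀ - C * Cᵀ =
      (Λ * G) * (Λ * G)ᵀ - (Λ * G) * Cᵀ - ((Λ * G) * Cᵀ)ᵀ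
      + ((Λ * G) * uᵀ - (H * uᵀ - (T : ℝ)⁻¹ • ((H * F) * (u * F)ᵀ)))
      + ((Λ * G) * uᵀ - (H * uᵀ - (T : ℝ)⁻¹ • ((H * F) * (u * F)ᵀ)))ᵀ
      - (T : ℝ)⁻¹ • ((u * F) * (u * F)ᵀ) := by
    rw [e0, Matrix.transpose_add, Matrix.add_mul, Matrix.mul_add, Matrix.mul_add, e4,
      show u * M * (u * M)ᵀ = u * uᵀ - (T : ℝ)⁻¹ • ((u * F) * (u * F)ᵀ) by
        rw [Matrix.transpose_mul, ← Matrix.mul_assoc, e2],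
      show u * M * (Λ * G - C)ᵀ = ((Λ * G - C) * (u * M)ᵀ)ᵀ by
        rw [Matrix.transpose_mul, Matrix.transpose_transpose], e4,
      Matrix.transpose_sub (Λ * G) C, Matrix.sub_mul, Matrix.mul_sub, Matrix.mul_sub,
      Matrix.transpose_mul (Λ * G) Cᵀ, Matrix.transpose_transpose]
    abel
  rw [e5]
  have k2 : K ≤ K ^ 6 := le_self_pow₀ hK (by norm_num)
  have hk : ∀ m ≤ 6, K ^ m ≤ K ^ 6 := fun m hm => pow_le_pow_right₀ hK hm
  have hτi : (T : ℝ)⁻¹ = (τ ^ 2)⁻¹ := by rw [hτT]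
  set q := p ^ 2 + τ + p * D with hq
  have q1 : 1 ≤ q := by nlinarith [mul_nonneg (by linarith : 0 ≤ p) hD]
  have q2 : τ ≤ q := by nlinarith [mul_nonneg (by linarith : 0 ≤ p) hD]
  have q3 : p * D ≤ q := by nlinarith
  have q4 : p ^ 2 ≤ q := by nlinarith [mul_nonneg (by linarith : 0 ≤ p) hD]
  have q5 : D ≤ q := (le_mul_of_one_le_left hD hp).trans q3
  have hu0 : 0 ≤ K * τ := by positivity
  have b1 : ∀ i j, |((Λ * G) * (Λ * G)ᵀ) i j| ≤ K ^ 6 * q := fun i j => by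
    refine (abs_mul_transpose_apply_le _ _ i j).trans ?_
    calc _ ≤ K ^ 2 * K ^ 2 := mul_le_mul (hΛG i) (hΛG j) (rowNorm_nonneg _ _) (by positivity)
      _ = K ^ 4 * 1 := by ring
      _ ≤ _ := by gcongr <;> first | exact hK | norm_num
  have b2 : ∀ i j, |((Λ * G) * Cᵀ) i j| ≤ K ^ 6 * q := fun i j => by
    refine (abs_mul_transpose_apply_le _ _ i j).trans ?_
    calc _ ≤ K ^ 2 * (K * D) := mul_le_mul (hΛG i) (hCf j) (rowNorm_nonneg _ _) (by positivity)
      _ = K ^ 3 * D := by ring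
      _ ≤ _ := by gcongr <;> first | exact hK | norm_num
  have b3 : ∀ i j, |((Λ * G) * uᵀ) i j| ≤ K ^ 6 * q := fun i j => by
    refine (abs_mul_transpose_apply_le _ _ i j).trans ?_
    calc _ ≤ K ^ 2 * (K * τ) := mul_le_mul (hΛG i) (hu j) (rowNorm_nonneg _ _) (by positivity)
      _ = K ^ 3 * τ := by ring
      _ ≤ _ := by gcongr <;> first | exact hK | norm_num
  have b4 : ∀ i j, |(H * uᵀ) i j| ≤ K ^ 6 * q := fun i j =>
    (hHu i j).trans (mul_le_mul k2 q3 (by positivity) (by positivity))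
  have b5 : ∀ i j, |((T : ℝ)⁻¹ • ((H * F) * (u * F)ᵀ)) i j| ≤ 4 * (K ^ 6 * q) := fun i j => by
    rw [Matrix.smul_apply, smul_eq_mul, abs_mul, abs_of_nonneg (by positivity), hτi,
      inv_mul_le_iff₀ (by positivity)]
    refine (abs_mul_transpose_apply_le _ _ i j).trans ?_
    calc _ ≤ (K * D * (K * τ)) * (4 * K ^ 3 * (τ * p)) :=
          mul_le_mul (hHF i) (huF' j) (rowNorm_nonneg _ _) (by positivity)
      _ = τ ^ 2 * (4 * (K ^ 5 * (p * D))) := by ring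
      _ ≤ _ := by gcongr <;> first | exact hK | norm_num
  have b6 : ∀ i j, |((T : ℝ)⁻¹ • ((u * F) * (u * F)ᵀ)) i j| ≤ 16 * (K ^ 6 * q) := fun i j => by
    rw [Matrix.smul_apply, smul_eq_mul, abs_mul, abs_of_nonneg (by positivity), hτi,
      inv_mul_le_iff₀ (by positivity)]
    refine (abs_mul_transpose_apply_le _ _ i j).trans ?_
    calc _ ≤ (4 * K ^ 3 * (τ * p)) * (4 * K ^ 3 * (τ * p)) :=
          mul_le_mul (huF' i) (huF' j) (rowNorm_nonneg _ _) (by positivity)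
      _ = τ ^ 2 * (16 * (K ^ 6 * p ^ 2)) := by ring
      _ ≤ _ := by gcongr
  have hkq : 0 ≤ K ^ 6 * q := by positivity
  simp only [Matrix.sub_apply, Matrix.add_apply, Matrix.transpose_apply]
  have c1 := abs_le.1 (b1 i j)
  have c2 := abs_le.1 (b2 i j)
  have c2' := abs_le.1 (b2 j i)
  have c3 := abs_le.1 (b3 i j)
  have c3' := abs_le.1 (b3 j i)
  have c4 := abs_le.1 (b4 i j)
  have c4' := abs_le.1 (b4 j i)
  have c5 := abs_le.1 (b5 i j)
  have c5' := abs_le.1 (b5 j i)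
  have c6 := abs_le.1 (b6 i j)
  rw [mul_assoc (50 : ℝ)]
  generalize K ^ 6 * q = y at *
  rw [abs_le]
  constructor <;> linarith [c1.1, c1.2]

end ResidualCovariance

/-! ### Perturbation of weighted projections -/

section ProjectionPerturbation

set_option linter.unusedSectionVars false

open scoped Matrix.Norms.L2Operator

variable {m k : Type*} [Fintype m] [Fintype k] [DecidableEq m] [DecidableEq k]

lemma op_mul_sub_mul_le {a b c : Type*} [Fintype a] [Fintype b] [Fintype c] [DecidableEq a]
    [DecidableEq b] [DecidableEq c] {A A' : Matrix a b ℝ} {B B' : Matrix b c ℝ} {x y s t : ℝ}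
    (hA : ‖A‖ ≤ x) (hB : ‖B'‖ ≤ y) (hA' : ‖A - A'‖ ≤ s) (hB' : ‖B - B'‖ ≤ t) :
    ‖A * B - A' * B'‖ ≤ x * t + s * y := by
  have : A * B - A' * B' = A * (B - B') + (A - A') * B' := by
    rw [Matrix.mul_sub, Matrix.sub_mul]; abel
  rw [this]
  exact (norm_add_le _ _).trans (add_le_add
    ((Matrix.l2_opNorm_mul _ _).trans (mul_le_mul hA hB' (norm_nonneg _) ((norm_nonneg _).trans hA)))
    ((Matrix.l2_opNorm_mul _ _).trans (mul_le_mul hA' hB (norm_nonneg _) ((norm_nonneg _).trans hA'))))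

lemma op_mul_le {a b c : Type*} [Fintype a] [Fintype b] [Fintype c] [DecidableEq a]
    [DecidableEq b] [DecidableEq c] {A : Matrix a b ℝ} {B : Matrix b c ℝ} {x y : ℝ}
    (hA : ‖A‖ ≤ x) (hB : ‖B‖ ≤ y) : ‖A * B‖ ≤ x * y :=
  (Matrix.l2_opNorm_mul _ _).trans (mul_le_mul hA hB (norm_nonneg _) ((norm_nonneg _).trans hA))

/-- Resolvent identity. -/
lemma op_inv_sub_inv_le {S S' : Matrix k k ℝ} (hS : IsUnit S.det) (hS' : IsUnit S'.det) {x y t : ℝ}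
    (h : ‖S⁻¹‖ ≤ x) (h' : ‖S'⁻¹‖ ≤ y) (ht : ‖S - S'‖ ≤ t) : ‖S⁻¹ - S'⁻¹‖ ≤ x * (t * y) := by
  have : S⁻¹ - S'⁻¹ = S⁻¹ * ((S' - S) * S'⁻¹) := by
    rw [Matrix.sub_mul, Matrix.mul_sub, Matrix.mul_nonsing_inv _ hS', Matrix.mul_one,
      ← Matrix.mul_assoc, Matrix.nonsing_inv_mul _ hS, Matrix.one_mul]
  rw [this]
  refine op_mul_le h (op_mul_le ?_ h')
  rwa [norm_sub_rev]

/-- The weighted projection `WB(B'WB)⁻¹B'W`. -/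
noncomputable def wproj (W : Matrix m m ℝ) (B : Matrix m k ℝ) : Matrix m m ℝ :=
  W * B * (Bᵀ * W * B)⁻¹ * Bᵀ * W

/-- The projection depends on the column space alone. Hence estimated loadings and factors may be
replaced by rotated ones, which are close to the true ones. -/
lemma wproj_mul_right (W : Matrix m m ℝ) (B : Matrix m k ℝ) {H : Matrix k k ℝ} (hH : IsUnit H.det) :
    wproj W (B * H) = wproj W B := by
  have hHt : IsUnit Hᵀ.det := by rwa [Matrix.det_transpose]
  have h1 : (B * H)ᵀ * W * (B * H) = Hᵀ * (Bᵀ * W * B) * H := by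
    rw [Matrix.transpose_mul]; simp only [Matrix.mul_assoc]
  have h2 : W * (B * H) * (H⁻¹ * ((Bᵀ * W * B)⁻¹ * Hᵀ⁻¹)) * (B * H)ᵀ * W
      = W * B * (H * H⁻¹) * (Bᵀ * W * B)⁻¹ * (Hᵀ⁻¹ * Hᵀ) * Bᵀ * W := by
    rw [Matrix.transpose_mul]; simp only [Matrix.mul_assoc]
  rw [wproj, h1, Matrix.mul_inv_rev, Matrix.mul_inv_rev, h2, Matrix.mul_nonsing_inv _ hH,
    Matrix.nonsing_inv_mul _ hHt, Matrix.mul_one, Matrix.mul_one, wproj]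

lemma wproj_smul (W : Matrix m m ℝ) (B : Matrix m k ℝ) {c : ℝ} (hc : c ≠ 0) :
    wproj W (c • B) = wproj W B := by
  have : c • B = B * (c • (1 : Matrix k k ℝ)) := by simp
  rw [this, wproj_mul_right]
  rw [Matrix.det_smul, Matrix.det_one, mul_one]
  exact (isUnit_iff_ne_zero.2 hc).pow _

lemma wproj_one (B : Matrix m k ℝ) : 1 - wproj 1 B = annih B := by
  simp [wproj, annih]

/-- Weighted projections depend continuously on the weight and on the spanning matrix. -/
lemma wproj_perturb {K : ℝ} (hK : 1 ≤ K) {W W' : Matrix m m ℝ} {B B' : Matrix m k ℝ} {ε : ℝ}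
    (hε : 0 ≤ ε) (hW : ‖W‖ ≤ K) (hB : ‖B‖ ≤ K)
    (hc : ∀ v : k → ℝ, K⁻¹ * (v ⬝ᵥ v) ≤ v ⬝ᵥ (Bᵀ * W * B) *ᵥ v)
    (hWW : ‖W' - W‖ ≤ ε) (hBB : ‖B' - B‖ ≤ ε) (hεK : 20 * K ^ 3 * ε ≤ 1) :
    ‖wproj W' B' - wproj W B‖ ≤ 200 * K ^ 9 * ε := by
  have hε1 : ε ≤ 1 := by
    have : 1 ≤ K ^ 3 := one_le_pow₀ hK
    nlinarith
  have hK0 : 0 < K := by linarith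
  have hW' : ‖W'‖ ≤ 2 * K := by
    have : ‖W'‖ ≤ ‖W' - W‖ + ‖W‖ := by simpa using norm_add_le (W' - W) W
    linarith
  have hB' : ‖B'‖ ≤ 2 * K := by
    have : ‖B'‖ ≤ ‖B' - B‖ + ‖B‖ := by simpa using norm_add_le (B' - B) B
    linarith
  have hBt : ‖Bᵀ‖ ≤ K := by rwa [op_transpose]
  have hBt' : ‖B'ᵀ‖ ≤ 2 * K := by rwa [op_transpose]
  have hBBt : ‖B'ᵀ - Bᵀ‖ ≤ ε := by rwa [← Matrix.transpose_sub, op_transpose]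
  have c1 : ‖B'ᵀ * W' - Bᵀ * W‖ ≤ 3 * K * ε := by
    refine (op_mul_sub_mul_le hBt' hW hBBt hWW).trans (le_of_eq (by ring))
  have c1' : ‖W' * B' - W * B‖ ≤ 3 * K * ε := by
    refine (op_mul_sub_mul_le hW' hB hWW hBB).trans (le_of_eq (by ring))
  have hBW : ‖Bᵀ * W‖ ≤ K ^ 2 := (op_mul_le hBt hW).trans (le_of_eq (by ring))
  have hBW' : ‖B'ᵀ * W'‖ ≤ 4 * K ^ 2 := (op_mul_le hBt' hW').trans (le_of_eq (by ring))
  have hWB' : ‖W' * B'‖ ≤ 4 * K ^ 2 := (op_mul_le hW' hB').trans (le_of_eq (by ring))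
  have hkk : K ≤ K ^ 2 := le_self_pow₀ hK two_ne_zero
  have c2 : ‖B'ᵀ * W' * B' - Bᵀ * W * B‖ ≤ 7 * K ^ 2 * ε := by
    refine (op_mul_sub_mul_le hBW' hB c1 hBB).trans (le_of_eq (by ring))
  obtain ⟨u1, n1⟩ := inv_of_coercive (inv_pos.2 hK0) hc
  obtain ⟨u2, n2⟩ := inv_of_coercive (S := B'ᵀ * W' * B') (c := (2 * K)⁻¹) (by positivity) fun v => by
    have h1 : v ⬝ᵥ (B'ᵀ * W' * B') *ᵥ v = v ⬝ᵥ (Bᵀ * W * B) *ᵥ v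
        + v ⬝ᵥ (B'ᵀ * W' * B' - Bᵀ * W * B) *ᵥ v := by
      rw [← dotProduct_add, ← Matrix.add_mulVec, add_sub_cancel]
    have h2 := abs_dot_mulVec_le (B'ᵀ * W' * B' - Bᵀ * W * B) v v
    have h3 : √(v ⬝ᵥ v) * √(v ⬝ᵥ v) = v ⬝ᵥ v := Real.mul_self_sqrt (by
      rw [dotProduct_self_eq_norm]; positivity)
    have hv : 0 ≤ v ⬝ᵥ v := by rw [dotProduct_self_eq_norm]; positivity
    have h4 : ‖B'ᵀ * W' * B' - Bᵀ * W * B‖ ≤ (2 * K)⁻¹ := by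
      refine c2.trans ?_
      rw [← one_div, le_div_iff₀ (by positivity)]
      have : 0 ≤ K ^ 3 * ε := by positivity
      calc 7 * K ^ 2 * ε * (2 * K) = 14 * (K ^ 3 * ε) := by ring
        _ ≤ 20 * (K ^ 3 * ε) := by linarith
        _ ≤ 1 := by linarith
    have h5 : |v ⬝ᵥ (B'ᵀ * W' * B' - Bᵀ * W * B) *ᵥ v| ≤ (2 * K)⁻¹ * (v ⬝ᵥ v) := by
      refine h2.trans ?_
      rw [h3]
      exact mul_le_mul_of_nonneg_right h4 hv
    have h6 := hc v
    have h7 : K⁻¹ * (v ⬝ᵥ v) = (2 * K)⁻¹ * (v ⬝ᵥ v) + (2 * K)⁻¹ * (v ⬝ᵥ v) := by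
      field_simp; ring
    have := (abs_le.1 h5).1
    linarith
  rw [one_div, inv_inv] at n1 n2
  have c3 := op_inv_sub_inv_le u2 u1 n2 n1 c2
  have c4 : ‖W' * B' * (B'ᵀ * W' * B')⁻¹ - W * B * (Bᵀ * W * B)⁻¹‖ ≤ 62 * K ^ 6 * ε := by
    refine (op_mul_sub_mul_le hWB' n1 c1' c3).trans ?_
    have : K ^ 2 * ε ≤ K ^ 6 * ε := by gcongr <;> first | exact hK | norm_num
    have : 0 ≤ K ^ 6 * ε := by positivity
    calc _ = 56 * (K ^ 6 * ε) + 3 * (K ^ 2 * ε) := by ring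
      _ ≤ _ := by linarith
  have c5 : ‖W' * B' * (B'ᵀ * W' * B')⁻¹‖ ≤ 8 * K ^ 3 := (op_mul_le hWB' n2).trans (le_of_eq (by ring))
  have c6 := op_mul_sub_mul_le c5 hBW c4 c1
  rw [wproj, wproj, Matrix.mul_assoc _ B'ᵀ, Matrix.mul_assoc _ Bᵀ]
  refine c6.trans ?_
  have k1 : K ^ 4 * ε ≤ K ^ 9 * ε := by gcongr <;> first | exact hK | norm_num
  have k2 : K ^ 8 * ε ≤ K ^ 9 * ε := by gcongr <;> first | exact hK | norm_num
  have k3 : 0 ≤ K ^ 9 * ε := by positivity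
  calc _ = 24 * (K ^ 4 * ε) + 62 * (K ^ 8 * ε) := by ring
    _ ≤ _ := by linarith

end ProjectionPerturbation


/-! ### Operator norm error of the thresholded covariance -/

section Thresholding

open scoped Matrix.Norms.L2Operator

/-- Write ω = ω^{1−q}ω^q. An error of order ω at an entry x not much smaller than ω is thereby
charged to that entry's share of the sparsity measure. -/
lemma rpow_split {K x ω q : ℝ} (hK : 1 ≤ K) (hω : 0 < ω) (hq0 : 0 ≤ q) (hq1 : q ≤ 1) (hx : ω ≤ K * x) :
    ω ≤ K * (ω ^ (1 - q) * x ^ q) := by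
  have hx0 : 0 < x := by
    by_contra h
    push Not at h
    nlinarith
  calc ω = ω ^ (1 - q) * ω ^ q := by rw [← Real.rpow_add hω]; simp
    _ ≤ ω ^ (1 - q) * (K * x) ^ q := by gcongr
    _ = ω ^ (1 - q) * (K ^ q * x ^ q) := by rw [Real.mul_rpow (by linarith) hx0.le]
    _ ≤ ω ^ (1 - q) * (K * x ^ q) := by
        gcongr
        calc K ^ q ≤ K ^ (1 : ℝ) := Real.rpow_le_rpow_of_exponent_le hK hq1
          _ = K := Real.rpow_one K
    _ = _ := by ring

/-- The entrywise error of a thresholded estimate `z` of `x`, for a noisy value `ρ` whose error is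
below half of the threshold up to `h`. -/
lemma threshold_entry_le {K C σ ω τ ρ x z h q : ℝ} (hK : 1 ≤ K) (hC : 44 ≤ C) (hσ : K⁻¹ ≤ σ) (hσ' : σ ≤ K)
    (hω : 0 < ω) (hτ : C * σ * ω / 2 ≤ τ) (hτ' : τ ≤ 2 * (C * σ * ω)) (hh : 0 ≤ h)
    (hρ : |ρ - x| ≤ 11 * σ * ω + h) (hz : |ρ| < τ → z = 0) (hz' : |z - ρ| ≤ τ) (hq0 : 0 ≤ q) (hq1 : q ≤ 1) :
    |z - x| ≤ (3 * C * K ^ 2 + 11 * K + 7) * (h + ω ^ (1 - q) * if x = 0 then 0 else |x| ^ q) := by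
  have hK0 : 0 < K := by linarith
  have hσ0 : 0 < σ := (inv_pos.2 hK0).trans_le hσ
  have hσω : 0 < σ * ω := mul_pos hσ0 hω
  -- The noise level. C ≥ 44 and a threshold of at least Cσω/2 make it at most half the threshold.
  set a := 11 * σ * ω with ha
  have ha0 : 0 < a := by rw [ha]; positivity
  have haτ : a ≤ τ / 2 := by nlinarith
  have hτK : τ ≤ 2 * C * K * ω := by
    refine hτ'.trans ?_
    have : C * σ * ω ≤ C * K * ω := by gcongr
    linarith
  set K' := 3 * C * K ^ 2 + 11 * K + 7 with hK'
  have hCK : 0 ≤ 3 * C * K ^ 2 := by positivity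
  have hgen : |z - x| ≤ 3 / 2 * τ + h ∨ (|ρ| < τ ∧ z = 0) := by
    rcases lt_or_ge |ρ| τ with h1 | h1
    · exact Or.inr ⟨h1, hz h1⟩
    · left
      calc |z - x| = |(z - ρ) + (ρ - x)| := by ring_nf
        _ ≤ |z - ρ| + |ρ - x| := abs_add_le _ _
        _ ≤ _ := by linarith
  have hpos : 0 ≤ ω ^ (1 - q) * if x = 0 then 0 else |x| ^ q := by
    split_ifs <;> positivity
  have hρx : |x| ≤ |ρ| + a + h := by
    calc |x| = |ρ - (ρ - x)| := by ring_nf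
      _ ≤ |ρ| + |ρ - x| := abs_sub _ _
      _ ≤ _ := by linarith
  have hxρ : |ρ| ≤ |x| + a + h := by
    calc |ρ| = |x + (ρ - x)| := by ring_nf
      _ ≤ |x| + |ρ - x| := abs_add_le _ _
      _ ≤ _ := by linarith
  -- Small entries are either set to zero, with error |x| = |x|^{1−q}|x|^q, or kept, which is
  -- possible only because of h. For large entries ω is at most of the order of |x|, so an error of
  -- order ω can be charged to |x|^q.
  rcases le_or_gt |x| (a / 2) with hx | hx
  · rcases lt_or_ge |ρ| τ with h1 | h1
    · rw [hz h1, zero_sub, abs_neg]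
      by_cases hx0 : x = 0
      · rw [hx0, abs_zero]
        rw [hx0] at hpos
        positivity
      · rw [if_neg hx0]
        rw [if_neg hx0] at hpos
        have hxp : 0 < |x| := abs_pos.2 hx0
        have h2 : |x| ≤ 11 * K * ω := by
          have : σ * ω ≤ K * ω := by gcongr
          nlinarith
        have h3 : |x| ≤ 11 * K * (ω ^ (1 - q) * |x| ^ q) := by
          calc |x| = |x| ^ (1 - q) * |x| ^ q := by rw [← Real.rpow_add hxp]; simp
            _ ≤ (11 * K * ω) ^ (1 - q) * |x| ^ q := by
                gcongr
            _ = (11 * K) ^ (1 - q) * ω ^ (1 - q) * |x| ^ q := by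
                rw [Real.mul_rpow (by positivity) hω.le]
            _ ≤ (11 * K) * ω ^ (1 - q) * |x| ^ q := by
                gcongr
                calc (11 * K) ^ (1 - q) ≤ (11 * K) ^ (1 : ℝ) :=
                      Real.rpow_le_rpow_of_exponent_le (by linarith) (by linarith)
                  _ = _ := Real.rpow_one _
            _ = _ := by ring
        refine h3.trans ?_
        refine mul_le_mul (by linarith) (by linarith) hpos (by positivity)
    -- A kept value satisfies τ ≤ |x| + a + h ≤ 3a/2 + h ≤ 3τ/4 + h.
    · have h2 : τ ≤ 4 * h := by linarith
      have h3 : |z - x| ≤ 3 / 2 * τ + h := by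
        rcases hgen with h | h
        · exact h
        · exact absurd h.1 (not_lt.2 h1)
      calc |z - x| ≤ 7 * h := by linarith
        _ ≤ K' * h := by gcongr; linarith
        _ ≤ _ := by gcongr; linarith
  · have hx0 : x ≠ 0 := by
      rintro rfl; rw [abs_zero] at hx; linarith
    have h2 : |z - x| ≤ 3 / 2 * τ + h := by
      rcases hgen with h1 | h1
      · exact h1
      · rw [h1.2, zero_sub, abs_neg]; linarith [h1.1]
    have h3 : ω ≤ K * |x| := by
      have h4 : K⁻¹ * ω ≤ σ * ω := by gcongr
      have h5 : K⁻¹ * ω ≤ |x| := by linarith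
      rwa [inv_mul_le_iff₀ hK0] at h5
    have h4 := rpow_split hK hω hq0 hq1 h3
    rw [if_neg hx0] at hpos ⊢
    have h5 : |z - x| ≤ 3 * C * K ^ 2 * (ω ^ (1 - q) * |x| ^ q) + 1 * h := by
      calc |z - x| ≤ 3 / 2 * (2 * C * K * ω) + h := by linarith
        _ = 3 * C * K * ω + h := by ring
        _ ≤ 3 * C * K * (K * (ω ^ (1 - q) * |x| ^ q)) + h := by gcongr
        _ = _ := by ring
    refine h5.trans ?_
    rw [mul_add, add_comm]
    gcongr <;> linarith

/-- Taking absolute values in the bilinear form changes neither ‖x‖ nor ‖y‖. -/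
lemma op_le_of_abs_le {m n : Type*} [Fintype m] [Fintype n] [DecidableEq m] [DecidableEq n]
    {A B : Matrix m n ℝ} (h : ∀ i j, |A i j| ≤ B i j) : ‖A‖ ≤ ‖B‖ := by
  refine op_le_of_dot (norm_nonneg _) fun x y => ?_
  have h1 := abs_dot_mulVec_le B (fun i => |x i|) (fun j => |y j|)
  have e1 : (fun i => |x i|) ⬝ᵥ (fun i => |x i|) = x ⬝ᵥ x := by simp [dotProduct]
  have e2 : (fun i => |y i|) ⬝ᵥ (fun i => |y i|) = y ⬝ᵥ y := by simp [dotProduct]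
  rw [e1, e2] at h1
  refine le_trans ?_ ((le_abs_self _).trans h1)
  simp only [dotProduct, Matrix.mulVec, Finset.mul_sum]
  refine Finset.sum_le_sum fun i _ => Finset.sum_le_sum fun j _ => ?_
  calc x i * (A i j * y j) ≤ |x i * (A i j * y j)| := le_abs_self _
    _ = |x i| * (|A i j| * |y j|) := by rw [abs_mul, abs_mul]
    _ ≤ _ := by gcongr; exact h i j

/-- The operator norm of a symmetric nonnegative matrix is at most its largest row sum. -/
lemma op_le_of_row_sum {m : Type*} [Fintype m] [DecidableEq m] {S : Matrix m m ℝ} {c : ℝ} (hc : 0 ≤ c)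
    (hS : Sᵀ = S) (h0 : ∀ i j, 0 ≤ S i j) (h : ∀ i, ∑ j, S i j ≤ c) : ‖S‖ ≤ c := by
  refine op_le_of_mulVec hc fun y => ?_
  have h1 : ∀ i, (S *ᵥ y) i ^ 2 ≤ c * ∑ j, S i j * y j ^ 2 := fun i => by
    have h2 : (∑ j, √(S i j) * (√(S i j) * y j)) ^ 2 ≤
        (∑ j, √(S i j) ^ 2) * ∑ j, (√(S i j) * y j) ^ 2 := Finset.sum_mul_sq_le_sq_mul_sq _ _ _
    simp only [← mul_assoc, Real.mul_self_sqrt (h0 i _), mul_pow, Real.sq_sqrt (h0 i _)] at h2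
    refine h2.trans (mul_le_mul_of_nonneg_right (h i) ?_)
    exact Finset.sum_nonneg fun j _ => mul_nonneg (h0 i j) (sq_nonneg _)
  calc (S *ᵥ y) ⬝ᵥ (S *ᵥ y) = ∑ i, (S *ᵥ y) i ^ 2 := by simp [dotProduct, pow_two]
    _ ≤ ∑ i, c * ∑ j, S i j * y j ^ 2 := Finset.sum_le_sum fun i _ => h1 i
    _ = c * ∑ j, (∑ i, S i j) * y j ^ 2 := by
        rw [← Finset.mul_sum, Finset.sum_comm]; simp only [Finset.sum_mul]
    _ ≤ c * ∑ j, c * y j ^ 2 := by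
        gcongr with j _
        calc ∑ i, S i j = ∑ i, S j i := Finset.sum_congr rfl fun i _ => by
              conv_lhs => rw [← hS, Matrix.transpose_apply]
          _ ≤ c := h j
    _ = _ := by rw [← Finset.mul_sum]; simp only [dotProduct, pow_two]; ring

lemma row_sum_le_sparsity {N : ℕ} (q : ℝ) (S : Matrix (Fin N) (Fin N) ℝ) (i : Fin N) :
    ∑ j, (if S i j = 0 then 0 else |S i j| ^ q) ≤ sparsity q S :=
  le_ciSup (f := fun i => ∑ j, if S i j = 0 then (0 : ℝ) else |S i j| ^ q) (Set.finite_range _).bddAbove i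

/-- The thresholded covariance matrix is close to `S` in operator norm if `R - S` is entrywise small
up to a matrix `H` that is small in Frobenius norm. -/
lemma thresholdCov_op_le {K C : ℝ} (hK : 1 ≤ K) (hC : 44 ≤ C) {N T : ℕ} {s : ℝ → ℝ → ℝ} (hs : IsThresholding s)
    {q : ℝ} (hq0 : 0 ≤ q) (hq1 : q ≤ 1) {R S H : Matrix (Fin N) (Fin N) ℝ} (hN : 0 < N) (hS : Sᵀ = S)
    (hSK : ∀ i, K⁻¹ ≤ S i i) (hSK' : ∀ i, S i i ≤ K) (hω : 0 < omegaRate N T)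
    (hsmall : 11 * K * omegaRate N T + frob H ≤ (2 * K)⁻¹)
    (hR : ∀ i j, |R i j - S i j - H i j| ≤ 11 * √(S i i * S j j) * omegaRate N T) :
    ‖thresholdCov T s C R - S‖ ≤ (3 * C * K ^ 2 + 11 * K + 7 + 11 * K ^ 2) *
      (frob H + omegaRate N T ^ (1 - q) * sparsity q S) := by
  obtain ⟨a, b, -, -, hs⟩ := hs
  set ω := omegaRate N T with hωd
  have hK0 : 0 < K := by linarith
  set K' := 3 * C * K ^ 2 + 11 * K + 7 + 11 * K ^ 2 with hK'
  have hCK : 0 ≤ 3 * C * K ^ 2 := by positivity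
  have hSp : ∀ i, 0 < S i i := fun i => (inv_pos.2 hK0).trans_le (hSK i)
  have hσ1 : ∀ i j, K⁻¹ ≤ √(S i i * S j j) := fun i j => by
    refine Real.le_sqrt_of_sq_le ?_
    rw [pow_two]
    exact mul_le_mul (hSK i) (hSK j) (by positivity) (hSp i).le
  have hσ2 : ∀ i j, √(S i i * S j j) ≤ K := fun i j => by
    refine Real.sqrt_le_iff.2 ⟨hK0.le, ?_⟩
    rw [pow_two]
    exact mul_le_mul (hSK' i) (hSK' j) (hSp j).le hK0.le
  have herr : ∀ i j, |R i j - S i j| ≤ 11 * √(S i i * S j j) * ω + |H i j| := fun i j => by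
    calc |R i j - S i j| = |(R i j - S i j - H i j) + H i j| := by ring_nf
      _ ≤ _ := (abs_add_le _ _).trans (add_le_add (hR i j) le_rfl)
  have hdiag : ∀ i, |R i i - S i i| ≤ S i i / 2 := fun i => by
    have h1 := herr i i
    have h2 := hσ2 i i
    have h3 := abs_entry_le_frob H i i
    have h4 : (2 * K)⁻¹ = K⁻¹ / 2 := by field_simp
    have h5 : 11 * √(S i i * S i i) * ω ≤ 11 * K * ω := by gcongr
    linarith [hSK i]
  have hR1 : ∀ i, S i i / 2 ≤ R i i := fun i => by linarith [(abs_le.1 (hdiag i)).1]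
  have hR2 : ∀ i, R i i ≤ 2 * S i i := fun i => by linarith [(abs_le.1 (hdiag i)).2, hSp i]
  have hRp : ∀ i, 0 ≤ R i i := fun i => by linarith [hSp i, hR1 i]
  have hr1 : ∀ i j, √(S i i * S j j) / 2 ≤ √(R i i * R j j) := fun i j => by
    refine Real.le_sqrt_of_sq_le ?_
    rw [div_pow, Real.sq_sqrt (mul_nonneg (hSp i).le (hSp j).le)]
    have := mul_le_mul (hR1 i) (hR1 j) (by linarith [hSp j]) (hRp i)
    linarith
  have hr2 : ∀ i j, √(R i i * R j j) ≤ 2 * √(S i i * S j j) := fun i j => by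
    refine Real.sqrt_le_iff.2 ⟨by positivity, ?_⟩
    rw [mul_pow, Real.sq_sqrt (mul_nonneg (hSp i).le (hSp j).le)]
    have := mul_le_mul (hR2 i) (hR2 j) (hRp j) (by linarith [hSp i])
    linarith
  set A : Matrix (Fin N) (Fin N) ℝ := Matrix.of fun i j => |H i j| with hA
  set B : Matrix (Fin N) (Fin N) ℝ := Matrix.of fun i j => if S i j = 0 then (0 : ℝ) else |S i j| ^ q with hB
  have hentry : ∀ i j, |(thresholdCov T s C R - S) i j| ≤ (K' • (A + ω ^ (1 - q) • B)) i j := by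
    intro i j
    simp only [Matrix.sub_apply, Matrix.smul_apply, Matrix.add_apply, smul_eq_mul, thresholdCov, hA, hB,
      Matrix.of_apply]
    by_cases hij : i = j
    · subst hij
      rw [if_pos rfl, if_neg (hSp i).ne']
      have h0 := hSK i
      -- The diagonal is not thresholded. As it is bounded below, its error of order ω is also
      -- charged to the sparsity measure.
      have h1 : ω ≤ K * (ω ^ (1 - q) * |S i i| ^ q) := by
        refine rpow_split hK hω hq0 hq1 ?_
        rw [abs_of_pos (hSp i)]
        have h2 : 11 * K * ω ≤ (2 * K)⁻¹ := by linarith [frob_nonneg H]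
        have h3 : (2 * K)⁻¹ ≤ 1 := inv_le_one_of_one_le₀ (by linarith)
        have h4 : 1 ≤ K * S i i := by
          rwa [← inv_le_iff_one_le_mul₀' hK0]
        nlinarith
      have h2 : 11 * √(S i i * S i i) * ω ≤ 11 * K * (K * (ω ^ (1 - q) * |S i i| ^ q)) := by
        gcongr; exact hσ2 i i
      have hp : 0 ≤ ω ^ (1 - q) * |S i i| ^ q := by positivity
      have hk1 : 11 * K ^ 2 ≤ K' := by linarith
      calc |R i i - S i i| ≤ 11 * K ^ 2 * (ω ^ (1 - q) * |S i i| ^ q) + 1 * |H i i| := by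
            have := herr i i
            linarith
        _ ≤ K' * (ω ^ (1 - q) * |S i i| ^ q) + K' * |H i i| := by gcongr; nlinarith
        _ = _ := by ring
    · rw [if_neg hij]
      have hRp' : 0 < √(R i i * R j j) := by
        have := hσ1 i j
        have := inv_pos.2 hK0
        linarith [hr1 i j]
      obtain ⟨t1, t2, -⟩ := hs (C * √(R i i * R j j) * ω) (R i j) (by positivity)
      have hCω : 0 ≤ C * ω := by positivity
      have := threshold_entry_le (h := |H i j|) hK hC (hσ1 i j) (hσ2 i j) hω
        (τ := C * √(R i i * R j j) * ω) (by nlinarith [hr1 i j])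
        (by nlinarith [hr2 i j]) (abs_nonneg (H i j)) (herr i j) t1 t2 hq0 hq1
      refine this.trans (mul_le_mul_of_nonneg_right (by nlinarith) ?_)
      split_ifs <;> positivity
  have hm0 : 0 ≤ sparsity q S := by
    refine le_trans ?_ (row_sum_le_sparsity q S ⟨0, hN⟩)
    exact Finset.sum_nonneg fun j _ => by split_ifs <;> positivity
  refine (op_le_of_abs_le hentry).trans ?_
  rw [norm_smul, Real.norm_of_nonneg (by positivity)]
  refine mul_le_mul_of_nonneg_left ?_ (by positivity)
  -- The two dominating matrices are measured differently: the one from H in Frobenius norm, the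
  -- sparse one by row sums.
  refine (norm_add_le _ _).trans (add_le_add ?_ ?_)
  · refine (op_le_frob A).trans (le_of_eq ?_)
    simp [frob, frobInner_eq_sum, hA]
  · rw [norm_smul, Real.norm_of_nonneg (by positivity)]
    refine mul_le_mul_of_nonneg_left ?_ (by positivity)
    refine op_le_of_row_sum hm0 ?_ (fun i j => ?_) (row_sum_le_sparsity q S)
    · ext i j
      have : S j i = S i j := by conv_lhs => rw [← hS, Matrix.transpose_apply]
      simp only [hB, Matrix.transpose_apply, Matrix.of_apply, this]
    · simp only [hB, Matrix.of_apply]; split_ifs <;> positivity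

lemma thresholdCov_transpose {N T : ℕ} {s : ℝ → ℝ → ℝ} {C : ℝ} {R : Matrix (Fin N) (Fin N) ℝ} (hR : Rᵀ = R) :
    (thresholdCov T s C R)ᵀ = thresholdCov T s C R := by
  ext i j
  have h : R j i = R i j := by conv_lhs => rw [← hR, Matrix.transpose_apply]
  simp only [thresholdCov, Matrix.transpose_apply, Matrix.of_apply]
  by_cases hij : i = j
  · subst hij; rfl
  · rw [if_neg hij, if_neg (Ne.symm hij), h, mul_comm (R i i)]

/-- Inverses of matrices close to a well conditioned symmetric matrix. -/
lemma inv_perturb {n : Type*} [Fintype n] [DecidableEq n] {K ε : ℝ} (hK : 1 ≤ K) {S S' : Matrix n n ℝ}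
    (hc : ∀ v : n → ℝ, K⁻¹ * (v ⬝ᵥ v) ≤ v ⬝ᵥ S *ᵥ v) (hS : ‖S‖ ≤ K) (hSS : ‖S' - S‖ ≤ ε)
    (hε : 2 * K * ε ≤ 1) :
    IsUnit S'.det ∧ ‖S'⁻¹‖ ≤ 2 * K ∧ ‖S'⁻¹ - S⁻¹‖ ≤ 2 * K ^ 2 * ε ∧
      ∀ v : n → ℝ, (8 * K ^ 3)⁻¹ * (v ⬝ᵥ v) ≤ v ⬝ᵥ S'⁻¹ *ᵥ v := by
  have hK0 : 0 < K := by linarith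
  have hε' : ε ≤ (2 * K)⁻¹ := by
    rw [← one_div, le_div_iff₀ (by positivity)]; linarith
  have hc' : ∀ v : n → ℝ, (2 * K)⁻¹ * (v ⬝ᵥ v) ≤ v ⬝ᵥ S' *ᵥ v := fun v => by
    have h1 : v ⬝ᵥ S' *ᵥ v = v ⬝ᵥ S *ᵥ v + v ⬝ᵥ (S' - S) *ᵥ v := by
      rw [← dotProduct_add, ← Matrix.add_mulVec, add_sub_cancel]
    have hv : 0 ≤ v ⬝ᵥ v := by rw [dotProduct_self_eq_norm]; positivity
    have h2 := abs_dot_mulVec_le (S' - S) v v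
    rw [Real.mul_self_sqrt hv] at h2
    have h3 : ‖S' - S‖ * (v ⬝ᵥ v) ≤ (2 * K)⁻¹ * (v ⬝ᵥ v) := by gcongr; exact hSS.trans hε'
    have h7 : K⁻¹ * (v ⬝ᵥ v) = (2 * K)⁻¹ * (v ⬝ᵥ v) + (2 * K)⁻¹ * (v ⬝ᵥ v) := by
      field_simp; ring
    linarith [hc v, (abs_le.1 h2).1]
  obtain ⟨u1, n1⟩ := inv_of_coercive (inv_pos.2 hK0) hc
  obtain ⟨u2, n2⟩ := inv_of_coercive (by positivity) hc'
  rw [one_div, inv_inv] at n1 n2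
  have hS' : ‖S'‖ ≤ 2 * K := by
    have h1 : ‖S'‖ ≤ ‖S' - S‖ + ‖S‖ := by simpa using norm_add_le (S' - S) S
    have h2 : (2 * K)⁻¹ ≤ 1 := inv_le_one_of_one_le₀ (by linarith)
    linarith
  refine ⟨u2, n2, (op_inv_sub_inv_le u2 u1 n2 n1 hSS).trans (le_of_eq (by ring)), fun v => ?_⟩
  set w := S'⁻¹ *ᵥ v with hw
  have hv : S' *ᵥ w = v := by
    rw [hw, Matrix.mulVec_mulVec, Matrix.mul_nonsing_inv _ u2, Matrix.one_mulVec]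
  have h1 := hc' w
  have h2 := mulVec_dot_le S' w
  rw [hv] at h1 h2
  rw [dotProduct_comm v w]
  have hw0 : 0 ≤ w ⬝ᵥ w := by rw [dotProduct_self_eq_norm]; positivity
  have h3 : v ⬝ᵥ v ≤ (2 * K) ^ 2 * (w ⬝ᵥ w) := h2.trans (by gcongr)
  calc (8 * K ^ 3)⁻¹ * (v ⬝ᵥ v) ≤ (8 * K ^ 3)⁻¹ * ((2 * K) ^ 2 * (w ⬝ᵥ w)) := by gcongr
    _ = (2 * K)⁻¹ * (w ⬝ᵥ w) := by field_simp; ring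
    _ ≤ _ := h1

end Thresholding


/-! ### Regular realizations and their first consequences -/

section Regularity

set_option linter.unusedSectionVars false

open scoped Matrix.Norms.L2Operator

variable {N T d r : ℕ}

/-- The matrix `W - WΛ(Λ'WΛ)⁻¹Λ'W`. -/
noncomputable def wannih {m k : Type*} [Fintype m] [Fintype k] [DecidableEq m] [DecidableEq k]
    (W : Matrix m m ℝ) (B : Matrix m k ℝ) : Matrix m m ℝ := W - wproj W B

/-- Deterministic conditions on one realization of a panel: `K` bounds everything that has to be
bounded, and `θ` everything that has to be small. -/
structure RegularPanel (K θ q : ℝ) (S : Matrix (Fin N) (Fin N) ℝ) (Λ : Matrix (Fin N) (Fin r) ℝ)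
    (F₀ : Matrix (Fin T) (Fin r) ℝ) (u : Matrix (Fin N) (Fin T) ℝ)
    (X : Fin d → Matrix (Fin N) (Fin T) ℝ) : Prop where
  one_le : 1 ≤ K
  r_le : (r : ℝ) ≤ K
  d_le : (d : ℝ) ≤ K
  N_pos : 0 < N
  T_pos : 0 < T
  r_lt : r < N
  r_le_T : r ≤ T
  θ_pos : 0 < θ
  q_nonneg : 0 ≤ q
  q_le : q ≤ 1
  rate_sqrt : √N * Real.log N ≤ θ ^ 2 * T
  rate_le : (T : ℝ) ≤ N
  rate_log : 1 ≤ θ ^ 2 * Real.log N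
  rate_omega : omegaRate N T ≤ θ
  rate_sparse : omegaRate N T ^ (1 - q) * sparsity q S ≤ θ
  symm : Sᵀ = S
  cov_lower : ∀ v : Fin N → ℝ, K⁻¹ * (v ⬝ᵥ v) ≤ v ⬝ᵥ S *ᵥ v
  cov_upper : ‖S‖ ≤ K
  load_lower : ∀ v : Fin r → ℝ, N * (v ⬝ᵥ v) ≤ K * ((Λ *ᵥ v) ⬝ᵥ (Λ *ᵥ v))
  load_upper : ∀ i, rowNorm Λ i ≤ K
  factor_lower : ∀ v : Fin r → ℝ, T * (v ⬝ᵥ v) ≤ K * ((F₀ *ᵥ v) ⬝ᵥ (F₀ *ᵥ v))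
  factor_upper : frob F₀ ≤ K * √T
  err_op : ‖u‖ ≤ K * √N
  err_load : frob (Λᵀ * u) ≤ K * (√N * √T * √(Real.log N))
  err_row : ∀ i, rowNorm u i ≤ K * √T
  err_factor : ∀ i, rowNorm (u * F₀) i ≤ K * (√T * √(Real.log N))
  err_cov : ∀ i j, |((T : ℝ)⁻¹ • (u * uᵀ) - S) i j| ≤ 10 * √(S i i * S j j) * √(Real.log N / T)
  reg_upper : ∀ k, frob (X k) ≤ K * (√N * √T)
  reg_err : ∀ k i j, |(X k * uᵀ) i j| ≤ K * √(Real.log N) * rowNorm (X k) i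
  score : ∀ k, |frobInner (X k) u| ≤ K * √(Real.log N) * (√N * √T)
  score_weighted : ∀ k, |frobInner (X k) (S⁻¹ * u)| ≤ K * √(Real.log N) * (√N * √T)
  score_annih : ∀ k, |frobInner (annih Λ * X k * annih F₀) u| ≤ K * √(Real.log N) * (√N * √T)
  ident : ∀ F : Matrix (Fin T) (Fin r) ℝ, (T : ℝ)⁻¹ • (Fᵀ * F) = 1 → ∀ v : Fin d → ℝ,
    N * T * (v ⬝ᵥ v) ≤ K * frobInner (regComb X v) (wannih S⁻¹ Λ * regComb X v * annih F)
  ident₀ : ∀ v : Fin d → ℝ,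
    N * T * (v ⬝ᵥ v) ≤ K * frobInner (regComb X v) (wannih S⁻¹ Λ * regComb X v * annih F₀)

lemma annih_of_normalized (hT : 0 < T) {F : Matrix (Fin T) (Fin r) ℝ} (hF : (T : ℝ)⁻¹ • (Fᵀ * F) = 1) :
    annih F = 1 - (T : ℝ)⁻¹ • (F * Fᵀ) := by
  have hT' : (T : ℝ) ≠ 0 := by exact_mod_cast hT.ne'
  have h1 : Fᵀ * F = (T : ℝ) • (1 : Matrix (Fin r) (Fin r) ℝ) := by
    rw [← hF, smul_smul, mul_inv_cancel₀ hT', one_smul]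
  have h2 : (Fᵀ * F)⁻¹ = (T : ℝ)⁻¹ • (1 : Matrix (Fin r) (Fin r) ℝ) := by
    refine Matrix.inv_eq_left_inv ?_
    rw [h1, Matrix.smul_mul, Matrix.mul_smul, Matrix.one_mul, smul_smul, inv_mul_cancel₀ hT', one_smul]
  rw [annih, h2, Matrix.mul_smul, Matrix.mul_one, Matrix.smul_mul]

section Tall

variable {m k : Type*} [Fintype m] [Fintype k] [DecidableEq m] [DecidableEq k]

lemma gram_dot (B : Matrix m k ℝ) (v : k → ℝ) : v ⬝ᵥ (Bᵀ * B) *ᵥ v = (B *ᵥ v) ⬝ᵥ (B *ᵥ v) := by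
  rw [← Matrix.mulVec_mulVec, Matrix.dotProduct_mulVec, Matrix.vecMul_transpose]

lemma gram_dot_weight (W : Matrix m m ℝ) (B : Matrix m k ℝ) (v : k → ℝ) :
    v ⬝ᵥ (Bᵀ * W * B) *ᵥ v = (B *ᵥ v) ⬝ᵥ W *ᵥ (B *ᵥ v) := by
  rw [Matrix.mul_assoc, ← Matrix.mulVec_mulVec, Matrix.dotProduct_mulVec, Matrix.vecMul_transpose,
    Matrix.mulVec_mulVec]

lemma gram_inv {K x : ℝ} (hK : 0 < K) (hx : 0 < x) {B : Matrix m k ℝ}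
    (h : ∀ v : k → ℝ, x * (v ⬝ᵥ v) ≤ K * ((B *ᵥ v) ⬝ᵥ (B *ᵥ v))) :
    IsUnit (Bᵀ * B).det ∧ ‖(Bᵀ * B)⁻¹‖ ≤ K / x := by
  have := inv_of_coercive (S := Bᵀ * B) (c := x / K) (by positivity) fun v => by
    rw [gram_dot, div_mul_eq_mul_div, div_le_iff₀ hK]
    linarith [h v]
  rwa [one_div_div] at this

lemma frob_le_of_tall {l : Type*} [Fintype l] {K x : ℝ} (hK : 1 ≤ K) (hx : 0 ≤ x) {B : Matrix m k ℝ}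
    (h : ∀ v : k → ℝ, x * (v ⬝ᵥ v) ≤ K * ((B *ᵥ v) ⬝ᵥ (B *ᵥ v))) (C : Matrix k l ℝ) :
    √x * frob C ≤ K * frob (B * C) := by
  refine (pow_le_pow_iff_left₀ (by have := frob_nonneg C; positivity)
    (by have := frob_nonneg (B * C); positivity) two_ne_zero).1 ?_
  rw [mul_pow, mul_pow, Real.sq_sqrt hx, frob_sq_eq_sum_cols, frob_sq_eq_sum_cols, Finset.mul_sum,
    Finset.mul_sum]
  refine Finset.sum_le_sum fun j _ => ?_
  have h1 := h fun i => C i j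
  have h2 : (B *ᵥ fun i => C i j) = fun i => (B * C) i j := by
    ext i; simp [Matrix.mul_apply, Matrix.mulVec, dotProduct]
  rw [h2] at h1
  refine h1.trans (mul_le_mul_of_nonneg_right (le_self_pow₀ hK two_ne_zero) ?_)
  rw [dotProduct_self_eq_norm]; positivity

lemma wproj_transpose {W : Matrix m m ℝ} (hW : Wᵀ = W) (B : Matrix m k ℝ) : (wproj W B)ᵀ = wproj W B := by
  have h1 : (Bᵀ * W * B)ᵀ = Bᵀ * W * B := by
    simp only [Matrix.transpose_mul, Matrix.transpose_transpose, hW, Matrix.mul_assoc]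
  simp only [wproj, Matrix.transpose_mul, Matrix.transpose_transpose, hW, Matrix.transpose_nonsing_inv,
    Matrix.mul_assoc]

lemma wannih_transpose {W : Matrix m m ℝ} (hW : Wᵀ = W) (B : Matrix m k ℝ) :
    (wannih W B)ᵀ = wannih W B := by
  rw [wannih, Matrix.transpose_sub, wproj_transpose hW, hW]

lemma wannih_mul {W : Matrix m m ℝ} {B : Matrix m k ℝ} (h : IsUnit (Bᵀ * W * B).det) :
    wannih W B * B = 0 := by
  have : wproj W B * B = W * B * ((Bᵀ * W * B)⁻¹ * (Bᵀ * W * B)) := by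
    rw [wproj]; simp only [Matrix.mul_assoc]
  rw [wannih, Matrix.sub_mul, this, Matrix.nonsing_inv_mul _ h, Matrix.mul_one, sub_self]

/-- The weighted matrix vanishes on the column space of B from both sides, so the unweighted
projection can be inserted. This links the weighted identification condition to the unweighted
estimate. -/
lemma wannih_conj {W : Matrix m m ℝ} (hW : Wᵀ = W) {B : Matrix m k ℝ} (h : IsUnit (Bᵀ * W * B).det) :
    annih B * wannih W B * annih B = wannih W B := by
  have h1 := wannih_mul h
  have h2 : Bᵀ * wannih W B = 0 := by
    rw [← wannih_transpose hW, ← Matrix.transpose_mul, h1, Matrix.transpose_zero]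
  have h3 : annih B * wannih W B = wannih W B := by
    rw [annih, Matrix.sub_mul, Matrix.one_mul, Matrix.mul_assoc _ Bᵀ, h2, Matrix.mul_zero, sub_zero]
  rw [h3, annih, Matrix.mul_sub, Matrix.mul_one, Matrix.mul_assoc B, ← Matrix.mul_assoc _ B, h1,
    Matrix.zero_mul, sub_zero]

lemma wproj_op_le {K : ℝ} (hK : 1 ≤ K) {W : Matrix m m ℝ} {B : Matrix m k ℝ} (hW : ‖W‖ ≤ K) (hB : ‖B‖ ≤ K)
    (hc : ∀ v : k → ℝ, K⁻¹ * (v ⬝ᵥ v) ≤ v ⬝ᵥ (Bᵀ * W * B) *ᵥ v) :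
    IsUnit (Bᵀ * W * B).det ∧ ‖wproj W B‖ ≤ K ^ 5 := by
  obtain ⟨h1, h2⟩ := inv_of_coercive (inv_pos.2 (by linarith)) hc
  rw [one_div, inv_inv] at h2
  refine ⟨h1, ?_⟩
  refine (op_mul_le (op_mul_le (op_mul_le (op_mul_le hW hB) h2)
    ((op_transpose B).trans_le hB)) hW).trans (le_of_eq (by ring))

end Tall

/-- Idempotence distributes M over both arguments. -/
lemma frobInner_wproj_le (Q : Matrix (Fin N) (Fin N) ℝ) {M : Matrix (Fin T) (Fin T) ℝ} (hM : Mᵀ = M) (hMM : M * M = M)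
    (A : Matrix (Fin N) (Fin T) ℝ) :
    frobInner A (Q * A * M) ≤ ‖Q‖ * frob (A * M) ^ 2 := by
  have h1 : frobInner A (Q * A * M) = frobInner (A * M) (Q * (A * M)) := by
    rw [frobInner_mul_right, hM, Matrix.mul_assoc Q, Matrix.mul_assoc Q, Matrix.mul_assoc A, hMM]
  rw [h1]
  refine (frobInner_le _ _).trans ?_
  have := frob_mul_le_op Q (A * M)
  nlinarith [frob_nonneg (A * M)]

lemma sum_abs_le (v : Fin d → ℝ) : ∑ k, |v k| ≤ √d * √(v ⬝ᵥ v) := by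
  have := Real.sum_mul_le_sqrt_mul_sqrt Finset.univ (fun _ : Fin d => (1 : ℝ)) (fun k => |v k|)
  simpa [dotProduct, pow_two] using this

namespace RegularPanel

variable {K θ q : ℝ} {S : Matrix (Fin N) (Fin N) ℝ} {Λ : Matrix (Fin N) (Fin r) ℝ}
  {F₀ : Matrix (Fin T) (Fin r) ℝ} {u : Matrix (Fin N) (Fin T) ℝ} {X : Fin d → Matrix (Fin N) (Fin T) ℝ}

lemma one_le_N (h : RegularPanel K θ q S Λ F₀ u X) : (1 : ℝ) ≤ N := by exact_mod_cast h.N_pos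

lemma one_le_T (h : RegularPanel K θ q S Λ F₀ u X) : (1 : ℝ) ≤ T := by exact_mod_cast h.T_pos

lemma frob_load_le (h : RegularPanel K θ q S Λ F₀ u X) : frob Λ ≤ K * √N := by
  have hK := h.one_le
  refine (pow_le_pow_iff_left₀ (frob_nonneg _) (by positivity) two_ne_zero).1 ?_
  rw [frob_sq_eq_sum_rows, mul_pow, Real.sq_sqrt (by positivity)]
  calc ∑ i, rowNorm Λ i ^ 2 ≤ ∑ _i : Fin N, K ^ 2 :=
        Finset.sum_le_sum fun i _ => pow_le_pow_left₀ (rowNorm_nonneg _ _) (h.load_upper i) 2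
    _ = _ := by simp; ring

lemma weight (h : RegularPanel K θ q S Λ F₀ u X) : IsUnit S.det ∧ ‖S⁻¹‖ ≤ 2 * K ∧
    (∀ v : Fin N → ℝ, (8 * K ^ 3)⁻¹ * (v ⬝ᵥ v) ≤ v ⬝ᵥ S⁻¹ *ᵥ v) ∧ (S⁻¹)ᵀ = S⁻¹ := by
  -- The perturbation lemma without perturbation.
  obtain ⟨h1, h2, -, h4⟩ := inv_perturb h.one_le h.cov_lower h.cov_upper (S' := S) (ε := 0) (by simp)
    (by simp)
  exact ⟨h1, h2, h4, by rw [Matrix.transpose_nonsing_inv, h.symm]⟩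

/-- Division by √N gives the loadings unit scale, as `wproj_perturb` requires; the single constant
8K⁴ serves for all of its hypotheses. -/
lemma scaled_load (h : RegularPanel K θ q S Λ F₀ u X) : ‖(√(N : ℝ))⁻¹ • Λ‖ ≤ 8 * K ^ 4 ∧
    ∀ v : Fin r → ℝ, (8 * K ^ 4)⁻¹ * (v ⬝ᵥ v) ≤
      v ⬝ᵥ (((√(N : ℝ))⁻¹ • Λ)ᵀ * S⁻¹ * ((√(N : ℝ))⁻¹ • Λ)) *ᵥ v := by
  have hK := h.one_le
  have hN := h.one_le_N
  have hn : 0 < √(N : ℝ) := Real.sqrt_pos.2 (by linarith)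
  have hn2 : √(N : ℝ) ^ 2 = N := Real.sq_sqrt (by linarith)
  constructor
  · rw [norm_smul, Real.norm_of_nonneg (by positivity), inv_mul_le_iff₀ hn]
    refine (op_le_frob Λ).trans (h.frob_load_le.trans ?_)
    rw [mul_comm]
    have : K ≤ K ^ 4 := le_self_pow₀ hK (by norm_num)
    gcongr
    linarith
  · intro v
    obtain ⟨-, -, h3, -⟩ := h.weight
    rw [gram_dot_weight]
    refine le_trans ?_ (h3 _)
    rw [Matrix.smul_mulVec, smul_dotProduct, dotProduct_smul, smul_eq_mul, smul_eq_mul]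
    have h4 := h.load_lower v
    have h5 : (√(N : ℝ))⁻¹ * ((√(N : ℝ))⁻¹ * ((Λ *ᵥ v) ⬝ᵥ (Λ *ᵥ v))) = (N : ℝ)⁻¹ * ((Λ *ᵥ v) ⬝ᵥ (Λ *ᵥ v)) := by
      rw [← mul_assoc, ← mul_inv, Real.mul_self_sqrt (by linarith)]
    rw [h5]
    have h6 : K⁻¹ * (v ⬝ᵥ v) ≤ (N : ℝ)⁻¹ * ((Λ *ᵥ v) ⬝ᵥ (Λ *ᵥ v)) := by
      rw [inv_mul_le_iff₀ (by linarith), mul_left_comm, le_inv_mul_iff₀ (by linarith)]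
      exact h4
    calc (8 * K ^ 4)⁻¹ * (v ⬝ᵥ v) = (8 * K ^ 3)⁻¹ * (K⁻¹ * (v ⬝ᵥ v)) := by field_simp
      _ ≤ _ := by gcongr

lemma wannih_scaled (h : RegularPanel K θ q S Λ F₀ u X) :
    wproj S⁻¹ ((√(N : ℝ))⁻¹ • Λ) = wproj S⁻¹ Λ :=
  wproj_smul _ _ (inv_ne_zero (Real.sqrt_pos.2 (by linarith [h.one_le_N])).ne')

lemma gram_isUnit (h : RegularPanel K θ q S Λ F₀ u X) : IsUnit (Λᵀ * S⁻¹ * Λ).det := by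
  have hK := h.one_le
  have hN := h.one_le_N
  have hn : 0 < √(N : ℝ) := Real.sqrt_pos.2 (by linarith)
  have h1 := (inv_of_coercive (by positivity) h.scaled_load.2).1
  rw [Matrix.transpose_smul, Matrix.smul_mul, Matrix.smul_mul, Matrix.mul_smul, smul_smul,
    Matrix.det_smul] at h1
  exact isUnit_of_mul_isUnit_right h1

lemma wannih_op_le (h : RegularPanel K θ q S Λ F₀ u X) : ‖wannih S⁻¹ Λ‖ ≤ 40000 * K ^ 20 := by
  have hK := h.one_le
  have h1 : K ≤ K ^ 4 := le_self_pow₀ hK (by norm_num)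
  have h2 := (wproj_op_le (K := 8 * K ^ 4) (by linarith) (by linarith [h.weight.2.1]) h.scaled_load.1
    h.scaled_load.2).2
  rw [h.wannih_scaled] at h2
  have h3 : K ≤ K ^ 20 := le_self_pow₀ hK (by norm_num)
  rw [wannih]
  calc _ ≤ ‖S⁻¹‖ + ‖wproj S⁻¹ Λ‖ := norm_sub_le _ _
    _ ≤ 2 * K + (8 * K ^ 4) ^ 5 := add_le_add h.weight.2.1 h2
    _ = 2 * K + 32768 * K ^ 20 := by ring
    _ ≤ _ := by linarith

/-- The size of `Xδ` that corresponds to the slope error `δ`. -/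
noncomputable def slopeSize (N T : ℕ) (v : Fin d → ℝ) : ℝ := √N * √T * √(v ⬝ᵥ v)

lemma slopeSize_nonneg (v : Fin d → ℝ) : 0 ≤ slopeSize N T v := by unfold slopeSize; positivity

lemma slopeSize_sq (v : Fin d → ℝ) : slopeSize N T v ^ 2 = N * T * (v ⬝ᵥ v) := by
  rw [slopeSize, mul_pow, mul_pow, Real.sq_sqrt (by positivity), Real.sq_sqrt (by positivity),
    Real.sq_sqrt (by rw [dotProduct_self_eq_norm]; positivity)]

lemma slopeSize_le_of_sq {K x : ℝ} (hK : 1 ≤ K) (hx : 0 ≤ x) {v : Fin d → ℝ}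
    (h : N * T * (v ⬝ᵥ v) ≤ K * (40000 * K ^ 20 * x ^ 2)) : slopeSize N T v ≤ 200 * K ^ 11 * x := by
  refine (pow_le_pow_iff_left₀ (slopeSize_nonneg _) (by positivity) two_ne_zero).1 ?_
  rw [slopeSize_sq]
  refine h.trans ?_
  calc K * (40000 * K ^ 20 * x ^ 2) = 40000 * K ^ 21 * x ^ 2 := by ring
    _ ≤ 40000 * K ^ 22 * x ^ 2 := by gcongr <;> first | exact hK | norm_num
    _ = _ := by ring

/-- The identifying form annihilates Λ, so any ΛG' may be added to Xv before it is bounded by the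
projected residual. No interactive effect can therefore mask a slope error. -/
lemma slope_le_resid (h : RegularPanel K θ q S Λ F₀ u X) {F : Matrix (Fin T) (Fin r) ℝ}
    (hF : (T : ℝ)⁻¹ • (Fᵀ * F) = 1) (v : Fin d → ℝ) (G : Matrix (Fin T) (Fin r) ℝ) :
    slopeSize N T v ≤ 200 * K ^ 11 * frob ((Λ * Gᵀ - regComb X v) * (1 - (T : ℝ)⁻¹ • (F * Fᵀ))) := by
  have hK := h.one_le
  refine slopeSize_le_of_sq hK (frob_nonneg _) ?_
  have h1 := h.ident F hF v
  obtain ⟨p1, p2, -, -⟩ := normalized_proj hF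
  rw [annih_of_normalized h.T_pos hF] at h1
  have e1 := wannih_mul h.gram_isUnit
  have e2 : Λᵀ * wannih S⁻¹ Λ = 0 := by
    rw [← wannih_transpose h.weight.2.2.2, ← Matrix.transpose_mul, e1, Matrix.transpose_zero]
  refine h1.trans (mul_le_mul_of_nonneg_left ?_ (by linarith))
  have h2 : frobInner (regComb X v) (wannih S⁻¹ Λ * regComb X v * (1 - (T : ℝ)⁻¹ • (F * Fᵀ))) =
      frobInner (Λ * Gᵀ - regComb X v)
        (wannih S⁻¹ Λ * (Λ * Gᵀ - regComb X v) * (1 - (T : ℝ)⁻¹ • (F * Fᵀ))) := by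
    rw [Matrix.mul_sub (wannih S⁻¹ Λ), ← Matrix.mul_assoc _ Λ, e1, Matrix.zero_mul, zero_sub,
      frobInner_sub_left, frobInner_mul_left Λ, Matrix.neg_mul, Matrix.mul_neg, ← Matrix.mul_assoc,
      ← Matrix.mul_assoc, e2, Matrix.zero_mul, Matrix.zero_mul]
    simp [frobInner]
  rw [h2]
  refine (frobInner_wproj_le _ p1 p2 _).trans ?_
  exact mul_le_mul_of_nonneg_right h.wannih_op_le (sq_nonneg _)

lemma factor_inv (h : RegularPanel K θ q S Λ F₀ u X) :
    IsUnit (F₀ᵀ * F₀).det ∧ ‖(F₀ᵀ * F₀)⁻¹‖ ≤ K / T :=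
  gram_inv (by linarith [h.one_le]) (by linarith [h.one_le_T]) h.factor_lower

lemma load_inv (h : RegularPanel K θ q S Λ F₀ u X) :
    IsUnit (Λᵀ * Λ).det ∧ ‖(Λᵀ * Λ)⁻¹‖ ≤ K / N :=
  gram_inv (by linarith [h.one_le]) (by linarith [h.one_le_N]) h.load_lower

/-- Identification at the true factors, with M_Λ inserted by `wannih_conj`: the lower bound for the
quadratic term of the refined expansion. -/
lemma slope_le_annih (h : RegularPanel K θ q S Λ F₀ u X) (v : Fin d → ℝ) :
    slopeSize N T v ≤ 200 * K ^ 11 * frob (annih Λ * regComb X v * annih F₀) := by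
  have hK := h.one_le
  refine slopeSize_le_of_sq hK (frob_nonneg _) ?_
  obtain ⟨f1, f2, -, -⟩ := annih_proj h.factor_inv.1
  obtain ⟨l1, -, -, -⟩ := annih_proj h.load_inv.1
  refine (h.ident₀ v).trans (mul_le_mul_of_nonneg_left ?_ (by linarith))
  have h2 : frobInner (regComb X v) (wannih S⁻¹ Λ * regComb X v * annih F₀) =
      frobInner (annih Λ * regComb X v) (wannih S⁻¹ Λ * (annih Λ * regComb X v) * annih F₀) := by
    conv_lhs => rw [← wannih_conj h.weight.2.2.2 h.gram_isUnit]
    rw [frobInner_mul_left (annih Λ), l1]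
    simp only [Matrix.mul_assoc]
  rw [h2]
  refine (frobInner_wproj_le _ f1 f2 _).trans ?_
  exact mul_le_mul_of_nonneg_right h.wannih_op_le (sq_nonneg _)

lemma sum_abs_slope_le (h : RegularPanel K θ q S Λ F₀ u X) (v : Fin d → ℝ) :
    √N * √T * ∑ k, |v k| ≤ K * slopeSize N T v := by
  have hK := h.one_le
  have h1 : √(d : ℝ) ≤ K := Real.sqrt_le_iff.2 ⟨by linarith, h.d_le.trans (le_self_pow₀ hK two_ne_zero)⟩
  calc √N * √T * ∑ k, |v k| ≤ √N * √T * (K * √(v ⬝ᵥ v)) := by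
        gcongr
        exact (sum_abs_le v).trans (by gcongr)
    _ = _ := by rw [slopeSize]; ring

lemma sum_slope_le (h : RegularPanel K θ q S Λ F₀ u X) (v : Fin d → ℝ) {a : Fin d → ℝ} {x : ℝ}
    (hx : 0 ≤ x) (ha : ∀ k, |a k| ≤ x * (√N * √T)) : |∑ k, v k * a k| ≤ x * (K * slopeSize N T v) := by
  calc |∑ k, v k * a k| ≤ ∑ k, |v k| * |a k| := by
        refine (Finset.abs_sum_le_sum_abs _ _).trans (le_of_eq ?_)
        simp only [abs_mul]
    _ ≤ ∑ k, |v k| * (x * (√N * √T)) :=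
        Finset.sum_le_sum fun k _ => mul_le_mul_of_nonneg_left (ha k) (abs_nonneg _)
    _ = x * (√N * √T * ∑ k, |v k|) := by rw [← Finset.sum_mul]; ring
    _ ≤ _ := mul_le_mul_of_nonneg_left (h.sum_abs_slope_le v) hx

lemma frob_reg_le (h : RegularPanel K θ q S Λ F₀ u X) (v : Fin d → ℝ) :
    frob (regComb X v) ≤ K ^ 2 * slopeSize N T v := by
  have hK := h.one_le
  calc frob (regComb X v) ≤ ∑ k, |v k| * frob (X k) := by
        refine (frob_sum_le _ _).trans (le_of_eq ?_)
        simp only [frob_smul]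
    _ ≤ ∑ k, |v k| * (K * (√N * √T)) :=
        Finset.sum_le_sum fun k _ => mul_le_mul_of_nonneg_left (h.reg_upper k) (abs_nonneg _)
    _ = K * (√N * √T * ∑ k, |v k|) := by rw [← Finset.sum_mul]; ring
    _ ≤ K * (K * slopeSize N T v) := mul_le_mul_of_nonneg_left (h.sum_abs_slope_le v) (by linarith)
    _ = _ := by ring

lemma score_le (h : RegularPanel K θ q S Λ F₀ u X) (v : Fin d → ℝ) :
    |frobInner (regComb X v) u| ≤ K ^ 2 * √(Real.log N) * slopeSize N T v := by
  have hK := h.one_le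
  have := h.sum_slope_le v (x := K * √(Real.log N)) (by positivity) h.score
  rw [regComb, frobInner_sum_left]
  simp only [frobInner_smul_left]
  exact this.trans (le_of_eq (by ring))

lemma score_weighted_le (h : RegularPanel K θ q S Λ F₀ u X) (v : Fin d → ℝ) :
    |frobInner (regComb X v) (S⁻¹ * u)| ≤ K ^ 2 * √(Real.log N) * slopeSize N T v := by
  have hK := h.one_le
  have := h.sum_slope_le v (x := K * √(Real.log N)) (by positivity) h.score_weighted
  rw [regComb, frobInner_sum_left]
  simp only [frobInner_smul_left]
  exact this.trans (le_of_eq (by ring))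

lemma score_annih_le (h : RegularPanel K θ q S Λ F₀ u X) (v : Fin d → ℝ) :
    |frobInner (annih Λ * regComb X v * annih F₀) u| ≤ K ^ 2 * √(Real.log N) * slopeSize N T v := by
  have hK := h.one_le
  have := h.sum_slope_le v (x := K * √(Real.log N)) (by positivity) h.score_annih
  have e : annih Λ * regComb X v * annih F₀ = ∑ k, v k • (annih Λ * X k * annih F₀) := by
    rw [regComb, Matrix.mul_sum, Matrix.sum_mul]
    simp only [Matrix.mul_smul, Matrix.smul_mul]
  rw [e, frobInner_sum_left]
  simp only [frobInner_smul_left]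
  exact this.trans (le_of_eq (by ring))

lemma reg_err_le (h : RegularPanel K θ q S Λ F₀ u X) (v : Fin d → ℝ) (i j : Fin N) :
    |(regComb X v * uᵀ) i j| ≤ K ^ 3 * (√(Real.log N) * slopeSize N T v) := by
  have hK := h.one_le
  have := h.sum_slope_le v (a := fun k => (X k * uᵀ) i j) (x := K ^ 2 * √(Real.log N)) (by positivity)
    fun k => by
      refine (h.reg_err k i j).trans ?_
      calc _ ≤ K * √(Real.log N) * (K * (√N * √T)) :=
            mul_le_mul_of_nonneg_left ((rowNorm_le_frob _ _).trans (h.reg_upper k)) (by positivity)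
        _ = _ := by ring
  have e : (regComb X v * uᵀ) i j = ∑ k, v k * (X k * uᵀ) i j := by
    rw [regComb, Matrix.sum_mul, Matrix.sum_apply]
    simp only [Matrix.smul_mul, Matrix.smul_apply, smul_eq_mul]
  rw [e]
  exact this.trans (le_of_eq (by ring))

/-- The order relations between 1, √(log N), √T and √N. They hold because log N ≥ θ⁻² and log N ≤ √N
log N ≤ θ²T. -/
lemma θ_sq_le (h : RegularPanel K θ q S Λ F₀ u X) (hθ : θ ≤ 1) : 1 ≤ √(Real.log N) ∧
    √(Real.log N) ≤ √N ∧ √(Real.log N) ≤ θ * √T ∧ 1 ≤ θ * √(Real.log N) ∧ 1 ≤ √(N : ℝ) ∧ 1 ≤ √(T : ℝ) ∧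
    1 ≤ θ * √T := by
  have hN := h.one_le_N
  have hθ0 := h.θ_pos
  have h1 := h.rate_log
  have h2 : 1 ≤ Real.log N := by
    by_contra h3
    push Not at h3
    have h4 : θ ^ 2 ≤ 1 := pow_le_one₀ hθ0.le hθ
    have h5 : θ ^ 2 * Real.log N < θ ^ 2 * 1 := mul_lt_mul_of_pos_left h3 (by positivity)
    linarith
  have h3 : Real.log N ≤ N := (Real.log_le_sub_one_of_pos (by linarith)).trans (by linarith)
  have hn : 1 ≤ √(N : ℝ) := Real.one_le_sqrt.2 hN
  have h4 : 1 ≤ θ * √(Real.log N) := by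
    have : √(θ ^ 2 * Real.log N) = θ * √(Real.log N) := by
      rw [Real.sqrt_mul (sq_nonneg _), Real.sqrt_sq hθ0.le]
    rw [← this]; exact Real.one_le_sqrt.2 h1
  have h5 : √(Real.log N) ≤ θ * √T := by
    have : √(θ ^ 2 * T) = θ * √T := by rw [Real.sqrt_mul (sq_nonneg _), Real.sqrt_sq hθ0.le]
    rw [← this]
    refine Real.sqrt_le_sqrt (le_trans ?_ h.rate_sqrt)
    nlinarith
  have h6 : 1 ≤ √(Real.log N) := Real.one_le_sqrt.2 h2
  exact ⟨h6, Real.sqrt_le_sqrt h3, h5, h4, hn, Real.one_le_sqrt.2 h.one_le_T, h6.trans h5⟩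

end RegularPanel

end Regularity


/-! ### The unweighted estimate and consistency of the thresholded covariance -/

section InitialStep

open scoped Matrix.Norms.L2Operator
open RegularPanel

lemma regComb_zero {N T d : ℕ} (X : Fin d → Matrix (Fin N) (Fin T) ℝ) : regComb X 0 = 0 := by
  simp [regComb]

lemma pow_le_twohundred {K : ℝ} (hK : 1 ≤ K) {m : ℕ} (hm : m ≤ 11) : K ^ m ≤ 200 * K ^ 11 := by
  have h1 : K ^ m ≤ K ^ 11 := pow_le_pow_right₀ hK hm
  have : 0 ≤ K ^ 11 := by positivity
  linarith

/-- The rate of the unweighted estimate on a regular panel. -/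
theorem initial_rate (K : ℝ) (hK : 1 ≤ K) (r : ℕ) (hr : r ≤ K) : ∃ K' : ℝ, 1 ≤ K' ∧
    ∀ {N T d : ℕ} {θ q : ℝ} {S : Matrix (Fin N) (Fin N) ℝ} {Λ : Matrix (Fin N) (Fin r) ℝ}
      {F₀ : Matrix (Fin T) (Fin r) ℝ} {u : Matrix (Fin N) (Fin T) ℝ}
      {X : Fin d → Matrix (Fin N) (Fin T) ℝ}, RegularPanel K θ q S Λ F₀ u X → K' * θ ≤ 1 →
    ∀ (δ : Fin d → ℝ) (L : Matrix (Fin N) (Fin r) ℝ) (F : Matrix (Fin T) (Fin r) ℝ),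
      (T : ℝ)⁻¹ • (Fᵀ * F) = 1 →
      (∀ (v : Fin d → ℝ) (L' : Matrix (Fin N) (Fin r) ℝ) (F' : Matrix (Fin T) (Fin r) ℝ),
        frob (Λ * F₀ᵀ + u - regComb X δ - L * Fᵀ) ^ 2 ≤
          frob (Λ * F₀ᵀ + u - regComb X v - L' * F'ᵀ) ^ 2) →
      frob (F₀ᵀ * (1 - (T : ℝ)⁻¹ • (F * Fᵀ))) ≤ K' ∧ slopeSize N T δ ≤ K' * (θ * √T) := by
  set K₁ := 200 * K ^ 11 with hK₁
  have hk1 : K ≤ K₁ := by simpa using pow_le_twohundred hK (m := 1) (by norm_num)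
  have hk2 : K ^ 2 ≤ K₁ := pow_le_twohundred hK (by norm_num)
  have h1K : 1 ≤ K₁ := hK.trans hk1
  clear_value K₁
  obtain ⟨Kc, hKc, hcrude⟩ := crude_rate K₁ r
  set K₂ := K₁ + Kc * (1 + K₁) with hK₂
  have hk12 : K₁ ≤ K₂ := by rw [hK₂]; nlinarith
  have hkc2 : Kc * (1 + K₁) ≤ K₂ := by linarith
  obtain ⟨K₃, h1K₃, href⟩ := refined_rate K₂ r (h1K.trans hk12) (hr.trans (hk1.trans hk12))
  clear_value K₂
  refine ⟨K₂ + K₃, by linarith, ?_⟩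
  intro N T d θ q S Λ F₀ u X h hθ δ L F hF hmin
  have hθ0 := h.θ_pos
  have hθ1 : θ ≤ 1 := by nlinarith
  have hK3θ : K₃ * θ ^ 2 ≤ 1 := by nlinarith
  obtain ⟨hp1, hpn, hpτ, hθp, hn1, hτ1, hθτ⟩ := h.θ_sq_le hθ1
  have hlog : √(Real.log N) ^ 2 = Real.log N := Real.sq_sqrt (by
    by_contra hh
    rw [Real.sqrt_eq_zero_of_nonpos (by linarith)] at hp1
    linarith)
  set p := √(Real.log N) with hp
  set D := slopeSize N T δ with hD
  have hD0 : 0 ≤ D := slopeSize_nonneg δ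
  obtain ⟨p1, p2, -, -⟩ := normalized_proj hF
  have c : ∀ {x y : ℝ}, 0 ≤ y → x ≤ K * y → x ≤ K₁ * y := fun hy hx =>
    hx.trans (mul_le_mul_of_nonneg_right hk1 hy)
  have c2 : ∀ {x y : ℝ}, 0 ≤ y → x ≤ K₁ * y → x ≤ K₂ * y := fun hy hx =>
    hx.trans (mul_le_mul_of_nonneg_right hk12 hy)
  have hXf : frob (regComb X δ) ≤ K₁ * D :=
    (h.frob_reg_le δ).trans (mul_le_mul_of_nonneg_right hk2 hD0)
  have hΛc : ∀ B : Matrix (Fin r) (Fin T) ℝ, √N * frob B ≤ K * frob (Λ * B) :=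
    frob_le_of_tall hK (Nat.cast_nonneg N) h.load_lower
  have hone : ‖(1 : Matrix (Fin N) (Fin N) ℝ)‖ ≤ 1 := op_le_one_of_proj (by simp) (by simp)
  have hle_u : frob (Λ * F₀ᵀ + u - regComb X δ - L * Fᵀ) ^ 2 ≤ frob u ^ 2 := by
    have := hmin 0 Λ F₀
    rwa [regComb_zero, sub_zero, add_sub_cancel_left] at this
  -- With unit weight the score is of order p = √(log N) ≤ √N, so the crude bound is D = O(√N) and
  -- F₀'M = O(1).
  obtain ⟨hD1, hG1⟩ := hcrude h.N_pos h.T_pos 1 Λ L F₀ F u X δ D (K₁ * p) hD0 (by positivity) h1K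
    (by simp) (fun v => by
      rw [Matrix.one_mulVec]
      refine mul_le_of_le_one_left (by rw [dotProduct_self_eq_norm]; positivity) (inv_le_one_of_one_le₀ h1K))
    (hone.trans h1K) hF (fun B => c (frob_nonneg _) (hΛc B)) (c (by positivity) h.frob_load_le)
    (c (by positivity) h.err_op) hXf (by
      refine (h.slope_le_resid hF δ F₀).trans ?_
      rw [hK₁])
    (by
      rw [Matrix.one_mul]
      refine (h.score_le δ).trans ?_
      gcongr)
    (by rw [Matrix.one_mul, Matrix.one_mul, ← frob_sq, ← frob_sq]; exact hle_u)
  have hbd : Kc * (√N + K₁ * p) ≤ K₂ * √N := by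
    calc Kc * (√N + K₁ * p) ≤ Kc * (√N + K₁ * √N) := by gcongr
      _ = Kc * (1 + K₁) * √N := by ring
      _ ≤ _ := by gcongr
  have hDn : D ≤ K₂ * √N := hD1.trans hbd
  have hG : frob (F₀ᵀ * (1 - (T : ℝ)⁻¹ • (F * Fᵀ))) ≤ K₂ := by
    have h2 := hG1.trans hbd
    rw [mul_comm K₂] at h2
    exact le_of_mul_le_mul_left h2 (by linarith)
  refine ⟨hG.trans (by linarith), ?_⟩
  have hNp : (0 : ℝ) < N := by linarith [h.one_le_N]
  have hTp : (0 : ℝ) < T := by linarith [h.one_le_T]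
  have hk02 : K ≤ K₂ := hk1.trans hk12
  -- The rate condition reads √N p² ≤ θ²T, so the smallness parameter here is θ², and the bound on
  -- D² gives θ√T for D.
  have hD2 := href h.N_pos h.T_pos Λ L F₀ F u X δ D (θ ^ 2) p hD0 (by positivity) hK3θ hp1
    (by rw [hlog]; exact h.rate_sqrt) (by exact_mod_cast h.rate_le) hF h.load_inv.1 h.factor_inv.1
    (h.load_inv.2.trans (by gcongr)) (h.factor_inv.2.trans (by gcongr))
    (fun v => (h.factor_lower v).trans (mul_le_mul_of_nonneg_right hk02 (by
      rw [dotProduct_self_eq_norm]; positivity)))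
    (fun B => c2 (frob_nonneg _) (c (frob_nonneg _) (hΛc B)))
    (c2 (by positivity) (c (by positivity) h.frob_load_le))
    (c2 (by positivity) (c (by positivity) h.factor_upper))
    (c2 (by positivity) (c (by positivity) h.err_op))
    (c2 (by positivity) (c (by positivity) h.err_load)) (c2 hD0 hXf) hDn hG
    (c2 (frob_nonneg _) (by rw [hK₁]; exact h.slope_le_annih δ))
    (by
      refine (h.score_annih_le δ).trans ?_
      have : K ^ 2 ≤ K₂ := hk2.trans hk12
      gcongr)
    (fun L' F' => hmin δ L' F')
    (fun L' F' => by
      have := hmin 0 L' F'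
      rwa [regComb_zero, sub_zero] at this)
  have h3 : D ^ 2 ≤ (K₃ * (θ * √T)) ^ 2 := by
    rw [mul_pow, mul_pow, Real.sq_sqrt hTp.le]
    refine hD2.trans (mul_le_mul_of_nonneg_right (le_self_pow₀ h1K₃ two_ne_zero) (by positivity))
  have h4 := (pow_le_pow_iff_left₀ hD0 (by positivity) two_ne_zero).1 h3
  refine h4.trans (mul_le_mul_of_nonneg_right (by linarith) (by positivity))

lemma RegularPanel.diag_ge {N T d r : ℕ} {K θ q : ℝ} {S : Matrix (Fin N) (Fin N) ℝ}
    {Λ : Matrix (Fin N) (Fin r) ℝ} {F₀ : Matrix (Fin T) (Fin r) ℝ} {u : Matrix (Fin N) (Fin T) ℝ}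
    {X : Fin d → Matrix (Fin N) (Fin T) ℝ} (h : RegularPanel K θ q S Λ F₀ u X) (i : Fin N) :
    K⁻¹ ≤ S i i ∧ S i i ≤ K := by
  have h1 := h.cov_lower (Pi.single i 1)
  have h2 := abs_dot_mulVec_le S (Pi.single i 1) (Pi.single i 1)
  simp at h1 h2
  exact ⟨h1, (le_abs_self _).trans (h2.trans h.cov_upper)⟩

/-- The residual second moments of the unweighted estimate. -/
theorem initial_resid (K : ℝ) (hK : 1 ≤ K) (r : ℕ) (hr : r ≤ K) : ∃ K' : ℝ, 1 ≤ K' ∧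
    ∀ {N T d : ℕ} {θ q : ℝ} {S : Matrix (Fin N) (Fin N) ℝ} {Λ : Matrix (Fin N) (Fin r) ℝ}
      {F₀ : Matrix (Fin T) (Fin r) ℝ} {u : Matrix (Fin N) (Fin T) ℝ}
      {X : Fin d → Matrix (Fin N) (Fin T) ℝ}, RegularPanel K θ q S Λ F₀ u X → K' * θ ≤ 1 →
    ∀ (δ : Fin d → ℝ) (L : Matrix (Fin N) (Fin r) ℝ) (F : Matrix (Fin T) (Fin r) ℝ),
      (T : ℝ)⁻¹ • (Fᵀ * F) = 1 →
      (∀ (v : Fin d → ℝ) (L' : Matrix (Fin N) (Fin r) ℝ) (F' : Matrix (Fin T) (Fin r) ℝ),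
        frob (Λ * F₀ᵀ + u - regComb X δ - L * Fᵀ) ^ 2 ≤
          frob (Λ * F₀ᵀ + u - regComb X v - L' * F'ᵀ) ^ 2) →
      ∃ H : Matrix (Fin N) (Fin N) ℝ, frob H ≤ K' * θ ∧ ∀ i j,
        |((T : ℝ)⁻¹ • ((Λ * F₀ᵀ + u - regComb X δ - L * Fᵀ) *
          (Λ * F₀ᵀ + u - regComb X δ - L * Fᵀ)ᵀ)) i j - S i j - H i j|
          ≤ 11 * √(S i i * S j j) * √(Real.log N / T) := by
  obtain ⟨K₅, h1K₅, hinit⟩ := initial_rate K hK r hr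
  set K₄ := K ^ 3 + K₅ with hK₄
  have hk3 : K ^ 3 ≤ K₄ := by linarith
  have hk5 : K₅ ≤ K₄ := by have : 0 ≤ K ^ 3 := by positivity
                           linarith
  have hk1 : K ≤ K₄ := (le_self_pow₀ hK (by norm_num)).trans hk3
  have hk2 : K ^ 2 ≤ K₄ := (pow_le_pow_right₀ hK (by norm_num)).trans hk3
  have h1K : 1 ≤ K₄ := hK.trans hk1
  clear_value K₄
  have hk8 : ∀ {m : ℕ}, m ≤ 8 → K₄ ^ m ≤ 150 * K₄ ^ 8 := fun {m} hm => by
    have h1 : K₄ ^ m ≤ K₄ ^ 8 := pow_le_pow_right₀ h1K hm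
    have : 0 ≤ K₄ ^ 8 := by positivity
    linarith
  have hk48 : K₄ ≤ 150 * K₄ ^ 8 := by simpa using hk8 (m := 1) (by norm_num)
  refine ⟨150 * K₄ ^ 8, by linarith, ?_⟩
  intro N T d θ q S Λ F₀ u X h hθ δ L F hF hmin
  have hθ0 := h.θ_pos
  obtain ⟨hG, hDθ⟩ := hinit h (by nlinarith) δ L F hF hmin
  have hθ1 : θ ≤ 1 := by nlinarith
  obtain ⟨hp1, hpn, hpτ, hθp, hn1, hτ1, hθτ⟩ := h.θ_sq_le hθ1
  have hTp : (0 : ℝ) < T := by linarith [h.one_le_T]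
  have hτ2 : √(T : ℝ) ^ 2 = T := Real.sq_sqrt hTp.le
  have hsq : √(Real.log N / T) = √(Real.log N) / √T := Real.sqrt_div' _ hTp.le
  rw [hsq]
  set p := √(Real.log N) with hp
  set τ := √(T : ℝ) with hτ
  set D := slopeSize N T δ with hD
  have hD0 : 0 ≤ D := slopeSize_nonneg δ
  obtain ⟨p1, p2, p3, p4⟩ := normalized_proj hF
  have hτ0 : 0 < τ := by linarith
  have hp0 : 0 < p := by linarith
  have hEF : (Λ * F₀ᵀ + u - regComb X δ - L * Fᵀ) * F = 0 := mul_eq_zero_of_min fun G => by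
    have h1 := hmin δ (L + G) F
    rwa [Matrix.add_mul, ← sub_sub] at h1
  -- By the first order condition the residual is orthogonal to F, so L can be eliminated in favour
  -- of the projection.
  have hE : Λ * F₀ᵀ + u - regComb X δ - L * Fᵀ =
      (Λ * F₀ᵀ + u - regComb X δ) * (1 - (T : ℝ)⁻¹ • (F * Fᵀ)) := by
    have h1 : (Λ * F₀ᵀ + u - regComb X δ - L * Fᵀ) * (1 - (T : ℝ)⁻¹ • (F * Fᵀ)) =
        Λ * F₀ᵀ + u - regComb X δ - L * Fᵀ := by
      rw [Matrix.mul_sub, Matrix.mul_one, Matrix.mul_smul, ← Matrix.mul_assoc, hEF, Matrix.zero_mul,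
        smul_zero, sub_zero]
    rw [← h1, Matrix.sub_mul _ (L * Fᵀ), Matrix.mul_assoc L, p4, Matrix.mul_zero, sub_zero]
  have hFf : frob F ≤ K₄ * τ := by
    refine (pow_le_pow_iff_left₀ (frob_nonneg _) (by positivity) two_ne_zero).1 ?_
    rw [normalized_frob_sq h.T_pos hF, mul_pow, hτ2]
    gcongr
    exact (h.r_le.trans hk1).trans (le_self_pow₀ h1K two_ne_zero)
  have hθinv : ∀ {x : ℝ}, x ≤ 150 * K₄ ^ 8 → x * θ ≤ 1 := fun hx =>
    (mul_le_mul_of_nonneg_right hx hθ0.le).trans hθ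
  obtain ⟨hRu, hRi⟩ := rotation_inv (K := K₄) h1K h.T_pos hF
    (fun v => (h.factor_lower v).trans (mul_le_mul_of_nonneg_right hk1 (by
      rw [dotProduct_self_eq_norm]; positivity))) (by
      calc 2 * K₄ * frob (F₀ᵀ * (1 - (T : ℝ)⁻¹ • (F * Fᵀ))) ^ 2 ≤ 2 * K₄ * K₄ ^ 2 := by
            gcongr
            · exact frob_nonneg _
            · exact hG.trans hk5
        _ = 2 * K₄ ^ 3 := by ring
        _ ≤ (150 * K₄ ^ 8) * (θ * τ) := by
            have h1 : K₄ ^ 3 ≤ K₄ ^ 8 := pow_le_pow_right₀ h1K (by norm_num)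
            have h2 : (150 * K₄ ^ 8) * 1 ≤ (150 * K₄ ^ 8) * (θ * τ) := by gcongr
            have : 0 ≤ K₄ ^ 8 := by positivity
            linarith
        _ = (150 * K₄ ^ 8 * θ) * τ := by ring
        _ ≤ 1 * τ := by gcongr
        _ ≤ τ ^ 2 := by nlinarith
        _ = T := hτ2)
  have c : ∀ {x y : ℝ}, 0 ≤ y → x ≤ K * y → x ≤ K₄ * y := fun hy hx =>
    hx.trans (mul_le_mul_of_nonneg_right hk1 hy)
  have hent := abs_resid_entry_le (u := u) (H := regComb X δ) (Λ := Λ) h1K hp1 hD0 hτ0 hτ2 hF hFf hRu hRi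
    (hG.trans hk5) (fun i => (h.load_upper i).trans hk1) (fun i => c hτ0.le (h.err_row i))
    (fun i => c (by positivity) (h.err_factor i))
    ((h.frob_reg_le δ).trans (mul_le_mul_of_nonneg_right hk2 hD0))
    (fun i j => (h.reg_err_le δ i j).trans (mul_le_mul_of_nonneg_right hk3 (by positivity)))
  rw [← hE] at hent
  set E := Λ * F₀ᵀ + u - regComb X δ - L * Fᵀ with hEd
  set M := 1 - (T : ℝ)⁻¹ • (F * Fᵀ) with hM
  have hMn : ‖M‖ ≤ 1 := op_le_one_of_proj p1 p2
  -- The contribution of the slope error. Its Frobenius norm is of order D²/T = O(θ²); this is where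
  -- the refined rate is needed.
  refine ⟨(T : ℝ)⁻¹ • ((regComb X δ * M) * (regComb X δ * M)ᵀ), ?_, fun i j => ?_⟩
  · rw [frob_smul, abs_of_pos (inv_pos.2 hTp), inv_mul_le_iff₀ hTp]
    have h1 : frob (regComb X δ * M) ≤ K₄ * (K₄ * (θ * τ)) := by
      refine (frob_contract_right hMn _).trans ((h.frob_reg_le δ).trans ?_)
      refine mul_le_mul hk2 (hDθ.trans ?_) hD0 (by positivity)
      gcongr
    refine (frob_mul_le _ _).trans ?_
    rw [frob_transpose]
    calc _ ≤ (K₄ * (K₄ * (θ * τ))) * (K₄ * (K₄ * (θ * τ))) :=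
          mul_le_mul h1 h1 (frob_nonneg _) (by positivity)
      _ = τ ^ 2 * (K₄ ^ 4 * θ * θ) := by ring
      _ ≤ τ ^ 2 * (150 * K₄ ^ 8 * θ * 1) := by
          gcongr
          exact hk8 (by norm_num)
      _ = _ := by rw [hτ2]; ring
  · have h1 := hent i j
    have h2 := h.err_cov i j
    rw [hsq] at h2
    -- In turn by p ≤ θτ, 1 ≤ θp and D = O(θτ). After division by T the remainder is at most
    -- σᵢσⱼp/τ, which raises the sampling error constant from 10 to 11.
    have hsum : p ^ 2 + τ + p * D ≤ 3 * K₄ * θ * (p * τ) := by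
      have a1 : p ^ 2 ≤ θ * (p * τ) := by
        calc p ^ 2 = p * p := pow_two p
          _ ≤ p * (θ * τ) := by gcongr
          _ = _ := by ring
      have a2 : τ ≤ θ * (p * τ) := by
        calc τ = 1 * τ := (one_mul τ).symm
          _ ≤ (θ * p) * τ := by gcongr
          _ = _ := by ring
      have a3 : p * D ≤ K₄ * (θ * (p * τ)) := by
        calc p * D ≤ p * (K₄ * (θ * τ)) := by
              gcongr; exact hDθ.trans (by gcongr)
          _ = _ := by ring
      have a4 : θ * (p * τ) ≤ K₄ * (θ * (p * τ)) := le_mul_of_one_le_left (by positivity) h1K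
      calc _ ≤ 3 * (K₄ * (θ * (p * τ))) := by linarith
        _ = _ := by ring
    have hσ : K₄⁻¹ ≤ √(S i i * S j j) := by
      refine Real.le_sqrt_of_sq_le ?_
      have hki : K₄⁻¹ ≤ K⁻¹ := inv_anti₀ (by linarith) hk1
      rw [pow_two]
      exact mul_le_mul (hki.trans (h.diag_ge i).1) (hki.trans (h.diag_ge j).1) (by positivity)
        ((by positivity : (0 : ℝ) ≤ K⁻¹).trans (h.diag_ge i).1)
    have h3 : |(T : ℝ)⁻¹ * (E * Eᵀ - u * uᵀ - (regComb X δ * M) * (regComb X δ * M)ᵀ :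
        Matrix (Fin N) (Fin N) ℝ) i j| ≤ √(S i i * S j j) * (p / τ) := by
      rw [abs_mul, abs_of_pos (inv_pos.2 hTp), inv_mul_le_iff₀ hTp]
      refine h1.trans ?_
      calc 50 * K₄ ^ 6 * (p ^ 2 + τ + p * D) ≤ 50 * K₄ ^ 6 * (3 * K₄ * θ * (p * τ)) := by gcongr
        _ = K₄⁻¹ * (150 * K₄ ^ 8 * θ) * (p * τ) := by field_simp; ring
        _ ≤ √(S i i * S j j) * 1 * (p * τ) := by gcongr
        _ = T * (√(S i i * S j j) * (p / τ)) := by rw [← hτ2]; field_simp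
    have e : ((T : ℝ)⁻¹ • (E * Eᵀ)) i j - S i j
        - ((T : ℝ)⁻¹ • ((regComb X δ * M) * (regComb X δ * M)ᵀ)) i j =
        (T : ℝ)⁻¹ * (E * Eᵀ - u * uᵀ - (regComb X δ * M) * (regComb X δ * M)ᵀ :
        Matrix (Fin N) (Fin N) ℝ) i j + ((T : ℝ)⁻¹ • (u * uᵀ) - S) i j := by
      simp only [Matrix.sub_apply, Matrix.smul_apply, smul_eq_mul]; ring
    rw [e]
    refine (abs_add_le _ _).trans ((add_le_add h3 h2).trans (le_of_eq (by ring)))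

/-- Consistency of the thresholded covariance matrix in operator norm. -/
theorem thresholdCov_consistent (K C : ℝ) (hK : 1 ≤ K) (hC : 44 ≤ C) (r : ℕ) (hr : r ≤ K) :
    ∃ K' : ℝ, 1 ≤ K' ∧
    ∀ {N T d : ℕ} {θ q : ℝ} {S : Matrix (Fin N) (Fin N) ℝ} {Λ : Matrix (Fin N) (Fin r) ℝ}
      {F₀ : Matrix (Fin T) (Fin r) ℝ} {u : Matrix (Fin N) (Fin T) ℝ}
      {X : Fin d → Matrix (Fin N) (Fin T) ℝ}, RegularPanel K θ q S Λ F₀ u X → K' * θ ≤ 1 →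
    ∀ (δ : Fin d → ℝ) (L : Matrix (Fin N) (Fin r) ℝ) (F : Matrix (Fin T) (Fin r) ℝ),
      (T : ℝ)⁻¹ • (Fᵀ * F) = 1 →
      (∀ (v : Fin d → ℝ) (L' : Matrix (Fin N) (Fin r) ℝ) (F' : Matrix (Fin T) (Fin r) ℝ),
        frob (Λ * F₀ᵀ + u - regComb X δ - L * Fᵀ) ^ 2 ≤
          frob (Λ * F₀ᵀ + u - regComb X v - L' * F'ᵀ) ^ 2) →
      ∀ s : ℝ → ℝ → ℝ, IsThresholding s →
      ‖thresholdCov T s C ((T : ℝ)⁻¹ • ((Λ * F₀ᵀ + u - regComb X δ - L * Fᵀ) *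
          (Λ * F₀ᵀ + u - regComb X δ - L * Fᵀ)ᵀ)) - S‖ ≤ K' * θ := by
  obtain ⟨K₁, h1K₁, hres⟩ := initial_resid K hK r hr
  set c := 3 * C * K ^ 2 + 11 * K + 7 + 11 * K ^ 2 with hc
  have hc1 : 1 ≤ c := by
    have : 0 ≤ C * K ^ 2 := by positivity
    nlinarith
  have hck : 1 ≤ c * (K₁ + 1) := by nlinarith
  have hkk : 1 ≤ 2 * K * (11 * K + K₁) := by nlinarith
  refine ⟨c * (K₁ + 1) + K₁ + 2 * K * (11 * K + K₁), by linarith, ?_⟩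
  intro N T d θ q S Λ F₀ u X h hθ δ L F hF hmin s hs
  have hθ0 := h.θ_pos
  have b1 : K₁ * θ ≤ 1 := by nlinarith
  have hθ1 : θ ≤ 1 := by nlinarith
  have b2 : 2 * K * (11 * K + K₁) * θ ≤ 1 := by
    have : 0 ≤ (c * (K₁ + 1) + K₁) * θ := by positivity
    linarith
  obtain ⟨H, hH, hent⟩ := hres h b1 δ L F hF hmin
  obtain ⟨hp1, -, -, -, hn1, -, -⟩ := h.θ_sq_le hθ1
  have hω0 : √(Real.log N / T) ≤ omegaRate N T := by
    rw [omegaRate]; linarith [show 0 ≤ 1 / √(N : ℝ) by positivity]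
  have hω : 0 < omegaRate N T := by
    rw [omegaRate]
    have : 0 < 1 / √(N : ℝ) := by positivity
    positivity
  have hsp := h.rate_sparse
  have := thresholdCov_op_le (H := H) hK hC hs h.q_nonneg h.q_le h.N_pos h.symm (fun i => (h.diag_ge i).1)
    (fun i => (h.diag_ge i).2) hω (by
      have h1 := h.rate_omega
      rw [← one_div, le_div_iff₀ (by positivity)]
      calc (11 * K * omegaRate N T + frob H) * (2 * K) ≤ (11 * K * θ + K₁ * θ) * (2 * K) := by gcongr
        _ ≤ 1 := by linarith)
    (fun i j => (hent i j).trans (by gcongr))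
  refine this.trans ?_
  calc c * (frob H + omegaRate N T ^ (1 - q) * sparsity q S) ≤ c * (K₁ * θ + θ) := by gcongr
    _ = c * (K₁ + 1) * θ := by ring
    _ ≤ _ := mul_le_mul_of_nonneg_right (by linarith) hθ0.le

end InitialStep


/-! ### The weighted estimate: convergence of the plug-in forms -/

section FinalStep

open scoped Matrix.Norms.L2Operator
open RegularPanel

/-- For a > 0 the linear term dominates for small t > 0. This gives first order conditions without
derivatives. -/
lemma nonpos_of_quadratic {a b : ℝ} (hb : 0 ≤ b) (h : ∀ t : ℝ, 2 * t * a ≤ t ^ 2 * b) : a ≤ 0 := by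
  by_contra ha
  push Not at ha
  have h1 := h (a / (b + 1))
  have h2 : 0 < b + 1 := by linarith
  have h3 : 2 * (a / (b + 1)) * a = 2 * a ^ 2 * (b + 1) / (b + 1) ^ 2 := by field_simp
  rw [div_pow, h3, div_mul_eq_mul_div, div_le_div_iff_of_pos_right (by positivity)] at h1
  nlinarith [mul_nonneg (sq_nonneg a) hb, pow_pos ha 2]

/-- First order condition for a weighted least squares fit. -/
lemma mul_eq_zero_of_weighted_min {N T r : ℕ} {W : Matrix (Fin N) (Fin N) ℝ} (hW : Wᵀ = W) {c : ℝ} (hc : 0 < c)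
    (hWc : ∀ v : Fin N → ℝ, c * (v ⬝ᵥ v) ≤ v ⬝ᵥ W *ᵥ v)
    {E : Matrix (Fin N) (Fin T) ℝ} {F : Matrix (Fin T) (Fin r) ℝ}
    (h : ∀ G : Matrix (Fin N) (Fin r) ℝ,
      frobInner E (W * E) ≤ frobInner (E - G * Fᵀ) (W * (E - G * Fᵀ))) : E * F = 0 := by
  have h1 := nonpos_of_quadratic (a := frobInner (E * F) (W * (E * F)))
    (b := frobInner (E * F * Fᵀ) (W * (E * F * Fᵀ)))
    (le_trans (mul_nonneg hc.le (sq_nonneg _)) (frobInner_coercive hWc _)) fun t => by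
      have h1 := h (t • (E * F))
      have e1 : frobInner (E * F * Fᵀ) (W * E) = frobInner (E * F) (W * (E * F)) := by
        rw [frobInner_mul_right, Matrix.transpose_transpose, Matrix.mul_assoc W]
      rw [Matrix.mul_sub, frobInner_sub_left, frobInner_sub_right, frobInner_sub_right,
        Matrix.smul_mul, Matrix.mul_smul, frobInner_smul_left, frobInner_smul_right, frobInner_smul_right,
        frobInner_weight_comm hW E (E * F * Fᵀ), frobInner_smul_left, e1] at h1
      linarith
  have h2 := frobInner_coercive hWc (E * F)
  refine frob_eq_zero (pow_eq_zero_iff two_ne_zero |>.1 ?_)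
  refine le_antisymm ?_ (sq_nonneg _)
  have h3 := h2.trans h1
  by_contra h4
  push Not at h4
  linarith [mul_pos hc h4]

/-- Rotated by F₀'F/T, the estimated factors are the projection of the true ones on their span, so
they miss F₀ only by F₀'M. -/
lemma factors_mul_rotation {T r : ℕ} (F₀ F : Matrix (Fin T) (Fin r) ℝ) :
    F * ((T : ℝ)⁻¹ • (F₀ᵀ * F))ᵀ = F₀ - (F₀ᵀ * (1 - (T : ℝ)⁻¹ • (F * Fᵀ)))ᵀ := by
  have hMt : (1 - (T : ℝ)⁻¹ • (F * Fᵀ))ᵀ = 1 - (T : ℝ)⁻¹ • (F * Fᵀ) := by simp [Matrix.transpose_mul]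
  rw [Matrix.transpose_mul, hMt, Matrix.transpose_transpose]
  simp [Matrix.sub_mul, Matrix.mul_assoc]

set_option maxHeartbeats 1000000 in
/-- The weighted estimate on a regular panel: the plug-in quadratic forms are close to those at the true
parameters. -/
theorem weighted_plugIn_close (K Kw : ℝ) (hK : 1 ≤ K) (hKw : 1 ≤ Kw) (r : ℕ) (hr : r ≤ K) :
    ∃ K' : ℝ, 1 ≤ K' ∧
    ∀ {N T d : ℕ} {θ q : ℝ} {S : Matrix (Fin N) (Fin N) ℝ} {Λ : Matrix (Fin N) (Fin r) ℝ}
      {F₀ : Matrix (Fin T) (Fin r) ℝ} {u : Matrix (Fin N) (Fin T) ℝ}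
      {X : Fin d → Matrix (Fin N) (Fin T) ℝ}, RegularPanel K θ q S Λ F₀ u X → K' * θ ≤ 1 →
    ∀ W : Matrix (Fin N) (Fin N) ℝ, Wᵀ = W → ‖W - S⁻¹‖ ≤ Kw * θ →
      (∀ v : Fin N → ℝ, Kw⁻¹ * (v ⬝ᵥ v) ≤ v ⬝ᵥ W *ᵥ v) →
    ∀ (δ : Fin d → ℝ) (L : Matrix (Fin N) (Fin r) ℝ) (F : Matrix (Fin T) (Fin r) ℝ),
      (T : ℝ)⁻¹ • (Fᵀ * F) = 1 →
      (∀ (v : Fin d → ℝ) (L' : Matrix (Fin N) (Fin r) ℝ) (F' : Matrix (Fin T) (Fin r) ℝ),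
        frobInner (Λ * F₀ᵀ + u - regComb X δ - L * Fᵀ) (W * (Λ * F₀ᵀ + u - regComb X δ - L * Fᵀ)) ≤
        frobInner (Λ * F₀ᵀ + u - regComb X v - L' * F'ᵀ) (W * (Λ * F₀ᵀ + u - regComb X v - L' * F'ᵀ))) →
      ∀ k l, |frobInner (X k) (wannih W L * X l * annih F) -
        frobInner (X k) (wannih S⁻¹ Λ * X l * annih F₀)| ≤ K' * θ * (N * T) := by
  set K₁ := 200 * K ^ 11 + 3 * Kw with hK₁
  have hk1' : ∀ {m : ℕ}, m ≤ 11 → K ^ m ≤ K₁ := fun hm => (pow_le_twohundred hK hm).trans (by linarith)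
  have hk1 : K ≤ K₁ := by simpa using hk1' (m := 1) (by norm_num)
  have hk2 : K ^ 2 ≤ K₁ := hk1' (by norm_num)
  have hk200 : 200 * K ^ 11 ≤ K₁ := by linarith
  have hkw : Kw ≤ K₁ := by
    have : 0 ≤ K ^ 11 := by positivity
    linarith
  have hk21 : 2 * K + 1 ≤ K₁ := by
    have : K ≤ K ^ 11 := le_self_pow₀ hK (by norm_num)
    linarith
  have h1K : 1 ≤ K₁ := hK.trans hk1
  clear_value K₁
  obtain ⟨Kc, hKc, hcrude⟩ := crude_rate K₁ r
  set K₂ := Kc * (1 + K ^ 2 + Kw * K ^ 3) with hK₂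
  have hK₂0 : 0 < K₂ := by positivity
  set K₃ := Kw + 2 * K ^ 2 * (K + K ^ 2 * K₂) with hK₃
  have hK₃0 : 0 < K₃ := by positivity
  set K₄ := K₃ + 200 * (8 * K ^ 4) ^ 9 * K₃ with hK₄
  have hK₄0 : 0 < K₄ := by positivity
  set K₅ := K ^ 2 * (K₄ + 40000 * K ^ 20 * (200 * K ^ 9 * K₂)) with hK₅
  have hK₅0 : 0 < K₅ := by positivity
  have x1 : 0 ≤ 2 * K * K₂ ^ 2 := by positivity
  have x2 : 0 ≤ 20 * K ^ 3 * K₂ := by positivity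
  have x3 : 0 ≤ 20 * (8 * K ^ 4) ^ 3 * K₃ := by positivity
  refine ⟨K₅ + Kw + 2 * K * K₂ ^ 2 + 20 * K ^ 3 * K₂ + 20 * (8 * K ^ 4) ^ 3 * K₃, by linarith, ?_⟩
  intro N T d θ q S Λ F₀ u X h hθ W hW hWS hWc δ L F hF hmin
  have hθ0 := h.θ_pos
  have b : ∀ {x : ℝ}, x ≤ K₅ + Kw + 2 * K * K₂ ^ 2 + 20 * K ^ 3 * K₂ + 20 * (8 * K ^ 4) ^ 3 * K₃ →
      x * θ ≤ 1 := fun hx => (mul_le_mul_of_nonneg_right hx hθ0.le).trans hθ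
  have b1 : Kw * θ ≤ 1 := b (by linarith)
  have b2 : 2 * K * K₂ ^ 2 * θ ≤ 1 := b (by linarith)
  have b3 : 20 * K ^ 3 * K₂ * θ ≤ 1 := b (by linarith)
  have b4 : 20 * (8 * K ^ 4) ^ 3 * K₃ * θ ≤ 1 := b (by linarith)
  have hfin : K₅ * θ * (N * T) ≤
      (K₅ + Kw + 2 * K * K₂ ^ 2 + 20 * K ^ 3 * K₂ + 20 * (8 * K ^ 4) ^ 3 * K₃) * θ * (N * T) := by
    gcongr; linarith
  clear hθ b
  have hθ1 : θ ≤ 1 := (le_mul_of_one_le_left hθ0.le hKw).trans b1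
  obtain ⟨hp1, hpn, hpτ, hθp, hn1, hτ1, hθτ⟩ := h.θ_sq_le hθ1
  have hNp : (0 : ℝ) < N := by linarith [h.one_le_N]
  have hTp : (0 : ℝ) < T := by linarith [h.one_le_T]
  obtain ⟨p1, p2, p3, p4⟩ := normalized_proj hF
  have hFf : frob F ≤ K * √T := by
    refine (pow_le_pow_iff_left₀ (frob_nonneg _) (by positivity) two_ne_zero).1 ?_
    rw [normalized_frob_sq h.T_pos hF, mul_pow, Real.sq_sqrt hTp.le]
    gcongr
    exact hr.trans (le_self_pow₀ hK two_ne_zero)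
  have hXf := h.frob_reg_le δ
  have hscore := h.score_weighted_le δ
  have hslope : slopeSize N T δ ≤
      K₁ * frob ((Λ * F₀ᵀ - regComb X δ) * (1 - (T : ℝ)⁻¹ • (F * Fᵀ))) :=
    (h.slope_le_resid hF δ F₀).trans (mul_le_mul_of_nonneg_right hk200 (frob_nonneg _))
  have hD0 : 0 ≤ slopeSize N T δ := slopeSize_nonneg δ
  have hΛc : ∀ B : Matrix (Fin r) (Fin T) ℝ, √N * frob B ≤ K * frob (Λ * B) :=
    frob_le_of_tall hK (Nat.cast_nonneg N) h.load_lower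
  have hΛf := h.frob_load_le
  have hu := h.err_op
  have hn2 : √(N : ℝ) ^ 2 = N := Real.sq_sqrt hNp.le
  have hτ2 : √(T : ℝ) ^ 2 = T := Real.sq_sqrt hTp.le
  have huf : frob u ≤ K * √N * √T := by
    have h1 := frob_mul_le_op u (1 : Matrix (Fin T) (Fin T) ℝ)
    rw [Matrix.mul_one, frob_one_eq, Fintype.card_fin] at h1
    exact h1.trans (mul_le_mul_of_nonneg_right hu (by positivity))
  have hF₀f := h.factor_upper
  set p := √(Real.log N) with hp
  set n := √(N : ℝ) with hn
  set τ := √(T : ℝ) with hτ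
  set D := slopeSize N T δ with hD
  have hn0 : 0 < n := by linarith
  have hτ0 : 0 < τ := by linarith
  have hWn : ‖W‖ ≤ K₁ := by
    have h1 : ‖W‖ ≤ ‖W - S⁻¹‖ + ‖S⁻¹‖ := by simpa using norm_add_le (W - S⁻¹) S⁻¹
    linarith [h.weight.2.1]
  have c : ∀ {x y : ℝ}, 0 ≤ y → x ≤ K * y → x ≤ K₁ * y := fun hy hx =>
    hx.trans (mul_le_mul_of_nonneg_right hk1 hy)
  have hle_u := hmin 0 Λ F₀
  rw [regComb_zero, sub_zero, add_sub_cancel_left] at hle_u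
  -- The estimated weight depends on u, so the tail bound covers only the score with Σ_u⁻¹. The
  -- difference of the weights is bounded in operator norm, at the cost of θ√(NT); this still gives
  -- a slope error of order θ.
  have hη : |frobInner (regComb X δ) (W * u)| ≤ (K ^ 2 + Kw * K ^ 3) * (θ * (n * τ)) * D := by
    have e : W * u = S⁻¹ * u + (W - S⁻¹) * u := by rw [Matrix.sub_mul]; abel
    rw [e, frobInner_add_right]
    have h1 : |frobInner (regComb X δ) ((W - S⁻¹) * u)| ≤ Kw * K ^ 3 * (θ * (n * τ)) * D := by
      refine (frobInner_weight_le _ _ _).trans ?_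
      calc _ ≤ (Kw * θ) * (K ^ 2 * D) * (K * n * τ) := by
            refine mul_le_mul (mul_le_mul hWS hXf (frob_nonneg _) (by positivity)) huf (frob_nonneg _) ?_
            positivity
        _ = _ := by ring
    have h2 : K ^ 2 * p * D ≤ K ^ 2 * (θ * (n * τ)) * D := by
      gcongr
      calc p ≤ θ * τ := hpτ
        _ ≤ θ * (n * τ) := by gcongr; exact le_mul_of_one_le_left hτ0.le hn1
    refine (abs_add_le _ _).trans ?_
    calc _ ≤ K ^ 2 * (θ * (n * τ)) * D + Kw * K ^ 3 * (θ * (n * τ)) * D :=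
          add_le_add (hscore.trans h2) h1
      _ = _ := by ring
  obtain ⟨hD1, hG1⟩ := hcrude h.N_pos h.T_pos W Λ L F₀ F u X δ D ((K ^ 2 + Kw * K ^ 3) * (θ * (n * τ))) hD0
    (by positivity) h1K hW (fun v => le_trans (mul_le_mul_of_nonneg_right
      (inv_anti₀ (by linarith) hkw) (by rw [dotProduct_self_eq_norm]; positivity)) (hWc v)) hWn hF
    (fun B => c (frob_nonneg _) (hΛc B)) (c (by positivity) hΛf)
    (c (by positivity) hu) (hXf.trans (mul_le_mul_of_nonneg_right hk2 hD0)) hslope hη hle_u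
  have hbd : Kc * (n + (K ^ 2 + Kw * K ^ 3) * (θ * (n * τ))) ≤ K₂ * θ * τ * n := by
    have : n ≤ θ * (n * τ) := by
      calc n = 1 * n := (one_mul n).symm
        _ ≤ (θ * τ) * n := by gcongr
        _ = _ := by ring
    calc _ ≤ Kc * (θ * (n * τ) + (K ^ 2 + Kw * K ^ 3) * (θ * (n * τ))) := by gcongr
      _ = _ := by rw [hK₂]; ring
  have hDn : D ≤ K₂ * θ * τ * n := hD1.trans hbd
  have hG : frob (F₀ᵀ * (1 - (T : ℝ)⁻¹ • (F * Fᵀ))) ≤ K₂ * θ * τ := by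
    have h2 := hG1.trans hbd
    rw [mul_comm _ n] at h2
    exact le_of_mul_le_mul_left h2 hn0
  obtain ⟨hRu, hRi⟩ := rotation_inv hK h.T_pos hF h.factor_lower (by
      calc 2 * K * frob (F₀ᵀ * (1 - (T : ℝ)⁻¹ • (F * Fᵀ))) ^ 2 ≤ 2 * K * (K₂ * θ * τ) ^ 2 := by
            gcongr
            exact frob_nonneg _
        _ = (2 * K * K₂ ^ 2 * θ) * θ * τ ^ 2 := by ring
        _ ≤ 1 * 1 * τ ^ 2 := by gcongr
        _ = T := by rw [hτ2]; ring)
  have hEF := mul_eq_zero_of_weighted_min hW (inv_pos.2 (by linarith : 0 < Kw)) hWc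
    (E := Λ * F₀ᵀ + u - regComb X δ - L * Fᵀ) (F := F) fun G => by
      have := hmin δ (L + G) F
      rwa [Matrix.add_mul, ← sub_sub] at this
  have hFrot := factors_mul_rotation F₀ F
  set R := (T : ℝ)⁻¹ • (F₀ᵀ * F) with hR
  set G := F₀ᵀ * (1 - (T : ℝ)⁻¹ • (F * Fᵀ)) with hGd
  -- The first order condition in the loadings, solved for their rotated version.
  have hL : L * R⁻¹ = Λ + (T : ℝ)⁻¹ • ((u - regComb X δ) * F * R⁻¹) := by
    have hFF : Fᵀ * F = (T : ℝ) • (1 : Matrix (Fin r) (Fin r) ℝ) := by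
      rw [← hF, smul_smul, mul_inv_cancel₀ hTp.ne', one_smul]
    have h1 : L = Λ * R + (T : ℝ)⁻¹ • ((u - regComb X δ) * F) := by
      rw [Matrix.sub_mul, Matrix.mul_assoc L, hFF, Matrix.mul_smul, Matrix.mul_one, sub_eq_zero] at hEF
      rw [hR, Matrix.mul_smul, ← Matrix.mul_assoc, ← smul_add, ← Matrix.add_mul, ← add_sub_assoc, hEF,
        smul_smul, inv_mul_cancel₀ hTp.ne', one_smul]
    conv_lhs => rw [h1]
    rw [Matrix.add_mul, Matrix.mul_assoc Λ, Matrix.mul_nonsing_inv _ hRu, Matrix.mul_one, Matrix.smul_mul]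
  have hLd : ‖n⁻¹ • (L * R⁻¹) - n⁻¹ • Λ‖ ≤ K₃ * θ := by
    rw [← smul_sub, hL, add_sub_cancel_left, norm_smul, norm_smul, Real.norm_of_nonneg (by positivity),
      Real.norm_of_nonneg (by positivity), inv_mul_le_iff₀ hn0, inv_mul_le_iff₀ hTp]
    have h1 : ‖u - regComb X δ‖ ≤ K * n + K ^ 2 * (K₂ * θ * τ * n) := by
      refine (norm_sub_le _ _).trans (add_le_add hu ?_)
      refine (op_le_frob _).trans (hXf.trans ?_)
      gcongr
    refine (op_mul_le (op_mul_le h1 ((op_le_frob F).trans hFf)) hRi).trans ?_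
    have h2 : K * n ≤ K * (θ * τ * n) := by
      gcongr
      calc n = 1 * n := (one_mul n).symm
        _ ≤ _ := by gcongr
    calc _ ≤ (K * (θ * τ * n) + K ^ 2 * (K₂ * θ * τ * n)) * (K * τ) * (2 * K) := by gcongr
      _ = τ ^ 2 * (n * (2 * K ^ 2 * (K + K ^ 2 * K₂) * θ)) := by ring
      _ ≤ T * (n * (K₃ * θ)) := by
          rw [hτ2]; gcongr; linarith
  -- Replace L by LR⁻¹/√N, which has the same span and is within O(θ) of Λ/√N, and perturb.
  have hQ : ‖wannih W L - wannih S⁻¹ Λ‖ ≤ K₄ * θ := by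
    have hRi' : IsUnit (R⁻¹).det := Matrix.isUnit_nonsing_inv_det _ hRu
    have h1 := wproj_perturb (K := 8 * K ^ 4) (ε := K₃ * θ) (W := S⁻¹) (W' := W)
      (by have := one_le_pow₀ hK (n := 4); linarith) (by positivity)
      (by have : K ≤ K ^ 4 := le_self_pow₀ hK (by norm_num)
          linarith [h.weight.2.1]) h.scaled_load.1 h.scaled_load.2
      (B' := n⁻¹ • (L * R⁻¹)) (hWS.trans (mul_le_mul_of_nonneg_right (by rw [hK₃]; linarith [show 0 ≤ 2 * K ^ 2 * (K + K ^ 2 * K₂) by positivity]) hθ0.le)) hLd (by linarith)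
    rw [h.wannih_scaled, wproj_smul _ _ (inv_ne_zero hn0.ne'), wproj_mul_right _ _ hRi'] at h1
    have e : wannih W L - wannih S⁻¹ Λ = (W - S⁻¹) - (wproj W L - wproj S⁻¹ Λ) := by
      rw [wannih, wannih]; abel
    rw [e]
    have h2 : Kw * θ ≤ K₃ * θ := mul_le_mul_of_nonneg_right (by rw [hK₃]; linarith [show 0 ≤ 2 * K ^ 2 * (K + K ^ 2 * K₂) by positivity]) hθ0.le
    calc _ ≤ K₃ * θ + 200 * (8 * K ^ 4) ^ 9 * (K₃ * θ) :=
          (norm_sub_le _ _).trans (add_le_add (hWS.trans h2) h1)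
      _ = _ := by rw [hK₄]; ring
  -- The case of unit weight, with FR'/√T close to F₀/√T.
  have hM : ‖annih F - annih F₀‖ ≤ 200 * K ^ 9 * K₂ * θ := by
    have hRt : IsUnit Rᵀ.det := by rwa [Matrix.det_transpose]
    have h1 := wproj_perturb (K := K) (ε := K₂ * θ) (W := (1 : Matrix (Fin T) (Fin T) ℝ)) (W' := 1)
      (B := τ⁻¹ • F₀) (B' := τ⁻¹ • (F * Rᵀ)) hK (by positivity)
      ((op_le_one_of_proj (by simp) (by simp)).trans hK) (by
        rw [norm_smul, Real.norm_of_nonneg (by positivity), inv_mul_le_iff₀ hτ0, mul_comm]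
        exact (op_le_frob _).trans hF₀f)
      (fun v => by
        rw [gram_dot_weight, Matrix.one_mulVec, Matrix.smul_mulVec, smul_dotProduct, dotProduct_smul,
          smul_eq_mul, smul_eq_mul, ← mul_assoc, ← mul_inv, Real.mul_self_sqrt hTp.le,
          inv_mul_le_iff₀ (by linarith), mul_left_comm, le_inv_mul_iff₀ hTp]
        exact h.factor_lower v)
      (by rw [sub_self, norm_zero]; positivity)
      (by
        rw [← smul_sub, hFrot, sub_sub_cancel_left, norm_smul, norm_neg, op_transpose,
          Real.norm_of_nonneg (by positivity), inv_mul_le_iff₀ hτ0]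
        refine (op_le_frob _).trans (hG.trans (le_of_eq (by ring))))
      (by linarith)
    rw [wproj_smul _ _ (inv_ne_zero hτ0.ne'), wproj_smul _ _ (inv_ne_zero hτ0.ne'),
      wproj_mul_right _ _ hRt] at h1
    rw [← wproj_one, ← wproj_one, sub_sub_sub_cancel_left, norm_sub_rev]
    exact h1.trans (le_of_eq (by ring))
  intro k l
  refine le_trans ?_ hfin
  rw [← frobInner_sub_right]
  have e : wannih W L * X l * annih F - wannih S⁻¹ Λ * X l * annih F₀ =
      (wannih W L - wannih S⁻¹ Λ) * X l * annih F + wannih S⁻¹ Λ * X l * (annih F - annih F₀) := by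
    rw [Matrix.sub_mul, Matrix.sub_mul, Matrix.mul_sub]; abel
  rw [e]
  have hMn : ‖annih F‖ ≤ 1 := by rw [annih_of_normalized h.T_pos hF]; exact op_le_one_of_proj p1 p2
  have hX := h.reg_upper
  have g1 : frob ((wannih W L - wannih S⁻¹ Λ) * X l * annih F) ≤ (K₄ * θ) * (K * (n * τ)) := by
    refine (frob_contract_right hMn _).trans ((frob_mul_le_op _ _).trans ?_)
    exact mul_le_mul hQ (hX l) (frob_nonneg _) (by positivity)
  have g2 : frob (wannih S⁻¹ Λ * X l * (annih F - annih F₀)) ≤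
      (40000 * K ^ 20 * (K * (n * τ))) * (200 * K ^ 9 * K₂ * θ) := by
    refine (frob_mul_le_op' _ _).trans (mul_le_mul ?_ hM (norm_nonneg _) (by positivity))
    exact (frob_mul_le_op _ _).trans (mul_le_mul h.wannih_op_le (hX l) (frob_nonneg _) (by positivity))
  refine (abs_frobInner_le _ _).trans ?_
  calc _ ≤ (K * (n * τ)) * ((K₄ * θ) * (K * (n * τ)) +
        (40000 * K ^ 20 * (K * (n * τ))) * (200 * K ^ 9 * K₂ * θ)) :=
        mul_le_mul (hX k) ((frob_add_le _ _).trans (add_le_add g1 g2)) (frob_nonneg _) (by positivity)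
    _ = K₅ * θ * (n ^ 2 * τ ^ 2) := by rw [hK₅]; ring
    _ = _ := by rw [hn2, hτ2]

end FinalStep


/-! ### From feasible estimates to Γ̃ on one regular realization -/

section PlugIn

open scoped Matrix.Norms.L2Operator
open RegularPanel

lemma annih_transpose {n k : Type*} [Fintype n] [Fintype k] [DecidableEq n] [DecidableEq k]
    (L : Matrix n k ℝ) : (annih L)ᵀ = annih L := by
  simp [annih, Matrix.transpose_mul, Matrix.transpose_nonsing_inv, Matrix.mul_assoc]

/-- The vectorization identity. It translates quadratic forms in the stacked design into Frobenius
products of N×T matrices. -/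
lemma kronecker_mulVec_apply {N T : ℕ} (A : Matrix (Fin N) (Fin N) ℝ) (M : Matrix (Fin T) (Fin T) ℝ)
    (B : Matrix (Fin N) (Fin T) ℝ) :
    (A ⊗ₖ M) *ᵥ (fun p : Fin N × Fin T => B p.1 p.2) = fun p => (A * B * Mᵀ) p.1 p.2 := by
  ext ⟨i, t⟩
  simp only [Matrix.mulVec, dotProduct, Fintype.sum_prod_type, Matrix.kroneckerMap_apply, Matrix.mul_apply,
    Matrix.transpose_apply, Finset.sum_mul]
  rw [Finset.sum_comm]
  exact Finset.sum_congr rfl fun _ _ => Finset.sum_congr rfl fun _ _ => by ring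

lemma kronecker_quad {N T : ℕ} (A : Matrix (Fin N) (Fin N) ℝ) (M : Matrix (Fin T) (Fin T) ℝ)
    (B C : Matrix (Fin N) (Fin T) ℝ) :
    (fun p : Fin N × Fin T => C p.1 p.2) ⬝ᵥ (A ⊗ₖ M) *ᵥ (fun p : Fin N × Fin T => B p.1 p.2) =
      frobInner C (A * B * Mᵀ) := by
  rw [kronecker_mulVec_apply, frobInner_eq_sum]
  simp [dotProduct, Fintype.sum_prod_type]

namespace PanelModel

variable {d r : ℕ} (m : PanelModel d r)

/-- The `N × T` matrix of the errors. -/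
def uMat (ω : m.Ω) : Matrix (Fin m.N) (Fin m.T) ℝ := stackY fun t => m.u t ω

lemma stackY_Y (ω : m.Ω) :
    stackY (m.Y ω) = regComb (stackX (m.Xs ω)) m.β + m.Λ * (m.F₀ ω)ᵀ + m.uMat ω := by
  ext i t
  simp only [stackY, Y, uMat, F₀, Matrix.of_apply, Matrix.add_apply, regComb_apply, Pi.add_apply,
    Matrix.mulVec, dotProduct, Matrix.mul_apply, Matrix.transpose_apply, stackX]
  congr 2
  exact Finset.sum_congr rfl fun _ _ => mul_comm _ _

lemma resid_eq (ω : m.Ω) (b : Fin d → ℝ) (L : Matrix (Fin m.N) (Fin r) ℝ) (F : Matrix (Fin m.T) (Fin r) ℝ) :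
    stackY (m.Y ω) - regComb (stackX (m.Xs ω)) b - L * Fᵀ =
      m.Λ * (m.F₀ ω)ᵀ + m.uMat ω - regComb (stackX (m.Xs ω)) (b - m.β) - L * Fᵀ := by
  rw [stackY_Y, regComb_sub]; abel

lemma quad_apply (ω : m.Ω) (W : Matrix (Fin m.N) (Fin m.N) ℝ) (L : Matrix (Fin m.N) (Fin r) ℝ)
    (F : Matrix (Fin m.T) (Fin r) ℝ) (k l : Fin d) :
    ((m.Z ω)ᵀ * projKron W L F * m.Z ω) k l =
      frobInner (stackX (m.Xs ω) k) (wannih W L * stackX (m.Xs ω) l * annih F) := by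
  have h := kronecker_quad (wannih W L) (annih F) (stackX (m.Xs ω) l) (stackX (m.Xs ω) k)
  rw [annih_transpose] at h
  rw [← h, Matrix.mul_assoc]
  rfl

lemma quad_dot (ω : m.Ω) (W : Matrix (Fin m.N) (Fin m.N) ℝ) (L : Matrix (Fin m.N) (Fin r) ℝ)
    (F : Matrix (Fin m.T) (Fin r) ℝ) (v : Fin d → ℝ) :
    v ⬝ᵥ ((m.Z ω)ᵀ * projKron W L F * m.Z ω) *ᵥ v =
      frobInner (regComb (stackX (m.Xs ω)) v) (wannih W L * regComb (stackX (m.Xs ω)) v * annih F) := by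
  have h := kronecker_quad (wannih W L) (annih F) (regComb (stackX (m.Xs ω)) v) (regComb (stackX (m.Xs ω)) v)
  rw [annih_transpose] at h
  rw [← h]
  have e : (fun p : Fin m.N × Fin m.T => regComb (stackX (m.Xs ω)) v p.1 p.2) = m.Z ω *ᵥ v := by
    ext ⟨i, t⟩
    simp only [regComb_apply, Z, Matrix.mulVec, dotProduct, Matrix.of_apply]
    exact Finset.sum_congr rfl fun _ _ => mul_comm _ _
  rw [e, gram_dot_weight]
  rfl

end PanelModel

/-- Minimality in terms of the slope error: the competing slope is shifted by β, and the
normalization is free by `IsWPC.le_of_any`. -/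
lemma IsWPC.resid_min {d r : ℕ} {m : PanelModel d r} {ω : m.Ω} {W : Matrix (Fin m.N) (Fin m.N) ℝ} (hW : Wᵀ = W)
    (hT : 0 < m.T) (hrT : r ≤ m.T) {b : Fin d → ℝ} {L : Matrix (Fin m.N) (Fin r) ℝ}
    {F : Matrix (Fin m.T) (Fin r) ℝ} (h : IsWPC W (m.Y ω) (m.Xs ω) b L F) (v : Fin d → ℝ)
    (L' : Matrix (Fin m.N) (Fin r) ℝ) (F' : Matrix (Fin m.T) (Fin r) ℝ) :
    frobInner (m.Λ * (m.F₀ ω)ᵀ + m.uMat ω - regComb (stackX (m.Xs ω)) (b - m.β) - L * Fᵀ)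
      (W * (m.Λ * (m.F₀ ω)ᵀ + m.uMat ω - regComb (stackX (m.Xs ω)) (b - m.β) - L * Fᵀ)) ≤
    frobInner (m.Λ * (m.F₀ ω)ᵀ + m.uMat ω - regComb (stackX (m.Xs ω)) v - L' * F'ᵀ)
      (W * (m.Λ * (m.F₀ ω)ᵀ + m.uMat ω - regComb (stackX (m.Xs ω)) v - L' * F'ᵀ)) := by
  have h1 := h.le_of_any hT hrT hW (v + m.β) L' F'
  rwa [m.resid_eq, m.resid_eq, add_sub_cancel_right] at h1

/-- On a regular realization, the plug-in estimate is close to `V(F₀)`. -/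
theorem plugIn_close (K C : ℝ) (hK : 1 ≤ K) (hC : 44 ≤ C) (r : ℕ) (hr : r ≤ K) :
    ∃ K' : ℝ, 1 ≤ K' ∧ ∀ {d : ℕ} (m : PanelModel d r) (ω : m.Ω) {θ q : ℝ},
      RegularPanel K θ q m.Sigma m.Λ (m.F₀ ω) (m.uMat ω) (stackX (m.Xs ω)) → K' * θ ≤ 1 →
      ∀ (s : ℝ → ℝ → ℝ), IsThresholding s → ∀ (β₀ : m.Ω → Fin d → ℝ)
        (R : m.Ω → Matrix (Fin m.N) (Fin m.N) ℝ) (β' : m.Ω → Fin d → ℝ)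
        (L : m.Ω → Matrix (Fin m.N) (Fin r) ℝ) (F : m.Ω → Matrix (Fin m.T) (Fin r) ℝ),
        m.IsFeasibleWPC s C β₀ R β' L F → ∀ k l,
        |m.plugIn ω (thresholdCov m.T s C (R ω))⁻¹ (L ω) (F ω) k l - m.V ω (m.F₀ ω) k l| ≤ K' * θ := by
  obtain ⟨K₁, h1K₁, hcov⟩ := thresholdCov_consistent K C hK hC r hr
  set Kw := 2 * K ^ 2 * K₁ + 8 * K ^ 3 with hKw
  have hk2 : 0 ≤ 2 * K ^ 2 * K₁ := by positivity
  have hk3 : 1 ≤ K ^ 3 := one_le_pow₀ hK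
  obtain ⟨K₂, h1K₂, hfin⟩ := weighted_plugIn_close K Kw hK (by linarith) r hr
  have hkk : 0 ≤ 2 * K * K₁ := by positivity
  refine ⟨K₁ + K₂ + 2 * K * K₁, by linarith, ?_⟩
  intro d m ω θ q h hθ s hs β₀ R β' L F hm k l
  have hθ0 := h.θ_pos
  have b1 : K₁ * θ ≤ 1 := by nlinarith
  have b2 : K₂ * θ ≤ 1 := by nlinarith
  have b3 : 2 * K * (K₁ * θ) ≤ 1 := by nlinarith
  have hNp : (0 : ℝ) < m.N := by linarith [h.one_le_N]
  have hTp : (0 : ℝ) < m.T := by linarith [h.one_le_T]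
  -- Identification is what makes the criterion coercive in the slope. Minimizers therefore exist
  -- for both weights, and the estimates are not arbitrary here.
  have hreg : ∀ F : Matrix (Fin m.T) (Fin r) ℝ, (m.T : ℝ)⁻¹ • (Fᵀ * F) = 1 → ∀ v : Fin d → ℝ,
      (m.N * m.T / (200 * K ^ 11) ^ 2) * (v ⬝ᵥ v) ≤
        frob (regComb (stackX (m.Xs ω)) v * (1 - (m.T : ℝ)⁻¹ • (F * Fᵀ))) ^ 2 := by
    intro F hF v
    have h1 := h.slope_le_resid hF v 0
    rw [Matrix.transpose_zero, Matrix.mul_zero, zero_sub, Matrix.neg_mul, frob_neg] at h1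
    have h2 := pow_le_pow_left₀ (slopeSize_nonneg v) h1 2
    rw [slopeSize_sq, mul_pow] at h2
    rw [div_mul_eq_mul_div, div_le_iff₀ (by positivity)]
    linarith
  have hcpos : (0 : ℝ) < m.N * m.T / (200 * K ^ 11) ^ 2 := by positivity
  have hex1 := exists_isWPC h.T_pos h.r_le_T (W := (1 : Matrix (Fin m.N) (Fin m.N) ℝ)) (by simp)
    (a := 1) one_pos hcpos (fun v => by rw [Matrix.one_mulVec, one_mul]) (m.Y ω) (m.Xs ω) hreg
  -- R comes with no loadings and factors attached, so a minimizer with the same slope and residual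
  -- covariance R is produced.
  obtain ⟨L₁, F₁, hw1, hR⟩ := (hm.resid ω).exists_isWPC h.r_lt h.T_pos h.r_le_T (hm.initial ω hex1)
  rw [m.resid_eq] at hR
  have hS := hcov h b1 (β₀ ω - m.β) L₁ F₁ hw1.1.1 (fun v L' F' => by
    have := hw1.resid_min (by simp) h.T_pos h.r_le_T v L' F'
    rwa [Matrix.one_mul, Matrix.one_mul, ← frob_sq, ← frob_sq] at this) s hs
  rw [← hR] at hS
  have hRt : (R ω)ᵀ = R ω := by
    rw [hR, Matrix.transpose_smul, Matrix.transpose_mul, Matrix.transpose_transpose]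
  have hSt : (thresholdCov m.T s C (R ω))ᵀ = thresholdCov m.T s C (R ω) := thresholdCov_transpose hRt
  obtain ⟨i1, i2, i3, i4⟩ := inv_perturb hK h.cov_lower h.cov_upper hS b3
  set W := (thresholdCov m.T s C (R ω))⁻¹ with hW
  have hWt : Wᵀ = W := by rw [hW, Matrix.transpose_nonsing_inv, hSt]
  have hwpc := hm.final ω (exists_isWPC h.T_pos h.r_le_T hWt (by positivity) hcpos i4 (m.Y ω) (m.Xs ω) hreg)
  have hclose := hfin h b2 W hWt (i3.trans (by rw [← mul_assoc]; gcongr; linarith)) (fun v =>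
    le_trans (mul_le_mul_of_nonneg_right (inv_anti₀ (by linarith) (by linarith))
      (by rw [dotProduct_self_eq_norm]; positivity)) (i4 v))
    (β' ω - m.β) (L ω) (F ω) hwpc.1.1 (fun v L' F' => hwpc.resid_min hWt h.T_pos h.r_le_T v L' F') k l
  rw [PanelModel.plugIn, PanelModel.V, Matrix.smul_apply, Matrix.smul_apply, smul_eq_mul, smul_eq_mul,
    ← mul_sub, m.quad_apply, m.quad_apply, abs_mul, abs_of_pos (by positivity),
    inv_mul_le_iff₀ (by positivity), mul_comm]
  refine hclose.trans ?_
  gcongr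
  linarith

end PlugIn


/-! ### Tails of linear forms in Gaussian errors -/

section GaussianTails

namespace PanelModel

variable {d r : ℕ} {m : PanelModel d r}

/-- The linear forms of Gaussian errors. -/
lemma map_dot_eq_gaussianReal (hS : m.Sigma.PosSemidef) {t : ℕ}
    (hg : Measure.map (fun ω => WithLp.toLp 2 (m.u t ω)) m.P = multivariateGaussian 0 m.Sigma)
    (w : Fin m.N → ℝ) :
    Measure.map (fun ω => w ⬝ᵥ m.u t ω) m.P = gaussianReal 0 (w ⬝ᵥ m.Sigma *ᵥ w).toNNReal := by
  set x : EuclideanSpace ℝ (Fin m.N) := WithLp.toLp 2 w with hx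
  have hu : Measurable fun ω => WithLp.toLp 2 (m.u t ω) := by
    have := m.measurable_u t
    fun_prop
  have e : (fun ω => w ⬝ᵥ m.u t ω) = (innerSL ℝ x) ∘ fun ω => WithLp.toLp 2 (m.u t ω) := by
    ext ω
    simp [hx, PiLp.inner_apply, dotProduct, mul_comm]
  have h0 : ∫ y, (innerSL ℝ x) y ∂(multivariateGaussian 0 m.Sigma) = 0 := by
    have := ContinuousLinearMap.integral_comp_id_comm (μ := multivariateGaussian 0 m.Sigma) 
      IsGaussian.integrable_id (innerSL ℝ x)
    rw [this, integral_id_multivariateGaussian, map_zero]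
  rw [e, ← Measure.map_map (by fun_prop) hu, hg, IsGaussian.map_eq_gaussianReal, h0]
  congr 2
  have h1 := covarianceBilin_multivariateGaussian (μ := 0) hS x x
  rw [covarianceBilin_apply_eq_cov IsGaussian.memLp_two_id, covariance_self] at h1
  · exact h1
  · exact Measurable.aemeasurable (by fun_prop)

lemma measurable_dot (t : ℕ) (w : Fin m.N → ℝ) : Measurable fun ω => w ⬝ᵥ m.u t ω := by
  have h : ∀ i, Measurable fun ω => m.u t ω i := fun i => (measurable_pi_apply i).comp (m.measurable_u t)
  simp only [dotProduct]
  exact Finset.measurable_sum _ fun i _ => (h i).const_mul _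

lemma hasSubgaussianMGF_dot (hS : m.Sigma.PosSemidef) {t : ℕ}
    (hg : Measure.map (fun ω => WithLp.toLp 2 (m.u t ω)) m.P = multivariateGaussian 0 m.Sigma)
    (w : Fin m.N → ℝ) {c : NNReal} (hc : w ⬝ᵥ m.Sigma *ᵥ w ≤ c) :
    HasSubgaussianMGF (fun ω => w ⬝ᵥ m.u t ω) c m.P := by
  have h := map_dot_eq_gaussianReal hS hg w
  refine ⟨fun s => ?_, fun s => ?_⟩
  · have h1 : Integrable (fun x => Real.exp (s * x)) (Measure.map (fun ω => w ⬝ᵥ m.u t ω) m.P) := by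
      rw [h]; exact integrable_exp_mul_gaussianReal s
    exact h1.comp_measurable (measurable_dot t w)
  · rw [mgf_gaussianReal h, zero_mul, zero_add, Real.exp_le_exp]
    have : ((w ⬝ᵥ m.Sigma *ᵥ w).toNNReal : ℝ) ≤ c := by
      rw [NNReal.coe_le_coe, Real.toNNReal_le_iff_le_coe]; exact hc
    gcongr

lemma frobInner_uMat (w : Matrix (Fin m.N) (Fin m.T) ℝ) (ω : m.Ω) :
    frobInner w (m.uMat ω) = ∑ t : Fin m.T, (fun i => w i t) ⬝ᵥ m.u t ω := by
  rw [frobInner_eq_sum, Finset.sum_comm]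
  rfl

lemma serial_u (hi : iIndepFun (fun (t : ℕ) ω => (m.u t ω, m.f t ω, m.X t ω)) m.P) :
    iIndepFun (fun t : ℕ => m.u t) m.P :=
  hi.comp (fun _ z => z.1) fun _ => measurable_fst

/-- The form is a sum over periods of independent Gaussians, whose variances add up to at most c
times the squared Frobenius norm of the coefficients. -/
lemma hasSubgaussianMGF_frobInner (hS : m.Sigma.PosSemidef)
    (hg : ∀ t, Measure.map (fun ω => WithLp.toLp 2 (m.u t ω)) m.P = multivariateGaussian 0 m.Sigma)
    (hi : iIndepFun (fun t : ℕ => m.u t) m.P) {c : ℝ} (hc0 : 0 ≤ c)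
    (hc : ∀ v : Fin m.N → ℝ, v ⬝ᵥ m.Sigma *ᵥ v ≤ c * (v ⬝ᵥ v)) (w : Matrix (Fin m.N) (Fin m.T) ℝ) :
    HasSubgaussianMGF (fun ω => frobInner w (m.uMat ω)) (c * frob w ^ 2).toNNReal m.P := by
  have h1 : iIndepFun (fun (t : Fin m.T) ω => (fun i => w i t) ⬝ᵥ m.u t ω) m.P :=
    (hi.precomp (g := fun t : Fin m.T => (t : ℕ)) Fin.val_injective).comp
      (fun t z => (fun i => w i t) ⬝ᵥ z) fun t => by
        simp only [dotProduct]; fun_prop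
  have hn : ∀ t : Fin m.T, 0 ≤ c * ((fun i => w i t) ⬝ᵥ fun i => w i t) := fun t => by
    rw [dotProduct_self_eq_norm]; positivity
  have h2 := HasSubgaussianMGF.sum_of_iIndepFun h1 (s := Finset.univ)
    (c := fun t => (c * ((fun i => w i t) ⬝ᵥ fun i => w i t)).toNNReal) fun t _ =>
      hasSubgaussianMGF_dot hS (hg t) _ (by
        rw [Real.coe_toNNReal _ (hn t)]
        exact hc _)
  have e : (c * frob w ^ 2).toNNReal = ∑ t : Fin m.T, (c * ((fun i => w i t) ⬝ᵥ fun i => w i t)).toNNReal := by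
    rw [← Real.toNNReal_sum_of_nonneg fun t _ => hn t, ← Finset.mul_sum, frob_sq_eq_sum_cols]
  rw [e]
  refine h2.congr (ae_of_all _ fun ω => ?_)
  exact (frobInner_uMat w ω).symm

/-- The tail bound for linear forms in the errors. -/
lemma tail_frobInner (hS : m.Sigma.PosSemidef)
    (hg : ∀ t, Measure.map (fun ω => WithLp.toLp 2 (m.u t ω)) m.P = multivariateGaussian 0 m.Sigma)
    (hi : iIndepFun (fun t : ℕ => m.u t) m.P) {c : ℝ} (hc0 : 0 < c)
    (hc : ∀ v : Fin m.N → ℝ, v ⬝ᵥ m.Sigma *ᵥ v ≤ c * (v ⬝ᵥ v)) (w : Matrix (Fin m.N) (Fin m.T) ℝ)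
    {x : ℝ} (hx : 0 ≤ x) :
    m.P {ω | x * frob w < |frobInner w (m.uMat ω)|} ≤ ENNReal.ofReal (2 * Real.exp (-x ^ 2 / (2 * c))) := by
  -- For vanishing coefficients the strict inequality makes the event empty, whatever x is.
  rcases (frob_nonneg w).eq_or_lt with h0 | h0
  · have : w = 0 := frob_eq_zero h0.symm
    have e : {ω | x * frob w < |frobInner w (m.uMat ω)|} = ∅ := by
      ext ω; simp [this, frobInner]
    rw [e, measure_empty]; positivity
  · have h := hasSubgaussianMGF_frobInner hS hg hi hc0.le hc w
    have h1 := h.measure_ge_le (ε := x * frob w) (by positivity)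
    have h2 := h.neg.measure_ge_le (ε := x * frob w) (by positivity)
    have e : -(x * frob w) ^ 2 / (2 * ((c * frob w ^ 2).toNNReal : ℝ)) = -x ^ 2 / (2 * c) := by
      rw [Real.coe_toNNReal _ (by positivity)]; field_simp
    rw [e] at h1 h2
    have hsub : {ω | x * frob w < |frobInner w (m.uMat ω)|} ⊆
        {ω | x * frob w ≤ frobInner w (m.uMat ω)} ∪ {ω | x * frob w ≤ (-fun ω => frobInner w (m.uMat ω)) ω} := by
      intro ω hω
      rcases lt_abs.1 (show x * frob w < |frobInner w (m.uMat ω)| from hω) with h | h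
      · exact Or.inl h.le
      · exact Or.inr h.le
    calc _ ≤ _ := measure_mono hsub
      _ ≤ _ := measure_union_le _ _
      _ = ENNReal.ofReal (m.P.real {ω | x * frob w ≤ frobInner w (m.uMat ω)}) +
          ENNReal.ofReal (m.P.real {ω | x * frob w ≤ (-fun ω => frobInner w (m.uMat ω)) ω}) := by
        rw [ofReal_measureReal, ofReal_measureReal]
      _ = ENNReal.ofReal (m.P.real {ω | x * frob w ≤ frobInner w (m.uMat ω)} +
          m.P.real {ω | x * frob w ≤ (-fun ω => frobInner w (m.uMat ω)) ω}) := by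
        rw [ENNReal.ofReal_add measureReal_nonneg measureReal_nonneg]
      _ ≤ _ := ENNReal.ofReal_le_ofReal (by linarith)

/-- The factors and regressors of all periods. -/
def fx (m : PanelModel d r) (ω : m.Ω) (t : ℕ) : (Fin r → ℝ) × (Fin m.N → Fin d → ℝ) := (m.f t ω, m.X t ω)

/-- The tail bound for linear forms in the errors whose coefficients depend on the factors and the
regressors. -/
lemma tail_frobInner_random (hS : m.Sigma.PosSemidef)
    (hg : ∀ t, Measure.map (fun ω => WithLp.toLp 2 (m.u t ω)) m.P = multivariateGaussian 0 m.Sigma)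
    (hi : iIndepFun (fun t : ℕ => m.u t) m.P) (hind : IndepFun (fun ω (t : ℕ) => m.u t ω) m.fx m.P)
    {c : ℝ} (hc0 : 0 < c)
    (hc : ∀ v : Fin m.N → ℝ, v ⬝ᵥ m.Sigma *ᵥ v ≤ c * (v ⬝ᵥ v))
    {w : (ℕ → (Fin r → ℝ) × (Fin m.N → Fin d → ℝ)) → Matrix (Fin m.N) (Fin m.T) ℝ}
    (hw : ∀ i t, Measurable fun z => w z i t) {x : ℝ} (hx : 0 ≤ x) :
    m.P {ω | x * frob (w (m.fx ω)) < |frobInner (w (m.fx ω)) (m.uMat ω)|} ≤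
      ENNReal.ofReal (2 * Real.exp (-x ^ 2 / (2 * c))) := by
  have hmu : Measurable fun ω (t : ℕ) => m.u t ω := measurable_pi_lambda _ m.measurable_u
  have hmv : Measurable m.fx := measurable_pi_lambda _ fun t => (m.measurable_f t).prodMk (m.measurable_X t)
  set U : (ℕ → Fin m.N → ℝ) → Matrix (Fin m.N) (Fin m.T) ℝ := fun y => Matrix.of fun i t => y t i with hU
  set A : Set ((ℕ → Fin m.N → ℝ) × (ℕ → (Fin r → ℝ) × (Fin m.N → Fin d → ℝ))) :=
    {p | x * frob (w p.2) < |frobInner (w p.2) (U p.1)|} with hA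
  have hAm : MeasurableSet A := by
    have h1 : ∀ i t, Measurable fun p : (ℕ → Fin m.N → ℝ) × (ℕ → (Fin r → ℝ) × (Fin m.N → Fin d → ℝ)) =>
        w p.2 i t := fun i t => (hw i t).comp measurable_snd
    have h2 : ∀ i t, Measurable fun p : (ℕ → Fin m.N → ℝ) × (ℕ → (Fin r → ℝ) × (Fin m.N → Fin d → ℝ)) =>
        U p.1 i t := fun i t => by
      simp only [hU, Matrix.of_apply]
      exact (measurable_pi_apply i).comp ((measurable_pi_apply (t : ℕ)).comp measurable_fst)
    refine measurableSet_lt ?_ ?_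
    · simp only [frob, frobInner_eq_sum]
      exact (Finset.measurable_sum _ fun i _ => Finset.measurable_sum _ fun t _ =>
        (h1 i t).mul (h1 i t)).sqrt.const_mul x
    · simp only [frobInner_eq_sum]
      exact (Finset.measurable_sum _ fun i _ => Finset.measurable_sum _ fun t _ =>
        (h1 i t).mul (h2 i t)).abs
  -- By independence the joint law is a product, so factors and regressors can be frozen by Fubini,
  -- and the bound for fixed coefficients is uniform in them.
  have h1 := (indepFun_iff_map_prod_eq_prod_map_map hmu.aemeasurable hmv.aemeasurable).1 hind
  have h2 : m.P {ω | x * frob (w (m.fx ω)) < |frobInner (w (m.fx ω)) (m.uMat ω)|} =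
      Measure.map (fun ω => ((fun t : ℕ => m.u t ω), m.fx ω)) m.P A := by
    rw [Measure.map_apply (hmu.prodMk hmv) hAm]
    rfl
  have hpu : IsProbabilityMeasure (Measure.map (fun ω (t : ℕ) => m.u t ω) m.P) :=
    Measure.isProbabilityMeasure_map hmu.aemeasurable
  have hpv : IsProbabilityMeasure (Measure.map m.fx m.P) := Measure.isProbabilityMeasure_map hmv.aemeasurable
  rw [h2, h1, Measure.prod_apply_symm hAm]
  calc _ ≤ ∫⁻ _, ENNReal.ofReal (2 * Real.exp (-x ^ 2 / (2 * c))) ∂(Measure.map m.fx m.P) := by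
        refine lintegral_mono fun z => ?_
        rw [Measure.map_apply hmu (measurable_prodMk_right hAm)]
        exact tail_frobInner hS hg hi hc0 hc (w z) hx
    _ = _ := by rw [lintegral_const, measure_univ, mul_one]

end PanelModel

end GaussianTails


/-! ### Operator norm of the error matrix -/

section OperatorNormTail

open scoped Matrix.Norms.L2Operator

/-- The unit ball of `ℝⁿ` has a `1/2`-net of at most `5ⁿ` points. -/
lemma exists_half_net (n : ℕ) : ∃ s : Finset (EuclideanSpace ℝ (Fin n)), s.card ≤ 5 ^ n ∧
    (∀ c ∈ s, ‖c‖ ≤ 1) ∧ ∀ x : EuclideanSpace ℝ (Fin n), ‖x‖ ≤ 1 → ∃ c ∈ s, ‖x - c‖ ≤ 1 / 2 := by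
  classical
  -- A largest 1-separated set in the ball of radius 2 has at most 5ⁿ points. By maximality every
  -- point of that ball is within distance 1 of it; halving everything gives the net.
  set p : ℕ → Prop := fun k => ∃ s : Finset (EuclideanSpace ℝ (Fin n)), s.card = k ∧
    (∀ c ∈ s, ‖c‖ ≤ 2) ∧ ∀ c ∈ s, ∀ d ∈ s, c ≠ d → 1 ≤ ‖c - d‖ with hp
  have hb : ∀ k, p k → k ≤ 5 ^ n := by
    rintro k ⟨s, rfl, h1, h2⟩
    simpa using Besicovitch.card_le_of_separated s h1 h2
  have h0 : p 0 := ⟨∅, by simp⟩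
  obtain ⟨s, hs, h1, h2⟩ := Nat.findGreatest_spec (P := p) (Nat.zero_le (5 ^ n)) h0
  refine ⟨s.image fun c => (1 / 2 : ℝ) • c, ?_, ?_, ?_⟩
  · exact Finset.card_image_le.trans (hs.trans_le (Nat.findGreatest_le _))
  · intro c hc
    obtain ⟨c, hcs, rfl⟩ := Finset.mem_image.1 hc
    have := h1 c hcs
    rw [norm_smul]; norm_num; linarith
  · intro x hx
    by_contra! hcon
    have hfar : ∀ c ∈ s, 1 < ‖(2 : ℝ) • x - c‖ := by
      intro c hc
      have h := hcon _ (Finset.mem_image_of_mem _ hc)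
      have e : (2 : ℝ) • x - c = (2 : ℝ) • (x - (1 / 2 : ℝ) • c) := by
        rw [smul_sub, smul_smul]; norm_num
      rw [e, norm_smul]; norm_num; linarith
    have hx2 : (2 : ℝ) • x ∉ s := fun h => by
      have := hfar _ h
      simp at this; linarith
    have hP : p (s.card + 1) := by
      refine ⟨insert ((2 : ℝ) • x) s, Finset.card_insert_of_notMem hx2, ?_, ?_⟩
      · intro c hc
        rcases Finset.mem_insert.1 hc with rfl | hc
        · rw [norm_smul]; norm_num; linarith
        · exact h1 c hc
      · intro c hc e he hce
        rcases Finset.mem_insert.1 hc with rfl | hc <;> rcases Finset.mem_insert.1 he with rfl | he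
        · exact absurd rfl hce
        · exact (hfar e he).le
        · rw [norm_sub_rev]; exact (hfar c hc).le
        · exact h2 c hc e he hce
    have := Nat.le_findGreatest (P := p) (hb _ hP) hP
    omega

/-- Approximate z/‖z‖ by a net point c: then ‖z‖ ≤ ⟨c, z⟩ + ‖z‖/2. -/
lemma norm_le_of_net {n : ℕ} {s : Finset (EuclideanSpace ℝ (Fin n))}
    (hs : ∀ x : EuclideanSpace ℝ (Fin n), ‖x‖ ≤ 1 → ∃ c ∈ s, ‖x - c‖ ≤ 1 / 2) {z : EuclideanSpace ℝ (Fin n)}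
    {B : ℝ} (h : ∀ c ∈ s, inner ℝ c z ≤ B) : ‖z‖ ≤ 2 * B := by
  rcases eq_or_ne z 0 with rfl | hz
  · obtain ⟨c, hc, -⟩ := hs 0 (by simp)
    have := h c hc
    simp at this ⊢; linarith
  · have hz' : 0 < ‖z‖ := norm_pos_iff.2 hz
    obtain ⟨c, hc, h1⟩ := hs (‖z‖⁻¹ • z) (by rw [norm_smul, norm_inv, norm_norm, inv_mul_cancel₀ hz'.ne'])
    have h2 : inner ℝ (‖z‖⁻¹ • z) z = ‖z‖ := by
      rw [real_inner_smul_left, real_inner_self_eq_norm_sq]; field_simp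
    have h3 := real_inner_le_norm (‖z‖⁻¹ • z - c) z
    rw [inner_sub_left, h2] at h3
    nlinarith [h c hc]

/-- Each of the two nets costs a factor 2. -/
lemma op_le_of_nets {n k : ℕ} {s : Finset (EuclideanSpace ℝ (Fin n))} {s' : Finset (EuclideanSpace ℝ (Fin k))}
    (hs : ∀ x : EuclideanSpace ℝ (Fin n), ‖x‖ ≤ 1 → ∃ c ∈ s, ‖x - c‖ ≤ 1 / 2)
    (hs' : ∀ x : EuclideanSpace ℝ (Fin k), ‖x‖ ≤ 1 → ∃ c ∈ s', ‖x - c‖ ≤ 1 / 2)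
    {A : Matrix (Fin n) (Fin k) ℝ} {B : ℝ} (hB : 0 ≤ B)
    (h : ∀ c ∈ s, ∀ c' ∈ s', |frobInner (Matrix.vecMulVec c.ofLp c'.ofLp) A| ≤ B) : ‖A‖ ≤ 4 * B := by
  have e : ∀ (x : Fin n → ℝ) (y : Fin k → ℝ), frobInner (Matrix.vecMulVec x y) A = x ⬝ᵥ A *ᵥ y := by
    intro x y
    simp only [frobInner_eq_sum, Matrix.vecMulVec_apply, dotProduct, Matrix.mulVec, Finset.mul_sum]
    exact Finset.sum_congr rfl fun _ _ => Finset.sum_congr rfl fun _ _ => by ring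
  have h1 : ∀ c ∈ s, ‖(WithLp.toLp 2 (Aᵀ *ᵥ c.ofLp) : EuclideanSpace ℝ (Fin k))‖ ≤ 2 * B := by
    intro c hc
    refine norm_le_of_net hs' fun c' hc' => ?_
    have := (le_abs_self _).trans (h c hc c' hc')
    rw [e, Matrix.dotProduct_mulVec, ← Matrix.mulVec_transpose] at this
    simpa [PiLp.inner_apply, dotProduct] using this
  rw [Matrix.l2_opNorm_def]
  refine ContinuousLinearMap.opNorm_le_bound _ (by positivity) fun x => ?_
  rcases eq_or_ne x 0 with rfl | hx
  · simp
  have h2 : ‖(WithLp.toLp 2 (A *ᵥ x.ofLp) : EuclideanSpace ℝ (Fin n))‖ ≤ 2 * (2 * B * ‖x‖) := by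
    refine norm_le_of_net hs fun c hc => ?_
    have := real_inner_le_norm (WithLp.toLp 2 (Aᵀ *ᵥ c.ofLp) : EuclideanSpace ℝ (Fin k)) x
    have e2 : inner ℝ (WithLp.toLp 2 (Aᵀ *ᵥ c.ofLp) : EuclideanSpace ℝ (Fin k)) x =
        inner ℝ c (WithLp.toLp 2 (A *ᵥ x.ofLp) : EuclideanSpace ℝ (Fin n)) := by
      have : (Aᵀ *ᵥ c.ofLp) ⬝ᵥ x.ofLp = c.ofLp ⬝ᵥ A *ᵥ x.ofLp := by
        rw [Matrix.dotProduct_mulVec, ← Matrix.mulVec_transpose]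
      simpa [PiLp.inner_apply, dotProduct, mul_comm] using this
    rw [← e2]
    exact this.trans (mul_le_mul_of_nonneg_right (h1 c hc) (norm_nonneg _))
  calc _ = ‖(WithLp.toLp 2 (A *ᵥ x.ofLp) : EuclideanSpace ℝ (Fin n))‖ := rfl
    _ ≤ _ := h2
    _ = _ := by ring

namespace PanelModel

variable {d r : ℕ} {m : PanelModel d r}

/-- Union bound over pairs of net points; each pair gives a linear form with coefficients cc'ᵀ of
Frobenius norm at most one. -/
lemma tail_opNorm (hS : m.Sigma.PosSemidef)
    (hg : ∀ t, Measure.map (fun ω => WithLp.toLp 2 (m.u t ω)) m.P = multivariateGaussian 0 m.Sigma)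
    (hi : iIndepFun (fun t : ℕ => m.u t) m.P) {c : ℝ} (hc0 : 0 < c)
    (hc : ∀ v : Fin m.N → ℝ, v ⬝ᵥ m.Sigma *ᵥ v ≤ c * (v ⬝ᵥ v)) {x : ℝ} (hx : 0 ≤ x) :
    m.P {ω | ¬ ‖m.uMat ω‖ ≤ 4 * x} ≤
      (5 ^ m.N * 5 ^ m.T : ℕ) * ENNReal.ofReal (2 * Real.exp (-x ^ 2 / (2 * c))) := by
  obtain ⟨s, hs1, hs2, hs3⟩ := exists_half_net m.N
  obtain ⟨s', hs1', hs2', hs3'⟩ := exists_half_net m.T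
  have hsub : {ω | ¬ ‖m.uMat ω‖ ≤ 4 * x} ⊆ ⋃ p ∈ s ×ˢ s', {ω | x * frob (Matrix.vecMulVec p.1.ofLp p.2.ofLp) <
      |frobInner (Matrix.vecMulVec p.1.ofLp p.2.ofLp) (m.uMat ω)|} := by
    intro ω hω
    by_contra hcon
    refine hω (op_le_of_nets hs3 hs3' hx fun c hc c' hc' => ?_)
    simp only [Set.mem_iUnion, not_exists, Set.mem_ofPred_eq, not_lt] at hcon
    refine (hcon (c, c') (Finset.mem_product.2 ⟨hc, hc'⟩)).trans ?_
    have : frob (Matrix.vecMulVec c.ofLp c'.ofLp) ≤ 1 := by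
      rw [frob, Real.sqrt_le_one, frobInner_eq_sum]
      have : ∑ i, ∑ j, Matrix.vecMulVec c.ofLp c'.ofLp i j * Matrix.vecMulVec c.ofLp c'.ofLp i j =
          ‖c‖ ^ 2 * ‖c'‖ ^ 2 := by
        rw [EuclideanSpace.norm_sq_eq, EuclideanSpace.norm_sq_eq, Finset.sum_mul_sum]
        simp only [Matrix.vecMulVec_apply, Real.norm_eq_abs, sq_abs]
        exact Finset.sum_congr rfl fun _ _ => Finset.sum_congr rfl fun _ _ => by ring
      rw [this, ← mul_pow]
      exact pow_le_one₀ (by positivity) (mul_le_one₀ (hs2 c hc) (norm_nonneg _) (hs2' c' hc'))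
    nlinarith
  calc _ ≤ _ := measure_mono hsub
    _ ≤ _ := measure_biUnion_finset_le _ _
    _ ≤ ∑ p ∈ s ×ˢ s', ENNReal.ofReal (2 * Real.exp (-x ^ 2 / (2 * c))) :=
        Finset.sum_le_sum fun p _ => tail_frobInner hS hg hi hc0 hc _ hx
    _ ≤ _ := by
        rw [Finset.sum_const, nsmul_eq_mul, Finset.card_product]
        gcongr

end PanelModel

end OperatorNormTail

/-! ### Chi-square tails and the sample covariance of the errors -/

section ChiSquareTail

lemma exp_sub_sq_le {y : ℝ} (hy : |y| ≤ 1 / 2) : Real.exp (-y - y ^ 2) ≤ 1 - y := by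
  obtain ⟨h1, h2⟩ := abs_le.1 hy
  have e : -y - y ^ 2 = -(y + y ^ 2) := by ring
  rw [e, Real.exp_neg, inv_le_comm₀ (Real.exp_pos _) (by linarith), inv_le_iff_one_le_mul₀ (by linarith)]
  rcases le_total 0 y with h0 | h0
  · have h := Real.quadratic_le_exp_of_nonneg (x := y + y ^ 2) (by positivity)
    have : 1 ≤ (1 + (y + y ^ 2) + (y + y ^ 2) ^ 2 / 2) * (1 - y) := by
      have h3 : 0 ≤ 1 - y - y ^ 2 - y ^ 3 := by nlinarith [mul_nonneg h0 h0, mul_nonneg (mul_nonneg h0 h0) h0]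
      have : (1 + (y + y ^ 2) + (y + y ^ 2) ^ 2 / 2) * (1 - y) = 1 + y ^ 2 / 2 * (1 - y - y ^ 2 - y ^ 3) := by
        ring
      rw [this]
      have := mul_nonneg (by positivity : 0 ≤ y ^ 2 / 2) h3
      linarith
    nlinarith
  · have h := Real.add_one_le_exp (y + y ^ 2)
    have : 0 ≤ -y * y ^ 2 := mul_nonneg (by linarith) (sq_nonneg y)
    nlinarith

/-- The exact value (1 − 2κ)^{-1/2} is estimated by `exp_sub_sq_le` at 2κ, which allows both signs
of κ and thus serves both tails. -/
lemma integrable_exp_mul_sq_gaussianReal {κ : ℝ} (hκ : |κ| ≤ 1 / 4) :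
    Integrable (fun x => Real.exp (κ * x ^ 2)) (gaussianReal 0 1) ∧
      ∫ x, Real.exp (κ * x ^ 2) ∂(gaussianReal 0 1) ≤ Real.exp (κ + 2 * κ ^ 2) := by
  obtain ⟨h1, h2⟩ := abs_le.1 hκ
  have hpos : 0 < 1 / 2 - κ := by linarith
  have e : ∀ x, gaussianPDFReal 0 1 x • Real.exp (κ * x ^ 2) =
      (√(2 * Real.pi))⁻¹ * Real.exp (-(1 / 2 - κ) * x ^ 2) := by
    intro x
    simp only [gaussianPDFReal, NNReal.coe_one, mul_one, sub_zero, smul_eq_mul]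
    rw [mul_assoc, ← Real.exp_add]
    congr 2
    ring
  refine ⟨?_, ?_⟩
  · rw [gaussianReal_of_var_ne_zero _ one_ne_zero, integrable_withDensity_iff_integrable_smul' (measurable_gaussianPDF _ _)
      (ae_of_all _ fun _ => gaussianPDF_lt_top)]
    simp only [toReal_gaussianPDF, e]
    exact (integrable_exp_neg_mul_sq hpos).const_mul _
  · rw [integral_gaussianReal_eq_integral_smul one_ne_zero]
    simp only [e]
    rw [integral_const_mul, integral_gaussian, ← Real.sqrt_inv, ← Real.sqrt_mul (by positivity)]
    have h3 := exp_sub_sq_le (y := 2 * κ) (by rw [abs_mul]; norm_num; linarith)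
    refine Real.sqrt_le_iff.2 ⟨(Real.exp_pos _).le, ?_⟩
    have e2 : (2 * Real.pi)⁻¹ * (Real.pi / (1 / 2 - κ)) = (1 - 2 * κ)⁻¹ := by
      have := Real.pi_pos
      have h5 : 1 - 2 * κ ≠ 0 := by linarith
      field_simp
    rw [e2, ← Real.exp_nat_mul]
    have e3 : ((2 : ℕ) : ℝ) * (κ + 2 * κ ^ 2) = -(-(2 * κ) - (2 * κ) ^ 2) := by push_cast; ring
    rw [e3, Real.exp_neg]
    exact inv_anti₀ (Real.exp_pos _) h3

lemma integrable_exp_mul_sq_gaussianReal_var (v : NNReal) {κ : ℝ} (hκ : |κ * v| ≤ 1 / 4) :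
    Integrable (fun x => Real.exp (κ * (x ^ 2 - v))) (gaussianReal 0 v) ∧
      ∫ x, Real.exp (κ * (x ^ 2 - v)) ∂(gaussianReal 0 v) ≤ Real.exp (2 * (κ * v) ^ 2) := by
  have hmap : gaussianReal 0 v = Measure.map (fun x => √(v : ℝ) * x) (gaussianReal 0 1) := by
    rw [gaussianReal_map_const_mul, mul_zero]
    congr 1
    ext
    simp [Real.sq_sqrt]
  have e : ∀ x : ℝ, Real.exp (κ * ((√(v : ℝ) * x) ^ 2 - v)) = Real.exp (-(κ * v)) * Real.exp (κ * v * x ^ 2) := by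
    intro x
    rw [mul_pow, Real.sq_sqrt v.coe_nonneg, ← Real.exp_add]
    congr 1; ring
  obtain ⟨h1, h2⟩ := integrable_exp_mul_sq_gaussianReal hκ
  rw [hmap]
  refine ⟨?_, ?_⟩
  · rw [integrable_map_measure (Measurable.aestronglyMeasurable (by fun_prop)) (by fun_prop)]
    simp only [Function.comp_def, e]
    exact h1.const_mul _
  · rw [integral_map (by fun_prop) (Measurable.aestronglyMeasurable (by fun_prop))]
    simp only [e]
    rw [integral_const_mul]
    calc _ ≤ Real.exp (-(κ * v)) * Real.exp (κ * v + 2 * (κ * v) ^ 2) := by gcongr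
      _ = _ := by rw [← Real.exp_add]; congr 1; ring

namespace PanelModel

variable {d r : ℕ} {m : PanelModel d r}

/-- The tail bound for sample variances of linear forms in the errors. -/
lemma tail_sum_sq (hS : m.Sigma.PosSemidef)
    (hg : ∀ t, Measure.map (fun ω => WithLp.toLp 2 (m.u t ω)) m.P = multivariateGaussian 0 m.Sigma)
    (hi : iIndepFun (fun t : ℕ => m.u t) m.P) (a : Fin m.N → ℝ) (ha : a ⬝ᵥ m.Sigma *ᵥ a ≤ 4) {l : ℝ}
    (hl0 : 0 ≤ l) (hl : l ≤ 1 / 4) :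
    m.P {ω | 20 * l * m.T < |∑ t : Fin m.T, ((a ⬝ᵥ m.u t ω) ^ 2 - a ⬝ᵥ m.Sigma *ᵥ a)|} ≤
      ENNReal.ofReal (2 * Real.exp (-(3 * (m.T * l ^ 2)))) := by
  have hv0 : 0 ≤ a ⬝ᵥ m.Sigma *ᵥ a := by simpa using hS.dotProduct_mulVec_nonneg a
  set v : NNReal := (a ⬝ᵥ m.Sigma *ᵥ a).toNNReal with hv
  have hvv : (v : ℝ) = a ⬝ᵥ m.Sigma *ᵥ a := Real.coe_toNNReal _ hv0
  rw [← hvv] at ha ⊢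
  set X : Fin m.T → m.Ω → ℝ := fun t ω => (a ⬝ᵥ m.u t ω) ^ 2 - v with hX
  have hXm : ∀ t, Measurable (X t) := fun t => ((measurable_dot t a).pow_const 2).sub_const _
  have hXi : iIndepFun X m.P :=
    (hi.precomp (g := fun t : Fin m.T => (t : ℕ)) Fin.val_injective).comp
      (fun t z => (a ⬝ᵥ z) ^ 2 - v) fun t => by
        simp only [dotProduct]; fun_prop
  have hv4 : 0 ≤ (v : ℝ) := v.coe_nonneg
  have key : ∀ κ : ℝ, |κ| ≤ l / 4 → (∀ t, Integrable (fun ω => Real.exp (κ * X t ω)) m.P) ∧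
      ∀ t, mgf (X t) m.P κ ≤ Real.exp (2 * l ^ 2) := by
    intro κ hκ
    have hkv : |κ * v| ≤ l := by
      rw [abs_mul, NNReal.abs_eq]; nlinarith [abs_nonneg κ]
    obtain ⟨h1, h2⟩ := integrable_exp_mul_sq_gaussianReal_var v (hkv.trans hl)
    refine ⟨fun t => ?_, fun t => ?_⟩
    · rw [← map_dot_eq_gaussianReal hS (hg t) a] at h1
      exact h1.comp_measurable (measurable_dot t a)
    · rw [← map_dot_eq_gaussianReal hS (hg t) a, integral_map (measurable_dot t a).aemeasurable
        (Measurable.aestronglyMeasurable (by fun_prop))] at h2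
      refine h2.trans (Real.exp_le_exp.2 ?_)
      have := sq_le_sq' (by linarith [(abs_le.1 hkv).1]) (abs_le.1 hkv).2
      linarith
  have hprod : ∀ κ : ℝ, |κ| ≤ l / 4 → mgf (∑ t, X t) m.P κ ≤ Real.exp (m.T * (2 * l ^ 2)) := by
    intro κ hκ
    rw [hXi.mgf_sum hXm]
    refine (Finset.prod_le_prod (fun _ _ => mgf_nonneg) fun t _ => (key κ hκ).2 t).trans ?_
    rw [Finset.prod_const, Finset.card_univ, Fintype.card_fin, ← Real.exp_nat_mul]
  have hl4 : |l / 4| ≤ l / 4 := by rw [abs_of_nonneg (by linarith)]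
  have hl4' : |-(l / 4)| ≤ l / 4 := by rw [abs_neg]; exact hl4
  -- Chernoff at ±l/4: since the variance is at most 4, each period contributes at most exp(2l²) to
  -- the moment generating function, and the exponent is −5Tl² + 2Tl² = −3Tl².
  have t1 := measure_ge_le_exp_mul_mgf (μ := m.P) (X := ∑ t, X t) (t := l / 4) (20 * l * m.T) (by linarith)
    (hXi.integrable_exp_mul_sum hXm fun t _ => (key _ hl4).1 t)
  have t2 := measure_le_le_exp_mul_mgf (μ := m.P) (X := ∑ t, X t) (t := -(l / 4)) (-(20 * l * m.T)) (by linarith)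
    (hXi.integrable_exp_mul_sum hXm fun t _ => (key _ hl4').1 t)
  have b1 := t1.trans (mul_le_mul_of_nonneg_left (hprod _ hl4) (Real.exp_pos _).le)
  have b2 := t2.trans (mul_le_mul_of_nonneg_left (hprod _ hl4') (Real.exp_pos _).le)
  rw [← Real.exp_add] at b1 b2
  have e1 : -(l / 4) * (20 * l * m.T) + m.T * (2 * l ^ 2) = -(3 * (m.T * l ^ 2)) := by ring
  have e2 : - -(l / 4) * -(20 * l * m.T) + m.T * (2 * l ^ 2) = -(3 * (m.T * l ^ 2)) := by ring
  rw [e1] at b1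
  rw [e2] at b2
  have hsub : {ω | 20 * l * m.T < |∑ t : Fin m.T, ((a ⬝ᵥ m.u t ω) ^ 2 - v)|} ⊆
      {ω | 20 * l * m.T ≤ (∑ t, X t) ω} ∪ {ω | (∑ t, X t) ω ≤ -(20 * l * m.T)} := by
    intro ω hω
    simp only [Set.mem_union, Set.mem_ofPred_eq, Finset.sum_apply, hX]
    rcases lt_abs.1 (show 20 * l * m.T < |∑ t : Fin m.T, ((a ⬝ᵥ m.u t ω) ^ 2 - v)| from hω) with h | h
    · exact Or.inl h.le
    · exact Or.inr (by linarith)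
  calc _ ≤ _ := measure_mono hsub
    _ ≤ _ := measure_union_le _ _
    _ = ENNReal.ofReal (m.P.real {ω | 20 * l * m.T ≤ (∑ t, X t) ω}) +
        ENNReal.ofReal (m.P.real {ω | (∑ t, X t) ω ≤ -(20 * l * m.T)}) := by
      rw [ofReal_measureReal, ofReal_measureReal]
    _ = ENNReal.ofReal (m.P.real {ω | 20 * l * m.T ≤ (∑ t, X t) ω} +
        m.P.real {ω | (∑ t, X t) ω ≤ -(20 * l * m.T)}) := by
      rw [ENNReal.ofReal_add measureReal_nonneg measureReal_nonneg]
    _ ≤ _ := ENNReal.ofReal_le_ofReal (by linarith)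

open scoped Matrix.Norms.L2Operator in
/-- The entries of the sample covariance of the errors, uniformly. -/
lemma tail_sampleCov (hS : m.Sigma.PosDef)
    (hg : ∀ t, Measure.map (fun ω => WithLp.toLp 2 (m.u t ω)) m.P = multivariateGaussian 0 m.Sigma)
    (hi : iIndepFun (fun t : ℕ => m.u t) m.P) (hT : 0 < m.T) {l : ℝ} (hl0 : 0 ≤ l) (hl : l ≤ 1 / 4) :
    m.P {ω | ¬ ∀ i j, |((m.T : ℝ)⁻¹ • (m.uMat ω * (m.uMat ω)ᵀ) - m.Sigma) i j| ≤
        10 * √(m.Sigma i i * m.Sigma j j) * l} ≤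
      (m.N ^ 2 : ℕ) * ENNReal.ofReal (4 * Real.exp (-(3 * (m.T * l ^ 2)))) := by
  have hpos : ∀ i, 0 < m.Sigma i i := fun i => hS.diag_pos
  set σ : Fin m.N → ℝ := fun i => √(m.Sigma i i) with hσ
  have hσ0 : ∀ i, 0 < σ i := fun i => Real.sqrt_pos.2 (hpos i)
  have hσ2 : ∀ i, σ i ^ 2 = m.Sigma i i := fun i => Real.sq_sqrt (hpos i).le
  have hsym : ∀ i j, m.Sigma j i = m.Sigma i j := fun i j => by
    have := hS.isHermitian.apply i j
    simpa using this
  -- Polarization with standardized coordinates, e = ±1: the squares of the two forms differ by four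
  -- times the standardized product, which turns 20 + 20 into 10.
  set a : ℝ → Fin m.N → Fin m.N → Fin m.N → ℝ := fun e i j =>
    (σ i)⁻¹ • Pi.single i 1 + (e * (σ j)⁻¹) • Pi.single j 1 with ha
  have hdot : ∀ e i j (z : Fin m.N → ℝ), a e i j ⬝ᵥ z = (σ i)⁻¹ * z i + e * (σ j)⁻¹ * z j := by
    intro e i j z
    simp [ha, add_dotProduct, smul_dotProduct]
  have hquad : ∀ e i j, a e i j ⬝ᵥ m.Sigma *ᵥ a e i j = 1 + e ^ 2 + 2 * e * ((σ i)⁻¹ * (σ j)⁻¹ * m.Sigma i j) := by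
    intro e i j
    rw [hdot]
    have h1 : ∀ k, (m.Sigma *ᵥ a e i j) k = (σ i)⁻¹ * m.Sigma k i + e * (σ j)⁻¹ * m.Sigma k j := by
      intro k
      simp [ha, Matrix.mulVec_add, Matrix.mulVec_smul]
    rw [h1, h1, hsym i j, ← hσ2 i, ← hσ2 j]
    have := (hσ0 i).ne'
    have := (hσ0 j).ne'
    field_simp
    ring
  have hnn : ∀ e i j, 0 ≤ a e i j ⬝ᵥ m.Sigma *ᵥ a e i j := fun e i j => by
    simpa using hS.posSemidef.dotProduct_mulVec_nonneg (a e i j)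
  -- The variances for the two signs are nonnegative and add up to 4.
  have h4p : ∀ i j, a 1 i j ⬝ᵥ m.Sigma *ᵥ a 1 i j ≤ 4 := fun i j => by
    have := hnn (-1) i j
    rw [hquad] at this ⊢
    linarith
  have h4n : ∀ i j, a (-1) i j ⬝ᵥ m.Sigma *ᵥ a (-1) i j ≤ 4 := fun i j => by
    have := hnn 1 i j
    rw [hquad] at this ⊢
    linarith
  set B : ℝ → Fin m.N → Fin m.N → Set m.Ω := fun e i j =>
    {ω | 20 * l * m.T < |∑ t : Fin m.T, ((a e i j ⬝ᵥ m.u t ω) ^ 2 - a e i j ⬝ᵥ m.Sigma *ᵥ a e i j)|} with hB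
  have hTp : (0 : ℝ) < m.T := by exact_mod_cast hT
  have hsub : {ω | ¬ ∀ i j, |((m.T : ℝ)⁻¹ • (m.uMat ω * (m.uMat ω)ᵀ) - m.Sigma) i j| ≤
        10 * √(m.Sigma i i * m.Sigma j j) * l} ⊆
      ⋃ p ∈ (Finset.univ : Finset (Fin m.N × Fin m.N)), (B 1 p.1 p.2 ∪ B (-1) p.1 p.2) := by
    intro ω hω
    by_contra hcon
    refine hω fun i j => ?_
    simp only [Set.mem_iUnion, not_exists, Finset.mem_univ, Set.mem_union, not_or, hB,
      Set.mem_ofPred_eq, not_lt] at hcon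
    obtain ⟨g1, g2⟩ := hcon (i, j) trivial
    dsimp only at g1 g2
    have e3 : (∑ t : Fin m.T, ((a 1 i j ⬝ᵥ m.u t ω) ^ 2 - a 1 i j ⬝ᵥ m.Sigma *ᵥ a 1 i j)) -
        ∑ t : Fin m.T, ((a (-1) i j ⬝ᵥ m.u t ω) ^ 2 - a (-1) i j ⬝ᵥ m.Sigma *ᵥ a (-1) i j) =
        4 * ((σ i)⁻¹ * (σ j)⁻¹) * (m.T * ((m.T : ℝ)⁻¹ • (m.uMat ω * (m.uMat ω)ᵀ) - m.Sigma) i j) := by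
      rw [← Finset.sum_sub_distrib]
      have : ∀ t : Fin m.T, (a 1 i j ⬝ᵥ m.u t ω) ^ 2 - a 1 i j ⬝ᵥ m.Sigma *ᵥ a 1 i j -
          ((a (-1) i j ⬝ᵥ m.u t ω) ^ 2 - a (-1) i j ⬝ᵥ m.Sigma *ᵥ a (-1) i j) =
          4 * ((σ i)⁻¹ * (σ j)⁻¹) * (m.u t ω i * m.u t ω j - m.Sigma i j) := by
        intro t
        rw [hquad, hquad, hdot, hdot]; ring
      rw [Finset.sum_congr rfl fun t _ => this t, ← Finset.mul_sum]
      congr 1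
      rw [Finset.sum_sub_distrib, Matrix.sub_apply, Matrix.smul_apply, smul_eq_mul, mul_sub,
        mul_inv_cancel_left₀ hTp.ne']
      simp [Matrix.mul_apply, uMat, stackY]
    set x := ((m.T : ℝ)⁻¹ • (m.uMat ω * (m.uMat ω)ᵀ) - m.Sigma) i j with hx
    have h5 := (abs_sub _ _).trans (add_le_add g1 g2)
    rw [e3, abs_mul, abs_mul, abs_mul (m.T : ℝ), abs_of_pos hTp] at h5
    have hii := hσ0 i
    have hjj := hσ0 j
    rw [abs_of_pos (by norm_num : (0 : ℝ) < 4), abs_of_pos (by positivity)] at h5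
    rw [Real.sqrt_mul (hpos i).le]
    change |x| ≤ 10 * (σ i * σ j) * l
    have h6 : 4 * ((σ i)⁻¹ * (σ j)⁻¹) * (m.T * |x|) = 4 * m.T * (|x| / (σ i * σ j)) := by field_simp
    rw [h6] at h5
    have h7 : |x| / (σ i * σ j) ≤ 10 * l := by
      by_contra! hlt
      have := mul_lt_mul_of_pos_left hlt (by positivity : 0 < 4 * (m.T : ℝ))
      linarith
    rw [div_le_iff₀ (by positivity)] at h7
    linarith
  calc _ ≤ _ := measure_mono hsub
    _ ≤ _ := measure_biUnion_finset_le _ _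
    _ ≤ ∑ p ∈ (Finset.univ : Finset (Fin m.N × Fin m.N)), ENNReal.ofReal (4 * Real.exp (-(3 * (m.T * l ^ 2)))) := by
        refine Finset.sum_le_sum fun p _ => (measure_union_le _ _).trans ?_
        refine (add_le_add (tail_sum_sq hS.posSemidef hg hi _ (h4p _ _) hl0 hl)
          (tail_sum_sq hS.posSemidef hg hi _ (h4n _ _) hl0 hl)).trans ?_
        rw [← ENNReal.ofReal_add (by positivity) (by positivity)]
        exact ENNReal.ofReal_le_ofReal (by linarith)
    _ = _ := by
        rw [Finset.sum_const, nsmul_eq_mul, Finset.card_univ, Fintype.card_prod, Fintype.card_fin, ← sq]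

end PanelModel

end ChiSquareTail


/-! ### Events of probability tending to one -/

section HighProbability

universe v

variable {d r : ℕ} {M : ℕ → PanelModel.{v} d r}

/-- The probability of `p k` tends to one. -/
def Whp (M : ℕ → PanelModel.{v} d r) (p : ∀ k, (M k).Ω → Prop) : Prop :=
  Tendsto (fun k => (M k).P {ω | ¬ p k ω}) atTop (𝓝 0)

/-- Only monotonicity and subadditivity of the outer measure are used, so the events need not be
measurable. -/
lemma Whp.and {p q : ∀ k, (M k).Ω → Prop} (hp : Whp M p) (hq : Whp M q) : Whp M fun k ω => p k ω ∧ q k ω := by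
  refine tendsto_of_tendsto_of_tendsto_of_le_of_le tendsto_const_nhds (by simpa using Tendsto.add hp hq)
    (fun _ => zero_le) fun k => ?_
  refine (measure_mono fun ω (hω : ¬ (p k ω ∧ q k ω)) => ?_).trans (measure_union_le _ _)
  by_cases h : p k ω
  · exact Or.inr fun h' => hω ⟨h, h'⟩
  · exact Or.inl h

lemma Whp.mono {p q : ∀ k, (M k).Ω → Prop} (hp : Whp M p) (h : ∀ᶠ k in atTop, ∀ ω, p k ω → q k ω) : Whp M q := by
  refine tendsto_of_tendsto_of_tendsto_of_le_of_le' tendsto_const_nhds hp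
    (Eventually.of_forall fun _ => zero_le) (h.mono fun k hk => ?_)
  exact measure_mono fun ω (hω : ¬ q k ω) hpω => hω (hk ω hpω)

lemma Whp.of_le {p : ∀ k, (M k).Ω → Prop} {a : ℕ → ℝ} (ha : Tendsto a atTop (𝓝 0))
    (h : ∀ᶠ k in atTop, (M k).P {ω | ¬ p k ω} ≤ ENNReal.ofReal (a k)) : Whp M p :=
  tendsto_of_tendsto_of_tendsto_of_le_of_le' tendsto_const_nhds
    (by simpa using ENNReal.tendsto_ofReal ha) (Eventually.of_forall fun _ => zero_le) h

lemma Whp.forall_fintype {ι : Type*} [Finite ι] {p : ι → ∀ k, (M k).Ω → Prop} (h : ∀ i, Whp M (p i)) :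
    Whp M fun k ω => ∀ i, p i k ω := by
  cases nonempty_fintype ι
  have h1 : Tendsto (fun k => ∑ i, (M k).P {ω | ¬ p i k ω}) atTop (𝓝 0) := by
    simpa using tendsto_finsetSum Finset.univ fun i _ => h i
  refine tendsto_of_tendsto_of_tendsto_of_le_of_le tendsto_const_nhds h1 (fun _ => zero_le) fun k => ?_
  refine (measure_mono ?_).trans (measure_biUnion_finset_le Finset.univ fun i => {ω | ¬ p i k ω})
  intro ω hω
  simp only [Set.mem_ofPred_eq, not_forall] at hω
  simpa using hω

/-- Gaussian errors that are serially independent and independent of factors and regressors, with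
uniformly bounded covariance, in panels of growing size. -/
structure GaussianPanels (M : ℕ → PanelModel.{v} d r) (c : ℝ) : Prop where
  pos : 0 < c
  posDef : ∀ k, (M k).Sigma.PosDef
  upper : ∀ k (x : Fin (M k).N → ℝ), x ⬝ᵥ (M k).Sigma *ᵥ x ≤ c * (x ⬝ᵥ x)
  gaussian : ∀ k t, Measure.map (fun ω => WithLp.toLp 2 ((M k).u t ω)) (M k).P =
    multivariateGaussian 0 (M k).Sigma
  serial : ∀ k, iIndepFun (fun t : ℕ => (M k).u t) (M k).P
  indep : ∀ k, IndepFun (fun ω (t : ℕ) => (M k).u t ω) (M k).fx (M k).P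
  N_tendsto : Tendsto (fun k => ((M k).N : ℝ)) atTop atTop
  T_pos : ∀ᶠ k in atTop, 0 < (M k).T
  T_le : ∀ᶠ k in atTop, (M k).T ≤ (M k).N

namespace GaussianPanels

variable {c : ℝ}

-- The level √(10cN) makes each tail exp(−5N), while T ≤ N bounds the number of net pairs by 25^N ≤
-- exp(4N).
open scoped Matrix.Norms.L2Operator in
lemma opNorm_le (h : GaussianPanels M c) :
    Whp M fun k ω => ‖(M k).uMat ω‖ ≤ 4 * (√(10 * c) * √(M k).N) := by
  have hc := h.pos
  have h0 : Tendsto (fun k => 2 * Real.exp (-((M k).N : ℝ))) atTop (𝓝 0) := by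
    simpa using (Real.tendsto_exp_neg_atTop_nhds_zero.comp h.N_tendsto).const_mul 2
  refine Whp.of_le h0 (h.T_le.mono fun k hk => ?_)
  refine (PanelModel.tail_opNorm (h.posDef k).posSemidef (h.gaussian k) (h.serial k) hc (h.upper k)
    (by positivity)).trans ?_
  rw [← ENNReal.ofReal_natCast, ← ENNReal.ofReal_mul (by positivity)]
  refine ENNReal.ofReal_le_ofReal ?_
  have e : -(√(10 * c) * √((M k).N : ℝ)) ^ 2 / (2 * c) = -(5 * (M k).N) := by
    rw [mul_pow, Real.sq_sqrt (by positivity), Real.sq_sqrt (by positivity)]; field_simp; ring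
  rw [e]
  have h5 : (5 : ℝ) ≤ Real.exp 2 := by
    have := Real.quadratic_le_exp_of_nonneg (x := 2) (by norm_num)
    linarith
  have h6 : ((5 ^ (M k).N * 5 ^ (M k).T : ℕ) : ℝ) ≤ Real.exp (4 * (M k).N) := by
    push_cast
    calc (5 : ℝ) ^ (M k).N * 5 ^ (M k).T ≤ 5 ^ (M k).N * 5 ^ (M k).N := by
          gcongr; norm_num
      _ ≤ Real.exp 2 ^ (M k).N * Real.exp 2 ^ (M k).N := by gcongr
      _ = _ := by rw [← Real.exp_nat_mul, ← Real.exp_add]; congr 1; ring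
  calc _ ≤ Real.exp (4 * (M k).N) * (2 * Real.exp (-(5 * (M k).N))) := by gcongr
    _ = 2 * (Real.exp (4 * (M k).N) * Real.exp (-(5 * (M k).N))) := by ring
    _ = _ := by rw [← Real.exp_add]; congr 2; ring

lemma tendsto_inv_N (h : GaussianPanels M c) (A : ℝ) : Tendsto (fun k => A * ((M k).N : ℝ)⁻¹) atTop (𝓝 0) := by
  simpa using (tendsto_inv_atTop_zero.comp h.N_tendsto).const_mul A

/-- Linear forms of the errors, uniformly over polynomially many of them. -/
lemma frobInner_le (h : GaussianPanels M c) {ι : ℕ → Type} [∀ k, Fintype (ι k)] {A : ℝ}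
    (hA : ∀ᶠ k in atTop, (Fintype.card (ι k) : ℝ) ≤ A * (M k).N ^ 2)
    {w : ∀ k, ι k → (ℕ → (Fin r → ℝ) × (Fin (M k).N → Fin d → ℝ)) → Matrix (Fin (M k).N) (Fin (M k).T) ℝ}
    (hw : ∀ k a i t, Measurable fun z => w k a z i t) :
    Whp M fun k ω => ∀ a, |frobInner (w k a ((M k).fx ω)) ((M k).uMat ω)| ≤
      √(8 * c) * √(Real.log (M k).N) * frob (w k a ((M k).fx ω)) := by
  have hc := h.pos
  refine Whp.of_le (h.tendsto_inv_N (2 * A)) ((hA.and (h.N_tendsto.eventually_ge_atTop 1)).mono ?_)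
  rintro k ⟨hk, hN⟩
  have hlog : 0 ≤ Real.log (M k).N := Real.log_nonneg hN
  -- With this level a single tail is 2N⁻⁴, which beats a union of order N².
  set x := √(8 * c) * √(Real.log (M k).N) with hx
  have hx0 : 0 ≤ x := by positivity
  have hN0 : (0 : ℝ) < (M k).N := by linarith
  have e : Real.exp (-x ^ 2 / (2 * c)) = ((M k).N : ℝ)⁻¹ ^ 4 := by
    have : -x ^ 2 / (2 * c) = ((4 : ℕ) : ℝ) * (-Real.log (M k).N) := by
      rw [hx, mul_pow, Real.sq_sqrt (by positivity), Real.sq_sqrt hlog]; push_cast; field_simp; ring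
    rw [this, Real.exp_nat_mul, Real.exp_neg, Real.exp_log hN0]
  have hsub : {ω | ¬ ∀ a, |frobInner (w k a ((M k).fx ω)) ((M k).uMat ω)| ≤ x * frob (w k a ((M k).fx ω))} ⊆
      ⋃ a ∈ (Finset.univ : Finset (ι k)), {ω | x * frob (w k a ((M k).fx ω)) <
        |frobInner (w k a ((M k).fx ω)) ((M k).uMat ω)|} := by
    intro ω hω
    simp only [Set.mem_ofPred_eq, not_forall, not_le] at hω
    simpa using hω
  calc _ ≤ _ := measure_mono hsub
    _ ≤ _ := measure_biUnion_finset_le _ _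
    _ ≤ ∑ a : ι k, ENNReal.ofReal (2 * Real.exp (-x ^ 2 / (2 * c))) :=
        Finset.sum_le_sum fun a _ => PanelModel.tail_frobInner_random (h.posDef k).posSemidef (h.gaussian k)
          (h.serial k) (h.indep k) hc (h.upper k) (hw k a) hx0
    _ = ENNReal.ofReal (Fintype.card (ι k) * (2 * ((M k).N : ℝ)⁻¹ ^ 4)) := by
        rw [e, Finset.sum_const, Finset.card_univ, nsmul_eq_mul, ← ENNReal.ofReal_natCast,
          ← ENNReal.ofReal_mul (by positivity)]
    _ ≤ _ := by
        refine ENNReal.ofReal_le_ofReal ?_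
        have hA0 : 0 ≤ A := by
          by_contra! hneg
          have : (0 : ℝ) ≤ Fintype.card (ι k) := by positivity
          have := mul_neg_of_neg_of_pos hneg (by positivity : (0 : ℝ) < (M k).N ^ 2)
          linarith
        have hi1 : ((M k).N : ℝ)⁻¹ ≤ 1 := inv_le_one_of_one_le₀ hN
        calc _ ≤ A * (M k).N ^ 2 * (2 * ((M k).N : ℝ)⁻¹ ^ 4) := by gcongr
          _ = 2 * A * ((M k).N : ℝ)⁻¹ ^ 2 := by field_simp
          _ ≤ 2 * A * ((M k).N : ℝ)⁻¹ := by
              gcongr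
              exact pow_le_of_le_one (by positivity) hi1 (by norm_num)

/-- At l² = log N/T each tail is 4N⁻³, against N² entries; log N/T → 0 keeps l in the range of the
chi-square bound. -/
lemma sampleCov_le (h : GaussianPanels M c) (hl : Tendsto (fun k => Real.log (M k).N / (M k).T) atTop (𝓝 0)) :
    Whp M fun k ω => ∀ i j, |(((M k).T : ℝ)⁻¹ • ((M k).uMat ω * ((M k).uMat ω)ᵀ) - (M k).Sigma) i j| ≤
      10 * √((M k).Sigma i i * (M k).Sigma j j) * √(Real.log (M k).N / (M k).T) := by
  refine Whp.of_le (h.tendsto_inv_N 4) (((h.N_tendsto.eventually_ge_atTop 1).and (h.T_pos.and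
    (hl.eventually_le_const (by norm_num : (0 : ℝ) < 1 / 16)))).mono ?_)
  rintro k ⟨hN, hT, hlk⟩
  have hlog : 0 ≤ Real.log (M k).N := Real.log_nonneg hN
  have hN0 : (0 : ℝ) < (M k).N := by linarith
  have hT0 : (0 : ℝ) < (M k).T := by exact_mod_cast hT
  refine (PanelModel.tail_sampleCov (h.posDef k) (h.gaussian k) (h.serial k) hT (Real.sqrt_nonneg _)
    (Real.sqrt_le_iff.2 ⟨by norm_num, hlk.trans (by norm_num)⟩)).trans ?_
  rw [Real.sq_sqrt (by positivity), mul_div_cancel₀ _ hT0.ne', ← ENNReal.ofReal_natCast,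
    ← ENNReal.ofReal_mul (by positivity)]
  refine ENNReal.ofReal_le_ofReal (le_of_eq ?_)
  have : -(3 * Real.log (M k).N) = ((3 : ℕ) : ℝ) * (-Real.log (M k).N) := by push_cast; ring
  rw [this, Real.exp_nat_mul, Real.exp_neg, Real.exp_log hN0]
  push_cast
  field_simp

end GaussianPanels

/-- By Cramer's rule, inversion is measurable even across singular matrices. It is needed because
the coefficients of a score involve the random projection M_{F₀}. -/
lemma measurable_matrix_inv_apply {α n : Type*} [MeasurableSpace α] [Fintype n] [DecidableEq n]
    {A : α → Matrix n n ℝ} (hA : ∀ i j, Measurable fun z => A z i j) (i j : n) :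
    Measurable fun z => (A z)⁻¹ i j := by
  have hm : Measurable fun z (a b : n) => A z a b :=
    measurable_pi_lambda _ fun a => measurable_pi_lambda _ fun b => hA a b
  have h1 : Measurable fun B : n → n → ℝ => (Matrix.of B).det :=
    (Continuous.matrix_det (continuous_id : Continuous fun B : n → n → ℝ => B)).measurable
  have h2 : Measurable fun B : n → n → ℝ => (Matrix.of B).adjugate i j :=
    (Continuous.matrix_elem
      (Continuous.matrix_adjugate (continuous_id : Continuous fun B : n → n → ℝ => B)) i j).measurable
  have e : (fun z => (A z)⁻¹ i j) = fun z => (A z).det⁻¹ * (A z).adjugate i j := by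
    ext z
    rw [Matrix.inv_def, Matrix.smul_apply, Ring.inverse_eq_inv', smul_eq_mul]
  rw [e]
  exact (h1.comp hm).inv.mul (h2.comp hm)

lemma measurable_matrix_mul_apply {α l n k : Type*} [MeasurableSpace α] [Fintype n]
    {A : α → Matrix l n ℝ} {B : α → Matrix n k ℝ} (hA : ∀ i j, Measurable fun z => A z i j)
    (hB : ∀ i j, Measurable fun z => B z i j) (i : l) (j : k) : Measurable fun z => (A z * B z) i j := by
  simp only [Matrix.mul_apply]
  exact Finset.measurable_sum _ fun a _ => (hA i a).mul (hB a j)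

lemma measurable_annih_apply {α n k : Type*} [MeasurableSpace α] [Fintype n] [DecidableEq n] [Fintype k]
    [DecidableEq k] {A : α → Matrix n k ℝ} (hA : ∀ i j, Measurable fun z => A z i j) (i j : n) :
    Measurable fun z => annih (A z) i j := by
  simp only [annih, Matrix.sub_apply]
  refine Measurable.const_sub ?_ _
  refine measurable_matrix_mul_apply (fun i j => ?_) (fun i j => hA j i) i j
  refine measurable_matrix_mul_apply hA (fun i j => ?_) i j
  exact measurable_matrix_inv_apply (fun i j => measurable_matrix_mul_apply (fun i j => hA j i) hA i j) i j

end HighProbability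


/-! ### Uniform bounds for the scores -/

section ScoreBounds

universe v

variable {d r : ℕ} {M : ℕ → PanelModel.{v} d r} {c : ℝ}

/-- The matrix with row `j` equal to `x` and zeros elsewhere. -/
def rowMat {N T : ℕ} (j : Fin N) (x : Fin T → ℝ) : Matrix (Fin N) (Fin T) ℝ :=
  Matrix.of fun i t => if i = j then x t else 0

lemma frobInner_rowMat {N T : ℕ} (j : Fin N) (x : Fin T → ℝ) (A : Matrix (Fin N) (Fin T) ℝ) :
    frobInner (rowMat j x) A = ∑ t, x t * A j t := by
  rw [frobInner_eq_sum, Finset.sum_eq_single j]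
  · simp [rowMat]
  · intro i _ hi; simp [rowMat, hi]
  · simp

lemma frob_rowMat {N T : ℕ} (j : Fin N) (x : Fin T → ℝ) : frob (rowMat j x) = √(∑ t, x t ^ 2) := by
  rw [frob, frobInner_rowMat]
  congr 1
  exact Finset.sum_congr rfl fun t _ => by simp [rowMat, pow_two]

/-- The factors as a function of the path of factors and regressors. -/
def pathF {N T : ℕ} (z : ℕ → (Fin r → ℝ) × (Fin N → Fin d → ℝ)) : Matrix (Fin T) (Fin r) ℝ :=
  Matrix.of fun t a => (z t).1 a

/-- The regressors as a function of the path of factors and regressors. -/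
def pathX {N T : ℕ} (k : Fin d) (z : ℕ → (Fin r → ℝ) × (Fin N → Fin d → ℝ)) : Matrix (Fin N) (Fin T) ℝ :=
  Matrix.of fun i t => (z t).2 i k

lemma measurable_pathF {N T : ℕ} (t : Fin T) (a : Fin r) :
    Measurable fun z : ℕ → (Fin r → ℝ) × (Fin N → Fin d → ℝ) => pathF (T := T) z t a :=
  (measurable_pi_apply a).comp (measurable_fst.comp (measurable_pi_apply (t : ℕ)))

lemma measurable_pathX {N T : ℕ} (k : Fin d) (i : Fin N) (t : Fin T) :
    Measurable fun z : ℕ → (Fin r → ℝ) × (Fin N → Fin d → ℝ) => pathX (T := T) k z i t :=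
  (measurable_pi_apply k).comp ((measurable_pi_apply i).comp (measurable_snd.comp (measurable_pi_apply (t : ℕ))))

namespace GaussianPanels

/-- Each of the rT entries of Λ'u is a linear form whose coefficients occupy a single column; the
squares are then added up. -/
lemma err_load_le (h : GaussianPanels M c) :
    Whp M fun k ω => frob ((M k).Λᵀ * (M k).uMat ω) ≤
      √(8 * c) * √(Real.log (M k).N) * (√(M k).T * frob (M k).Λ) := by
  have hcard : ∀ᶠ k in atTop, (Fintype.card (Fin r × Fin (M k).T) : ℝ) ≤ r * (M k).N ^ 2 := by
    filter_upwards [h.T_le, h.N_tendsto.eventually_ge_atTop 1] with k hk hN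
    have : ((M k).T : ℝ) ≤ (M k).N := by exact_mod_cast hk
    rw [Fintype.card_prod, Fintype.card_fin, Fintype.card_fin]
    push_cast
    gcongr
    nlinarith
  have h1 := h.frobInner_le hcard (w := fun k p _ => Matrix.of fun i t => if t = p.2 then (M k).Λ i p.1 else 0)
    fun k a i t => measurable_const
  refine h1.mono (Eventually.of_forall fun k ω hω => ?_)
  set κ := √(8 * c) * √(Real.log (M k).N) with hκ
  have hκ0 : 0 ≤ κ := by positivity
  have h2 : ∀ a t, ((M k).Λᵀ * (M k).uMat ω) a t ^ 2 ≤ κ ^ 2 * ∑ i, (M k).Λ i a ^ 2 := by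
    intro a t
    have h3 := hω (a, t)
    have e1 : frobInner (Matrix.of fun i t' => if t' = t then (M k).Λ i a else 0) ((M k).uMat ω) =
        ((M k).Λᵀ * (M k).uMat ω) a t := by
      simp [frobInner_eq_sum, Matrix.mul_apply]
    have e2 : frob (Matrix.of fun i (t' : Fin (M k).T) => if t' = t then (M k).Λ i a else 0) ^ 2 =
        ∑ i, (M k).Λ i a ^ 2 := by
      rw [frob_sq, frobInner_eq_sum]; simp [pow_two]
    rw [e1] at h3
    rw [← e2, ← mul_pow, ← sq_abs]
    exact pow_le_pow_left₀ (abs_nonneg _) h3 2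
  refine (pow_le_pow_iff_left₀ (frob_nonneg _) (by have := frob_nonneg (M k).Λ; positivity) two_ne_zero).1 ?_
  have e3 : frob (M k).Λ ^ 2 = ∑ a, ∑ i, (M k).Λ i a ^ 2 := by
    rw [frob_sq, frobInner_eq_sum, Finset.sum_comm]; simp [pow_two]
  rw [mul_pow κ, mul_pow (√((M k).T : ℝ)), Real.sq_sqrt (by positivity), e3, frob_sq, frobInner_eq_sum]
  calc _ ≤ ∑ a : Fin r, ∑ _t : Fin (M k).T, κ ^ 2 * ∑ i, (M k).Λ i a ^ 2 :=
        Finset.sum_le_sum fun a _ => Finset.sum_le_sum fun t _ => by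
          rw [← pow_two]; exact h2 a t
    _ = _ := by
        simp only [Finset.sum_const, Finset.card_univ, Fintype.card_fin, nsmul_eq_mul]
        rw [← Finset.mul_sum, ← Finset.mul_sum]; ring

/-- Each entry of uF₀ is a linear form in one row of u with a factor path as coefficients, which is
random but independent of u. -/
lemma err_factor_le (h : GaussianPanels M c) :
    Whp M fun k ω => ∀ i, rowNorm ((M k).uMat ω * (M k).F₀ ω) i ≤
      √(8 * c) * √(Real.log (M k).N) * frob ((M k).F₀ ω) := by
  have hcard : ∀ᶠ k in atTop, (Fintype.card (Fin (M k).N × Fin r) : ℝ) ≤ r * (M k).N ^ 2 := by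
    filter_upwards [h.N_tendsto.eventually_ge_atTop 1] with k hN
    rw [Fintype.card_prod, Fintype.card_fin, Fintype.card_fin, mul_comm]
    push_cast
    gcongr
    nlinarith
  have h1 := h.frobInner_le hcard (w := fun k p z => rowMat p.1 fun t => pathF z t p.2) fun k p i t => by
    simp only [rowMat, Matrix.of_apply]
    split_ifs
    · exact measurable_pathF t p.2
    · exact measurable_const
  refine h1.mono (Eventually.of_forall fun k ω hω i => ?_)
  set κ := √(8 * c) * √(Real.log (M k).N) with hκ
  have hκ0 : 0 ≤ κ := by positivity
  have h2 : ∀ a, ((M k).uMat ω * (M k).F₀ ω) i a ^ 2 ≤ κ ^ 2 * ∑ t, (M k).F₀ ω t a ^ 2 := by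
    intro a
    have h3 := hω (i, a)
    rw [frobInner_rowMat, frob_rowMat] at h3
    have e1 : ((M k).uMat ω * (M k).F₀ ω) i a = ∑ t : Fin (M k).T, pathF ((M k).fx ω) t a * (M k).uMat ω i t := by
      rw [Matrix.mul_apply]
      exact Finset.sum_congr rfl fun t _ => mul_comm _ _
    have h4 := pow_le_pow_left₀ (abs_nonneg _) h3 2
    rw [sq_abs, mul_pow, Real.sq_sqrt (Finset.sum_nonneg fun _ _ => sq_nonneg _)] at h4
    rw [e1]
    exact h4
  refine (pow_le_pow_iff_left₀ (rowNorm_nonneg _ _) (by have := frob_nonneg ((M k).F₀ ω); positivity)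
    two_ne_zero).1 ?_
  have e3 : frob ((M k).F₀ ω) ^ 2 = ∑ a, ∑ t, (M k).F₀ ω t a ^ 2 := by
    rw [frob_sq, frobInner_eq_sum, Finset.sum_comm]; simp [pow_two]
  rw [rowNorm_sq, mul_pow κ, e3, Finset.mul_sum]
  exact Finset.sum_le_sum fun a _ => h2 a

/-- One form for each regressor and each pair of individuals: dN² forms in all. -/
lemma reg_err_le (h : GaussianPanels M c) :
    Whp M fun k ω => ∀ (l : Fin d) i j, |(stackX ((M k).Xs ω) l * ((M k).uMat ω)ᵀ) i j| ≤
      √(8 * c) * √(Real.log (M k).N) * rowNorm (stackX ((M k).Xs ω) l) i := by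
  have hcard : ∀ᶠ k in atTop, (Fintype.card (Fin d × Fin (M k).N × Fin (M k).N) : ℝ) ≤ d * (M k).N ^ 2 := by
    refine Eventually.of_forall fun k => le_of_eq ?_
    simp [Fintype.card_prod, pow_two]
  have h1 := h.frobInner_le hcard (w := fun k p z => rowMat p.2.2 fun t => pathX p.1 z p.2.1 t) fun k p i t => by
    simp only [rowMat, Matrix.of_apply]
    split_ifs
    · exact measurable_pathX p.1 p.2.1 t
    · exact measurable_const
  refine h1.mono (Eventually.of_forall fun k ω hω l i j => ?_)
  have h3 := hω (l, i, j)
  rw [frobInner_rowMat, frob_rowMat] at h3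
  have e : rowNorm (stackX ((M k).Xs ω) l) i = √(∑ t : Fin (M k).T, pathX l ((M k).fx ω) i t ^ 2) := by
    rw [← Real.sqrt_sq (rowNorm_nonneg _ _), rowNorm_sq]
    rfl
  rw [e, Matrix.mul_apply]
  exact h3

lemma score_le (h : GaussianPanels M c) (B : ∀ k, Matrix (Fin (M k).N) (Fin (M k).N) ℝ) :
    Whp M fun k ω => ∀ l : Fin d, |frobInner (B k * stackX ((M k).Xs ω) l) ((M k).uMat ω)| ≤
      √(8 * c) * √(Real.log (M k).N) * frob (B k * stackX ((M k).Xs ω) l) := by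
  have hcard : ∀ᶠ k in atTop, (Fintype.card (Fin d) : ℝ) ≤ d * (M k).N ^ 2 := by
    filter_upwards [h.N_tendsto.eventually_ge_atTop 1] with k hN
    rw [Fintype.card_fin]
    have : (1 : ℝ) ≤ (M k).N ^ 2 := one_le_pow₀ hN
    have : (0 : ℝ) ≤ d := by positivity
    nlinarith
  exact h.frobInner_le hcard (w := fun k l z => B k * pathX l z) fun k l i t =>
    measurable_matrix_mul_apply (A := fun _ => B k) (B := fun z => pathX l z) (fun _ _ => measurable_const)
      (measurable_pathX l) i t

lemma score_annih_le (h : GaussianPanels M c) :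
    Whp M fun k ω => ∀ l : Fin d,
      |frobInner (annih (M k).Λ * stackX ((M k).Xs ω) l * annih ((M k).F₀ ω)) ((M k).uMat ω)| ≤
      √(8 * c) * √(Real.log (M k).N) *
        frob (annih (M k).Λ * stackX ((M k).Xs ω) l * annih ((M k).F₀ ω)) := by
  have hcard : ∀ᶠ k in atTop, (Fintype.card (Fin d) : ℝ) ≤ d * (M k).N ^ 2 := by
    filter_upwards [h.N_tendsto.eventually_ge_atTop 1] with k hN
    rw [Fintype.card_fin]
    have : (1 : ℝ) ≤ (M k).N ^ 2 := one_le_pow₀ hN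
    have : (0 : ℝ) ≤ d := by positivity
    nlinarith
  exact h.frobInner_le hcard (w := fun k l z => annih (M k).Λ * pathX l z * annih (pathF z)) fun k l i t =>
    measurable_matrix_mul_apply (A := fun z => annih (M k).Λ * pathX l z) (B := fun z => annih (pathF z))
      (measurable_matrix_mul_apply (A := fun _ => annih (M k).Λ) (B := fun z => pathX l z)
        (fun _ _ => measurable_const) (measurable_pathX l))
      (measurable_annih_apply (A := fun z => pathF z) measurable_pathF) i t

end GaussianPanels

end ScoreBounds


/-! ### Sample second moments of the factors -/

section FactorMoments

universe v

/-- Random variables with a common exponential-type tail have bounded fourth moments. -/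
lemma exists_fourth_moment_bound {b ρ : ℝ} (hb : 0 < b) (hρ : 0 < ρ) :
    ∃ K : ℝ, 0 ≤ K ∧ ∀ {Ω : Type v} [MeasurableSpace Ω] (μ : Measure Ω) [IsProbabilityMeasure μ] {X : Ω → ℝ},
      Measurable X → (∀ x : ℝ, 0 < x → μ.real {ω | x < |X ω|} ≤ Real.exp (-(x / b) ^ ρ)) →
      Integrable (fun ω => X ω ^ 4) μ ∧ ∫ ω, X ω ^ 4 ∂μ ≤ K := by
  set g : ℝ → ℝ := fun t => t ^ (3 : ℝ) * Real.exp (-(b⁻¹ ^ ρ) * t ^ ρ) with hg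
  have hgi : IntegrableOn g (Set.Ioi 0) :=
    integrableOn_rpow_mul_exp_neg_mul_rpow (by norm_num) hρ (by positivity)
  have hg0 : ∀ᵐ t ∂(volume.restrict (Set.Ioi (0 : ℝ))), 0 ≤ g t :=
    (ae_restrict_mem measurableSet_Ioi).mono fun t (ht : 0 < t) => by positivity
  have hI : 0 ≤ ∫ t in Set.Ioi 0, g t := integral_nonneg_of_ae hg0
  refine ⟨4 * ∫ t in Set.Ioi 0, g t, by positivity, fun {Ω} _ μ _ X hX h => ?_⟩
  have e : ∀ ω, |X ω| ^ (4 : ℝ) = X ω ^ 4 := fun ω => by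
    rw [show (4 : ℝ) = ((4 : ℕ) : ℝ) by norm_num, Real.rpow_natCast, Even.pow_abs ⟨2, rfl⟩]
  have h1 : ∫⁻ ω, ENNReal.ofReal (X ω ^ 4) ∂μ ≤ ENNReal.ofReal (4 * ∫ t in Set.Ioi 0, g t) := by
    -- Layer cake formula: the fourth moment is 4∫t³P(|X| > t)dt, and the tail makes the integrand
    -- at most `g`.
    have h2 := lintegral_rpow_eq_lintegral_meas_lt_mul μ (f := fun ω => |X ω|)
      (ae_of_all _ fun ω => abs_nonneg _) hX.abs.aemeasurable (p := 4) (by norm_num)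
    simp only [e] at h2
    rw [h2, ENNReal.ofReal_mul (by norm_num), ofReal_integral_eq_lintegral_ofReal hgi hg0]
    gcongr ENNReal.ofReal 4 * ?_
    refine setLIntegral_mono' measurableSet_Ioi fun t (ht : 0 < t) => ?_
    rw [← ofReal_measureReal, ← ENNReal.ofReal_mul measureReal_nonneg]
    refine ENNReal.ofReal_le_ofReal ?_
    have h3 := h t ht
    rw [div_eq_inv_mul, Real.mul_rpow (by positivity) ht.le] at h3
    norm_num only
    rw [mul_comm, hg]
    simp only [neg_mul]
    gcongr
  have h4 : Integrable (fun ω => X ω ^ 4) μ := by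
    refine ⟨(hX.pow_const 4).aestronglyMeasurable, ?_⟩
    rw [hasFiniteIntegral_iff_ofReal (ae_of_all _ fun ω => by positivity)]
    exact h1.trans_lt ENNReal.ofReal_lt_top
  refine ⟨h4, ?_⟩
  rw [← ENNReal.ofReal_le_ofReal_iff (by positivity),
    ofReal_integral_eq_lintegral_ofReal h4 (ae_of_all _ fun ω => by positivity)]
  exact h1

variable {d r : ℕ}

namespace PanelModel

variable {m : PanelModel.{v} d r} {K : ℝ}

lemma measurable_f_apply (t : ℕ) (a : Fin r) : Measurable fun ω => m.f t ω a :=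
  (measurable_pi_apply a).comp (m.measurable_f t)

lemma memLp_f_mul (h4 : ∀ t a, Integrable (fun ω => m.f t ω a ^ 4) m.P) (t : ℕ) (a b : Fin r) :
    MemLp (fun ω => m.f t ω a * m.f t ω b) 2 m.P := by
  have hm : AEStronglyMeasurable (fun ω => m.f t ω a * m.f t ω b) m.P :=
    ((measurable_f_apply t a).mul (measurable_f_apply t b)).aestronglyMeasurable
  rw [memLp_two_iff_integrable_sq hm]
  refine ((h4 t a).add (h4 t b)).mono' (hm.pow 2) (ae_of_all _ fun ω => ?_)
  rw [Real.norm_of_nonneg (by positivity), Pi.add_apply]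
  nlinarith [sq_nonneg (m.f t ω a ^ 2 - m.f t ω b ^ 2), sq_nonneg (m.f t ω a ^ 2 + m.f t ω b ^ 2)]

lemma memLp_f (h4 : ∀ t a, Integrable (fun ω => m.f t ω a ^ 4) m.P) (t : ℕ) (a : Fin r) :
    MemLp (fun ω => m.f t ω a) 2 m.P := by
  rw [memLp_two_iff_integrable_sq (measurable_f_apply t a).aestronglyMeasurable]
  have := (memLp_f_mul h4 t a a).integrable (by norm_num)
  simpa [pow_two] using this

/-- Chebyshev's inequality for the sample second moments of the factors. -/
lemma tail_factor_sum (h4 : ∀ t a, Integrable (fun ω => m.f t ω a ^ 4) m.P)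
    (hK : ∀ t a, ∫ ω, m.f t ω a ^ 4 ∂m.P ≤ K) (hi : iIndepFun (fun t : ℕ => m.f t) m.P) (hT : 0 < m.T)
    (a b : Fin r) {η : ℝ} (hη : 0 < η) :
    m.P {ω | ¬ |∑ t : Fin m.T, (m.f t ω a * m.f t ω b - ∫ ω', m.f t ω' a * m.f t ω' b ∂m.P)| ≤ η * m.T} ≤
      ENNReal.ofReal (K / η ^ 2 * (m.T : ℝ)⁻¹) := by
  set Y : Fin m.T → m.Ω → ℝ := fun t ω => m.f t ω a * m.f t ω b with hY
  have hYL : ∀ t, MemLp (Y t) 2 m.P := fun t => memLp_f_mul h4 t a b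
  have hYi : iIndepFun Y m.P :=
    (hi.precomp (g := fun t : Fin m.T => (t : ℕ)) Fin.val_injective).comp (fun t z => z a * z b) fun t => by fun_prop
  have hvar : ∀ t, Var[Y t; m.P] ≤ K := by
    intro t
    refine (variance_le_expectation_sq (hYL t).1).trans ?_
    have h5 : ∫ ω, (Y t ^ 2) ω ∂m.P ≤ ∫ ω, (m.f t ω a ^ 4 + m.f t ω b ^ 4) / 2 ∂m.P := by
      refine integral_mono ((memLp_two_iff_integrable_sq (hYL t).1).1 (hYL t))
        (((h4 t a).add (h4 t b)).div_const 2) fun ω => ?_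
      simp only [hY, Pi.pow_apply]
      nlinarith [sq_nonneg (m.f t ω a ^ 2 - m.f t ω b ^ 2)]
    rw [integral_div, integral_add (h4 t a) (h4 t b)] at h5
    linarith [hK t a, hK t b]
  have hT0 : (0 : ℝ) < m.T := by exact_mod_cast hT
  have hsum : Var[∑ t, Y t; m.P] ≤ m.T * K := by
    rw [IndepFun.variance_sum (fun t _ => hYL t) fun i _ j _ hij => hYi.indepFun hij]
    refine (Finset.sum_le_sum fun t _ => hvar t).trans ?_
    simp
  have hL : MemLp (∑ t, Y t) 2 m.P := memLp_finsetSum' _ fun t _ => hYL t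
  have h6 := meas_ge_le_variance_div_sq hL (c := η * m.T) (by positivity)
  refine (measure_mono ?_).trans (h6.trans (ENNReal.ofReal_le_ofReal ?_))
  · intro ω hω
    have hω' := not_le.1 hω
    have e1 : ∫ ω, (∑ t, Y t) ω ∂m.P = ∑ t, ∫ ω, Y t ω ∂m.P := by
      simp only [Finset.sum_apply]
      exact integral_finsetSum _ fun t _ => (hYL t).integrable (by norm_num)
    change η * m.T ≤ |(∑ t, Y t) ω - ∫ ω, (∑ t, Y t) ω ∂m.P|
    rw [e1, Finset.sum_apply, ← Finset.sum_sub_distrib]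
    exact hω'.le
  · calc _ ≤ m.T * K / (η * m.T) ^ 2 := by gcongr
      _ = _ := by field_simp

/-- The factors need not be centred: the second moment matrix is the covariance plus the positive
semidefinite square of the mean. -/
lemma second_moment_lower (h4 : ∀ t a, Integrable (fun ω => m.f t ω a ^ 4) m.P) {c : ℝ} (t : ℕ)
    (hc : (covMatrix m.P (m.f t) - c • (1 : Matrix _ _ ℝ)).PosDef) (v : Fin r → ℝ) :
    c * (v ⬝ᵥ v) ≤ ∑ a, ∑ b, v a * v b * ∫ ω, m.f t ω a * m.f t ω b ∂m.P := by
  have h1 := hc.posSemidef.dotProduct_mulVec_nonneg v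
  have e : ∀ a b, ∫ ω, m.f t ω a * m.f t ω b ∂m.P =
      covMatrix m.P (m.f t) a b + (∫ ω, m.f t ω a ∂m.P) * ∫ ω, m.f t ω b ∂m.P := by
    intro a b
    rw [covMatrix, Matrix.of_apply, covariance_eq_sub (memLp_f h4 t a) (memLp_f h4 t b)]
    simp
  have e2 : v ⬝ᵥ covMatrix m.P (m.f t) *ᵥ v = ∑ a, ∑ b, v a * v b * covMatrix m.P (m.f t) a b := by
    simp only [dotProduct, Matrix.mulVec, Finset.mul_sum]
    exact Finset.sum_congr rfl fun _ _ => Finset.sum_congr rfl fun _ _ => by ring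
  have e3 : ∑ a, ∑ b, v a * v b * ((∫ ω, m.f t ω a ∂m.P) * ∫ ω, m.f t ω b ∂m.P) =
      (∑ a, v a * ∫ ω, m.f t ω a ∂m.P) ^ 2 := by
    rw [pow_two, Finset.sum_mul_sum]
    exact Finset.sum_congr rfl fun _ _ => Finset.sum_congr rfl fun _ _ => by ring
  simp only [e, mul_add, Finset.sum_add_distrib]
  rw [e3, ← e2]
  rw [Matrix.sub_mulVec, Matrix.smul_mulVec, Matrix.one_mulVec, star_trivial, dotProduct_sub,
    dotProduct_smul, smul_eq_mul] at h1
  nlinarith [sq_nonneg (∑ a, v a * ∫ ω, m.f t ω a ∂m.P)]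

/-- An entrywise error η changes a quadratic form by at most ηr‖v‖², as (Σ|vₐ|)² ≤ r‖v‖². The choice
η = c/(2(r + 1)) spends half of the lower bound and also covers r = 0. -/
lemma factor_bounds_of_close (h4 : ∀ t a, Integrable (fun ω => m.f t ω a ^ 4) m.P)
    (hK : ∀ t a, ∫ ω, m.f t ω a ^ 4 ∂m.P ≤ K) {c : ℝ} (hc0 : 0 < c)
    (hc : ∀ t, (covMatrix m.P (m.f t) - c • (1 : Matrix _ _ ℝ)).PosDef) {ω : m.Ω}
    (h : ∀ a b, |∑ t : Fin m.T, (m.f t ω a * m.f t ω b - ∫ ω', m.f t ω' a * m.f t ω' b ∂m.P)| ≤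
      c / (2 * (r + 1)) * m.T) :
    (∀ v : Fin r → ℝ, c / 2 * (m.T * (v ⬝ᵥ v)) ≤ (m.F₀ ω *ᵥ v) ⬝ᵥ (m.F₀ ω *ᵥ v)) ∧
      frob (m.F₀ ω) ^ 2 ≤ r * (1 + K + c) * m.T := by
  set η := c / (2 * (r + 1)) with hη
  have hT : (0 : ℝ) ≤ m.T := by positivity
  have hη0 : 0 ≤ η := by positivity
  constructor
  · intro v
    have e1 : (m.F₀ ω *ᵥ v) ⬝ᵥ (m.F₀ ω *ᵥ v) = ∑ a, ∑ b, v a * v b * ∑ t : Fin m.T, m.f t ω a * m.f t ω b := by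
      simp only [dotProduct, Matrix.mulVec, F₀, Matrix.of_apply, Finset.mul_sum, Finset.sum_mul]
      rw [Finset.sum_comm]
      refine Finset.sum_congr rfl fun a _ => ?_
      rw [Finset.sum_comm]
      exact Finset.sum_congr rfl fun _ _ => Finset.sum_congr rfl fun _ _ => by ring
    have e2 : ∑ t : Fin m.T, ∑ a, ∑ b, v a * v b * ∫ ω', m.f t ω' a * m.f t ω' b ∂m.P =
        ∑ a, ∑ b, v a * v b * ∑ t : Fin m.T, ∫ ω', m.f t ω' a * m.f t ω' b ∂m.P := by
      simp only [Finset.mul_sum]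
      rw [Finset.sum_comm]
      exact Finset.sum_congr rfl fun a _ => Finset.sum_comm
    have h1 : m.T * (c * (v ⬝ᵥ v)) ≤ ∑ t : Fin m.T, ∑ a, ∑ b, v a * v b * ∫ ω', m.f t ω' a * m.f t ω' b ∂m.P := by
      calc _ = ∑ _t : Fin m.T, c * (v ⬝ᵥ v) := by simp
        _ ≤ _ := Finset.sum_le_sum fun t _ => second_moment_lower h4 t (hc t) v
    have h2 : ∑ a, ∑ b, v a * v b * ∑ t : Fin m.T, ∫ ω', m.f t ω' a * m.f t ω' b ∂m.P -
        ∑ a, ∑ b, v a * v b * ∑ t : Fin m.T, m.f t ω a * m.f t ω b ≤ η * m.T * (∑ a, |v a|) ^ 2 := by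
      rw [← Finset.sum_sub_distrib, pow_two, Finset.sum_mul_sum, Finset.mul_sum]
      refine Finset.sum_le_sum fun a _ => ?_
      rw [← Finset.sum_sub_distrib, Finset.mul_sum]
      refine Finset.sum_le_sum fun b _ => ?_
      have h3 := h a b
      rw [Finset.sum_sub_distrib, abs_sub_comm] at h3
      rw [← mul_sub]
      refine (le_abs_self _).trans ?_
      rw [abs_mul, abs_mul, mul_comm]
      gcongr
    have h5 : (∑ a, |v a|) ^ 2 ≤ r * (v ⬝ᵥ v) := by
      have := sq_sum_le_card_mul_sum_sq (s := (Finset.univ : Finset (Fin r))) (f := fun a => |v a|)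
      simpa [dotProduct, pow_two] using this
    have hvv : 0 ≤ v ⬝ᵥ v := by rw [dotProduct_self_eq_norm]; positivity
    have h6 : η * m.T * (∑ a, |v a|) ^ 2 ≤ c / 2 * (m.T * (v ⬝ᵥ v)) := by
      calc _ ≤ η * m.T * (r * (v ⬝ᵥ v)) := by gcongr
        _ = η * r * (m.T * (v ⬝ᵥ v)) := by ring
        _ ≤ _ := by
          gcongr
          rw [hη, div_mul_eq_mul_div, div_le_div_iff₀ (by positivity) (by norm_num)]
          nlinarith
    rw [e1]
    rw [e2] at h1
    linarith
  · have e1 : frob (m.F₀ ω) ^ 2 = ∑ a, ∑ t : Fin m.T, m.f t ω a * m.f t ω a := by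
      rw [frob_sq, frobInner_eq_sum, Finset.sum_comm]; rfl
    rw [e1]
    have h1 : ∀ a, ∑ t : Fin m.T, m.f t ω a * m.f t ω a ≤ (1 + K + c) * m.T := by
      intro a
      have h3 := (le_abs_self _).trans (h a a)
      rw [Finset.sum_sub_distrib] at h3
      have h5 : ∀ t : Fin m.T, ∫ ω', m.f t ω' a * m.f t ω' a ∂m.P ≤ 1 + K := by
        intro t
        have : ∫ ω', m.f t ω' a * m.f t ω' a ∂m.P ≤ ∫ ω', (1 + m.f t ω' a ^ 4) ∂m.P := by
          refine integral_mono ((memLp_f_mul h4 t a a).integrable (by norm_num))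
            ((integrable_const _).add (h4 t a)) fun ω => ?_
          simp only
          nlinarith [sq_nonneg (m.f t ω a ^ 2 - 1)]
        rw [integral_add (integrable_const _) (h4 t a)] at this
        simp at this
        linarith [hK t a]
      have h6 : ∑ t : Fin m.T, ∫ ω', m.f t ω' a * m.f t ω' a ∂m.P ≤ (1 + K) * m.T := by
        refine (Finset.sum_le_sum fun t _ => h5 t).trans ?_
        simp only [Finset.sum_const, Finset.card_univ, Fintype.card_fin, nsmul_eq_mul]
        linarith
      have h7 : η ≤ c := by
        rw [hη, div_le_iff₀ (by positivity)]
        have : (0 : ℝ) ≤ r := by positivity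
        nlinarith
      nlinarith
    refine (Finset.sum_le_sum fun a _ => h1 a).trans ?_
    simp
    linarith

end PanelModel

variable {M : ℕ → PanelModel.{v} d r}

/-- The sample second moments of the factors are bounded and bounded away from zero. -/
lemma factor_bounds {K c : ℝ} (h4 : ∀ k t a, Integrable (fun ω => (M k).f t ω a ^ 4) (M k).P)
    (hK : ∀ k t a, ∫ ω, (M k).f t ω a ^ 4 ∂(M k).P ≤ K) (hc0 : 0 < c)
    (hc : ∀ k t, (covMatrix (M k).P ((M k).f t) - c • (1 : Matrix _ _ ℝ)).PosDef)
    (hi : ∀ k, iIndepFun (fun t : ℕ => (M k).f t) (M k).P)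
    (hT : Tendsto (fun k => ((M k).T : ℝ)) atTop atTop) :
    Whp M fun k ω =>
      (∀ v : Fin r → ℝ, c / 2 * ((M k).T * (v ⬝ᵥ v)) ≤ ((M k).F₀ ω *ᵥ v) ⬝ᵥ ((M k).F₀ ω *ᵥ v)) ∧
      frob ((M k).F₀ ω) ^ 2 ≤ r * (1 + K + c) * (M k).T := by
  have h1 : Whp M fun k ω => ∀ a b, |∑ t : Fin (M k).T, ((M k).f t ω a * (M k).f t ω b -
      ∫ ω', (M k).f t ω' a * (M k).f t ω' b ∂(M k).P)| ≤ c / (2 * (r + 1)) * (M k).T := by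
    refine Whp.forall_fintype fun a => Whp.forall_fintype fun b => ?_
    have h0 : Tendsto (fun k => K / (c / (2 * (r + 1))) ^ 2 * ((M k).T : ℝ)⁻¹) atTop (𝓝 0) := by
      simpa using (tendsto_inv_atTop_zero.comp hT).const_mul (K / (c / (2 * (r + 1))) ^ 2)
    refine Whp.of_le h0 ((hT.eventually_gt_atTop 0).mono fun k hk => ?_)
    exact PanelModel.tail_factor_sum (h4 k) (hK k) (hi k) (by exact_mod_cast hk) a b (by positivity)
  exact h1.mono (Eventually.of_forall fun k ω hω =>
    PanelModel.factor_bounds_of_close (h4 k) (hK k) hc0 (hc k) hω)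

end FactorMoments


/-! ### Rates implied by the sparsity condition -/

section Growth

universe v

variable {d r : ℕ} {M : ℕ → PanelModel.{v} d r} {q : ℝ}

/-- A diagonal entry alone contributes at least c^q ≥ c. So m_N is bounded below, and upper rates
for m_N become conditions on N and T. -/
lemma le_sparsity {N : ℕ} {S : Matrix (Fin N) (Fin N) ℝ} {c : ℝ} (hc0 : 0 < c) (hc1 : c ≤ 1) (hq0 : 0 ≤ q) (hq1 : q ≤ 1)
    {i : Fin N} (hi : c ≤ S i i) : c ≤ sparsity q S := by
  have h1 : c ≤ |S i i| ^ q := by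
    calc c = c ^ (1 : ℝ) := (Real.rpow_one c).symm
      _ ≤ c ^ q := Real.rpow_le_rpow_of_exponent_ge hc0 hc1 hq1
      _ ≤ |S i i| ^ q := Real.rpow_le_rpow hc0.le (hi.trans (le_abs_self _)) hq0
  have h2 : |S i i| ^ q ≤ ∑ j, if S i j = 0 then 0 else |S i j| ^ q := by
    have := Finset.single_le_sum (s := Finset.univ) (f := fun j => if S i j = 0 then 0 else |S i j| ^ q)
      (fun j _ => by split_ifs <;> positivity) (Finset.mem_univ i)
    refine le_trans (le_of_eq ?_) this
    rw [if_neg (by linarith)]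
  exact h1.trans (h2.trans (le_ciSup (f := fun i => ∑ j, if S i j = 0 then 0 else |S i j| ^ q)
    (Set.finite_range _).bddAbove i))

/-- Here l = log N. The lower bound on m against the first rate gives A N^{1/4} ≤ (T/l)^{(1−q)/2} ≤
(T/l)^{1/2}, to be squared. For the second claim x ↦ x^{1−q} is subadditive, and each part of
ω^{1−q} cancels one of the two rates up to N^{-1/4} ≤ 1. -/
lemma rates_of_sparsity {N T m l ε θ A q : ℝ} (hN : 1 ≤ N) (hT : 0 < T) (hl : 0 < l) (hq0 : 0 ≤ q) (hq1 : q ≤ 1)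
    (hA : 1 < A) (hm : A * ε ≤ m) (hε : 0 < ε) (hεθ : 2 * ε ≤ θ)
    (h1 : m ≤ ε * (1 / N ^ (1 / 4 : ℝ) * (T / l) ^ ((1 - q) / 2))) (h2 : m ≤ ε * N ^ (1 / 4 - q / 2)) :
    A ^ 2 * (√N * l) ≤ T ∧ (√(l / T) + 1 / √N) ^ (1 - q) * m ≤ θ := by
  have hN0 : 0 < N := by linarith
  set y := T / l with hy
  have hy0 : 0 < y := by positivity
  have hn1 : 1 ≤ N ^ (1 / 4 : ℝ) := Real.one_le_rpow hN (by norm_num)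
  have hn0 : 0 < N ^ (1 / 4 : ℝ) := by linarith
  constructor
  · have h3 : A * N ^ (1 / 4 : ℝ) ≤ y ^ ((1 - q) / 2) := by
      have h4 : A * ε ≤ ε * (1 / N ^ (1 / 4 : ℝ) * y ^ ((1 - q) / 2)) := hm.trans h1
      have h5 : A ≤ 1 / N ^ (1 / 4 : ℝ) * y ^ ((1 - q) / 2) := by
        by_contra! hlt
        have := mul_lt_mul_of_pos_left hlt hε
        linarith
      rw [one_div, inv_mul_eq_div, le_div_iff₀ hn0] at h5
      exact h5
    have hy1 : 1 ≤ y := by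
      by_contra! hlt
      have h4 : y ^ ((1 - q) / 2) ≤ 1 := Real.rpow_le_one hy0.le hlt.le (by linarith)
      nlinarith
    have h4 : A * N ^ (1 / 4 : ℝ) ≤ y ^ (1 / 2 : ℝ) :=
      h3.trans (Real.rpow_le_rpow_of_exponent_le hy1 (by linarith))
    have h5 := pow_le_pow_left₀ (by positivity) h4 2
    rw [mul_pow, ← Real.rpow_natCast (N ^ (1 / 4 : ℝ)), ← Real.rpow_natCast (y ^ (1 / 2 : ℝ)), ← Real.rpow_mul hN0.le,
      ← Real.rpow_mul hy0.le] at h5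
    norm_num only at h5
    rw [Real.rpow_one, ← Real.sqrt_eq_rpow, hy, le_div_iff₀ hl] at h5
    linarith
  · have hb : 0 ≤ 1 / √N := by positivity
    have h3 := Real.rpow_add_le_add_rpow (Real.sqrt_nonneg (l / T)) hb (p := 1 - q) (by linarith) (by linarith)
    have hm0 : 0 ≤ m := le_trans (by positivity) hm
    have e1 : √(l / T) ^ (1 - q) * y ^ ((1 - q) / 2) = 1 := by
      have e : l / T = y⁻¹ := by rw [hy, inv_div]
      rw [e, Real.sqrt_eq_rpow, ← Real.rpow_mul (by positivity), Real.inv_rpow hy0.le,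
        show 1 / 2 * (1 - q) = (1 - q) / 2 by ring]
      exact inv_mul_cancel₀ (by positivity)
    have e2 : (1 / √N) ^ (1 - q) * N ^ (1 / 4 - q / 2) = (N ^ (1 / 4 : ℝ))⁻¹ := by
      rw [Real.sqrt_eq_rpow, one_div, ← Real.rpow_neg hN0.le, ← Real.rpow_mul hN0.le, ← Real.rpow_add hN0,
        ← Real.rpow_neg hN0.le]
      congr 1; ring
    have hinv : (N ^ (1 / 4 : ℝ))⁻¹ ≤ 1 := inv_le_one_of_one_le₀ hn1
    have p1 : √(l / T) ^ (1 - q) * m ≤ ε := by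
      calc _ ≤ √(l / T) ^ (1 - q) * (ε * (1 / N ^ (1 / 4 : ℝ) * y ^ ((1 - q) / 2))) := by gcongr
        _ = ε * (N ^ (1 / 4 : ℝ))⁻¹ * (√(l / T) ^ (1 - q) * y ^ ((1 - q) / 2)) := by rw [one_div]; ring
        _ ≤ ε * 1 * 1 := by rw [e1]; gcongr
        _ = ε := by ring
    have p2 : (1 / √N) ^ (1 - q) * m ≤ ε := by
      calc _ ≤ (1 / √N) ^ (1 - q) * (ε * N ^ (1 / 4 - q / 2)) := by gcongr
        _ = ε * ((1 / √N) ^ (1 - q) * N ^ (1 / 4 - q / 2)) := by ring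
        _ ≤ ε * 1 := by rw [e2]; gcongr
        _ = ε := mul_one _
    calc _ ≤ (√(l / T) ^ (1 - q) + (1 / √N) ^ (1 - q)) * m := by gcongr
      _ = √(l / T) ^ (1 - q) * m + (1 / √N) ^ (1 - q) * m := add_mul _ _ _
      _ ≤ θ := by linarith

lemma PanelGrowth.T_le (hG : PanelGrowth M q) : ∀ᶠ k in atTop, (M k).T ≤ (M k).N := by
  filter_upwards [hG.ratio.eventually_ge_atTop 1, hG.T_tendsto.eventually_gt_atTop 0] with k h1 h2
  have h3 : (0 : ℝ) < (M k).T := by exact_mod_cast h2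
  rw [le_div_iff₀ h3, one_mul] at h1
  exact_mod_cast h1

/-- The relations between `N`, `T` and the sparsity that hold for large panels. -/
lemma PanelGrowth.rates (hG : PanelGrowth M q) (hS : ConditionallySparse M q) {c : ℝ} (hc : 0 < c)
    (hdiag : ∀ k i, c ≤ (M k).Sigma i i) {θ : ℝ} (hθ : 0 < θ) :
    ∀ᶠ k in atTop, √((M k).N : ℝ) * Real.log (M k).N ≤ θ ^ 2 * (M k).T ∧ 1 ≤ θ ^ 2 * Real.log (M k).N ∧
      omegaRate (M k).N (M k).T ≤ θ ∧
      omegaRate (M k).N (M k).T ^ (1 - q) * sparsity q (M k).Sigma ≤ θ := by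
  have hNr : Tendsto (fun k => ((M k).N : ℝ)) atTop atTop := tendsto_natCast_atTop_atTop.comp hG.N_tendsto
  have hlog : Tendsto (fun k => Real.log (M k).N) atTop atTop := Real.tendsto_log_atTop.comp hNr
  have hsq : Tendsto (fun k => √((M k).N : ℝ)) atTop atTop := Real.tendsto_sqrt_atTop.comp hNr
  set m₀ := min c 1 with hm₀
  set θ₁ := min θ 1 with hθ₁
  have hm₀p : 0 < m₀ := lt_min hc one_pos
  have hθ₁p : 0 < θ₁ := lt_min hθ one_pos
  have hm₀1 : m₀ ≤ 1 := min_le_right _ _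
  have hθ₁1 : θ₁ ≤ 1 := min_le_right _ _
  have hθ₁θ : θ₁ ≤ θ := min_le_left _ _
  -- Chosen so that (2/θ₁)ε = m₀ and 2ε ≤ θ. The truncations at 1 keep A = 2/θ₁ above 1 and the
  -- lower bound m₀ at most 1.
  set ε := m₀ * θ₁ / 2 with hε
  have hεp : 0 < ε := by positivity
  filter_upwards [hS.rate.bound hεp, hNr.eventually_ge_atTop 1, hlog.eventually_ge_atTop (1 / θ ^ 2),
    hsq.eventually_ge_atTop (2 / θ), hG.T_tendsto.eventually_gt_atTop 0] with k hb hN hl hs hT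
  have hN0 : (0 : ℝ) < (M k).N := by linarith
  have hT0 : (0 : ℝ) < (M k).T := by exact_mod_cast hT
  have hl0 : 0 < Real.log (M k).N := lt_of_lt_of_le (by positivity) hl
  have hm : m₀ ≤ sparsity q (M k).Sigma := by
    refine le_sparsity hm₀p hm₀1 hS.q_nonneg (by linarith [hS.q_lt]) (i := ⟨0, by exact_mod_cast hN0⟩) ?_
    exact (min_le_left _ _).trans (hdiag k _)
  have hmin0 : 0 ≤ min (1 / ((M k).N : ℝ) ^ (1 / 4 : ℝ) * ((M k).T / Real.log (M k).N) ^ ((1 - q) / 2))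
      (((M k).N : ℝ) ^ (1 / 4 - q / 2)) := le_min (by positivity) (by positivity)
  rw [Real.norm_of_nonneg (hm₀p.le.trans hm), Real.norm_of_nonneg hmin0] at hb
  have hA : 1 < 2 / θ₁ := by rw [lt_div_iff₀ hθ₁p]; linarith
  have hm2 : 2 / θ₁ * ε ≤ sparsity q (M k).Sigma := by
    refine le_trans (le_of_eq ?_) hm
    rw [hε]; field_simp
  have hεθ : 2 * ε ≤ θ := by
    rw [hε]; nlinarith
  obtain ⟨r1, r2⟩ := rates_of_sparsity hN hT0 hl0 hS.q_nonneg (by linarith [hS.q_lt]) hA hm2 hεp hεθ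
    (hb.trans (by gcongr; exact min_le_left _ _)) (hb.trans (by gcongr; exact min_le_right _ _))
  have hsN : 1 ≤ √((M k).N : ℝ) := Real.one_le_sqrt.2 hN
  have r3 : 4 * (√((M k).N : ℝ) * Real.log (M k).N) ≤ θ₁ ^ 2 * (M k).T := by
    rw [div_pow, div_mul_eq_mul_div, div_le_iff₀ (by positivity)] at r1
    linarith
  have hθ2 : θ₁ ^ 2 ≤ θ ^ 2 := pow_le_pow_left₀ hθ₁p.le hθ₁θ 2
  have r4 : 4 * (√((M k).N : ℝ) * Real.log (M k).N) ≤ θ ^ 2 * (M k).T := r3.trans (by gcongr)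
  have hp : 0 < √((M k).N : ℝ) * Real.log (M k).N := by positivity
  refine ⟨by linarith, ?_, ?_, r2⟩
  · rw [div_le_iff₀ (by positivity)] at hl; linarith
  · have a1 : √(Real.log (M k).N / (M k).T) ≤ θ / 2 := by
      refine Real.sqrt_le_iff.2 ⟨by positivity, ?_⟩
      rw [div_le_iff₀ hT0]
      nlinarith
    have a2 : 1 / √((M k).N : ℝ) ≤ θ / 2 := by
      rw [div_le_iff₀ hθ] at hs
      rw [div_le_iff₀ (by linarith)]
      linarith
    rw [omegaRate]; linarith

lemma PanelGrowth.log_div_tendsto (hG : PanelGrowth M q) (hS : ConditionallySparse M q) {c : ℝ} (hc : 0 < c)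
    (hdiag : ∀ k i, c ≤ (M k).Sigma i i) :
    Tendsto (fun k => Real.log (M k).N / (M k).T) atTop (𝓝 0) := by
  rw [Metric.tendsto_atTop']
  intro ε hε
  have h := hG.rates hS hc hdiag (θ := √(ε / 2)) (by positivity)
  rw [Real.sq_sqrt (by positivity)] at h
  obtain ⟨k₀, hk₀⟩ := eventually_atTop.1 (h.and ((hG.N_tendsto.eventually_ge_atTop 1).and
    (hG.T_tendsto.eventually_gt_atTop 0)))
  refine ⟨k₀, fun k hk => ?_⟩
  obtain ⟨⟨h1, -⟩, h2, h3⟩ := hk₀ k hk.le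
  have hN : (1 : ℝ) ≤ (M k).N := by exact_mod_cast h2
  have hT : (0 : ℝ) < (M k).T := by exact_mod_cast h3
  have hl := Real.log_nonneg hN
  have hsN : 1 ≤ √((M k).N : ℝ) := Real.one_le_sqrt.2 hN
  rw [Real.dist_0_eq_abs, abs_of_nonneg (by positivity), div_lt_iff₀ hT]
  nlinarith

end Growth

/-! ### Assembling a regular realization -/

section RegularOfBounds

open scoped Matrix.Norms.L2Operator

/-- Nonnegativity of the form at x − c⁻¹Sx gives ‖Sx‖² ≤ c·x'Sx ≤ c²‖x‖². -/
lemma op_le_of_quad_le {n : Type*} [Fintype n] [DecidableEq n] {S : Matrix n n ℝ} (hs : Sᵀ = S) {c : ℝ} (hc : 0 < c)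
    (h0 : ∀ v : n → ℝ, 0 ≤ v ⬝ᵥ S *ᵥ v) (h : ∀ v : n → ℝ, v ⬝ᵥ S *ᵥ v ≤ c * (v ⬝ᵥ v)) : ‖S‖ ≤ c := by
  refine op_le_of_mulVec hc.le fun x => ?_
  set y := S *ᵥ x with hy
  have h1 := h0 (x - c⁻¹ • y)
  have e1 : y ⬝ᵥ S *ᵥ x = y ⬝ᵥ y := rfl
  have e2 : x ⬝ᵥ S *ᵥ y = y ⬝ᵥ y := by
    rw [Matrix.dotProduct_mulVec, ← Matrix.mulVec_transpose, hs]
  rw [Matrix.mulVec_sub, Matrix.mulVec_smul, sub_dotProduct, dotProduct_sub, dotProduct_sub, smul_dotProduct,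
    smul_dotProduct, dotProduct_smul, dotProduct_smul, e1, e2] at h1
  simp only [smul_eq_mul] at h1
  have h2 := h y
  have h3 := h x
  have h4 : c⁻¹ * (c⁻¹ * (y ⬝ᵥ S *ᵥ y)) ≤ c⁻¹ * (y ⬝ᵥ y) := by
    have : c⁻¹ * (y ⬝ᵥ S *ᵥ y) ≤ y ⬝ᵥ y := by rw [inv_mul_le_iff₀ hc]; exact h2
    gcongr
  have h5 : c⁻¹ * (y ⬝ᵥ y) ≤ x ⬝ᵥ S *ᵥ x := by linarith
  rw [inv_mul_le_iff₀ hc] at h5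
  nlinarith

variable {N T d r : ℕ} {S : Matrix (Fin N) (Fin N) ℝ} {Λ : Matrix (Fin N) (Fin r) ℝ}
  {F₀ : Matrix (Fin T) (Fin r) ℝ} {u : Matrix (Fin N) (Fin T) ℝ} {X : Fin d → Matrix (Fin N) (Fin T) ℝ}

lemma frob_le_of_rowNorm_le {c : ℝ} (hc : 0 ≤ c) (h : ∀ i, rowNorm Λ i ≤ c) : frob Λ ≤ c * √N := by
  refine (pow_le_pow_iff_left₀ (frob_nonneg _) (by positivity) two_ne_zero).1 ?_
  rw [mul_pow, Real.sq_sqrt (by positivity), frob_sq_eq_sum_rows]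
  calc _ ≤ ∑ _i : Fin N, c ^ 2 := Finset.sum_le_sum fun i _ => pow_le_pow_left₀ (rowNorm_nonneg _ _) (h i) 2
    _ = _ := by simp [mul_comm]

/-- A realization is regular if the random quantities satisfy the bounds that hold with high probability. -/
lemma RegularPanel.of_bounds {K θ q c₁ c₂ cΛ κ Kop φ ξ ι ι₀ : ℝ}
    (hc₁ : 0 < c₁) (hc₂ : 0 < c₂) (hcΛ : 0 < cΛ) (hκ : 0 ≤ κ) (hφ : 0 ≤ φ) (hι : 0 < ι)
    (hι₀ : 0 < ι₀)
    (hK : K ∈ upperBounds ({1, (r : ℝ), (d : ℝ), c₁, c₂⁻¹, 2 / c₂, cΛ⁻¹, Kop, κ * c₁, 11 * c₁, φ, κ * φ, ξ, κ,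
      κ * ξ, κ * (c₂⁻¹ * ξ), ι⁻¹, ι₀⁻¹} : Set ℝ))
    (hrN : r < N) (hrT : r ≤ T) (hT : 0 < T) (hθ : 0 < θ) (hθ1 : θ ≤ 1) (hq0 : 0 ≤ q) (hq1 : q ≤ 1)
    (hTN : T ≤ N)
    (rates : √(N : ℝ) * Real.log N ≤ θ ^ 2 * T ∧ 1 ≤ θ ^ 2 * Real.log N ∧ omegaRate N T ≤ θ ∧
      omegaRate N T ^ (1 - q) * sparsity q S ≤ θ)
    (hs : Sᵀ = S) (hlow : ∀ v : Fin N → ℝ, c₂ * (v ⬝ᵥ v) ≤ v ⬝ᵥ S *ᵥ v)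
    (hup : ∀ v : Fin N → ℝ, v ⬝ᵥ S *ᵥ v ≤ c₁ * (v ⬝ᵥ v))
    (hΛl : ∀ v : Fin r → ℝ, cΛ * (N * (v ⬝ᵥ v)) ≤ (Λ *ᵥ v) ⬝ᵥ (Λ *ᵥ v)) (hΛu : ∀ i, rowNorm Λ i ≤ c₁)
    (hop : ‖u‖ ≤ Kop * √N)
    (hload : frob (Λᵀ * u) ≤ κ * √(Real.log N) * (√T * frob Λ))
    (hfac : ∀ i, rowNorm (u * F₀) i ≤ κ * √(Real.log N) * frob F₀)
    (hcov : ∀ i j, |((T : ℝ)⁻¹ • (u * uᵀ) - S) i j| ≤ 10 * √(S i i * S j j) * √(Real.log N / T))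
    (hreg : ∀ l i j, |(X l * uᵀ) i j| ≤ κ * √(Real.log N) * rowNorm (X l) i)
    (hs1 : ∀ l, |frobInner ((1 : Matrix (Fin N) (Fin N) ℝ) * X l) u| ≤
      κ * √(Real.log N) * frob ((1 : Matrix (Fin N) (Fin N) ℝ) * X l))
    (hs2 : ∀ l, |frobInner (S⁻¹ * X l) u| ≤ κ * √(Real.log N) * frob (S⁻¹ * X l))
    (hs3 : ∀ l, |frobInner (annih Λ * X l * annih F₀) u| ≤ κ * √(Real.log N) * frob (annih Λ * X l * annih F₀))
    (hF : (∀ v : Fin r → ℝ, c₂ / 2 * (T * (v ⬝ᵥ v)) ≤ (F₀ *ᵥ v) ⬝ᵥ (F₀ *ᵥ v)) ∧ frob F₀ ^ 2 ≤ φ ^ 2 * T)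
    (hX : ∀ l, frob (X l) ≤ ξ * (√N * √T))
    (hid : ∀ F : Matrix (Fin T) (Fin r) ℝ, (T : ℝ)⁻¹ • (Fᵀ * F) = 1 → ∀ v : Fin d → ℝ,
      ι * (N * T * (v ⬝ᵥ v)) ≤ frobInner (regComb X v) (wannih S⁻¹ Λ * regComb X v * annih F))
    (hid₀ : ∀ v : Fin d → ℝ,
      ι₀ * (N * T * (v ⬝ᵥ v)) ≤ frobInner (regComb X v) (wannih S⁻¹ Λ * regComb X v * annih F₀)) :
    RegularPanel K θ q S Λ F₀ u X := by
  have k1 : 1 ≤ K := hK (by simp)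
  have k2 : c₂⁻¹ ≤ K := hK (by simp)
  have k3 : 2 / c₂ ≤ K := hK (by simp)
  have k4 : cΛ⁻¹ ≤ K := hK (by simp)
  have k5 : κ * ξ ≤ K := hK (by simp)
  have k6 : 11 * c₁ ≤ K := hK (by simp)
  have k7 : κ * c₁ ≤ K := hK (by simp)
  have k8 : κ * φ ≤ K := hK (by simp)
  have k9 : κ * (c₂⁻¹ * ξ) ≤ K := hK (by simp)
  have k10 : ι⁻¹ ≤ K := hK (by simp)
  have k11 : ι₀⁻¹ ≤ K := hK (by simp)
  have hvv : ∀ {n : ℕ} (v : Fin n → ℝ), 0 ≤ v ⬝ᵥ v := fun v => by rw [dotProduct_self_eq_norm]; positivity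
  have hN : 0 < N := by omega
  have hT0 : (0 : ℝ) < T := by exact_mod_cast hT
  have hN0 : (0 : ℝ) < N := by exact_mod_cast hN
  have hsT : 0 < √(T : ℝ) := Real.sqrt_pos.2 hT0
  have hsN : 0 < √(N : ℝ) := Real.sqrt_pos.2 hN0
  set l := √(Real.log N) with hl
  have hl0 : 0 ≤ l := Real.sqrt_nonneg _
  have hdiag : ∀ i, 0 < S i i ∧ S i i ≤ c₁ := by
    intro i
    have a1 := hlow (Pi.single i 1)
    have a2 := hup (Pi.single i 1)
    simp at a1 a2
    exact ⟨by linarith, a2⟩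
  have hfrobF : frob F₀ ≤ φ * √T := by
    refine (pow_le_pow_iff_left₀ (frob_nonneg _) (by positivity) two_ne_zero).1 ?_
    rw [mul_pow, Real.sq_sqrt hT0.le]; exact hF.2
  obtain ⟨rt1, rt2, rt3, rt4⟩ := rates
  have hsc : ∀ (B : Matrix (Fin N) (Fin T) ℝ) (k : ℝ), frob B ≤ k * (√N * √T) → κ * k ≤ K →
      κ * l * frob B ≤ K * l * (√N * √T) := by
    intro B k hB hk
    calc _ ≤ κ * l * (k * (√N * √T)) := by gcongr
      _ = κ * k * (l * (√N * √T)) := by ring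
      _ ≤ K * (l * (√N * √T)) := by gcongr
      _ = _ := by ring
  obtain ⟨hu, hinv⟩ := inv_of_coercive hc₂ hlow
  have hsi : (S⁻¹)ᵀ = S⁻¹ := by rw [Matrix.transpose_nonsing_inv, hs]
  refine
    { one_le := k1
      r_le := hK (by simp)
      d_le := hK (by simp)
      N_pos := hN
      T_pos := hT
      r_lt := hrN
      r_le_T := hrT
      θ_pos := hθ
      q_nonneg := hq0
      q_le := hq1
      rate_sqrt := rt1
      rate_le := by exact_mod_cast hTN
      rate_log := rt2
      rate_omega := rt3
      rate_sparse := rt4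
      symm := hs
      cov_lower := fun v => (mul_le_mul_of_nonneg_right ?_ (hvv v)).trans (hlow v)
      cov_upper := (op_le_of_quad_le hs hc₁ (fun v => le_trans (by have := hvv v; positivity) (hlow v)) hup).trans
        (hK (by simp))
      load_lower := fun v => ?_
      load_upper := fun i => (hΛu i).trans (hK (by simp))
      factor_lower := fun v => ?_
      factor_upper := hfrobF.trans (mul_le_mul_of_nonneg_right (hK (by simp)) hsT.le)
      err_op := hop.trans (mul_le_mul_of_nonneg_right (hK (by simp)) hsN.le)
      err_load := ?_
      err_row := fun i => ?_
      err_factor := fun i => (hfac i).trans ?_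
      err_cov := hcov
      reg_upper := fun k => (hX k).trans (mul_le_mul_of_nonneg_right (hK (by simp)) (by positivity))
      reg_err := fun k i j => (hreg k i j).trans 
        (mul_le_mul_of_nonneg_right (mul_le_mul_of_nonneg_right (hK (by simp)) hl0) (rowNorm_nonneg _ _))
      score := fun k => ?_
      score_weighted := fun k => ?_
      score_annih := fun k => (hs3 k).trans (hsc _ ξ ?_ k5)
      ident := fun F hF v => ?_
      ident₀ := fun v => ?_ }
  · exact inv_le_of_inv_le₀ hc₂ k2
  · have h1 : cΛ⁻¹ * ((Λ *ᵥ v) ⬝ᵥ (Λ *ᵥ v)) ≤ K * ((Λ *ᵥ v) ⬝ᵥ (Λ *ᵥ v)) :=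
      mul_le_mul_of_nonneg_right k4 (hvv _)
    refine le_trans ?_ h1
    rw [le_inv_mul_iff₀ hcΛ]; exact hΛl v
  · have h1 : 2 / c₂ * ((F₀ *ᵥ v) ⬝ᵥ (F₀ *ᵥ v)) ≤ K * ((F₀ *ᵥ v) ⬝ᵥ (F₀ *ᵥ v)) :=
      mul_le_mul_of_nonneg_right k3 (hvv _)
    refine le_trans ?_ h1
    have h2 := hF.1 v
    rw [div_mul_eq_mul_div, le_div_iff₀ hc₂]
    linarith only [h2]
  · refine hload.trans ?_
    have := frob_le_of_rowNorm_le hc₁.le hΛu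
    calc κ * l * (√T * frob Λ) ≤ κ * l * (√T * (c₁ * √N)) := by gcongr
      _ = κ * c₁ * (√N * √T * l) := by ring
      _ ≤ _ := mul_le_mul_of_nonneg_right k7 (by positivity)
  -- The rows of u need no tail bound of their own: their squared norms over T are the diagonal of
  -- the sample covariance, at most (1 + 10)c₁ since √(log N/T) ≤ ω ≤ 1.
  · refine (pow_le_pow_iff_left₀ (rowNorm_nonneg _ _) (mul_nonneg (by linarith only [k1]) hsT.le) two_ne_zero).1 ?_
    have h1 := (le_abs_self _).trans (hcov i i)
    rw [Real.sqrt_mul_self (hdiag i).1.le, Matrix.sub_apply, Matrix.smul_apply, smul_eq_mul] at h1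
    have e : (u * uᵀ) i i = rowNorm u i ^ 2 := by
      rw [rowNorm_sq, Matrix.mul_apply]
      exact Finset.sum_congr rfl fun t _ => by rw [Matrix.transpose_apply, pow_two]
    have hω : √(Real.log N / T) ≤ 1 := by
      have : 0 ≤ 1 / √(N : ℝ) := by positivity
      rw [omegaRate] at rt3; linarith
    have h2 : 10 * S i i * √(Real.log N / T) ≤ 10 * c₁ * 1 := by
      have := hdiag i
      gcongr
      · exact this.2
    have h3 : (T : ℝ)⁻¹ * (u * uᵀ) i i ≤ 11 * c₁ := by linarith only [(hdiag i).2, h1, h2]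
    rw [inv_mul_le_iff₀ hT0, e] at h3
    rw [mul_pow, Real.sq_sqrt hT0.le]
    have h4 : 11 * c₁ ≤ K ^ 2 := k6.trans (le_self_pow₀ k1 two_ne_zero)
    have h5 := mul_le_mul_of_nonneg_left h4 hT0.le
    linarith only [h3, h5]
  · calc κ * l * frob F₀ ≤ κ * l * (φ * √T) := by gcongr
      _ = κ * φ * (√T * l) := by ring
      _ ≤ _ := mul_le_mul_of_nonneg_right k8 (by positivity)
  · have h1 := hs1 k
    rw [Matrix.one_mul] at h1
    exact h1.trans (hsc _ ξ (hX k) k5)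
  · have h1 := hs2 k
    -- The weight is moved from the coefficients to the errors by symmetry.
    rw [frobInner_mul_left, hsi] at h1
    refine h1.trans (hsc _ (c₂⁻¹ * ξ) ?_ k9)
    refine (frob_mul_le_op _ _).trans ?_
    rw [mul_assoc]
    rw [one_div] at hinv
    exact mul_le_mul hinv (hX k) (frob_nonneg _) (by positivity)
  · have g1 := (gram_inv (K := cΛ⁻¹) (x := N) (by positivity) hN0 (B := Λ) fun v => by
      rw [le_inv_mul_iff₀ hcΛ]; exact hΛl v).1
    have g2 := (gram_inv (K := 2 / c₂) (x := T) (by positivity) hT0 (B := F₀) fun v => by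
      have h2 := hF.1 v
      rw [div_mul_eq_mul_div, le_div_iff₀ hc₂]; linarith only [h2]).1
    obtain ⟨a1, a2, -⟩ := annih_proj g1
    obtain ⟨b1, b2, -⟩ := annih_proj g2
    exact (frob_contract_right (op_le_one_of_proj b1 b2) _).trans
      ((frob_contract_left (op_le_one_of_proj a1 a2) _).trans (hX k))
  · have h1 := hid F hF v
    rw [mul_comm ι, ← le_div_iff₀ hι, div_eq_inv_mul] at h1
    refine h1.trans (mul_le_mul_of_nonneg_right k10 (le_trans ?_ (hid F hF v)))
    have := hvv v
    positivity
  · have h1 := hid₀ v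
    rw [mul_comm ι₀, ← le_div_iff₀ hι₀, div_eq_inv_mul] at h1
    refine h1.trans (mul_le_mul_of_nonneg_right k11 (le_trans ?_ (hid₀ v)))
    have := hvv v
    positivity

end RegularOfBounds


/-! ### Regularity with high probability -/

section Consistency

-- Nonnegativity of the form at v − b⁻¹G⁻¹v, with b above the norm of G⁻¹, yields the constant b⁻¹
-- without any spectral theory.
open scoped Matrix.Norms.L2Operator in
lemma Matrix.PosDef.exists_coercive {n : Type*} [Fintype n] [DecidableEq n] {G : Matrix n n ℝ} (h : G.PosDef) :
    ∃ c : ℝ, 0 < c ∧ ∀ v : n → ℝ, c * (v ⬝ᵥ v) ≤ v ⬝ᵥ G *ᵥ v := by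
  have hs : Gᵀ = G := h.isHermitian
  have hu : IsUnit G.det := h.det_pos.ne'.isUnit
  set b := ‖G⁻¹‖ + 1 with hb
  have hb0 : 0 < b := by positivity
  refine ⟨b⁻¹, by positivity, fun v => ?_⟩
  set w := G⁻¹ *ᵥ v with hw
  have e0 : G *ᵥ w = v := by rw [hw, Matrix.mulVec_mulVec, Matrix.mul_nonsing_inv _ hu, Matrix.one_mulVec]
  have h1 : 0 ≤ (v - b⁻¹ • w) ⬝ᵥ G *ᵥ (v - b⁻¹ • w) := by
    simpa using h.posSemidef.dotProduct_mulVec_nonneg (v - b⁻¹ • w)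
  have e1 : w ⬝ᵥ G *ᵥ v = v ⬝ᵥ v := by
    rw [Matrix.dotProduct_mulVec, ← Matrix.mulVec_transpose, hs, e0]
  rw [Matrix.mulVec_sub, Matrix.mulVec_smul, e0, sub_dotProduct, dotProduct_sub, dotProduct_sub, smul_dotProduct,
    smul_dotProduct, dotProduct_smul, dotProduct_smul, e1] at h1
  simp only [smul_eq_mul] at h1
  have hvv : 0 ≤ v ⬝ᵥ v := by rw [dotProduct_self_eq_norm]; positivity
  have h2 := (le_abs_self _).trans (abs_dot_mulVec_le G⁻¹ v v)
  rw [Real.mul_self_sqrt hvv, ← hw, dotProduct_comm] at h2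
  have h3 : b⁻¹ * (w ⬝ᵥ v) ≤ v ⬝ᵥ v := by
    rw [inv_mul_le_iff₀ hb0]
    nlinarith
  have h4 := mul_le_mul_of_nonneg_left h3 (inv_nonneg.2 hb0.le)
  linarith

lemma quad_le_of_entries {d : ℕ} {A : Matrix (Fin d) (Fin d) ℝ} {ε : ℝ} (h : ∀ i j, |A i j| ≤ ε)
    (v : Fin d → ℝ) : |v ⬝ᵥ A *ᵥ v| ≤ ε * (d * (v ⬝ᵥ v)) := by
  rcases Nat.eq_zero_or_pos d with rfl | hd
  · simp
  have hε : 0 ≤ ε := (abs_nonneg _).trans (h ⟨0, hd⟩ ⟨0, hd⟩)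
  have h5 : (∑ a, |v a|) ^ 2 ≤ d * (v ⬝ᵥ v) := by
    have := sq_sum_le_card_mul_sum_sq (s := (Finset.univ : Finset (Fin d))) (f := fun a => |v a|)
    simpa [dotProduct, pow_two] using this
  refine le_trans ?_ (mul_le_mul_of_nonneg_left h5 hε)
  have e : v ⬝ᵥ A *ᵥ v = ∑ a, ∑ b, v a * v b * A a b := by
    simp only [dotProduct, Matrix.mulVec, Finset.mul_sum]
    exact Finset.sum_congr rfl fun _ _ => Finset.sum_congr rfl fun _ _ => by ring
  rw [e, pow_two, Finset.sum_mul_sum, Finset.mul_sum]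
  refine (Finset.abs_sum_le_sum_abs _ _).trans (Finset.sum_le_sum fun a _ => ?_)
  rw [Finset.mul_sum]
  refine (Finset.abs_sum_le_sum_abs _ _).trans (Finset.sum_le_sum fun b _ => ?_)
  rw [abs_mul, abs_mul, mul_comm]
  have := h a b
  gcongr

/-- Inverse determinant times adjugate is continuous where the determinant does not vanish. Matrices
are treated as functions so that closeness is entrywise. -/
lemma exists_inv_close {d : ℕ} {G : Matrix (Fin d) (Fin d) ℝ} (hG : G.PosDef) {η : ℝ} (hη : 0 < η) :
    ∃ ρ : ℝ, 0 < ρ ∧ ∀ A : Matrix (Fin d) (Fin d) ℝ, (∀ i j, |A i j - G i j| < ρ) →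
      ∀ i j, |A⁻¹ i j - G⁻¹ i j| < η := by
  have hdet : Matrix.det (Matrix.of fun i j => G i j) ≠ 0 := hG.det_pos.ne'
  set g : (Fin d → Fin d → ℝ) → Fin d → Fin d → ℝ := fun B i j => (Matrix.of B).det⁻¹ * (Matrix.of B).adjugate i j with hg
  have e : ∀ A : Matrix (Fin d) (Fin d) ℝ, ∀ i j, A⁻¹ i j = g (fun i j => A i j) i j := by
    intro A i j
    rw [Matrix.inv_def, Matrix.smul_apply, Ring.inverse_eq_inv', smul_eq_mul]
    rfl
  have hc : ContinuousAt g (fun i j => G i j) := by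
    refine continuousAt_pi.2 fun i => continuousAt_pi.2 fun j => ?_
    refine ContinuousAt.mul (ContinuousAt.inv₀ (Continuous.continuousAt
      (Continuous.matrix_det (continuous_id : Continuous fun B : Fin d → Fin d → ℝ => B))) hdet)
      (Continuous.continuousAt (Continuous.matrix_elem
        (Continuous.matrix_adjugate (continuous_id : Continuous fun B : Fin d → Fin d → ℝ => B)) i j))
  obtain ⟨ρ, hρ, h⟩ := Metric.continuousAt_iff.1 hc η hη
  refine ⟨ρ, hρ, fun A hA i j => ?_⟩
  have h1 : dist (fun i j => A i j) (fun i j => G i j) < ρ :=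
    (dist_pi_lt_iff hρ).2 fun i => (dist_pi_lt_iff hρ).2 fun j => by rw [Real.dist_eq]; exact hA i j
  have h2 := (dist_pi_lt_iff hη).1 ((dist_pi_lt_iff hη).1 (h h1) i) j
  rw [Real.dist_eq] at h2
  rw [e, e]
  exact h2

universe v

variable {d r : ℕ}

namespace PanelModel

variable {m : PanelModel.{v} d r}

lemma frob_stackX_le {ω : m.Ω} {B : ℝ} (hN : 0 < m.N) (hT : 0 < m.T)
    (h : ((m.N : ℝ) * m.T)⁻¹ * ∑ i, ∑ t : Fin m.T, enorm2 (m.X t ω i) ^ 2 ≤ B) (l : Fin d) :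
    frob (stackX (m.Xs ω) l) ≤ √B * (√m.N * √m.T) := by
  have hN0 : (0 : ℝ) < m.N := by exact_mod_cast hN
  have hT0 : (0 : ℝ) < m.T := by exact_mod_cast hT
  have hB : 0 ≤ B := le_trans (by positivity) h
  refine (pow_le_pow_iff_left₀ (frob_nonneg _) (by positivity) two_ne_zero).1 ?_
  rw [mul_pow, mul_pow, Real.sq_sqrt hB, Real.sq_sqrt hN0.le, Real.sq_sqrt hT0.le, frob_sq, frobInner_eq_sum]
  rw [inv_mul_le_iff₀ (by positivity)] at h
  refine le_trans (Finset.sum_le_sum fun i _ => Finset.sum_le_sum fun t _ => ?_) (h.trans_eq (mul_comm _ _))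
  rw [enorm2, ← dotProduct_self_eq_norm]
  exact Finset.single_le_sum (f := fun l => m.X t ω i l * m.X t ω i l) (fun l _ => mul_self_nonneg _) (Finset.mem_univ l)

lemma V_quad (ω : m.Ω) (F : Matrix (Fin m.T) (Fin r) ℝ) (x : Fin d → ℝ) :
    x ⬝ᵥ m.V ω F *ᵥ x = ((m.N : ℝ) * m.T)⁻¹ *
      frobInner (regComb (stackX (m.Xs ω)) x) (wannih m.Sigma⁻¹ m.Λ * regComb (stackX (m.Xs ω)) x * annih F) := by
  rw [V, Matrix.smul_mulVec, dotProduct_smul, quad_dot, smul_eq_mul]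

lemma le_of_V_quad (hN : 0 < m.N) (hT : 0 < m.T) {ω : m.Ω} {F : Matrix (Fin m.T) (Fin r) ℝ} {x : Fin d → ℝ} {c : ℝ}
    (h : c * (x ⬝ᵥ x) ≤ x ⬝ᵥ m.V ω F *ᵥ x) :
    c * (m.N * m.T * (x ⬝ᵥ x)) ≤
      frobInner (regComb (stackX (m.Xs ω)) x) (wannih m.Sigma⁻¹ m.Λ * regComb (stackX (m.Xs ω)) x * annih F) := by
  have hN0 : (0 : ℝ) < m.N := by exact_mod_cast hN
  have hT0 : (0 : ℝ) < m.T := by exact_mod_cast hT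
  rw [V_quad, le_inv_mul_iff₀ (by positivity)] at h
  linarith

end PanelModel

lemma quad_of_sub_posDef {n : Type*} [Fintype n] [DecidableEq n] {A : Matrix n n ℝ} {c : ℝ}
    (h : (A - c • (1 : Matrix n n ℝ)).PosDef) (x : n → ℝ) : c * (x ⬝ᵥ x) ≤ x ⬝ᵥ A *ᵥ x := by
  have h1 := h.posSemidef.dotProduct_mulVec_nonneg x
  rw [Matrix.sub_mulVec, Matrix.smul_mulVec, Matrix.one_mulVec, star_trivial, dotProduct_sub,
    dotProduct_smul, smul_eq_mul] at h1
  linarith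

lemma quad_of_posDef_sub {n : Type*} [Fintype n] [DecidableEq n] {A : Matrix n n ℝ} {c : ℝ}
    (h : (c • (1 : Matrix n n ℝ) - A).PosDef) (x : n → ℝ) : x ⬝ᵥ A *ᵥ x ≤ c * (x ⬝ᵥ x) := by
  have h1 := h.posSemidef.dotProduct_mulVec_nonneg x
  rw [Matrix.sub_mulVec, Matrix.smul_mulVec, Matrix.one_mulVec, star_trivial, dotProduct_sub,
    dotProduct_smul, smul_eq_mul] at h1
  linarith

variable {M : ℕ → PanelModel.{v} d r}

lemma TendstoInProb.whp {A : ∀ k, (M k).Ω → Matrix (Fin d) (Fin d) ℝ} {B : Matrix (Fin d) (Fin d) ℝ}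
    (h : TendstoInProb M A B) {ε : ℝ} (hε : 0 < ε) : Whp M fun k ω => ∀ i j, |A k ω i j - B i j| < ε :=
  Whp.forall_fintype fun i => Whp.forall_fintype fun j => by
    simpa only [Whp, not_lt] using h i j ε hε

lemma gaussianPanels_of {q : ℝ} (hG : PanelGrowth M q) (hE : GaussianErrors M) {c₁ c₂ : ℝ} (hc₁ : 0 < c₁)
    (hc₂ : 0 < c₂) (hl : ∀ k, ((M k).Sigma - c₂ • (1 : Matrix _ _ ℝ)).PosDef)
    (hu : ∀ k, (c₁ • (1 : Matrix _ _ ℝ) - (M k).Sigma).PosDef) : GaussianPanels M c₁ where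
  pos := hc₁
  posDef k := by
    have h1 : (c₂ • (1 : Matrix (Fin (M k).N) (Fin (M k).N) ℝ)).PosDef := Matrix.PosDef.one.smul hc₂
    simpa using (hl k).add h1
  upper k := quad_of_posDef_sub (hu k)
  gaussian := hE.gaussian
  serial k := PanelModel.serial_u (hE.serial k)
  indep := hE.indep
  N_tendsto := tendsto_natCast_atTop_atTop.comp hG.N_tendsto
  T_pos := hG.T_tendsto.eventually_gt_atTop 0
  T_le := hG.T_le

/-- If all other bounds hold, a bound on the regressors makes a realization regular. The constant depends
on that bound only through `K`. -/
lemma regular_whp {q : ℝ} {Γ : Matrix (Fin d) (Fin d) ℝ} (hG : PanelGrowth M q) (hD : DataGenerating M)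
    (hP : Pervasive M) (hS : ConditionallySparse M q) (hI : UniformlyIdentified M) (hL : ScoreLimit M Γ)
    (hE : GaussianErrors M) (B : ℝ) :
    ∃ K : ℝ, 1 ≤ K ∧ (r : ℝ) ≤ K ∧ ∀ θ : ℝ, 0 < θ → θ ≤ 1 → Whp M fun k ω =>
      (((M k).N : ℝ) * (M k).T)⁻¹ * ∑ i, ∑ t : Fin (M k).T, enorm2 ((M k).X t ω i) ^ 2 ≤ B →
      RegularPanel K θ q (M k).Sigma (M k).Λ ((M k).F₀ ω) ((M k).uMat ω) (stackX ((M k).Xs ω)) := by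
  obtain ⟨c₁, c₂, hc₁, hc₂, hb⟩ := hD.bounds
  obtain ⟨r₁, r₂, b₁, b₂, -, hr₂, -, hb₂, htail⟩ := hD.tails
  obtain ⟨cΛ, CΛ, hcΛ, -, hpv⟩ := hP
  obtain ⟨ι, hι, hid⟩ := hI
  obtain ⟨γ, hγ, hΓ⟩ := hL.posDef.exists_coercive
  obtain ⟨K₄, hK₄, hmom⟩ := exists_fourth_moment_bound.{v} hb₂ hr₂
  have hmom' : ∀ k t a, Integrable (fun ω => (M k).f t ω a ^ 4) (M k).P ∧
      ∫ ω, (M k).f t ω a ^ 4 ∂(M k).P ≤ K₄ := fun k t a =>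
    hmom (M k).P (PanelModel.measurable_f_apply t a) fun x hx => (htail k t x hx).2 a
  have hgp := gaussianPanels_of hG hE hc₁ hc₂ (fun k => (hb k).1) fun k => (hb k).2.1
  have hlow : ∀ k (x : Fin (M k).N → ℝ), c₂ * (x ⬝ᵥ x) ≤ x ⬝ᵥ (M k).Sigma *ᵥ x := fun k =>
    quad_of_sub_posDef (hb k).1
  have hdiag : ∀ k i, c₂ ≤ (M k).Sigma i i := by
    intro k i
    have := hlow k (Pi.single i 1)
    simpa using this
  set φ := √(r * (1 + K₄ + c₂)) with hφ
  set κ := √(8 * c₁) with hκ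
  set Kop := 4 * √(10 * c₁) with hKop
  set ξ := √B with hξ
  -- K is fixed before θ; the final argument needs this order, because θ is chosen small relative to
  -- a function of K.
  obtain ⟨K, hK⟩ := (Set.toFinite ({1, (r : ℝ), (d : ℝ), c₁, c₂⁻¹, 2 / c₂, cΛ⁻¹, Kop, κ * c₁, 11 * c₁, φ, κ * φ, ξ, κ,
      κ * ξ, κ * (c₂⁻¹ * ξ), ι⁻¹, (γ / 2)⁻¹} : Set ℝ)).bddAbove
  refine ⟨K, hK (by simp), hK (by simp), fun θ hθ hθ1 => ?_⟩
  -- With V(F₀) this close to Γ entrywise, its quadratic form loses at most half of the lower bound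
  -- γ. This is how identification at the true factors, which are not normalized, is obtained.
  have hδ : 0 < γ / (2 * (d + 1)) := by positivity
  have hfac := factor_bounds (fun k t a => (hmom' k t a).1) (fun k t a => (hmom' k t a).2) hc₂
    (fun k t => ((hb k).2.2.2 t).1)
    (fun k => (hE.serial k).comp (fun _ z => z.2.1) fun _ => measurable_fst.comp measurable_snd)
    (tendsto_natCast_atTop_atTop.comp hG.T_tendsto)
  have hwhp := ((((((((((hgp.opNorm_le.and hgp.err_load_le).and hgp.err_factor_le).and
    (hgp.sampleCov_le (hG.log_div_tendsto hS hc₂ hdiag))).and hgp.reg_err_le).and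
    (hgp.score_le fun k => 1)).and (hgp.score_le fun k => (M k).Sigma⁻¹)).and hgp.score_annih_le).and hfac).and
    (show Whp M fun k ω => ∀ F : Matrix (Fin (M k).T) (Fin r) ℝ, ((M k).T : ℝ)⁻¹ • (Fᵀ * F) = 1 →
      ∀ v : Fin d → ℝ, ι * (v ⬝ᵥ v) ≤ v ⬝ᵥ (M k).V ω F *ᵥ v from hid)).and (hL.prob.whp hδ))
  refine hwhp.mono ?_
  filter_upwards [hpv, hG.rates hS hc₂ hdiag hθ, hG.T_le, hG.N_tendsto.eventually_gt_atTop r,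
    hG.T_tendsto.eventually_ge_atTop r, hG.T_tendsto.eventually_gt_atTop 0] with k hpk hrk hTN hrN hrT hT
  rintro ω ⟨⟨⟨⟨⟨⟨⟨⟨⟨⟨w1, w2⟩, w3⟩, w4⟩, w5⟩, w6⟩, w7⟩, w8⟩, w9⟩, w10⟩, w11⟩ hX
  have hN : 0 < (M k).N := by omega
  have hN0 : (0 : ℝ) < (M k).N := by exact_mod_cast hN
  refine RegularPanel.of_bounds hc₁ hc₂ hcΛ (Real.sqrt_nonneg _) (Real.sqrt_nonneg _) hι
    (half_pos hγ) hK hrN hrT hT hθ hθ1 hS.q_nonneg (by linarith [hS.q_lt]) hTN hrk (hgp.posDef k).isHermitian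
    (hlow k) (hgp.upper k) (fun x => ?_) (fun i => ?_) (by rw [hKop, mul_assoc]; exact w1) w2 w3 w4 w5 w6 w7 w8
    ⟨w9.1, ?_⟩ (PanelModel.frob_stackX_le hN hT hX)
    (fun F hF x => PanelModel.le_of_V_quad hN hT (w10 F hF x))
    (fun x => PanelModel.le_of_V_quad hN hT ?_)
  · have := quad_of_sub_posDef hpk.1 x
    rw [Matrix.smul_mulVec, dotProduct_smul, gram_dot, smul_eq_mul, le_inv_mul_iff₀ hN0] at this
    linarith
  · have h1 := (hb k).2.2.1 i
    refine le_trans (le_of_eq ?_) h1.le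
    rw [enorm2, ← Real.sqrt_sq (rowNorm_nonneg _ _), rowNorm_sq, EuclideanSpace.norm_eq]
    simp
  · rw [Real.sq_sqrt (by positivity)]; exact w9.2
  · have h1 := quad_le_of_entries (A := (M k).V ω ((M k).F₀ ω) - Γ) (fun i j => (w11 i j).le) x
    rw [Matrix.sub_mulVec, dotProduct_sub] at h1
    have h2 := (abs_le.1 h1).1
    have h3 := hΓ x
    have hxx : 0 ≤ x ⬝ᵥ x := by rw [dotProduct_self_eq_norm]; positivity
    have h4 : γ / (2 * (d + 1)) * (d * (x ⬝ᵥ x)) ≤ γ / 2 * (x ⬝ᵥ x) := by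
      rw [← mul_assoc]
      refine mul_le_mul_of_nonneg_right ?_ hxx
      rw [div_mul_eq_mul_div, div_le_div_iff₀ (by positivity) (by norm_num)]
      nlinarith
    linarith

end Consistency

/-! ### Convergence of the inverse plug-in estimate -/

theorem theorem5p2 : ∃ C₀ : ℝ, 0 < C₀ ∧
    ∀ (d r : ℕ) (M : ℕ → PanelModel d r) (q : ℝ) (Γ : Matrix (Fin d) (Fin d) ℝ)
      (_ : PanelGrowth M q) (_ : DataGenerating M) (_ : Pervasive M) (_ : WeightedMoments M)
      (_ : ConditionallySparse M q) (_ : UniformlyIdentified M) (_ : ScoreLimit M Γ)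
      (_ : GaussianErrors M) (_ : RegressorsBounded M)
      (s : ℝ → ℝ → ℝ) (_ : IsThresholding s) (C : ℝ) (_ : C₀ ≤ C)
      (β₀ : ∀ k, (M k).Ω → Fin d → ℝ)
      (R : ∀ k, (M k).Ω → Matrix (Fin (M k).N) (Fin (M k).N) ℝ)
      (β' : ∀ k, (M k).Ω → Fin d → ℝ)
      (L : ∀ k, (M k).Ω → Matrix (Fin (M k).N) (Fin r) ℝ)
      (F : ∀ k, (M k).Ω → Matrix (Fin (M k).T) (Fin r) ℝ)
      (_ : ∀ k, (M k).IsFeasibleWPC s C (β₀ k) (R k) (β' k) (L k) (F k)),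
      TendstoInProb M
        (fun k ω => ((M k).plugIn ω (thresholdCov (M k).T s C (R k ω))⁻¹ (L k ω) (F k ω))⁻¹)
        Γ⁻¹ := by
  refine ⟨44, by norm_num, ?_⟩
  intro d r M q Γ hG hD hP _ hS hI hL hE hX s hs C hC β₀ R β' L F hF i j η hη
  obtain ⟨ρ, hρ, hinv⟩ := exists_inv_close hL.posDef hη
  rw [ENNReal.tendsto_nhds_zero]
  intro ε hε
  have hε2 : 0 < ε / 2 := ENNReal.half_pos hε.ne'
  -- Half of ε is spent on large regressors. Boundedness in probability gives no single bound valid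
  -- with probability tending to one, so B, and with it K, depends on ε.
  obtain ⟨e, he0, heε⟩ := ENNReal.lt_iff_exists_nnreal_btwn.1 hε2
  have he : (0 : ℝ) < e := by exact_mod_cast he0
  obtain ⟨B, hB⟩ := hX e he
  obtain ⟨K, hK, hrK, hreg⟩ := regular_whp hG hD hP hS hI hL hE B
  obtain ⟨K', hK', hclose⟩ := plugIn_close K C hK hC r hrK
  -- Chosen last: K'θ ≤ 1 makes the deterministic bounds applicable, and K'θ ≤ ρ/2 leaves the other
  -- half of ρ for V(F₀) − Γ.
  set θ := min 1 (ρ / 2) / K' with hθ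
  have hθ0 : 0 < θ := by positivity
  have hKθ : K' * θ = min 1 (ρ / 2) := by rw [hθ]; field_simp
  have hmin1 : min 1 (ρ / 2) ≤ 1 := min_le_left _ _
  have hmin2 : min 1 (ρ / 2) ≤ ρ / 2 := min_le_right _ _
  have hθ1 : θ ≤ 1 := by nlinarith
  have hw := (hreg θ hθ0 hθ1).and (hL.prob.whp (half_pos hρ))
  filter_upwards [hB, ENNReal.tendsto_nhds_zero.1 hw (ε / 2) hε2] with k hBk hwk
  refine (measure_mono (t := {ω | B < (((M k).N : ℝ) * (M k).T)⁻¹ *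
    ∑ i, ∑ t : Fin (M k).T, enorm2 ((M k).X t ω i) ^ 2} ∪ _) ?_).trans
    ((measure_union_le _ _).trans ((add_le_add (hBk.trans ?_) hwk).trans_eq (ENNReal.add_halves ε)))
  · intro ω hω
    by_contra hcon
    rw [Set.mem_union, not_or] at hcon
    obtain ⟨h1, h2⟩ := hcon
    obtain ⟨h3, h4⟩ := not_not.1 h2
    have h5 := hclose (M k) ω (h3 (not_lt.1 h1)) (by rw [hKθ]; exact hmin1) s hs _ _ _ _ _ (hF k)
    have h6 := hinv ((M k).plugIn ω (thresholdCov (M k).T s C (R k ω))⁻¹ (L k ω) (F k ω)) (fun a b => by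
      have := abs_sub_le ((M k).plugIn ω (thresholdCov (M k).T s C (R k ω))⁻¹ (L k ω) (F k ω) a b)
        ((M k).V ω ((M k).F₀ ω) a b) (Γ a b)
      have h7 := h5 a b
      have h8 := h4 a b
      rw [hKθ] at h7
      linarith) i j
    exact absurd (show η ≤ _ from hω) (not_le.2 h6)
  · rw [ENNReal.ofReal_coe_nnreal]; exact heε.le
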